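/- **Setting.** There are groups $g=1,\dots,N_G+1$ ($N_G\ge 1$; group $1$ is treated, the others are controls) and periods $t=1,\dots,\mathcal T$ ($\mathcal T\ge 2$; treatment occurs in period $\mathcal T$ only). A unit has potential outcomes $Y_t(0),Y_t(1)$, a group $G$ and covariates $X\in\mathcal X$ with law $F_X$; $\mathcal G_g=\mathbf 1\{G=g\}$, $Y_t=\mathcal G_1Y_t(1)+(1-\mathcal G_1)Y_t(0)$, $\Delta Y=Y_{\mathcal T}-Y_{\mathcal T-1}$, $S=(Y_1,\dots,Y_{\mathcal T},G,X)$. Put $p_g(x)=P(G=g\mid X=x)$, $r_{1,g}=p_1/p_g$, $\pi_1=P(G=1)$, $m_\Delta(x)=E[\Delta Y\mid G\ne1,X=x]$, $m_{g,t}(x)=E[Y_t\mid G=g,X=x]$, $m_{g,\Delta}=m_{g,\mathcal T}-m_{g,\mathcal T-1}$, $\theta=E[Y_{\mathcal T}(1)-Y_{\mathcal T}(0)\mid G=1]$ and $$\phi(S;m,r,w;\pi)=\frac1\pi\Big(\mathcal G_1-\sum_{g\ge2}w_g(X)r_g(X)\mathcal G_g\Big)(\Delta Y-m(X)).$$ $S_1,S_2,\dots$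 are iid copies of $S$, $\mathcal S_n=(S_1,\dots,S_n)$. The bootstrap weights $W_1,W_2,\dots$ are iid, independent of the data, with $E W_i=\operatorname{var}W_i=1$ and $E|W_i|^{2+\delta}<\infty$ for some $\delta>0$. The units $1,\dots,n$ are split into $L\ge2$ folds $I_1,\dots,I_L$ of equal size. For each fold $\ell$, the nuisance estimators $\hat m_\Delta^\ell,\hat r_{1,g}^\ell,\hat w_g^\ell$ are functions of $(S_i)_{i\notin I_\ell}$ and the bootstrap nuisance estimators $\hat m_\Delta^{*,\ell},\hat r_{1,g}^{*,\ell},\hat w_g^{*,\ell}$ are functions of $(S_i,W_i)_{i\notin I_\ell}$; conditions on estimators are meant for every fold. Let $$\hat\theta=\frac1n\sum_{\ell}\sum_{i\in I_\ell}\phi(S_i;\hat m^\ell_\Delta,\hat r^\ell,\hat w^\ell;\hat\pi_1),\qquad \hat\theta^*=\frac1n\sum_{\ell}\sum_{i\in I_\ell}W_i\,\phi(S_i;\hat m^{*,\ell}_\Delta,\hat r^{*,\ell},\hat w^{*,\ell};\hat\pi^*_1),$$ with $\hat\pi_1=\frac1n\sum_i\mathcal G_{1i}$ and $\hat\pi_1^*=\frac1n\sum_iW_i\mathcal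 G_{1i}$. Here $N_G,\mathcal T,L$ are fixed, $n\to\infty$ through multiples of $L$, and $o_p,O_p$ refer to the joint law of data and weights. Throughout, assume no anticipation ($Y_t(1)=Y_t(0)$ a.s. for $t<\mathcal T$) and overlap ($p_g(X)>0$ a.s. for all $g$). For functions $\omega=(\omega_g)_{g\ge2}$, say that estimators $(\hat m_\Delta,\hat r,\hat w)$ satisfy **condition N($\omega$)** if (1) $\sum_{g\ge2}\hat w_g=1$ and $\|\hat w_g\|_\infty=O_p(1)$; (2) $\|\hat m_\Delta-m_\Delta\|$, $\|\hat r_{1,g}-r_{1,g}\|$ and $\|\hat w_g-\omega_g\|$ are $o_p(1)$ for $g\ge2$; (3) $\|\hat r_{1,g}-r_{1,g}\|\,\|\hat m_\Delta-m_\Delta\|=o_p(n^{-1/2})$ for $g\ge2$; where $\|\cdot\|$ is the norm of $L_2(F_X)$. Let **condition B($\omega$)** be: $E[(\Delta Y-m_\Delta(X))^2\mid X,G=g]$ and $1/p_g$ ($g\ge1$) and $\omega_g$ ($g\ge 2$) are bounded functions of $X$. **Theorem.** In each of the following two cases, $$\sup_{a\in\mathbb R}\Big|P^*\big(\sqrt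 n(\hat\theta^*-\hat\theta)\le a\mid\mathcal S_n\big)-P\big(\sqrt n(\hat\theta-\theta)\le a\big)\Big|=o_p(1),$$ where $P^*(\cdot\mid\mathcal S_n)$ is the conditional distribution given the sample. **(i) Parallel trends.** For each $g\ge2$, $E[Y_{\mathcal T}(0)-Y_{\mathcal T-1}(0)\mid G=1,X]=E[Y_{\mathcal T}(0)-Y_{\mathcal T-1}(0)\mid G=g,X]$ a.s.; for some $\omega$, B($\omega$) holds and both the original and the bootstrap nuisance estimators satisfy N($\omega$); and $\psi_{PT}(S)=\phi(S;m_\Delta,(r_{1,g})_g,\omega;\pi_1)-\theta\mathcal G_1/\pi_1$ satisfies $E|\psi_{PT}(S)|^{2+\delta}<\infty$ for some $\delta>0$ and $E[\psi_{PT}(S)^2]>0$. **(ii) Synthetic control.** $X$ is real-valued with density $f_X$ and compact support $\mathcal X$, and there are functions $w=(w_2,\dots,w_{N_G+1})$ with $\sum_gw_g=1$ and $E[Y_t(0)\mid G=1,X=x]=\sum_{g\ge2}w_g(x)E[Y_t(0)\mid G=g,X=x]$ for $t=1,\dots,\mathcal T$ and almost all $x$; $\mathcal T\ge N_G$; $E[Y_t^2]<\infty$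 for $t\le\mathcal T-1$; B($w$) holds. For numbers $q=(q_{g,t})_{1\le g\le N_G+1,\,1\le t\le\mathcal T-1}$ let $M[q]$ be the $(\mathcal T-1)\times(N_G-1)$ matrix with entries $q_{g,t}-q_{N_G+1,t}$ (row $t$, column $g=2,\dots,N_G$) and $b[q]$ the vector $(q_{1,t}-q_{N_G+1,t})_t$. Write $m(x)=(m_{g,t}(x))$, $M(x)=M[m(x)]$, $m_1(x)=b[m(x)]$. The functions $w_g,m_{g,t},p_g$ are twice continuously differentiable on $\mathcal X$, and for some $c>0$ all eigenvalues of $M(x)'M(x)$ exceed $c$ for all $x\in\mathcal X$. The weight estimators are $(\hat w_2,\dots,\hat w_{N_G})'=(\hat M'\hat M)^{-1}\hat M'\hat m_1$, $\hat w_{N_G+1}=1-\sum_{g=2}^{N_G}\hat w_g$, where $\hat M=M[\hat m]$, $\hat m_1=b[\hat m]$ for estimators $\hat m_{g,t}$, $t\le\mathcal T-1$, that are functions of the same subsamples as above; $\hat w^*$ is built in the same way from $\hat m^*_{g,t}$. The kernel $K$ is a symmetric probability density with $\int u^2K(u)\,du<\infty$, the bandwidth satisfies $h>0$, $h=o(n^{-1/4})$,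 and $K_h=K(\cdot/h)/h$. Both the original and the bootstrap estimators satisfy N($w$), and for them $$\|\hat m_{g,t}-m_{g,t}\|,\ \|\hat r_{1,g}-r_{1,g}\|,\ \|\hat w_g-w_g\|=o_p(n^{-1/4}),$$ $$\hat r_{1,g}(x)-r_{1,g}(x)=\mathbb P_n\Big[\tfrac{K_h(X-x)}{f_X(x)}\tfrac{\mathcal G_1-r_{1,g}(X)\mathcal G_g}{p_g(X)}\Big]+o_p(n^{-1/2}),$$ $$\hat m_{g,t}(x)-m_{g,t}(x)=\mathbb P_n\Big[\tfrac{K_h(X-x)}{f_X(x)}\tfrac{\mathcal G_g(Y_t-m_{g,t}(X))}{p_g(X)}\Big]+o_p(n^{-1/2})$$ uniformly in $x\in\mathcal X$, for all $g$ and all $t\le\mathcal T-1$. Here, for the estimators of fold $\ell$, $\mathbb P_n[F]$ is the average of $F(S_i)$ over $i\notin I_\ell$ for the original estimators, and the average of $W_iF(S_i)$ over $i\notin I_\ell$ for the bootstrap estimators. Finally, let $a_{g,t}(S)=\mathcal G_g(Y_t-m_{g,t}(X))/p_g(X)$, $A=M[a(S)]$, $a_1=b[a(S)]$ and, with $M,m_1$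 evaluated at $X$, $$Q=(M'M)^{-1}M'a_1+(M'M)^{-1}A'm_1-(M'M)^{-1}\big[A'M+M'A\big](M'M)^{-1}M'm_1,$$ $$\psi_1=-\frac1{\pi_1}\sum_{g\ge2}w_g(X)\big(\mathcal G_1-r_{1,g}(X)\mathcal G_g\big)\big(m_{g,\Delta}(X)-m_\Delta(X)\big),\qquad \psi_2=-\frac1{\pi_1}u(X)'\begin{bmatrix}Q\\-\mathbf 1'Q\end{bmatrix},$$ where $u(x)=p_1(x)\,(m_{g,\Delta}(x)-m_\Delta(x))_{2\le g\le N_G+1}$. The influence function $\psi_{SC}=\phi(S;m_\Delta,(r_{1,g})_g,w;\pi_1)-\theta\mathcal G_1/\pi_1+\psi_1+\psi_2$ satisfies $E|\psi_{SC}|^{2+\delta}<\infty$ for some $\delta>0$ and $E[\psi_{SC}^2]>0$. -/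

import Mathlib

open MeasureTheory ProbabilityTheory Filter Topology
open scoped ENNReal Matrix

noncomputable section

namespace PanelATT

/-! ### Stochastic orders -/

/-- `Z k = o_p(a k)` for nonnegative extended-valued random quantities `Z k`. -/
def IsLittleOp {Ω : Type*} [MeasurableSpace Ω] (Pr : Measure Ω)
    (Z : ℕ → Ω → ℝ≥0∞) (a : ℕ → ℝ) : Prop :=
  ∀ ε : ℝ, 0 < ε → Tendsto (fun k => Pr {η | ENNReal.ofReal (ε * a k) < Z k η}) atTop (𝓝 0)

/-- `Z k = O_p(1)`: the sequence is bounded in probability. -/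
def IsBoundedInProb {Ω : Type*} [MeasurableSpace Ω] (Pr : Measure Ω)
    (Z : ℕ → Ω → ℝ≥0∞) : Prop :=
  ∀ ε : ℝ≥0∞, 0 < ε → ∃ C : ℝ, ∀ᶠ k in atTop, Pr {η | ENNReal.ofReal C < Z k η} ≤ ε

/-! ### Observations and the moment function

There are `J + 2` groups: group `0` is the treated group and `g.succ`, `g : Fin (J + 1)`, are the
control groups, so the number of control groups is `J + 1`. There are `R + 2` time periods: the
pre-treatment periods are `t.castSucc`, `t : Fin (R + 1)`, and treatment happens in the last one. -/

/-- An observation `(Y_1, …, Y_𝒯, G, X)`. -/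
abbrev Obs (J R : ℕ) (E : Type*) := (Fin (R + 2) → ℝ) × Fin (J + 2) × E

/-- The indicator that the observation belongs to group `g`. -/
def ind {J R : ℕ} {E : Type*} (g : Fin (J + 2)) (s : Obs J R E) : ℝ :=
  if s.2.1 = g then 1 else 0

/-- The covariate of an observation. -/
def cov {J R : ℕ} {E : Type*} (s : Obs J R E) : E := s.2.2

/-- The outcome change `ΔY` between the last pre-treatment period and the treatment period. -/
def dY {J R : ℕ} {E : Type*} (s : Obs J R E) : ℝ :=
  s.1 (Fin.last (R + 1)) - s.1 (Fin.last R).castSucc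

/-- The moment function `φ(S; m, r, w; π)`, with the ratios `r_g = p_1 / p_g` of the propensity
scores in place of the propensity scores themselves. -/
def phi {J R : ℕ} {E : Type*} (s : Obs J R E) (m : E → ℝ) (r w : Fin (J + 1) → E → ℝ)
    (π : ℝ) : ℝ :=
  1 / π * (ind 0 s - ∑ g : Fin (J + 1), w g (cov s) * r g (cov s) * ind g.succ s)
    * (dY s - m (cov s))

/-! ### The population -/

/-- The population model: untreated and treated potential outcomes, group and covariates. -/
structure Population (Ω E : Type*) [MeasurableSpace Ω] [MeasurableSpace E] (J R : ℕ) where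
  /-- the population distribution -/
  P : Measure Ω
  isProb : IsProbabilityMeasure P
  /-- the potential outcomes without treatment -/
  Y0 : Fin (R + 2) → Ω → ℝ
  /-- the potential outcomes with treatment in the last period -/
  Y1 : Fin (R + 2) → Ω → ℝ
  /-- the group -/
  G : Ω → Fin (J + 2)
  /-- the covariates -/
  X : Ω → E
  measurable_Y0 : ∀ t, Measurable (Y0 t)
  measurable_Y1 : ∀ t, Measurable (Y1 t)
  measurable_G : Measurable G
  measurable_X : Measurable X

/-- `f` is a version of the regression function `x ↦ E[Z | A, X = x]`. -/
def IsCondMean {Ω E : Type*} [MeasurableSpace Ω] [mE : MeasurableSpace E] (P : Measure Ω)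
    (X : Ω → E) (A : Set Ω) (Z : Ω → ℝ) (f : E → ℝ) : Prop :=
  Measurable f ∧ Integrable Z (cond P A) ∧
    condExp (MeasurableSpace.comap X mE) (cond P A) Z =ᵐ[cond P A] f ∘ X

namespace Population

section

variable {Ω E : Type*} [MeasurableSpace Ω] [mE : MeasurableSpace E] {J R : ℕ}

/-- The event `{G = g}`. -/
def grp (pop : Population Ω E J R) (g : Fin (J + 2)) : Set Ω := {a | pop.G a = g}

/-- The observed outcome `Y_t = 𝒢_1 Y_t(1) + (1 - 𝒢_1) Y_t(0)`. -/
def Y (pop : Population Ω E J R) (t : Fin (R + 2)) (a : Ω) : ℝ :=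
  if pop.G a = 0 then pop.Y1 t a else pop.Y0 t a

/-- The observed variable `S = (Y_1, …, Y_𝒯, G, X)`. -/
def obs (pop : Population Ω E J R) (a : Ω) : Obs J R E := (fun t => pop.Y t a, pop.G a, pop.X a)

/-- The distribution of the covariates. -/
def FX (pop : Population Ω E J R) : Measure E := pop.P.map pop.X

/-- `π_1 = P(G = 1)`. -/
def pi1 (pop : Population Ω E J R) : ℝ := pop.P.real (pop.grp 0)

/-- The average treatment effect on the treated in the last period. -/
def att (pop : Population Ω E J R) : ℝ :=
  ∫ a, (pop.Y1 (Fin.last (R + 1)) a - pop.Y0 (Fin.last (R + 1)) a) ∂(cond pop.P (pop.grp 0))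

/-- No anticipation. -/
def NoAnticipation (pop : Population Ω E J R) : Prop :=
  ∀ t : Fin (R + 1), ∀ᵐ a ∂pop.P, pop.Y1 t.castSucc a = pop.Y0 t.castSucc a

/-- `p g` is a version of the propensity score `P(G = g | X = ·)`. -/
def IsPropensity (pop : Population Ω E J R) (p : Fin (J + 2) → E → ℝ) : Prop :=
  ∀ g, Measurable (p g) ∧
    condExp (MeasurableSpace.comap pop.X mE) pop.P ((pop.grp g).indicator fun _ => (1 : ℝ))
      =ᵐ[pop.P] p g ∘ pop.X

/-- Overlap. -/
def Overlap (pop : Population Ω E J R) (p : Fin (J + 2) → E → ℝ) : Prop :=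
  ∀ g, ∀ᵐ x ∂pop.FX, 0 < p g x

/-- Conditional parallel trends between the last two periods. -/
def ParallelTrends (pop : Population Ω E J R) : Prop :=
  ∃ τ : Fin (J + 2) → E → ℝ,
    (∀ g, IsCondMean pop.P pop.X (pop.grp g)
      (fun a => pop.Y0 (Fin.last (R + 1)) a - pop.Y0 (Fin.last R).castSucc a) (τ g)) ∧
    ∀ g : Fin (J + 1), ∀ᵐ x ∂pop.FX, τ 0 x = τ g.succ x

/-- The group-level synthetic control condition, with weight functions `w`. The last clause says
that the number of periods is at least the number of control groups. -/
def SyntheticControl (pop : Population Ω E J R) (w : Fin (J + 1) → E → ℝ) : Prop :=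
  (∀ g, Measurable (w g)) ∧ (∀ᵐ x ∂pop.FX, ∑ g, w g x = 1) ∧
  (∃ q : Fin (J + 2) → Fin (R + 2) → E → ℝ,
    (∀ g t, IsCondMean pop.P pop.X (pop.grp g) (pop.Y0 t) (q g t)) ∧
    ∀ t, ∀ᵐ x ∂pop.FX, q 0 t x = ∑ g : Fin (J + 1), w g x * q g.succ t x) ∧
  J + 1 ≤ R + 2

/-- `m` is a version of `m_Δ(x) = E[ΔY | G ≠ 1, X = x]`. -/
def IsControlTrend (pop : Population Ω E J R) (m : E → ℝ) : Prop :=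
  IsCondMean pop.P pop.X (pop.grp 0)ᶜ (fun a => dY (pop.obs a)) m

/-- `E[(ΔY - m_Δ(X))² | X, G = g]` and `1 / p_g` (all `g`) and `ω_g` (control groups) are
bounded functions of `X`. -/
def BoundedMoments (pop : Population Ω E J R) (m : E → ℝ) (p : Fin (J + 2) → E → ℝ)
    (ω : Fin (J + 1) → E → ℝ) : Prop :=
  (∀ g, MemLp (fun a => dY (pop.obs a) - m (pop.X a)) 2 (cond pop.P (pop.grp g)) ∧
    ∃ C : ℝ, ∀ᵐ a ∂(cond pop.P (pop.grp g)),
      condExp (MeasurableSpace.comap pop.X mE) (cond pop.P (pop.grp g))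
        (fun b => (dY (pop.obs b) - m (pop.X b)) ^ 2) a ≤ C) ∧
  (∀ g, ∃ C : ℝ, ∀ᵐ x ∂pop.FX, 1 / p g x ≤ C) ∧
  ∀ g, ∃ C : ℝ, ∀ᵐ x ∂pop.FX, |ω g x| ≤ C

end

end Population

/-- The ratios `r_{1,g} = p_1 / p_g` for the control groups. -/
def ratio {J : ℕ} {E : Type*} (p : Fin (J + 2) → E → ℝ) (g : Fin (J + 1)) (x : E) : ℝ :=
  p 0 x / p g.succ x

/-! ### Sample, bootstrap weights, folds -/

section

variable {Ω : Type*} [MeasurableSpace Ω]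

/-- `S 0, S 1, …` are iid copies of the observed population variable. -/
def IsSample {Ω₀ E : Type*} [MeasurableSpace Ω₀] [MeasurableSpace E] {J R : ℕ}
    (pop : Population Ω₀ E J R) (Pr : Measure Ω) (S : ℕ → Ω → Obs J R E) : Prop :=
  (∀ i, Measurable (S i)) ∧ iIndepFun S Pr ∧ ∀ i, Pr.map (S i) = pop.P.map pop.obs

/-- The bootstrap weights are iid, independent of the data, have mean and variance one, and a
finite moment of some order larger than two. -/
def IsBootstrapWeights {A : Type*} [MeasurableSpace A] (Pr : Measure Ω) (S : ℕ → Ω → A)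
    (W : ℕ → Ω → ℝ) : Prop :=
  (∀ i, Measurable (W i)) ∧ iIndepFun W Pr ∧ (∀ i, IdentDistrib (W i) (W 0) Pr Pr) ∧
  IndepFun (fun η i => S i η) (fun η i => W i η) Pr ∧
  ∫ η, W 0 η ∂Pr = 1 ∧ variance (W 0) Pr = 1 ∧
  ∃ δ : ℝ, 0 < δ ∧ Integrable (fun η => |W 0 η| ^ (2 + δ)) Pr

/-- For every `k`, the `n = L * k` units are split into `L` folds; `fold k i` is the fold of unit
`i`. -/
abbrev FoldMap (L : ℕ) := ∀ k : ℕ, Fin (L * k) → Fin L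

/-- All folds have the same size. -/
def FoldMap.Balanced {L : ℕ} (fold : FoldMap L) : Prop :=
  ∀ k ℓ, (Finset.univ.filter fun i => fold k i = ℓ).card = k

/-- The units outside fold `ℓ`. -/
abbrev Train {L : ℕ} (fold : FoldMap L) (k : ℕ) (ℓ : Fin L) := {i : Fin (L * k) // fold k i ≠ ℓ}

/-- A cross-fitted estimator of a function on `E`: for each fold, a function of the data points
outside this fold. -/
abbrev Estimator {L : ℕ} (fold : FoldMap L) (A E : Type*) :=
  ∀ (k : ℕ) (ℓ : Fin L), (Train fold k ℓ → A) → E → ℝ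

/-- Joint measurability in the data and the argument. -/
def Estimator.IsMeas {L : ℕ} {fold : FoldMap L} {A E : Type*} [MeasurableSpace A]
    [MeasurableSpace E] (est : Estimator fold A E) : Prop :=
  ∀ k ℓ, Measurable fun q : (Train fold k ℓ → A) × E => est k ℓ q.1 q.2

/-- The random function obtained by applying an estimator to the data `D 0, D 1, …`. -/
def Estimator.eval {L : ℕ} {fold : FoldMap L} {A E : Type*} (est : Estimator fold A E)
    (D : ℕ → Ω → A) (k : ℕ) (ℓ : Fin L) (η : Ω) (x : E) : ℝ :=
  est k ℓ (fun i => D i.1 η) x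

/-- The data available to bootstrap estimators: observations together with their weights. -/
def withWeights {A : Type*} (S : ℕ → Ω → A) (W : ℕ → Ω → ℝ) (i : ℕ) (η : Ω) : A × ℝ :=
  (S i η, W i η)

/-- The rate `n ^ (-c)` for `n = L * k`. -/
def rate (L : ℕ) (c : ℝ) (k : ℕ) : ℝ := ((L * k : ℕ) : ℝ) ^ (-c)

/-- The conditions on the first-stage estimators, in terms of the random functions they produce:
(1) the estimated weights sum to one and are bounded in probability, (2) the estimators are
`L₂`-consistent, with `ω` the limit of the weights, (3) the product rate condition. -/
structure FirstStage {E : Type*} [MeasurableSpace E] {L J : ℕ} (Pr : Measure Ω) (FX : Measure E)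
    (m : E → ℝ) (r ω : Fin (J + 1) → E → ℝ)
    (mHat : ℕ → Fin L → Ω → E → ℝ) (rHat wHat : Fin (J + 1) → ℕ → Fin L → Ω → E → ℝ) :
    Prop where
  sum_one : ∀ k ℓ, ∀ᵐ η ∂Pr, ∀ᵐ x ∂FX, ∑ g, wHat g k ℓ η x = 1
  bounded : ∀ ℓ g, IsBoundedInProb Pr (fun k η => eLpNorm (wHat g k ℓ η) ∞ FX)
  trend : ∀ ℓ, IsLittleOp Pr (fun k η => eLpNorm (fun x => mHat k ℓ η x - m x) 2 FX) (fun _ => 1)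
  ratios : ∀ ℓ g,
    IsLittleOp Pr (fun k η => eLpNorm (fun x => rHat g k ℓ η x - r g x) 2 FX) (fun _ => 1)
  weights : ∀ ℓ g,
    IsLittleOp Pr (fun k η => eLpNorm (fun x => wHat g k ℓ η x - ω g x) 2 FX) (fun _ => 1)
  product : ∀ ℓ g,
    IsLittleOp Pr (fun k η => eLpNorm (fun x => rHat g k ℓ η x - r g x) 2 FX *
      eLpNorm (fun x => mHat k ℓ η x - m x) 2 FX) (rate L (1 / 2))

/-- The cross-fitted estimator of the ATT based on `n = L * k` units with multipliers `V`:
`n⁻¹ ∑_ℓ ∑_{i ∈ I_ℓ} V_i φ(S_i; m̂^ℓ, r̂^ℓ, ŵ^ℓ; π̂)`, `π̂ = n⁻¹ ∑_i V_i 𝒢_{1i}`. The original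
estimator has `V = 1`, the bootstrap estimator has `V = W`. -/
def thetaEst {E : Type*} {L J R : ℕ} (fold : FoldMap L) (S : ℕ → Ω → Obs J R E)
    (V : ℕ → Ω → ℝ) (mHat : ℕ → Fin L → Ω → E → ℝ)
    (rHat wHat : Fin (J + 1) → ℕ → Fin L → Ω → E → ℝ) (k : ℕ) (η : Ω) : ℝ :=
  (1 / ((L * k : ℕ) : ℝ)) * ∑ ℓ : Fin L, ∑ i : Fin (L * k) with fold k i = ℓ,
    V i η * phi (S i η) (mHat k ℓ η) (fun g => rHat g k ℓ η) (fun g => wHat g k ℓ η)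
      ((1 / ((L * k : ℕ) : ℝ)) * ∑ j : Fin (L * k), V j η * ind 0 (S j η))

/-- The multipliers of the original estimator. -/
def unitWeights (_ : ℕ) (_ : Ω) : ℝ := 1

/-- Bootstrap consistency:
`sup_a |P*(√n (θ* - θ̂) ≤ a | S_1, …, S_n) - P(√n (θ̂ - θ) ≤ a)| = o_p(1)` as `n = L * k → ∞`. -/
def BootstrapConsistent {A : Type*} [MeasurableSpace A] (L : ℕ) (Pr : Measure Ω)
    [IsProbabilityMeasure Pr] (S : ℕ → Ω → A) (θ : ℝ) (θHat θStar : ℕ → Ω → ℝ) : Prop :=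
  TendstoInMeasure Pr
    (fun k η => ⨆ a : ℝ,
      |(condDistrib (fun η' => √((L * k : ℕ) : ℝ) * (θStar k η' - θHat k η'))
          (fun η' (i : Fin (L * k)) => S i η') Pr (fun i => S i η)).real (Set.Iic a)
        - Pr.real {η' | √((L * k : ℕ) : ℝ) * (θHat k η' - θ) ≤ a}|)
    atTop (fun _ => 0)

end

/-! ### Influence functions and the synthetic control weights -/

/-- `ψ_PT(S) = φ(S; m_Δ, p, ω; π_1) - θ 𝒢_1 / π_1`. -/
def psiPT {J R : ℕ} {E : Type*} (m : E → ℝ) (p : Fin (J + 2) → E → ℝ) (ω : Fin (J + 1) → E → ℝ)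
    (π θ : ℝ) (s : Obs J R E) : ℝ :=
  phi s m (ratio p) ω π - θ * ind 0 s / π

/-- The matrix with rows `(q_{2,t} - q_{N+1,t}, …, q_{N,t} - q_{N+1,t})`, where `t` runs through
the pre-treatment periods and `N = J + 1` is the number of control groups. -/
def diffMatrix {J R : ℕ} (q : Fin (J + 2) → Fin (R + 1) → ℝ) : Matrix (Fin (R + 1)) (Fin J) ℝ :=
  Matrix.of fun t j => q j.castSucc.succ t - q (Fin.last (J + 1)) t

/-- The vector with entries `q_{1,t} - q_{N+1,t}`. -/
def diffVec {J R : ℕ} (q : Fin (J + 2) → Fin (R + 1) → ℝ) : Fin (R + 1) → ℝ :=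
  fun t => q 0 t - q (Fin.last (J + 1)) t

/-- The least squares weights of all control groups but the last,
`(M' M)⁻¹ M' m_1` with `M` and `m_1` built from `q`. -/
def lsWeights {J R : ℕ} (q : Fin (J + 2) → Fin (R + 1) → ℝ) : Fin J → ℝ :=
  ((diffMatrix q)ᵀ * diffMatrix q)⁻¹ *ᵥ ((diffMatrix q)ᵀ *ᵥ diffVec q)

/-- The weights of all control groups; the last one is determined by the sum being one. -/
def scWeights {J R : ℕ} (q : Fin (J + 2) → Fin (R + 1) → ℝ) : Fin (J + 1) → ℝ :=
  Fin.snoc (α := fun _ => ℝ) (lsWeights q) (1 - ∑ j, lsWeights q j)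

/-- The cross-fitted synthetic control weights obtained from the random functions `qHat g t`. -/
def scWeightsHat {Ω E : Type*} {L J R : ℕ}
    (qHat : Fin (J + 2) → Fin (R + 1) → ℕ → Fin L → Ω → E → ℝ) (g : Fin (J + 1)) (k : ℕ)
    (ℓ : Fin L) (η : Ω) (x : E) : ℝ :=
  scWeights (fun g' t => qHat g' t k ℓ η x) g

/-- `𝒢_g (Y_t - m_{g,t}(X)) / p_g(X)` for the pre-treatment periods `t`. -/
def ipwResid {J R : ℕ} {E : Type*} (q : Fin (J + 2) → Fin (R + 2) → E → ℝ)
    (p : Fin (J + 2) → E → ℝ) (s : Obs J R E) (g : Fin (J + 2)) (t : Fin (R + 1)) : ℝ :=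
  ind g s * (s.1 t.castSucc - q g t.castSucc (cov s)) / p g (cov s)

/-- `(𝒢_1 - r_{1,g}(X) 𝒢_g) / p_g(X)` for a control group `g`. -/
def ratioResid {J R : ℕ} {E : Type*} (p : Fin (J + 2) → E → ℝ) (s : Obs J R E)
    (g : Fin (J + 1)) : ℝ :=
  (ind 0 s - ratio p g (cov s) * ind g.succ s) / p g.succ (cov s)

/-- `m_{g,Δ} = m_{g,𝒯} - m_{g,𝒯-1}`. -/
def groupTrend {J R : ℕ} {E : Type*} (q : Fin (J + 2) → Fin (R + 2) → E → ℝ) (g : Fin (J + 2))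
    (x : E) : ℝ :=
  q g (Fin.last (R + 1)) x - q g (Fin.last R).castSucc x

/-- The adjustment `ψ_1` for the estimation of the ratios. -/
def psi1 {J R : ℕ} {E : Type*} (m : E → ℝ) (q : Fin (J + 2) → Fin (R + 2) → E → ℝ)
    (p : Fin (J + 2) → E → ℝ) (w : Fin (J + 1) → E → ℝ) (π : ℝ) (s : Obs J R E) : ℝ :=
  -(1 / π) * ∑ g : Fin (J + 1), w g (cov s) * (ind 0 s - ratio p g (cov s) * ind g.succ s)
    * (groupTrend q g.succ (cov s) - m (cov s))

/-- The vector `P(S) = P_1(S) + P_2(S) + P_3(S)` of influence functions of the least squares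
weights. -/
def weightInfluence {J R : ℕ} {E : Type*} (q : Fin (J + 2) → Fin (R + 2) → E → ℝ)
    (p : Fin (J + 2) → E → ℝ) (s : Obs J R E) : Fin J → ℝ :=
  let qx : Fin (J + 2) → Fin (R + 1) → ℝ := fun g t => q g t.castSucc (cov s)
  let M := diffMatrix qx
  let m1 := diffVec qx
  let A := diffMatrix (ipwResid q p s)
  let a1 := diffVec (ipwResid q p s)
  (Mᵀ * M)⁻¹ *ᵥ (Mᵀ *ᵥ a1) + (Mᵀ * M)⁻¹ *ᵥ (Aᵀ *ᵥ m1)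
    - (Mᵀ * M)⁻¹ *ᵥ ((Aᵀ * M + Mᵀ * A) *ᵥ ((Mᵀ * M)⁻¹ *ᵥ (Mᵀ *ᵥ m1)))

/-- The adjustment `ψ_2 = -π_1⁻¹ u(X)' [P(S); -1' P(S)]`, with
`u_g = p_1 (m_{g,Δ} - m_Δ)`, for the estimation of the weights. -/
def psi2 {J R : ℕ} {E : Type*} (m : E → ℝ) (q : Fin (J + 2) → Fin (R + 2) → E → ℝ)
    (p : Fin (J + 2) → E → ℝ) (π : ℝ) (s : Obs J R E) : ℝ :=
  -(1 / π) * ∑ g : Fin (J + 1),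
    p 0 (cov s) * (groupTrend q g.succ (cov s) - m (cov s)) *
      Fin.snoc (α := fun _ => ℝ) (weightInfluence q p s) (-∑ j, weightInfluence q p s j) g

/-- The influence function `ψ_SC = ψ_PT + ψ_1 + ψ_2`. -/
def psiSC {J R : ℕ} {E : Type*} (m : E → ℝ) (q : Fin (J + 2) → Fin (R + 2) → E → ℝ)
    (p : Fin (J + 2) → E → ℝ) (w : Fin (J + 1) → E → ℝ) (π θ : ℝ) (s : Obs J R E) : ℝ :=
  psiPT m p w π θ s + psi1 m q p w π s + psi2 m q p π s

/-! ### Kernels and Bahadur representations (scalar covariate) -/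

/-- A symmetric probability density with finite second moment. -/
def IsKernel (K : ℝ → ℝ) : Prop :=
  Measurable K ∧ (∀ u, 0 ≤ K u) ∧ (∀ u, K (-u) = K u) ∧ ∫ u, K u = 1 ∧
    Integrable fun u => u ^ 2 * K u

/-- `f` is a probability density of `μ`. -/
def IsDensity (μ : Measure ℝ) (f : ℝ → ℝ) : Prop :=
  Measurable f ∧ (∀ x, 0 ≤ f x) ∧ μ = volume.withDensity fun x => ENNReal.ofReal (f x)

/-- The leading term `P_n[V K_h(X - x) / f(x) ξ(S)]`, `K_h = K(· / h) / h`, of a Bahadur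
representation, with the average over the units outside fold `ℓ`. -/
def leadingTerm {Ω : Type*} {L J R : ℕ} (fold : FoldMap L) (S : ℕ → Ω → Obs J R ℝ)
    (V : ℕ → Ω → ℝ) (K : ℝ → ℝ) (h : ℕ → ℝ) (f : ℝ → ℝ) (ξ : Obs J R ℝ → ℝ)
    (k : ℕ) (ℓ : Fin L) (η : Ω) (x : ℝ) : ℝ :=
  (1 / (Fintype.card (Train fold k ℓ) : ℝ)) * ∑ i : Train fold k ℓ,
    V i.1 η * (K ((cov (S i.1 η) - x) / h k) / h k / f x * ξ (S i.1 η))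

/-- Rate conditions and uniform Bahadur representations of the nuisance estimators `rHat` of the
ratios and `qHat` of the functions `m_{g,t}` in the pre-treatment periods, and the rate condition on
the synthetic control weights built from `qHat`. -/
structure KernelConditions {Ω : Type*} [MeasurableSpace Ω] {L J R : ℕ} (Pr : Measure Ω)
    (FX : Measure ℝ) (fold : FoldMap L) (S : ℕ → Ω → Obs J R ℝ) (V : ℕ → Ω → ℝ)
    (K : ℝ → ℝ) (h : ℕ → ℝ) (f : ℝ → ℝ) (q : Fin (J + 2) → Fin (R + 2) → ℝ → ℝ)
    (p : Fin (J + 2) → ℝ → ℝ) (w : Fin (J + 1) → ℝ → ℝ)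
    (rHat : Fin (J + 1) → ℕ → Fin L → Ω → ℝ → ℝ)
    (qHat : Fin (J + 2) → Fin (R + 1) → ℕ → Fin L → Ω → ℝ → ℝ) : Prop where
  rate_m : ∀ ℓ g t, IsLittleOp Pr
    (fun k η => eLpNorm (fun x => qHat g t k ℓ η x - q g t.castSucc x) 2 FX) (rate L (1 / 4))
  rate_r : ∀ ℓ g, IsLittleOp Pr
    (fun k η => eLpNorm (fun x => rHat g k ℓ η x - ratio p g x) 2 FX) (rate L (1 / 4))
  rate_w : ∀ ℓ g, IsLittleOp Pr
    (fun k η => eLpNorm (fun x => scWeightsHat qHat g k ℓ η x - w g x) 2 FX) (rate L (1 / 4))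
  bahadur_r : ∀ ℓ g, IsLittleOp Pr
    (fun k η => eLpNorm (fun x => rHat g k ℓ η x - ratio p g x -
      leadingTerm fold S V K h f (fun s => ratioResid p s g) k ℓ η x) ∞ FX) (rate L (1 / 2))
  bahadur_m : ∀ ℓ g t, IsLittleOp Pr
    (fun k η => eLpNorm (fun x => qHat g t k ℓ η x - q g t.castSucc x -
      leadingTerm fold S V K h f (fun s => ipwResid q p s g t) k ℓ η x) ∞ FX) (rate L (1 / 2))

end PanelATT

end

open PanelATT

/-! Let `ψ` be the influence function, `n = L * k`, and `Φ` the distribution function of the centred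
Gaussian law with variance `E ψ²`. Each case reduces to two expansions up to `o_p(1)`: `√n (θ̂ - θ)`
is `n^{-1/2} ∑ ψ(S_i)`, and `√n (θ* - θ)` is `n^{-1/2} ∑ W_i ψ(S_i)`. Their difference shows that
`√n (θ* - θ̂)` is the multiplier sum `n^{-1/2} ∑ (W_i - 1) ψ(S_i)`. Both expansions are proved at
once, for a sample with iid multipliers of mean one (`IsWeightedSample`); the original estimator has
multipliers with law `δ_1`.

Bootstrap consistency follows from the expansions by a second moment argument
(`bootstrapConsistent_of_linear`). Let `g` be the conditional probability, given the data, that the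
multiplier sum is at most `b`. Then `E g` tends to `Φ(b)` by the central limit theorem, and `E g²`
is the probability that two multiplier sums with the same data and independent copies of the weights
are both at most `b`. These sums are uncorrelated, so the bivariate limit is a product and `E g²`
tends to `Φ(b)²` (`tendsto_multSum_quadrant`); hence `g` tends to `Φ(b)` in `L²`.
`integral_abs_condDistrib_sub_le` carries this over to the bootstrap estimator despite the
remainder, and Pólya's argument makes it uniform in `b`, because `E ψ² > 0` makes `Φ` continuous.

For the expansions, the moment function with estimated nuisance functions is compared with the true
one, given the data outside the fold (`phi_sub_phi`, `smallProb_fold_sum_phi`). Centred first-order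
terms vanish because their conditional variance does. The terms linear in `m̂ - m` have conditional
means that cancel, since the estimated weights sum to one and `r_{1,g} p_g = p_1`. The product of
the errors of `m̂` and `r̂` is negligible by Cauchy-Schwarz and the product rate. What remains is
the bias `∑_g ∫ (ŵ_g r̂_g - ω_g r_g) p_g d_g`, where `d_g(X)` is the mean of `ΔY - m_Δ(X)` in
control group `g` given `X`.

Under parallel trends every `d_g` is zero (`ParallelTrends.trend_eq`), so the bias vanishes. Under
synthetic control the bias is linearized in the errors of the ratios and of the outcome regressions,
with a quadratic remainder that is `o_p(n^{-1/2})` by the `n^{-1/4}` rates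
(`exists_abs_weight_ratio_remainder_le`, which rests on perturbing the normal equations in
`norm_ls_remainder_le`). The Bahadur representations turn the linear part into averages over the
training samples (`smallProb_bahadur`). Every unit lies in `L - 1` training samples of size `(L - 1)
k`, so summing over folds restores the full sample average (`smallProb_sum_adjustment`), and the
result is `ψ_1 + ψ_2` (`psiSC_eq`). That the influence functions have mean zero is the
identification of the treatment effect in `integral_phi`, together with the orthogonality of the
residuals to functions of `X`. -/

namespace PanelATT

/-! ### Calculus of quantities that vanish in probability -/

section Calculus

variable {Ω : Type*} [MeasurableSpace Ω] {Pr : Measure Ω}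

/-- `Z k = o_p(1)` for nonnegative extended-valued `Z k`. -/
def SmallProb (Pr : Measure Ω) (Z : ℕ → Ω → ℝ≥0∞) : Prop :=
  ∀ ε : ℝ≥0∞, ε ≠ 0 → Tendsto (fun k => Pr {η | ε < Z k η}) atTop (𝓝 0)

lemma tendsto_measure_of_subset {A B : ℕ → Set Ω} (hB : Tendsto (fun k => Pr (B k)) atTop (𝓝 0))
    (h : ∀ᶠ k in atTop, A k ⊆ B k) : Tendsto (fun k => Pr (A k)) atTop (𝓝 0) :=
  tendsto_of_tendsto_of_tendsto_of_le_of_le' tendsto_const_nhds hB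
    (Eventually.of_forall fun _ => zero_le) (h.mono fun _ hk => measure_mono hk)

lemma tendsto_measure_union {A B : ℕ → Set Ω} (hA : Tendsto (fun k => Pr (A k)) atTop (𝓝 0))
    (hB : Tendsto (fun k => Pr (B k)) atTop (𝓝 0)) :
    Tendsto (fun k => Pr (A k ∪ B k)) atTop (𝓝 0) :=
  tendsto_of_tendsto_of_tendsto_of_le_of_le tendsto_const_nhds (by simpa using hA.add hB)
    (fun _ => zero_le) fun _ => measure_union_le _ _

/-- On the complement of events of vanishing probability, `Z'` is dominated by `Z`. -/
lemma SmallProb.mono_event {Z Z' : ℕ → Ω → ℝ≥0∞} {B : ℕ → Set Ω} (hZ : SmallProb Pr Z)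
    (hB : Tendsto (fun k => Pr (B k)) atTop (𝓝 0))
    (h : ∀ᶠ k in atTop, ∀ η, η ∉ B k → Z' k η ≤ Z k η) : SmallProb Pr Z' := by
  intro ε hε
  refine tendsto_measure_of_subset (tendsto_measure_union (hZ ε hε) hB) ?_
  filter_upwards [h] with k hk η hη
  by_cases hb : η ∈ B k
  · exact Or.inr hb
  · exact Or.inl (lt_of_lt_of_le hη (hk η hb))

lemma SmallProb.mono_ae {Z Z' : ℕ → Ω → ℝ≥0∞} (hZ : SmallProb Pr Z)
    (h : ∀ᶠ k in atTop, ∀ᵐ η ∂Pr, Z' k η ≤ Z k η) : SmallProb Pr Z' := by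
  refine hZ.mono_event (B := fun k => {η | ¬ Z' k η ≤ Z k η}) ?_
    (Eventually.of_forall fun k η hη => by simpa using hη)
  refine tendsto_const_nhds.congr' ?_
  filter_upwards [h] with k hk
  exact (ae_iff.1 hk).symm

lemma SmallProb.mono {Z Z' : ℕ → Ω → ℝ≥0∞} (hZ : SmallProb Pr Z)
    (h : ∀ k η, Z' k η ≤ Z k η) : SmallProb Pr Z' :=
  hZ.mono_ae (Eventually.of_forall fun k => Eventually.of_forall fun η => h k η)

lemma smallProb_zero : SmallProb Pr (fun _ _ => 0) := by
  intro ε _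
  simp

lemma SmallProb.add {Z Z' : ℕ → Ω → ℝ≥0∞} (hZ : SmallProb Pr Z) (hZ' : SmallProb Pr Z') :
    SmallProb Pr (fun k η => Z k η + Z' k η) := by
  intro ε hε
  have h2 : ε / 2 ≠ 0 := (ENNReal.half_pos hε).ne'
  refine tendsto_measure_of_subset (tendsto_measure_union (hZ _ h2) (hZ' _ h2))
    (Eventually.of_forall fun k η hη => ?_)
  by_contra hcon
  simp only [Set.mem_union, Set.mem_ofPred_eq, not_or, not_lt] at hcon hη
  exact absurd hη (not_lt.2 ((add_le_add hcon.1 hcon.2).trans (ENNReal.add_halves ε).le))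

lemma SmallProb.sum {ι : Type*} (s : Finset ι) {Z : ι → ℕ → Ω → ℝ≥0∞}
    (hZ : ∀ i ∈ s, SmallProb Pr (Z i)) : SmallProb Pr (fun k η => ∑ i ∈ s, Z i k η) := by
  classical
  induction s using Finset.induction_on with
  | empty => simpa using smallProb_zero
  | insert i s hi ih =>
    simp only [Finset.sum_insert hi]
    exact (hZ i (by simp)).add (ih fun j hj => hZ j (by simp [hj]))

/-- An `O_p(1)` factor does not matter. -/
lemma SmallProb.mul_bounded {Z B : ℕ → Ω → ℝ≥0∞} (hZ : SmallProb Pr Z)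
    (hB : IsBoundedInProb Pr B) : SmallProb Pr (fun k η => B k η * Z k η) := by
  intro ε hε
  rw [ENNReal.tendsto_nhds_zero]
  intro δ hδ
  obtain ⟨C, hC⟩ := hB (δ / 2) (ENNReal.half_pos hδ.ne')
  have hc : ε / ENNReal.ofReal (|C| + 1) ≠ 0 :=
    (ENNReal.div_pos hε ENNReal.ofReal_ne_top).ne'
  filter_upwards [hC, (ENNReal.tendsto_nhds_zero.1 (hZ _ hc)) (δ / 2) (ENNReal.half_pos hδ.ne')]
    with k h1 h2
  refine (measure_mono (t := {η | ENNReal.ofReal C < B k η} ∪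
    {η | ε / ENNReal.ofReal (|C| + 1) < Z k η}) fun η hη => ?_).trans
    ((measure_union_le _ _).trans ((add_le_add h1 h2).trans (ENNReal.add_halves δ).le))
  by_contra hcon
  simp only [Set.mem_union, Set.mem_ofPred_eq, not_or, not_lt] at hcon hη
  refine absurd hη (not_lt.2 ?_)
  calc B k η * Z k η
      ≤ ENNReal.ofReal (|C| + 1) * (ε / ENNReal.ofReal (|C| + 1)) := by
        refine mul_le_mul' (hcon.1.trans (ENNReal.ofReal_le_ofReal ?_)) hcon.2
        linarith [le_abs_self C]
    _ ≤ ε := ENNReal.mul_div_le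

lemma isBoundedInProb_const {c : ℝ≥0∞} (hc : c ≠ ∞) : IsBoundedInProb Pr (fun _ _ => c) := by
  intro ε _
  refine ⟨c.toReal, Eventually.of_forall fun k => ?_⟩
  simp [ENNReal.ofReal_toReal hc]

lemma SmallProb.const_mul {Z : ℕ → Ω → ℝ≥0∞} (hZ : SmallProb Pr Z) {c : ℝ≥0∞} (hc : c ≠ ∞) :
    SmallProb Pr (fun k η => c * Z k η) :=
  hZ.mul_bounded (isBoundedInProb_const hc)

lemma SmallProb.isBoundedInProb {Z : ℕ → Ω → ℝ≥0∞} (hZ : SmallProb Pr Z) :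
    IsBoundedInProb Pr Z := by
  intro ε hε
  refine ⟨1, ?_⟩
  simpa using (ENNReal.tendsto_nhds_zero.1 (hZ 1 one_ne_zero)) ε hε

/-- Variance bounds control the square; this returns to the variable itself. -/
lemma SmallProb.sqrt {Z : ℕ → Ω → ℝ≥0∞} (hZ : SmallProb Pr fun k η => Z k η ^ 2) :
    SmallProb Pr Z := by
  intro ε hε
  refine tendsto_measure_of_subset (hZ (ε ^ 2) (pow_ne_zero _ hε))
    (Eventually.of_forall fun k η hη => ?_)
  exact ENNReal.pow_lt_pow_left two_ne_zero hη

lemma SmallProb.sq {Z : ℕ → Ω → ℝ≥0∞} (hZ : SmallProb Pr Z) :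
    SmallProb Pr fun k η => Z k η ^ 2 := by
  simpa [pow_two] using hZ.mul_bounded hZ.isBoundedInProb

lemma SmallProb.of_lintegral {Z : ℕ → Ω → ℝ≥0∞} (hm : ∀ k, AEMeasurable (Z k) Pr)
    (h : Tendsto (fun k => ∫⁻ η, Z k η ∂Pr) atTop (𝓝 0)) : SmallProb Pr Z := by
  intro ε hε
  rcases eq_or_ne ε ∞ with rfl | hε'
  · simp
  have h' : Tendsto (fun k => (∫⁻ η, Z k η ∂Pr) / ε) atTop (𝓝 0) := by
    simpa [div_eq_mul_inv] using ENNReal.Tendsto.mul_const (b := ε⁻¹) h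
      (Or.inr (ENNReal.inv_ne_top.2 hε))
  refine tendsto_of_tendsto_of_tendsto_of_le_of_le tendsto_const_nhds h' (fun _ => zero_le)
    fun k => ?_
  exact (measure_mono fun η (hη : ε < _) => hη.le).trans
    (meas_ge_le_lintegral_div (hm k) hε hε')

/-- Norms of estimators are extended-valued. The event of an infinite norm can thus be put into the
exceptional set of `SmallProb.mono_event`, and off that event the integrals involved are genuine. -/
lemma SmallProb.ne_top {Z : ℕ → Ω → ℝ≥0∞} (hZ : SmallProb Pr Z) :
    Tendsto (fun k => Pr {η | Z k η = ∞}) atTop (𝓝 0) :=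
  tendsto_measure_of_subset (hZ 1 one_ne_zero)
    (Eventually.of_forall fun k η hη => by
      simp only [Set.mem_ofPred_eq] at hη ⊢
      simp [hη])

lemma IsBoundedInProb.ne_top {Z : ℕ → Ω → ℝ≥0∞} (hZ : IsBoundedInProb Pr Z) :
    Tendsto (fun k => Pr {η | Z k η = ∞}) atTop (𝓝 0) := by
  rw [ENNReal.tendsto_nhds_zero]
  intro ε hε
  obtain ⟨C, hC⟩ := hZ ε hε
  refine hC.mono fun k hk => (measure_mono fun η hη => ?_).trans hk
  simp only [Set.mem_ofPred_eq] at hη ⊢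
  simp [hη]

lemma IsLittleOp.smallProb {Z : ℕ → Ω → ℝ≥0∞} (hZ : IsLittleOp Pr Z fun _ => 1) :
    SmallProb Pr Z := by
  intro ε hε
  obtain ⟨r, hr0, hr⟩ := ENNReal.lt_iff_exists_real_btwn.1 (pos_iff_ne_zero.2 hε)
  refine tendsto_measure_of_subset (hZ r (by
    by_contra hcon
    simp [ENNReal.ofReal_of_nonpos (not_lt.1 hcon)] at hr)) (Eventually.of_forall fun k η hη => ?_)
  simp only [Set.mem_ofPred_eq, mul_one] at hη ⊢
  exact hr.2.trans hη

/-- `Z = o_p(n^{-c})` means that `n^c Z = o_p(1)`. -/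
lemma IsLittleOp.smallProb_rate {Z : ℕ → Ω → ℝ≥0∞} {L : ℕ} (hL : 0 < L) {c : ℝ}
    (hZ : IsLittleOp Pr Z (rate L c)) :
    SmallProb Pr (fun k η => ENNReal.ofReal (((L * k : ℕ) : ℝ) ^ c) * Z k η) := by
  intro ε hε
  obtain ⟨r, hr0, hr⟩ := ENNReal.lt_iff_exists_real_btwn.1 (pos_iff_ne_zero.2 hε)
  refine tendsto_measure_of_subset (hZ r (by
    by_contra hcon
    simp [ENNReal.ofReal_of_nonpos (not_lt.1 hcon)] at hr)) ?_
  filter_upwards [eventually_gt_atTop 0] with k hk η hη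
  by_contra hcon
  simp only [Set.mem_ofPred_eq, not_lt] at hη hcon
  have hn : (0 : ℝ) < ((L * k : ℕ) : ℝ) := by exact_mod_cast Nat.mul_pos hL hk
  refine absurd hη (not_lt.2 ?_)
  calc _ ≤ ENNReal.ofReal (((L * k : ℕ) : ℝ) ^ c) * ENNReal.ofReal (r * rate L c k) :=
        mul_le_mul' le_rfl hcon
    _ = ENNReal.ofReal r := by
        rw [← ENNReal.ofReal_mul (by positivity), rate, Real.rpow_neg hn.le]
        congr 1
        field_simp
    _ ≤ ε := hr.2.le

/-- Convergence in measure uses non-strict level sets and `SmallProb` strict ones; halving the level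
absorbs the difference. -/
lemma smallProb_enorm_iff_tendstoInMeasure {X : ℕ → Ω → ℝ} :
    SmallProb Pr (fun k η => ‖X k η‖ₑ) ↔ TendstoInMeasure Pr X atTop (fun _ => 0) := by
  rw [tendstoInMeasure_iff_enorm]
  constructor
  · intro h ε hε hε'
    refine tendsto_measure_of_subset (h (ε / 2) (ENNReal.half_pos hε.ne').ne')
      (Eventually.of_forall fun k η hη => ?_)
    simp only [Set.mem_ofPred_eq, sub_zero] at hη ⊢
    exact (ENNReal.half_lt_self hε.ne' hε').trans_le hη
  · intro h ε hε
    rcases eq_or_ne ε ∞ with rfl | hε'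
    · simp
    refine tendsto_measure_of_subset (h ε (pos_iff_ne_zero.2 hε) hε')
      (Eventually.of_forall fun k η hη => ?_)
    simp only [Set.mem_ofPred_eq, sub_zero] at hη ⊢
    exact hη.le

lemma SmallProb.enorm_add {X Y : ℕ → Ω → ℝ} (hX : SmallProb Pr fun k η => ‖X k η‖ₑ)
    (hY : SmallProb Pr fun k η => ‖Y k η‖ₑ) : SmallProb Pr fun k η => ‖X k η + Y k η‖ₑ :=
  (hX.add hY).mono fun _ _ => enorm_add_le _ _

lemma SmallProb.enorm_sub {X Y : ℕ → Ω → ℝ} (hX : SmallProb Pr fun k η => ‖X k η‖ₑ)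
    (hY : SmallProb Pr fun k η => ‖Y k η‖ₑ) : SmallProb Pr fun k η => ‖X k η - Y k η‖ₑ :=
  (hX.add hY).mono fun _ _ => enorm_sub_le

lemma SmallProb.enorm_sum {ι : Type*} (s : Finset ι) {X : ι → ℕ → Ω → ℝ}
    (hX : ∀ i ∈ s, SmallProb Pr fun k η => ‖X i k η‖ₑ) :
    SmallProb Pr fun k η => ‖∑ i ∈ s, X i k η‖ₑ :=
  (SmallProb.sum s hX).mono fun _ _ => enorm_sum_le _ _

lemma SmallProb.enorm_const_mul {X : ℕ → Ω → ℝ} (hX : SmallProb Pr fun k η => ‖X k η‖ₑ)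
    (c : ℝ) : SmallProb Pr fun k η => ‖c * X k η‖ₑ := by
  simpa only [enorm_mul] using hX.const_mul (c := ‖c‖ₑ) enorm_ne_top

end Calculus

end PanelATT

/-! ### Independence of pairs and central limit theorems -/

namespace PanelATT

section CentralLimit

variable {Ω : Type*} [MeasurableSpace Ω] {Pr : Measure Ω}

/-- Pairs built from two mutually independent independent sequences are independent. -/
lemma iIndepFun_prodMk_of_indepFun {A B : Type*} [MeasurableSpace A] [MeasurableSpace B]
    {S : ℕ → Ω → A} {W : ℕ → Ω → B} (hSm : ∀ i, Measurable (S i)) (hWm : ∀ i, Measurable (W i))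
    (hS : iIndepFun S Pr) (hW : iIndepFun W Pr)
    (hSW : IndepFun (fun η i => S i η) (fun η i => W i η) Pr) :
    iIndepFun (fun i η => (S i η, W i η)) Pr := by
  -- Measurable rectangles generate the σ-algebra of a pair and are stable under intersection, so
  -- independence need only be checked on them.
  let π : ℕ → Set (Set Ω) := fun i =>
    {u | ∃ s : Set A, MeasurableSet s ∧ ∃ t : Set B, MeasurableSet t ∧
      u = (fun η => (S i η, W i η)) ⁻¹' (s ×ˢ t)}
  have hπ : ∀ i, MeasurableSpace.comap (fun η => (S i η, W i η)) Prod.instMeasurableSpace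
      = MeasurableSpace.generateFrom (π i) := by
    intro i
    rw [← generateFrom_prod, MeasurableSpace.comap_generateFrom]
    congr 1
    ext u
    simp only [Set.mem_image, Set.mem_image2, Set.mem_ofPred_eq, π]
    constructor
    · rintro ⟨_, ⟨s, hs, t, ht, rfl⟩, rfl⟩
      exact ⟨s, hs, t, ht, rfl⟩
    · rintro ⟨s, hs, t, ht, rfl⟩
      exact ⟨_, ⟨s, hs, t, ht, rfl⟩, rfl⟩
  refine iIndepSets.iIndep (fun i => (((hSm i).prodMk (hWm i)).comap_le)) π ?_ hπ ?_
  · rintro i _ ⟨s, hs, t, ht, rfl⟩ _ ⟨s', hs', t', ht', rfl⟩ -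
    refine ⟨s ∩ s', hs.inter hs', t ∩ t', ht.inter ht', ?_⟩
    rw [← Set.preimage_inter, Set.prod_inter_prod]
  · rw [iIndepSets_iff]
    intro F f hf
    have hf' : ∀ i, ∃ s : Set A, MeasurableSet s ∧ ∃ t : Set B, MeasurableSet t ∧
        (i ∈ F → f i = S i ⁻¹' s ∩ W i ⁻¹' t) := by
      intro i
      by_cases hi : i ∈ F
      · obtain ⟨s, hs, t, ht, h⟩ := hf i hi
        exact ⟨s, hs, t, ht, fun _ => h⟩
      -- Arbitrary values for indices outside `F`, which do not enter the intersection.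
      · exact ⟨∅, MeasurableSet.empty, ∅, MeasurableSet.empty, fun h => absurd h hi⟩
    choose s hs t ht h using hf'
    have hmul : ∀ (u : Set (ℕ → A)) (v : Set (ℕ → B)), MeasurableSet u → MeasurableSet v →
        Pr ((fun η i => S i η) ⁻¹' u ∩ (fun η i => W i η) ⁻¹' v)
          = Pr ((fun η i => S i η) ⁻¹' u) * Pr ((fun η i => W i η) ⁻¹' v) :=
      fun u v hu hv => hSW.measure_inter_preimage_eq_mul u v hu hv
    -- A finite intersection of rectangles is a single rectangle in the pair of sequences, and the
    -- independence of the two sequences splits its probability.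
    have h1 : (⋂ i ∈ F, f i) = (fun η i => S i η) ⁻¹' (⋂ i ∈ F, (fun x => x i) ⁻¹' s i) ∩
        (fun η i => W i η) ⁻¹' (⋂ i ∈ F, (fun x => x i) ⁻¹' t i) := by
      rw [Set.iInter₂_congr h]
      ext η
      simp only [Set.mem_iInter, Set.mem_inter_iff, Set.mem_preimage]
      exact ⟨fun h => ⟨fun i hi => (h i hi).1, fun i hi => (h i hi).2⟩,
        fun h i hi => ⟨h.1 i hi, h.2 i hi⟩⟩
    rw [h1, hmul _ _ (Finset.measurableSet_biInter _ fun i _ => measurable_pi_apply i (hs i))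
      (Finset.measurableSet_biInter _ fun i _ => measurable_pi_apply i (ht i))]
    have h2 : ∀ i ∈ F, Pr (f i) = Pr (S i ⁻¹' s i) * Pr (W i ⁻¹' t i) := by
      intro i hi
      rw [h i hi]
      have := hmul ((fun x => x i) ⁻¹' s i) ((fun x => x i) ⁻¹' t i)
        (measurable_pi_apply i (hs i)) (measurable_pi_apply i (ht i))
      simpa [Set.preimage_preimage] using this
    rw [Finset.prod_congr rfl h2, Finset.prod_mul_distrib]
    congr 1
    · rw [← (iIndepFun_iff_measure_inter_preimage_eq_mul.1 hS) F fun i _ => hs i]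
      simp [Set.preimage_iInter, Set.preimage_preimage]
    · rw [← (iIndepFun_iff_measure_inter_preimage_eq_mul.1 hW) F fun i _ => ht i]
      simp [Set.preimage_iInter, Set.preimage_preimage]

variable [IsProbabilityMeasure Pr]

/-- The central limit theorem in terms of characteristic functions, allowing degenerate limits. -/
lemma tendsto_charFun_sum_div_sqrt {X : ℕ → Ω → ℝ} (hX : MemLp (X 0) 2 Pr)
    (h0 : ∫ η, X 0 η ∂Pr = 0) (hindep : iIndepFun X Pr)
    (hident : ∀ i, IdentDistrib (X i) (X 0) Pr Pr) (t : ℝ) :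
    Tendsto (fun n : ℕ => charFun (Pr.map fun η => (√n)⁻¹ * ∑ i ∈ Finset.range n, X i η) t) atTop
      (𝓝 (charFun (gaussianReal 0 (∫ η, X 0 η ^ 2 ∂Pr).toNNReal) t)) := by
  have hvar : Var[X 0; Pr] = ∫ η, X 0 η ^ 2 ∂Pr :=
    variance_of_integral_eq_zero hX.aestronglyMeasurable.aemeasurable h0
  have h := (tendstoInDistribution_inv_sqrt_mul_sum_sub (Y := id)
    (P' := gaussianReal 0 Var[X 0; Pr].toNNReal) HasLaw.id hX hindep hident).tendsto
  simpa [h0, hvar] using ProbabilityMeasure.tendsto_iff_tendsto_charFun.1 h t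

lemma sum_sqrt_tendstoInDistribution {X : ℕ → Ω → ℝ} (hX : MemLp (X 0) 2 Pr)
    (h0 : ∫ η, X 0 η ∂Pr = 0) (hindep : iIndepFun X Pr)
    (hident : ∀ i, IdentDistrib (X i) (X 0) Pr Pr) :
    TendstoInDistribution (fun (n : ℕ) η => (√n)⁻¹ * ∑ i ∈ Finset.range n, X i η) atTop id
      (fun _ => Pr) (gaussianReal 0 (∫ η, X 0 η ^ 2 ∂Pr).toNNReal) := by
  have hvar : Var[X 0; Pr] = ∫ η, X 0 η ^ 2 ∂Pr :=
    variance_of_integral_eq_zero hX.aestronglyMeasurable.aemeasurable h0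
  rw [← hvar]
  simpa [h0] using (tendstoInDistribution_inv_sqrt_mul_sum_sub (Y := id)
    (P' := gaussianReal 0 Var[X 0; Pr].toNNReal) HasLaw.id hX hindep hident)

/-- If all linear combinations of `Z k, Z' k` behave like those of two independent centred Gaussian
variables with variance `v`, then so do the quadrant probabilities. -/
lemma tendsto_measure_quadrant {Z Z' : ℕ → Ω → ℝ} (hZ : ∀ k, Measurable (Z k))
    (hZ' : ∀ k, Measurable (Z' k)) {v : NNReal} (hv : v ≠ 0)
    (h : ∀ c d : ℝ, Tendsto (fun k => charFun (Pr.map fun η => c * Z k η + d * Z' k η) 1) atTop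
      (𝓝 (charFun (gaussianReal 0 v) c * charFun (gaussianReal 0 v) d))) (b : ℝ) :
    Tendsto (fun k => Pr {η | Z k η ≤ b ∧ Z' k η ≤ b}) atTop
      (𝓝 (gaussianReal 0 v (Set.Iic b) * gaussianReal 0 v (Set.Iic b))) := by
  have hna := nullSingletonClass_gaussianReal (μ := 0) hv
  -- Cramér-Wold in the Euclidean plane: the characteristic function of the pair at `t` is that of
  -- the linear combination with coefficients `t 0`, `t 1` at the point `1`.
  let e : ℝ × ℝ → EuclideanSpace ℝ (Fin 2) := fun z => !₂[z.1, z.2]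
  have he : Measurable e := by
    refine (WithLp.measurable_toLp 2 (Fin 2 → ℝ)).comp (measurable_pi_iff.2 fun i => ?_)
    fin_cases i
    · exact measurable_fst
    · exact measurable_snd
  have hq : ∀ k, Measurable fun η => e (Z k η, Z' k η) := fun k =>
    he.comp ((hZ k).prodMk (hZ' k))
  let γ : Measure (EuclideanSpace ℝ (Fin 2)) :=
    ((gaussianReal 0 v).prod (gaussianReal 0 v)).map e
  have : IsProbabilityMeasure γ := Measure.isProbabilityMeasure_map he.aemeasurable
  let μs : ℕ → ProbabilityMeasure (EuclideanSpace ℝ (Fin 2)) := fun k =>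
    ⟨Pr.map fun η => e (Z k η, Z' k η), Measure.isProbabilityMeasure_map (hq k).aemeasurable⟩
  have hinner : ∀ (z : ℝ × ℝ) (t : EuclideanSpace ℝ (Fin 2)),
      inner ℝ (e z) t = t 0 * z.1 + t 1 * z.2 := by
    intro z t
    simp [e, PiLp.inner_apply, Fin.sum_univ_two]
  let γ' : ProbabilityMeasure (EuclideanSpace ℝ (Fin 2)) := ⟨γ, this⟩
  have hlim : Tendsto μs atTop (𝓝 γ') := by
    refine ProbabilityMeasure.tendsto_iff_tendsto_charFun.2 fun t => ?_
    have h1 : ∀ k, charFun (μs k : Measure (EuclideanSpace ℝ (Fin 2))) t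
        = charFun (Pr.map fun η => t 0 * Z k η + t 1 * Z' k η) 1 := by
      intro k
      have hm : Measurable fun η => t 0 * Z k η + t 1 * Z' k η :=
        ((hZ k).const_mul _).add ((hZ' k).const_mul _)
      rw [charFun_apply, charFun_apply]
      simp only [μs, ProbabilityMeasure.coe_mk]
      rw [integral_map (hq k).aemeasurable (by fun_prop),
        integral_map hm.aemeasurable (by fun_prop)]
      simp [hinner]
    have h2 : charFun γ t
        = charFun (gaussianReal 0 v) (t 0) * charFun (gaussianReal 0 v) (t 1) := by
      rw [charFun_apply, charFun_apply, charFun_apply, ← integral_prod_mul]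
      simp only [γ]
      rw [integral_map he.aemeasurable (by fun_prop)]
      refine integral_congr_ae (Eventually.of_forall fun z => ?_)
      simp only [hinner, ← Complex.exp_add]
      congr 1
      simp
      ring
    simp only [h1]
    have h3 : (γ' : Measure (EuclideanSpace ℝ (Fin 2))) = γ := rfl
    rw [h3, h2]
    exact h (t 0) (t 1)
  let Q : Set (EuclideanSpace ℝ (Fin 2)) := {z | z 0 ≤ b ∧ z 1 ≤ b}
  have hc0 : Continuous fun z : EuclideanSpace ℝ (Fin 2) => z 0 := by fun_prop
  have hc1 : Continuous fun z : EuclideanSpace ℝ (Fin 2) => z 1 := by fun_prop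
  have hQc : IsClosed Q :=
    (isClosed_le hc0 continuous_const).inter (isClosed_le hc1 continuous_const)
  -- The boundary of the quadrant lies on two lines, which are null for a product of atomless laws.
  -- This is where `v ≠ 0` matters.
  have hfr : frontier Q ⊆ {z | z 0 = b} ∪ {z | z 1 = b} := by
    intro z hz
    rw [hQc.frontier_eq] at hz
    by_contra hcon
    simp only [Set.mem_union, Set.mem_ofPred_eq, not_or] at hcon
    refine hz.2 (mem_interior.2 ⟨{z | z 0 < b ∧ z 1 < b}, fun y hy => ⟨hy.1.le, hy.2.le⟩,
      (isOpen_lt hc0 continuous_const).inter (isOpen_lt hc1 continuous_const), ?_⟩)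
    exact ⟨lt_of_le_of_ne hz.1.1 hcon.1, lt_of_le_of_ne hz.1.2 hcon.2⟩
  have hnull : γ (frontier Q) = 0 := by
    refine measure_mono_null hfr (measure_union_null ?_ ?_)
    · simp only [γ]
      rw [Measure.map_apply he (measurableSet_eq_fun hc0.measurable measurable_const)]
      have : e ⁻¹' {z | z 0 = b} = {b} ×ˢ Set.univ := by
        ext z; simp [e]
      rw [this, Measure.prod_prod]
      simp
    · simp only [γ]
      rw [Measure.map_apply he (measurableSet_eq_fun hc1.measurable measurable_const)]
      have : e ⁻¹' {z | z 1 = b} = Set.univ ×ˢ {b} := by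
        ext z; simp [e]
      rw [this, Measure.prod_prod]
      simp
  have hfin := ProbabilityMeasure.tendsto_measure_of_null_frontier_of_tendsto' hlim (E := Q) hnull
  have h3 : γ Q = gaussianReal 0 v (Set.Iic b) * gaussianReal 0 v (Set.Iic b) := by
    simp only [γ]
    rw [Measure.map_apply he hQc.measurableSet, ← Measure.prod_prod]
    congr 1
  have h4 : ∀ k, (μs k : Measure (EuclideanSpace ℝ (Fin 2))) Q
      = Pr {η | Z k η ≤ b ∧ Z' k η ≤ b} := by
    intro k
    simp only [μs, ProbabilityMeasure.coe_mk]
    rw [Measure.map_apply (hq k) hQc.measurableSet]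
    congr 1
  simp only [h4] at hfin
  rwa [show (γ' : Measure (EuclideanSpace ℝ (Fin 2))) Q = _ from h3] at hfin

end CentralLimit

end PanelATT

/-! ### Pólya's theorem on uniform convergence of distribution functions -/

namespace PanelATT

section Polya

/-- Pólya: the distance of a distribution function to a continuous one is controlled by the
distances at finitely many points. -/
lemma exists_finset_forall_abs_measureReal_Iic_sub_le (γ : Measure ℝ) [IsProbabilityMeasure γ]
    (hγ : Continuous fun a => γ.real (Set.Iic a)) {ε : ℝ} (hε : 0 < ε) :
    ∃ F : Finset ℝ, ∀ (ν : Measure ℝ), IsProbabilityMeasure ν → ∀ a : ℝ,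
      |ν.real (Set.Iic a) - γ.real (Set.Iic a)|
        ≤ ∑ b ∈ F, |ν.real (Set.Iic b) - γ.real (Set.Iic b)| + ε := by
  obtain ⟨N, hN⟩ := exists_nat_gt (1 / ε)
  have hN0 : (0 : ℝ) < N := lt_trans (by positivity) hN
  have hNε : 1 / (N : ℝ) < ε := by
    rw [div_lt_iff₀ hN0]
    rw [div_lt_iff₀ hε] at hN
    linarith
  have hbot : Tendsto (fun a => γ.real (Set.Iic a)) atBot (𝓝 0) := by
    simpa only [← cdf_eq_real] using tendsto_cdf_atBot γ
  have htop : Tendsto (fun a => γ.real (Set.Iic a)) atTop (𝓝 1) := by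
    simpa only [← cdf_eq_real] using tendsto_cdf_atTop γ
  have hmono : ∀ (ν : Measure ℝ) [IsProbabilityMeasure ν] {a b : ℝ}, a ≤ b →
      ν.real (Set.Iic a) ≤ ν.real (Set.Iic b) := fun ν _ a b hab =>
    measureReal_mono (Set.Iic_subset_Iic.2 hab)
  -- Intermediate values at the levels `j / N`. Outside `0 < j < N` any point will do; `j = 0` only
  -- adds a nonnegative term to the sum `D`.
  have hex : ∀ j : ℕ, ∃ b : ℝ, 0 < j → j < N → γ.real (Set.Iic b) = j / N := by
    intro j
    by_cases hj : 0 < j ∧ j < N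
    · have h0 : (0 : ℝ) < j / N := div_pos (by exact_mod_cast hj.1) hN0
      have h1 : (j : ℝ) / N < 1 := (div_lt_one hN0).2 (by exact_mod_cast hj.2)
      obtain ⟨x, hx⟩ := (hbot.eventually (gt_mem_nhds h0)).exists
      obtain ⟨y, hy⟩ := (htop.eventually (lt_mem_nhds h1)).exists
      obtain ⟨b, hb⟩ := mem_range_of_exists_le_of_exists_ge hγ ⟨x, hx.le⟩ ⟨y, hy.le⟩
      exact ⟨b, fun _ _ => hb⟩
    · exact ⟨0, fun h1 h2 => absurd ⟨h1, h2⟩ hj⟩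
  choose b hb using hex
  refine ⟨(Finset.range N).image b, fun ν hν a => ?_⟩
  set D := ∑ x ∈ (Finset.range N).image b, |ν.real (Set.Iic x) - γ.real (Set.Iic x)| with hD
  have hD0 : 0 ≤ D := Finset.sum_nonneg fun _ _ => abs_nonneg _
  have hDb : ∀ j < N, |ν.real (Set.Iic (b j)) - γ.real (Set.Iic (b j))| ≤ D := fun j hj =>
    Finset.single_le_sum (f := fun x => |ν.real (Set.Iic x) - γ.real (Set.Iic x)|)
      (fun _ _ => abs_nonneg _) (Finset.mem_image_of_mem b (Finset.mem_range.2 hj))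
  set x := γ.real (Set.Iic a) with hx
  have hx0 : 0 ≤ x := measureReal_nonneg
  have hx1 : x ≤ 1 := measureReal_le_one
  have hNx : 0 ≤ N * x := by positivity
  rw [abs_le]
  constructor
  -- Lower bound: compare with the point of the largest level `i / N` strictly below `x`, which lies
  -- to the left of `a` and loses at most `1 / N`. If there is no positive level below `x`, then `x
  -- ≤ 1 / N` and nonnegativity suffices.
  · rcases Nat.eq_zero_or_pos (⌈N * x⌉₊ - 1) with h0 | hpos
    · have h1 : N * x ≤ 1 := by
        have := Nat.le_ceil (N * x)
        have h2 : ((⌈N * x⌉₊ : ℕ) : ℝ) ≤ 1 := by exact_mod_cast (by omega : ⌈N * x⌉₊ ≤ 1)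
        linarith
      have h2 : x ≤ 1 / N := by rw [le_div_iff₀ hN0]; linarith
      have : 0 ≤ ν.real (Set.Iic a) := measureReal_nonneg
      linarith
    · set i := ⌈N * x⌉₊ - 1 with hi
      have hci : ⌈N * x⌉₊ = i + 1 := by omega
      have hlt : (i : ℝ) < N * x := Nat.lt_ceil.1 (by omega)
      have hle : N * x ≤ i + 1 := by
        have := Nat.le_ceil (N * x)
        rw [hci] at this
        exact_mod_cast this
      have hiN : i < N := by
        have : (i : ℝ) < N := by nlinarith
        exact_mod_cast this
      have hbi := hb i hpos hiN
      have hba : b i ≤ a := by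
        by_contra hcon
        have := hmono γ (not_le.1 hcon).le
        rw [hbi, ← hx, le_div_iff₀ hN0] at this
        linarith
      have h1 := hmono ν hba
      have h2 := (abs_le.1 (hDb i hiN)).1
      have h3 : x ≤ i / N + 1 / N := by
        rw [← add_div, le_div_iff₀ hN0]; linarith
      linarith
  -- Upper bound: the mirror image, with the smallest level strictly above `x`. If that level is at
  -- least one, then `x ≥ 1 - 1 / N`.
  · rcases lt_or_ge (⌊N * x⌋₊ + 1) N with hlt | hge
    · set i := ⌊N * x⌋₊ + 1 with hi
      have hle : (i : ℝ) ≤ N * x + 1 := by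
        have := Nat.floor_le hNx
        rw [hi]; push_cast; linarith
      have hlt' : N * x < i := by
        rw [hi]; push_cast; exact Nat.lt_floor_add_one _
      have hbi := hb i (by omega) hlt
      have hab : a ≤ b i := by
        by_contra hcon
        have := hmono γ (not_le.1 hcon).le
        rw [hbi, ← hx, div_le_iff₀ hN0] at this
        linarith
      have h1 := hmono ν hab
      have h2 := (abs_le.1 (hDb i hlt)).2
      have h3 : (i : ℝ) / N ≤ x + 1 / N := by
        rw [div_le_iff₀ hN0, add_mul, one_div, inv_mul_cancel₀ hN0.ne']; linarith
      linarith
    · have h1 : (N : ℝ) ≤ N * x + 1 := by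
        have := Nat.floor_le hNx
        have h2 : (N : ℝ) ≤ ((⌊N * x⌋₊ + 1 : ℕ) : ℝ) := by exact_mod_cast hge
        push_cast at h2
        linarith
      have h3 : 1 ≤ x + 1 / N := by
        rw [← mul_le_mul_iff_right₀ hN0, mul_add, mul_one_div, div_self hN0.ne']; linarith
      have : ν.real (Set.Iic a) ≤ 1 := measureReal_le_one
      linarith

/-- A distribution function is right continuous and its jump at a point is the mass of that point.
-/
lemma continuous_measureReal_Iic (γ : Measure ℝ) [IsProbabilityMeasure γ]
    (hγ : ∀ a, γ {a} = 0) : Continuous fun a => γ.real (Set.Iic a) := by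
  simp only [← cdf_eq_real]
  refine continuous_iff_continuousAt.2 fun a => ?_
  have h := StieltjesFunction.measure_singleton (cdf γ) a
  rw [measure_cdf, hγ a, eq_comm, ENNReal.ofReal_eq_zero] at h
  have h1 : Function.leftLim (cdf γ) a = cdf γ a :=
    le_antisymm ((monotone_cdf γ).leftLim_le le_rfl) (by linarith)
  exact (continuousAt_iff_continuous_left'_right'.2
    ⟨(monotone_cdf γ).continuousWithinAt_Iio_iff_leftLim_eq.2 h1,
      ((cdf γ).right_continuous a).mono Set.Ioi_subset_Ici_self⟩)

end Polya

end PanelATT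

/-! ### The multiplier sum with two independent copies of the weights -/

namespace PanelATT

section Multiplier

variable {Ω A : Type*} [MeasurableSpace Ω] [MeasurableSpace A] {Pr : Measure Ω}
  [IsProbabilityMeasure Pr]

/-- The multiplier sum `n^{-1/2} ∑_{i < n} (w_i - 1) ψ(s_i)`. -/
noncomputable def multSum (ψ : A → ℝ) (n : ℕ) (x : (ℕ → A) × (ℕ → ℝ)) : ℝ :=
  (√n)⁻¹ * ∑ i ∈ Finset.range n, (x.2 i - 1) * ψ (x.1 i)

lemma measurable_multSum {ψ : A → ℝ} (hψ : Measurable ψ) (n : ℕ) : Measurable (multSum ψ n) := by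
  unfold multSum
  fun_prop

/-- Fubini for functions of two independent variables. -/
lemma lintegral_indepFun {B C : Type*} [MeasurableSpace B] [MeasurableSpace C] {X : Ω → B}
    {Y : Ω → C} (hX : Measurable X) (hY : Measurable Y) (h : IndepFun X Y Pr)
    {F : B × C → ℝ≥0∞} (hF : Measurable F) :
    ∫⁻ η, F (X η, Y η) ∂Pr = ∫⁻ η, ∫⁻ η', F (X η, Y η') ∂Pr ∂Pr := by
  have h1 := (indepFun_iff_map_prod_eq_prod_map_map hX.aemeasurable hY.aemeasurable).1 h
  have : IsProbabilityMeasure (Pr.map Y) := Measure.isProbabilityMeasure_map hY.aemeasurable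
  rw [← lintegral_map hF (hX.prodMk hY), h1, lintegral_prod _ hF.aemeasurable,
    lintegral_map hF.lintegral_prod_right' hX]
  refine lintegral_congr fun η => ?_
  exact lintegral_map (hF.comp measurable_prodMk_left) hY

/-- Two multiplier sums with the same data and independent copies of the weights behave like two
independent Gaussian variables. -/
lemma tendsto_multSum_quadrant {S : ℕ → Ω → A} {W : ℕ → Ω → ℝ} {ψ : A → ℝ}
    (hSm : ∀ i, Measurable (S i)) (hSi : iIndepFun S Pr)
    (hSd : ∀ i, IdentDistrib (S i) (S 0) Pr Pr) (hW : IsBootstrapWeights Pr S W)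
    (hψ : Measurable ψ) (hψ2 : MemLp (fun η => ψ (S 0 η)) 2 Pr)
    (hpos : 0 < ∫ η, ψ (S 0 η) ^ 2 ∂Pr) (b : ℝ) :
    Tendsto (fun n => (Pr.prod Pr) {x : Ω × Ω |
      multSum ψ n (fun i => S i x.1, fun i => W i x.1) ≤ b ∧
      multSum ψ n (fun i => S i x.1, fun i => W i x.2) ≤ b}) atTop
      (𝓝 (gaussianReal 0 (∫ η, ψ (S 0 η) ^ 2 ∂Pr).toNNReal (Set.Iic b) *
        gaussianReal 0 (∫ η, ψ (S 0 η) ^ 2 ∂Pr).toNNReal (Set.Iic b))) := by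
  obtain ⟨hWm, hWi, hWd, hSW, hW1, hWv, -⟩ := hW
  set v := ∫ η, ψ (S 0 η) ^ 2 ∂Pr with hv
  have hSWi := iIndepFun_prodMk_of_indepFun hSm hWm hSi hWi hSW
  have hSWm : ∀ i, Measurable fun η => (S i η, W i η) := fun i => (hSm i).prodMk (hWm i)
  have hSs : Measurable fun η i => S i η := measurable_pi_iff.2 hSm
  have hWs : Measurable fun η i => W i η := measurable_pi_iff.2 hWm
  have hSWind : ∀ i, IndepFun (S i) (W i) Pr := fun i =>
    hSW.comp (measurable_pi_apply i) (measurable_pi_apply i)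
  have hfst : MeasurePreserving (Prod.fst : Ω × Ω → Ω) (Pr.prod Pr) Pr := measurePreserving_fst
  have hsnd : MeasurePreserving (Prod.snd : Ω × Ω → Ω) (Pr.prod Pr) Pr := measurePreserving_snd
  -- On the product space the second coordinate carries the independent copy of the weights, while
  -- both sums use the data of the first. The triples of observation, weight and copied weight are
  -- iid.
  let T : ℕ → Ω × Ω → (A × ℝ) × ℝ := fun i x => ((S i x.1, W i x.1), W i x.2)
  have hTm : ∀ i, Measurable (T i) := fun i =>
    ((hSWm i).comp measurable_fst).prodMk ((hWm i).comp measurable_snd)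
  have hT : iIndepFun T (Pr.prod Pr) := by
    refine iIndepFun_prodMk_of_indepFun (S := fun i (x : Ω × Ω) => (S i x.1, W i x.1))
      (W := fun i (x : Ω × Ω) => W i x.2) (fun i => (hSWm i).comp measurable_fst)
      (fun i => (hWm i).comp measurable_snd) ?_ ?_ ?_
    · rw [iIndepFun_iff_measure_inter_preimage_eq_mul] at hSWi ⊢
      intro F sets hsets
      have h1 := hSWi F hsets
      rw [← hfst.measure_preimage (Finset.measurableSet_biInter _
        fun i hi => hSWm i (hsets i hi)).nullMeasurableSet] at h1
      simp only [Set.preimage_iInter, Set.preimage_preimage] at h1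
      rw [h1]
      refine Finset.prod_congr rfl fun i hi => ?_
      rw [← hfst.measure_preimage (hSWm i (hsets i hi)).nullMeasurableSet]
      rfl
    · rw [iIndepFun_iff_measure_inter_preimage_eq_mul] at hWi ⊢
      intro F sets hsets
      have h1 := hWi F hsets
      rw [← hsnd.measure_preimage (Finset.measurableSet_biInter _
        fun i hi => hWm i (hsets i hi)).nullMeasurableSet] at h1
      simp only [Set.preimage_iInter, Set.preimage_preimage] at h1
      rw [h1]
      refine Finset.prod_congr rfl fun i hi => ?_
      rw [← hsnd.measure_preimage (hWm i (hsets i hi)).nullMeasurableSet]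
      rfl
    · exact indepFun_prod (X := fun η i => (S i η, W i η)) (Y := fun η i => W i η)
        (measurable_pi_iff.2 hSWm) hWs
  have hlaw : ∀ i, (Pr.prod Pr).map (T i)
      = ((Pr.map (S i)).prod (Pr.map (W i))).prod (Pr.map (W i)) := by
    intro i
    have h1 : T i = Prod.map (fun η => (S i η, W i η)) (W i) := rfl
    rw [h1, ← Measure.map_prod_map _ _ (hSWm i) (hWm i),
      (indepFun_iff_map_prod_eq_prod_map_map (hSm i).aemeasurable (hWm i).aemeasurable).1
        (hSWind i)]
  have hTd : ∀ i, IdentDistrib (T i) (T 0) (Pr.prod Pr) (Pr.prod Pr) := fun i =>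
    ⟨(hTm i).aemeasurable, (hTm 0).aemeasurable, by
      rw [hlaw, hlaw, (hSd i).map_eq, (hWd i).map_eq]⟩
  have hW2 : MemLp (fun η => W 0 η - 1) 2 Pr := by
    have h1 : MemLp (W 0) 2 Pr :=
      memLp_two_of_variance_ne_zero (hWm 0).aestronglyMeasurable (by rw [hWv]; exact one_ne_zero)
    exact h1.sub (memLp_const 1)
  have hWint : ∫ η, (W 0 η - 1) ∂Pr = 0 := by
    have h1 : MemLp (W 0) 2 Pr :=
      memLp_two_of_variance_ne_zero (hWm 0).aestronglyMeasurable (by rw [hWv]; exact one_ne_zero)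
    rw [integral_sub (h1.integrable one_le_two) (integrable_const _), hW1]
    simp
  have hWsq : ∫ η, (W 0 η - 1) ^ 2 ∂Pr = 1 := by
    have h1 := variance_eq_integral (μ := Pr) (hWm 0).aemeasurable
    rw [hW1, hWv] at h1
    exact h1.symm
  have hind : IndepFun (fun η => W 0 η - 1) (fun η => ψ (S 0 η)) Pr :=
    ((hSWind 0).comp (φ := ψ) (ψ := fun w => w - 1) hψ (measurable_id.sub_const 1)).symm
  have hindsq : IndepFun (fun η => (W 0 η - 1) ^ 2) (fun η => ψ (S 0 η) ^ 2) Pr :=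
    hind.comp (measurable_id.pow_const 2) (measurable_id.pow_const 2)
  have hψm0 : Measurable fun η => ψ (S 0 η) := hψ.comp (hSm 0)
  have hwm0 : Measurable fun η => W 0 η - 1 := (hWm 0).sub_const 1
  have ha2 : MemLp (fun η => (W 0 η - 1) * ψ (S 0 η)) 2 Pr := by
    refine (memLp_two_iff_integrable_sq (hwm0.mul hψm0).aestronglyMeasurable).2 ?_
    simp only [Pi.mul_apply, mul_pow]
    exact hindsq.integrable_mul hW2.integrable_sq hψ2.integrable_sq
  have ha0 : ∫ η, (W 0 η - 1) * ψ (S 0 η) ∂Pr = 0 := by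
    have := hind.integral_mul_eq_mul_integral hwm0.aestronglyMeasurable
      hψm0.aestronglyMeasurable
    simp only [Pi.mul_apply] at this
    rw [this, hWint, zero_mul]
  have hasq : ∫ η, ((W 0 η - 1) * ψ (S 0 η)) ^ 2 ∂Pr = v := by
    have := hindsq.integral_mul_eq_mul_integral (hwm0.pow_const 2).aestronglyMeasurable
      (hψm0.pow_const 2).aestronglyMeasurable
    simp only [Pi.mul_apply, ← mul_pow] at this
    rw [this, hWsq, one_mul]
  have hvpos : v.toNNReal ≠ 0 := by simpa using hpos
  refine tendsto_measure_quadrant (Pr := Pr.prod Pr)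
    (Z := fun n x => multSum ψ n (fun i => S i x.1, fun i => W i x.1))
    (Z' := fun n x => multSum ψ n (fun i => S i x.1, fun i => W i x.2))
    (fun n => (measurable_multSum hψ n).comp ((hSs.comp measurable_fst).prodMk
      (hWs.comp measurable_fst)))
    (fun n => (measurable_multSum hψ n).comp ((hSs.comp measurable_fst).prodMk
      (hWs.comp measurable_snd))) hvpos ?_ b
  intro c d
  -- A linear combination of the two multiplier sums is itself a normalized iid sum, so the
  -- one-dimensional central limit theorem applies to it.
  let g : (A × ℝ) × ℝ → ℝ := fun y => (c * (y.1.2 - 1) + d * (y.2 - 1)) * ψ y.1.1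
  have hg : Measurable g := by fun_prop
  let X : ℕ → Ω × Ω → ℝ := fun i => g ∘ T i
  have hX0 : X 0 = fun x => c * ((W 0 x.1 - 1) * ψ (S 0 x.1)) +
      d * (ψ (S 0 x.1) * (W 0 x.2 - 1)) := by
    ext x; simp only [X, g, T, Function.comp]; ring
  have hA2 : MemLp (fun x : Ω × Ω => (W 0 x.1 - 1) * ψ (S 0 x.1)) 2 (Pr.prod Pr) :=
    ha2.comp_measurePreserving hfst
  have hB2 : MemLp (fun x : Ω × Ω => ψ (S 0 x.1) * (W 0 x.2 - 1)) 2 (Pr.prod Pr) := by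
    refine (memLp_two_iff_integrable_sq ((hψm0.comp measurable_fst).mul
      (hwm0.comp measurable_snd)).aestronglyMeasurable).2 ?_
    simp only [Pi.mul_apply, Function.comp_apply, mul_pow]
    exact hψ2.integrable_sq.mul_prod hW2.integrable_sq
  have hX2 : MemLp (X 0) 2 (Pr.prod Pr) := by
    rw [hX0]
    exact (hA2.const_mul c).add (hB2.const_mul d)
  have hA0 : ∫ x : Ω × Ω, (W 0 x.1 - 1) * ψ (S 0 x.1) ∂(Pr.prod Pr) = 0 := by
    rw [← ha0]
    have := integral_prod_mul (μ := Pr) (ν := Pr) (fun η => (W 0 η - 1) * ψ (S 0 η))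
      (fun _ => (1 : ℝ))
    simpa using this
  have hB0 : ∫ x : Ω × Ω, ψ (S 0 x.1) * (W 0 x.2 - 1) ∂(Pr.prod Pr) = 0 := by
    rw [integral_prod_mul (μ := Pr) (ν := Pr) (fun η => ψ (S 0 η)) (fun η => W 0 η - 1), hWint,
      mul_zero]
  have hXint : ∫ x, X 0 x ∂(Pr.prod Pr) = 0 := by
    rw [hX0, integral_add ((hA2.integrable one_le_two).const_mul c)
      ((hB2.integrable one_le_two).const_mul d), integral_const_mul, integral_const_mul, hA0, hB0]
    simp
  -- The cross term has the factor `W' - 1`, where `W'` is the copied weight; it is independent of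
  -- the rest and has mean zero. So the variance is `(c² + d²) v`, and the limiting characteristic
  -- function factors into those at `c` and `d`.
  have hXsq : ∫ x, X 0 x ^ 2 ∂(Pr.prod Pr) = (c ^ 2 + d ^ 2) * v := by
    have e1 : ∀ x, X 0 x ^ 2 = c ^ 2 * ((W 0 x.1 - 1) * ψ (S 0 x.1)) ^ 2 +
        (2 * c * d) * (((W 0 x.1 - 1) * ψ (S 0 x.1) * ψ (S 0 x.1)) * (W 0 x.2 - 1)) +
        d ^ 2 * (ψ (S 0 x.1) ^ 2 * (W 0 x.2 - 1) ^ 2) := by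
      intro x; rw [hX0]; ring
    have i1 : Integrable (fun x : Ω × Ω => ((W 0 x.1 - 1) * ψ (S 0 x.1)) ^ 2) (Pr.prod Pr) :=
      hA2.integrable_sq
    have i2 : Integrable (fun x : Ω × Ω =>
        ((W 0 x.1 - 1) * ψ (S 0 x.1) * ψ (S 0 x.1)) * (W 0 x.2 - 1)) (Pr.prod Pr) :=
      (ha2.integrable_mul hψ2).mul_prod (hW2.integrable one_le_two)
    have i3 : Integrable (fun x : Ω × Ω => ψ (S 0 x.1) ^ 2 * (W 0 x.2 - 1) ^ 2) (Pr.prod Pr) :=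
      hψ2.integrable_sq.mul_prod hW2.integrable_sq
    simp only [e1]
    have j1 : ∫ x : Ω × Ω, ((W 0 x.1 - 1) * ψ (S 0 x.1)) ^ 2 ∂(Pr.prod Pr) = v := by
      rw [← hasq]
      simpa using integral_prod_mul (μ := Pr) (ν := Pr)
        (fun η => ((W 0 η - 1) * ψ (S 0 η)) ^ 2) (fun _ => (1 : ℝ))
    have j2 : ∫ x : Ω × Ω, ((W 0 x.1 - 1) * ψ (S 0 x.1) * ψ (S 0 x.1)) * (W 0 x.2 - 1)
        ∂(Pr.prod Pr) = 0 := by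
      rw [integral_prod_mul (μ := Pr) (ν := Pr)
        (fun η => (W 0 η - 1) * ψ (S 0 η) * ψ (S 0 η)) (fun η => W 0 η - 1), hWint, mul_zero]
    have j3 : ∫ x : Ω × Ω, ψ (S 0 x.1) ^ 2 * (W 0 x.2 - 1) ^ 2 ∂(Pr.prod Pr) = v := by
      rw [integral_prod_mul (μ := Pr) (ν := Pr)
        (fun η => ψ (S 0 η) ^ 2) (fun η => (W 0 η - 1) ^ 2), hWsq, mul_one]
    have k := integral_add ((i1.const_mul (c ^ 2)).add (i2.const_mul (2 * c * d)))
      (i3.const_mul (d ^ 2))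
    simp only [Pi.add_apply] at k
    rw [k, integral_add (i1.const_mul _) (i2.const_mul _), integral_const_mul, integral_const_mul,
      integral_const_mul, j1, j2, j3]
    ring
  have hXi : iIndepFun X (Pr.prod Pr) := hT.comp (fun _ => g) fun _ => hg
  have hXd : ∀ i, IdentDistrib (X i) (X 0) (Pr.prod Pr) (Pr.prod Pr) := fun i =>
    (hTd i).comp hg
  have hclt := tendsto_charFun_sum_div_sqrt hX2 hXint hXi hXd 1
  have e2 : ∀ n : ℕ, (fun x : Ω × Ω =>
      c * multSum ψ n (fun i => S i x.1, fun i => W i x.1) +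
      d * multSum ψ n (fun i => S i x.1, fun i => W i x.2))
      = fun x => (√n)⁻¹ * ∑ i ∈ Finset.range n, X i x := by
    intro n
    ext x
    simp only [multSum, X, g, T, Function.comp, Finset.mul_sum, ← Finset.sum_add_distrib]
    exact Finset.sum_congr rfl fun i _ => by ring
  simp only [e2]
  convert hclt using 2
  rw [hXsq, charFun_gaussianReal, charFun_gaussianReal, charFun_gaussianReal, ← Complex.exp_add,
    Real.coe_toNNReal _ (mul_nonneg (by positivity) hpos.le), Real.coe_toNNReal _ hpos.le]
  congr 1
  push_cast
  ring

/-- In terms of the conditional distribution function given the data. -/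
lemma tendsto_lintegral_multSum {S : ℕ → Ω → A} {W : ℕ → Ω → ℝ} {ψ : A → ℝ}
    (hSm : ∀ i, Measurable (S i)) (hSi : iIndepFun S Pr)
    (hSd : ∀ i, IdentDistrib (S i) (S 0) Pr Pr) (hW : IsBootstrapWeights Pr S W)
    (hψ : Measurable ψ) (hψ2 : MemLp (fun η => ψ (S 0 η)) 2 Pr)
    (hpos : 0 < ∫ η, ψ (S 0 η) ^ 2 ∂Pr) (b : ℝ) :
    Tendsto (fun n => ∫⁻ η, Pr {η' | multSum ψ n (fun i => S i η, fun i => W i η') ≤ b} ^ 2 ∂Pr)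
      atTop (𝓝 (gaussianReal 0 (∫ η, ψ (S 0 η) ^ 2 ∂Pr).toNNReal (Set.Iic b) ^ 2)) := by
  have h := tendsto_multSum_quadrant hSm hSi hSd hW hψ hψ2 hpos b
  rw [← pow_two] at h
  refine h.congr fun n => ?_
  obtain ⟨hWm, hWi, hWd, hSW, hW1, hWv, -⟩ := hW
  have hSs : Measurable fun η i => S i η := measurable_pi_iff.2 hSm
  have hWs : Measurable fun η i => W i η := measurable_pi_iff.2 hWm
  have hm := measurable_multSum hψ n
  let G : (ℕ → A) → ℝ≥0∞ := fun s => Pr {η' | multSum ψ n (s, fun i => W i η') ≤ b}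
  have hGm : Measurable G := by
    have h1 : MeasurableSet {x : (ℕ → A) × Ω | multSum ψ n (x.1, fun i => W i x.2) ≤ b} :=
      measurableSet_le (hm.comp (measurable_fst.prodMk (hWs.comp measurable_snd)))
        measurable_const
    exact measurable_measure_prodMk_left h1
  -- The quadrant event has probability `E[1{Z ≤ b} G(S)]`, where `Z` is the first multiplier sum.
  -- Integrating out the weights of `Z` given the data produces a second factor `G(S)`.
  let F : (ℕ → A) × (ℕ → ℝ) → ℝ≥0∞ := fun x =>
    {y | multSum ψ n y ≤ b}.indicator (fun y => G y.1) x
  have hF : Measurable F :=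
    (hGm.comp measurable_fst).indicator (measurableSet_le hm measurable_const)
  have hm1 : Measurable fun x : Ω × Ω => multSum ψ n (fun i => S i x.1, fun i => W i x.1) :=
    hm.comp ((hSs.comp measurable_fst).prodMk (hWs.comp measurable_fst))
  have hm2 : Measurable fun x : Ω × Ω => multSum ψ n (fun i => S i x.1, fun i => W i x.2) :=
    hm.comp ((hSs.comp measurable_fst).prodMk (hWs.comp measurable_snd))
  have hms : MeasurableSet {x : Ω × Ω | multSum ψ n (fun i => S i x.1, fun i => W i x.1) ≤ b ∧
      multSum ψ n (fun i => S i x.1, fun i => W i x.2) ≤ b} :=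
    (measurableSet_le hm1 measurable_const).inter (measurableSet_le hm2 measurable_const)
  rw [Measure.prod_apply hms]
  have e1 : ∀ η, Pr (Prod.mk η ⁻¹' {x : Ω × Ω |
      multSum ψ n (fun i => S i x.1, fun i => W i x.1) ≤ b ∧
      multSum ψ n (fun i => S i x.1, fun i => W i x.2) ≤ b})
      = F (fun i => S i η, fun i => W i η) := by
    intro η
    by_cases hη : multSum ψ n (fun i => S i η, fun i => W i η) ≤ b
    · simp [F, G, hη, Set.preimage]
    · simp [F, hη, Set.preimage]
  simp only [e1]
  rw [lintegral_indepFun hSs hWs hSW hF]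
  refine lintegral_congr fun η => ?_
  have e2 : ∀ η', F (fun i => S i η, fun i => W i η') =
      {η'' | multSum ψ n (fun i => S i η, fun i => W i η'') ≤ b}.indicator
        (fun _ => G fun i => S i η) η' := by
    intro η'
    simp [F, Set.indicator]
  simp only [e2]
  have hm3 : Measurable fun η' => multSum ψ n (fun i => S i η, fun i => W i η') :=
    hm.comp (measurable_const.prodMk hWs)
  rw [lintegral_indicator (measurableSet_le hm3 measurable_const), setLIntegral_const, pow_two]

end Multiplier

end PanelATT

/-! ### Bootstrap consistency from asymptotic linearity -/

namespace PanelATT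

section Bootstrap

variable {Ω A : Type*} [MeasurableSpace Ω] [MeasurableSpace A] {Pr : Measure Ω}
  [IsProbabilityMeasure Pr]

lemma tendsto_measureReal_of_tendstoInDistribution {X : ℕ → Ω → ℝ} {γ : Measure ℝ}
    [IsProbabilityMeasure γ] (hγ : ∀ a, γ {a} = 0) (hX : ∀ k, Measurable (X k))
    (h : TendstoInDistribution X atTop id (fun _ => Pr) γ) (b : ℝ) :
    Tendsto (fun k => Pr.real {η | X k η ≤ b}) atTop (𝓝 (γ.real (Set.Iic b))) := by
  have h1 := ProbabilityMeasure.tendsto_measure_of_null_frontier_of_tendsto' h.tendsto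
    (E := Set.Iic b) (by simp [hγ])
  simp only [ProbabilityMeasure.coe_mk, Measure.map_id] at h1
  refine ((ENNReal.tendsto_toReal (measure_ne_top _ _)).comp h1).congr fun k => ?_
  rw [Function.comp_apply, Measure.map_apply (hX k) measurableSet_Iic]
  rfl

/-- If the conditional probabilities of `Z ≤ a ± ε` are close to `γ₁ ≤ γ₂`, and `T` is close to
`Z`, then the conditional probability of `T ≤ a` is close to any value in between. -/
lemma integral_abs_condDistrib_sub_le {β : Type*} [MeasurableSpace β] {X : Ω → β} {T Z : Ω → ℝ}
    (hX : Measurable X) (hT : Measurable T) (hZ : Measurable Z) {g₁ g₂ : Ω → ℝ}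
    (hg₁ : Integrable g₁ Pr) (hg₂ : Integrable g₂ Pr) {a ε γ₁ γ γ₂ : ℝ}
    (h₁ : ∀ B, MeasurableSet B → ∫ η in X ⁻¹' B, g₁ η ∂Pr = Pr.real (X ⁻¹' B ∩ {η | Z η ≤ a - ε}))
    (h₂ : ∀ B, MeasurableSet B → ∫ η in X ⁻¹' B, g₂ η ∂Pr = Pr.real (X ⁻¹' B ∩ {η | Z η ≤ a + ε}))
    (hγ₁ : γ₁ ≤ γ) (hγ₂ : γ ≤ γ₂) :
    ∫ η, |(condDistrib T X Pr (X η)).real (Set.Iic a) - γ| ∂Pr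
      ≤ ∫ η, |g₂ η - γ₂| ∂Pr + ∫ η, |g₁ η - γ₁| ∂Pr + (γ₂ - γ₁)
        + 2 * Pr.real {η | ε < |T η - Z η|} := by
  set κ : Ω → ℝ := fun η => (condDistrib T X Pr (X η)).real (Set.Iic a) with hκ
  have hκi : Integrable κ Pr := integrable_toReal_condDistrib hX.aemeasurable measurableSet_Iic
  have hκB : ∀ B, MeasurableSet B →
      ∫ η in X ⁻¹' B, κ η ∂Pr = Pr.real (X ⁻¹' B ∩ {η | T η ≤ a}) := by
    intro B hB
    have h := setLIntegral_preimage_condDistrib hX hT.aemeasurable (measurableSet_Iic (a := a)) hB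
      (μ := Pr)
    rw [Measure.real, show X ⁻¹' B ∩ {η | T η ≤ a} = X ⁻¹' B ∩ T ⁻¹' Set.Iic a from rfl, ← h]
    exact integral_toReal ((Kernel.measurable_coe _ measurableSet_Iic).comp hX).aemeasurable
      (Eventually.of_forall fun _ => measure_lt_top _ _)
  -- The sign of the conditional probability minus `γ` is a function of the data. Splitting the
  -- absolute value along it leaves integrals over data events, which the defining property of
  -- conditional distributions turns into joint probabilities.
  let B : Set β := {y | γ < (condDistrib T X Pr y).real (Set.Iic a)}
  have hB : MeasurableSet B := measurableSet_lt measurable_const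
    (Kernel.measurable_coe _ measurableSet_Iic).ennreal_toReal
  have hR : MeasurableSet {η | ε < |T η - Z η|} :=
    measurableSet_lt measurable_const (hT.sub hZ).abs
  have hBm : MeasurableSet (X ⁻¹' B) := hX hB
  have hsplit : ∫ η, |κ η - γ| ∂Pr
      = ∫ η in X ⁻¹' B, (κ η - γ) ∂Pr + ∫ η in X ⁻¹' Bᶜ, (γ - κ η) ∂Pr := by
    have hi : Integrable (fun η => |κ η - γ|) Pr := (hκi.sub (integrable_const γ)).abs
    rw [← integral_add_compl hBm hi]
    congr 1
    · refine setIntegral_congr_fun hBm fun η hη => ?_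
      exact abs_of_pos (sub_pos.2 hη)
    · refine setIntegral_congr_fun hBm.compl fun η hη => ?_
      have h1 : κ η ≤ γ := not_lt.1 hη
      rw [abs_sub_comm]
      exact abs_of_nonneg (sub_nonneg.2 h1)
  have hle : ∀ (C : Set Ω) (g : Ω → ℝ) (c : ℝ), MeasurableSet C → Integrable g Pr →
      |∫ η in C, (g η - c) ∂Pr| ≤ ∫ η, |g η - c| ∂Pr := by
    intro C g c hC hg
    have hi : Integrable (fun η => g η - c) Pr := hg.sub (integrable_const c)
    exact abs_integral_le_integral_abs.trans
      (setIntegral_le_integral hi.abs (Eventually.of_forall fun _ => abs_nonneg _))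
  have hc : ∀ (C : Set Ω) (g : Ω → ℝ) (c : ℝ), Integrable g Pr →
      ∫ η in C, (g η - c) ∂Pr = ∫ η in C, g η ∂Pr - c * Pr.real C := by
    intro C g c hg
    rw [integral_sub hg.integrableOn (integrable_const c)]
    simp [mul_comm]
  -- Unless `T` and `Z` differ by more than `ε`, the event `T ≤ a` is contained in `Z ≤ a + ε`,
  -- whose joint probability with the data event is the integral of `g₂`. The lower bound uses `a -
  -- ε` and `g₁` in the same way.
  have hup : ∫ η in X ⁻¹' B, (κ η - γ) ∂Pr ≤
      ∫ η, |g₂ η - γ₂| ∂Pr + (γ₂ - γ) * Pr.real (X ⁻¹' B) + Pr.real {η | ε < |T η - Z η|} := by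
    have h3 : Pr.real (X ⁻¹' B ∩ {η | T η ≤ a}) ≤
        Pr.real (X ⁻¹' B ∩ {η | Z η ≤ a + ε}) + Pr.real {η | ε < |T η - Z η|} := by
      refine (measureReal_mono ?_).trans (measureReal_union_le _ _)
      rintro η ⟨h4, h5⟩
      by_cases h6 : ε < |T η - Z η|
      · exact Or.inr h6
      · have := (abs_le.1 (not_lt.1 h6)).1
        exact Or.inl ⟨h4, by simp only [Set.mem_ofPred_eq] at h5 ⊢; linarith⟩
    have h4 := le_of_abs_le (hle _ g₂ γ₂ hBm hg₂)
    rw [hc _ _ _ hg₂, h₂ B hB] at h4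
    rw [hc _ _ _ hκi, hκB B hB]
    linarith
  have hdn : ∫ η in X ⁻¹' Bᶜ, (γ - κ η) ∂Pr ≤
      ∫ η, |g₁ η - γ₁| ∂Pr + (γ - γ₁) * Pr.real (X ⁻¹' Bᶜ) + Pr.real {η | ε < |T η - Z η|} := by
    have h3 : Pr.real (X ⁻¹' Bᶜ ∩ {η | Z η ≤ a - ε}) ≤
        Pr.real (X ⁻¹' Bᶜ ∩ {η | T η ≤ a}) + Pr.real {η | ε < |T η - Z η|} := by
      refine (measureReal_mono ?_).trans (measureReal_union_le _ _)
      rintro η ⟨h4, h5⟩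
      by_cases h6 : ε < |T η - Z η|
      · exact Or.inr h6
      · have := (abs_le.1 (not_lt.1 h6)).2
        exact Or.inl ⟨h4, by simp only [Set.mem_ofPred_eq] at h5 ⊢; linarith⟩
    have h4 := neg_le_of_abs_le (hle _ g₁ γ₁ hBm.compl hg₁)
    have h5 : ∫ η in X ⁻¹' Bᶜ, (γ - κ η) ∂Pr = - ∫ η in X ⁻¹' Bᶜ, (κ η - γ) ∂Pr := by
      rw [← integral_neg]; simp
    rw [← Set.preimage_compl, hc _ _ _ hg₁, h₁ _ hB.compl] at h4
    rw [h5, hc _ _ _ hκi, hκB _ hB.compl]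
    linarith
  have h1 : Pr.real (X ⁻¹' B) ≤ 1 := measureReal_le_one
  have h2 : Pr.real (X ⁻¹' Bᶜ) ≤ 1 := measureReal_le_one
  have h3 := mul_le_mul_of_nonneg_left h1 (sub_nonneg.2 hγ₂)
  have h4 := mul_le_mul_of_nonneg_left h2 (sub_nonneg.2 hγ₁)
  rw [hsplit]
  linarith

/-- Conditional distribution function of the multiplier sum given the data, for data indexed by
an initial segment. -/
lemma setIntegral_multSum_eq {S : ℕ → Ω → A} {W : ℕ → Ω → ℝ} {ψ : A → ℝ}
    (hSm : ∀ i, Measurable (S i)) (hWm : ∀ i, Measurable (W i))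
    (hSW : IndepFun (fun η i => S i η) (fun η i => W i η) Pr) (hψ : Measurable ψ) (n N : ℕ) (b : ℝ)
    (B : Set (Fin N → A)) (hB : MeasurableSet B) :
    ∫ η in (fun η (i : Fin N) => S i η) ⁻¹' B,
        Pr.real {η' | multSum ψ n (fun i => S i η, fun i => W i η') ≤ b} ∂Pr
      = Pr.real ((fun η (i : Fin N) => S i η) ⁻¹' B ∩
        {η | multSum ψ n (fun i => S i η, fun i => W i η) ≤ b}) := by
  have hSs : Measurable fun η i => S i η := measurable_pi_iff.2 hSm
  have hWs : Measurable fun η i => W i η := measurable_pi_iff.2 hWm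
  have hm := measurable_multSum hψ n
  have hX : Measurable fun η (i : Fin N) => S i η := measurable_pi_iff.2 fun i => hSm i
  have hr : Measurable fun (s : ℕ → A) (i : Fin N) => s i := by fun_prop
  let Q : Set ((ℕ → A) × (ℕ → ℝ)) :=
    {y | (fun i : Fin N => y.1 i) ∈ B} ∩ {y | multSum ψ n y ≤ b}
  have hQ : MeasurableSet Q :=
    ((hr.comp measurable_fst) hB).inter (measurableSet_le hm measurable_const)
  have hF := lintegral_indepFun (Pr := Pr) hSs hWs hSW (F := Q.indicator 1)
    (measurable_one.indicator hQ)
  have hG : Measurable fun η => Pr {η' | multSum ψ n (fun i => S i η, fun i => W i η') ≤ b} := by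
    have h1 : MeasurableSet {x : Ω × Ω | multSum ψ n (fun i => S i x.1, fun i => W i x.2) ≤ b} :=
      measurableSet_le (hm.comp ((hSs.comp measurable_fst).prodMk (hWs.comp measurable_snd)))
        measurable_const
    exact measurable_measure_prodMk_left h1
  have e1 : ∫⁻ η, Q.indicator 1 (fun i => S i η, fun i => W i η) ∂Pr
      = Pr ((fun η (i : Fin N) => S i η) ⁻¹' B ∩
        {η | multSum ψ n (fun i => S i η, fun i => W i η) ≤ b}) := by
    have h2 : ∀ η, Q.indicator (1 : (ℕ → A) × (ℕ → ℝ) → ℝ≥0∞) (fun i => S i η, fun i => W i η) =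
        ((fun η (i : Fin N) => S i η) ⁻¹' B ∩
        {η | multSum ψ n (fun i => S i η, fun i => W i η) ≤ b}).indicator 1 η := fun η => by
      by_cases h3 : (fun i : Fin N => S i η) ∈ B ∧ multSum ψ n (fun i => S i η, fun i => W i η) ≤ b
      · rw [Set.indicator_of_mem (show _ ∈ Q from h3), Set.indicator_of_mem (by exact h3)]
        rfl
      · rw [Set.indicator_of_notMem (show _ ∉ Q from h3), Set.indicator_of_notMem (by exact h3)]
    simp only [h2]
    have hm1 : Measurable fun η => multSum ψ n (fun i => S i η, fun i => W i η) :=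
      hm.comp (hSs.prodMk hWs)
    rw [lintegral_indicator_one ((hX hB).inter (measurableSet_le hm1 measurable_const))]
  have e2 : ∫⁻ η, ∫⁻ η', Q.indicator 1 (fun i => S i η, fun i => W i η') ∂Pr ∂Pr
      = ∫⁻ η in (fun η (i : Fin N) => S i η) ⁻¹' B,
        Pr {η' | multSum ψ n (fun i => S i η, fun i => W i η') ≤ b} ∂Pr := by
    rw [← lintegral_indicator (hX hB)]
    refine lintegral_congr fun η => ?_
    have hm1 : Measurable fun η' => multSum ψ n (fun i => S i η, fun i => W i η') :=
      hm.comp (measurable_const.prodMk hWs)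
    by_cases hη : (fun i : Fin N => S i η) ∈ B
    · rw [Set.indicator_of_mem (by exact hη)]
      rw [← lintegral_indicator_one (measurableSet_le hm1 measurable_const)]
      refine lintegral_congr fun η' => ?_
      simp [Set.indicator, Q, hη]
    · rw [Set.indicator_of_notMem (by exact hη)]
      simp [Set.indicator, Q, hη]
  rw [Measure.real, ← e1, hF, e2]
  exact integral_toReal hG.aemeasurable (Eventually.of_forall fun _ => measure_lt_top _ _)

/-- The variance of `|h|` is nonnegative. -/
lemma sq_integral_abs_le {h : Ω → ℝ} (hh : MemLp h 2 Pr) :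
    (∫ η, |h η| ∂Pr) ^ 2 ≤ ∫ η, h η ^ 2 ∂Pr := by
  have h1 := variance_nonneg (fun η => |h η|) Pr
  have h2 : MemLp (fun η => |h η|) 2 Pr := hh.abs
  rw [variance_eq_sub h2] at h1
  simp only [Pi.pow_apply, sq_abs] at h1
  linarith

/-- Consistency of the multiplier bootstrap for estimators that are asymptotically linear, both
in the original and in the bootstrap world. -/
theorem bootstrapConsistent_of_linear {L : ℕ} (hL : 0 < L) {S : ℕ → Ω → A} {W : ℕ → Ω → ℝ}
    {ψ : A → ℝ} (hSm : ∀ i, Measurable (S i)) (hSi : iIndepFun S Pr)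
    (hSd : ∀ i, IdentDistrib (S i) (S 0) Pr Pr) (hW : IsBootstrapWeights Pr S W)
    (hψ : Measurable ψ) (hψ2 : MemLp (fun η => ψ (S 0 η)) 2 Pr) (hψ0 : ∫ η, ψ (S 0 η) ∂Pr = 0)
    (hpos : 0 < ∫ η, ψ (S 0 η) ^ 2 ∂Pr) {θ : ℝ} {θHat θStar : ℕ → Ω → ℝ}
    (hm : ∀ k, Measurable (θHat k)) (hm' : ∀ k, Measurable (θStar k))
    (h : SmallProb Pr fun k η => ‖√((L * k : ℕ) : ℝ) * (θHat k η - θ) -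
      (√((L * k : ℕ) : ℝ))⁻¹ * ∑ i ∈ Finset.range (L * k), ψ (S i η)‖ₑ)
    (h' : SmallProb Pr fun k η => ‖√((L * k : ℕ) : ℝ) * (θStar k η - θHat k η) -
      (√((L * k : ℕ) : ℝ))⁻¹ * ∑ i ∈ Finset.range (L * k), (W i η - 1) * ψ (S i η)‖ₑ) :
    BootstrapConsistent L Pr S θ θHat θStar := by
  have hW' := hW
  obtain ⟨hWm, hWi, hWd, hSW, hW1, hWv, -⟩ := hW'
  set v := ∫ η, ψ (S 0 η) ^ 2 ∂Pr with hv
  set γ := gaussianReal 0 v.toNNReal with hγdef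
  have hna : NullSingletonClass γ := nullSingletonClass_gaussianReal (by simpa using hpos)
  have hγ0 : ∀ a, γ {a} = 0 := fun a => measure_singleton a
  have hγc := continuous_measureReal_Iic γ hγ0
  have hSs : Measurable fun η i => S i η := measurable_pi_iff.2 hSm
  have hWs : Measurable fun η i => W i η := measurable_pi_iff.2 hWm
  have htop : Tendsto (fun k => L * k) atTop atTop :=
    tendsto_id.const_mul_atTop' hL
  -- the distribution of the original estimator
  have hP : ∀ b, Tendsto (fun k => Pr.real {η | √((L * k : ℕ) : ℝ) * (θHat k η - θ) ≤ b}) atTop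
      (𝓝 (γ.real (Set.Iic b))) := by
    have hm1 : ∀ k : ℕ, Measurable fun η => √((L * k : ℕ) : ℝ) * (θHat k η - θ) := fun k =>
      ((hm k).sub_const θ).const_mul _
    have h1 := sum_sqrt_tendstoInDistribution (X := fun i η => ψ (S i η)) hψ2 hψ0
      (hSi.comp (fun _ => ψ) fun _ => hψ) (fun i => (hSd i).comp hψ)
    have h2 : TendstoInDistribution (fun (k : ℕ) η => (√((L * k : ℕ) : ℝ))⁻¹ *
        ∑ i ∈ Finset.range (L * k), ψ (S i η)) atTop id (fun _ => Pr) γ :=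
      ⟨fun k => h1.forall_aemeasurable (L * k), h1.aemeasurable_limit, h1.tendsto.comp htop⟩
    refine tendsto_measureReal_of_tendstoInDistribution hγ0 hm1
      (tendstoInDistribution_of_tendstoInMeasure_sub _ _ h2 ?_ fun k => (hm1 k).aemeasurable)
    exact smallProb_enorm_iff_tendstoInMeasure.1 h
  -- the conditional distribution of the multiplier sum
  let Z : ℕ → Ω → ℝ := fun k η => multSum ψ (L * k) (fun i => S i η, fun i => W i η)
  have hZm : ∀ k, Measurable (Z k) := fun k =>
    (measurable_multSum hψ _).comp (hSs.prodMk hWs)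
  let g : ℝ → ℕ → Ω → ℝ := fun b k η =>
    Pr.real {η' | multSum ψ (L * k) (fun i => S i η, fun i => W i η') ≤ b}
  have hgm : ∀ b k, Measurable (g b k) := by
    intro b k
    have h1 : MeasurableSet
        {x : Ω × Ω | multSum ψ (L * k) (fun i => S i x.1, fun i => W i x.2) ≤ b} :=
      measurableSet_le ((measurable_multSum hψ _).comp
        ((hSs.comp measurable_fst).prodMk (hWs.comp measurable_snd))) measurable_const
    exact (measurable_measure_prodMk_left h1).ennreal_toReal
  have hg2 : ∀ b k, MemLp (g b k) 2 Pr := fun b k =>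
    MemLp.of_bound (hgm b k).aestronglyMeasurable 1 (Eventually.of_forall fun η => by
      rw [Real.norm_eq_abs, abs_of_nonneg measureReal_nonneg]; exact measureReal_le_one)
  have hgi : ∀ b k, Integrable (g b k) Pr := fun b k => (hg2 b k).integrable one_le_two
  -- The central limit theorem for the iid products `(W_i - 1) ψ(S_i)`, which are centred with the
  -- same variance as `ψ`. It yields the limit of the first moment of `g`.
  have hZdist : ∀ b, Tendsto (fun k => Pr.real {η | Z k η ≤ b}) atTop (𝓝 (γ.real (Set.Iic b))) := by
    have hind : IndepFun (fun η => W 0 η - 1) (fun η => ψ (S 0 η)) Pr :=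
      ((hSW.comp (measurable_pi_apply 0) (measurable_pi_apply 0)).comp (φ := ψ)
        (ψ := fun w => w - 1) hψ (measurable_id.sub_const 1)).symm
    have hindsq : IndepFun (fun η => (W 0 η - 1) ^ 2) (fun η => ψ (S 0 η) ^ 2) Pr :=
      hind.comp (measurable_id.pow_const 2) (measurable_id.pow_const 2)
    have hwm0 : Measurable fun η => W 0 η - 1 := (hWm 0).sub_const 1
    have hψm0 : Measurable fun η => ψ (S 0 η) := hψ.comp (hSm 0)
    have hWL : MemLp (W 0) 2 Pr :=
      memLp_two_of_variance_ne_zero (hWm 0).aestronglyMeasurable (by rw [hWv]; exact one_ne_zero)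
    have hW2 : MemLp (fun η => W 0 η - 1) 2 Pr := hWL.sub (memLp_const 1)
    have hWint : ∫ η, (W 0 η - 1) ∂Pr = 0 := by
      rw [integral_sub (hWL.integrable one_le_two) (integrable_const _), hW1]
      simp
    have hWsq : ∫ η, (W 0 η - 1) ^ 2 ∂Pr = 1 := by
      have h1 := variance_eq_integral (μ := Pr) (hWm 0).aemeasurable
      rw [hW1, hWv] at h1
      exact h1.symm
    have ha2 : MemLp (fun η => (W 0 η - 1) * ψ (S 0 η)) 2 Pr := by
      refine (memLp_two_iff_integrable_sq (hwm0.mul hψm0).aestronglyMeasurable).2 ?_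
      simp only [Pi.mul_apply, mul_pow]
      exact hindsq.integrable_mul hW2.integrable_sq hψ2.integrable_sq
    have ha0 : ∫ η, (W 0 η - 1) * ψ (S 0 η) ∂Pr = 0 := by
      have := hind.integral_mul_eq_mul_integral hwm0.aestronglyMeasurable
        hψm0.aestronglyMeasurable
      simp only [Pi.mul_apply] at this
      rw [this, hWint, zero_mul]
    have hasq : ∫ η, ((W 0 η - 1) * ψ (S 0 η)) ^ 2 ∂Pr = v := by
      have := hindsq.integral_mul_eq_mul_integral (hwm0.pow_const 2).aestronglyMeasurable
        (hψm0.pow_const 2).aestronglyMeasurable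
      simp only [Pi.mul_apply, ← mul_pow] at this
      rw [this, hWsq, one_mul]
    have hSWi := iIndepFun_prodMk_of_indepFun hSm hWm hSi hWi hSW
    have hG : Measurable fun y : A × ℝ => (y.2 - 1) * ψ y.1 := by fun_prop
    have hd : ∀ i, IdentDistrib (fun η => (S i η, W i η)) (fun η => (S 0 η, W 0 η)) Pr Pr := by
      intro i
      refine ⟨((hSm i).prodMk (hWm i)).aemeasurable, ((hSm 0).prodMk (hWm 0)).aemeasurable, ?_⟩
      have hi : ∀ j, Pr.map (fun η => (S j η, W j η)) = (Pr.map (S j)).prod (Pr.map (W j)) :=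
        fun j => (indepFun_iff_map_prod_eq_prod_map_map (hSm j).aemeasurable
          (hWm j).aemeasurable).1 (hSW.comp (measurable_pi_apply j) (measurable_pi_apply j))
      rw [hi, hi, (hSd i).map_eq, (hWd i).map_eq]
    have h1 := sum_sqrt_tendstoInDistribution (X := fun i η => (W i η - 1) * ψ (S i η)) ha2 ha0
      (hSWi.comp (fun _ => fun y : A × ℝ => (y.2 - 1) * ψ y.1) fun _ => hG)
      (fun i => (hd i).comp hG)
    rw [hasq] at h1
    have h2 : TendstoInDistribution Z atTop id (fun _ => Pr) γ :=
      ⟨fun k => h1.forall_aemeasurable (L * k), h1.aemeasurable_limit, h1.tendsto.comp htop⟩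
    exact tendsto_measureReal_of_tendstoInDistribution hγ0 hZm h2
  have hgZ : ∀ b k (B : Set (Fin (L * k) → A)), MeasurableSet B →
      ∫ η in (fun η (i : Fin (L * k)) => S i η) ⁻¹' B, g b k η ∂Pr
        = Pr.real ((fun η (i : Fin (L * k)) => S i η) ⁻¹' B ∩ {η | Z k η ≤ b}) :=
    fun b k B hB => setIntegral_multSum_eq hSm hWm hSW hψ (L * k) (L * k) b B hB
  -- With `c` the limiting probability, `E (g - c)²` is `E g² - 2 c E g + c²`, and the two moments
  -- tend to `c²` and `c`. The `L¹` distance is bounded by the `L²` distance.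
  have hgL : ∀ b, Tendsto (fun k => ∫ η, |g b k η - γ.real (Set.Iic b)| ∂Pr) atTop (𝓝 0) := by
    intro b
    set c := γ.real (Set.Iic b) with hc
    have h1 : Tendsto (fun k => ∫ η, g b k η ^ 2 ∂Pr) atTop (𝓝 (c ^ 2)) := by
      have h2 := (tendsto_lintegral_multSum hSm hSi hSd hW hψ hψ2 hpos b).comp htop
      have h3 := (ENNReal.tendsto_toReal (ENNReal.pow_ne_top (measure_ne_top _ _))).comp h2
      rw [ENNReal.toReal_pow] at h3
      refine h3.congr fun k => ?_
      simp only [Function.comp_apply, g, Measure.real, ← ENNReal.toReal_pow]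
      refine (integral_toReal ?_ (Eventually.of_forall fun _ =>
        ENNReal.pow_lt_top (measure_lt_top _ _))).symm
      have h4 : MeasurableSet
          {x : Ω × Ω | multSum ψ (L * k) (fun i => S i x.1, fun i => W i x.2) ≤ b} :=
        measurableSet_le ((measurable_multSum hψ _).comp
          ((hSs.comp measurable_fst).prodMk (hWs.comp measurable_snd))) measurable_const
      exact ((measurable_measure_prodMk_left h4).pow_const 2).aemeasurable
    have h2 : Tendsto (fun k => ∫ η, g b k η ∂Pr) atTop (𝓝 c) := by
      refine (hZdist b).congr fun k => ?_
      have := hgZ b k Set.univ MeasurableSet.univ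
      simpa using this.symm
    have h3 : Tendsto (fun k => ∫ η, (g b k η - c) ^ 2 ∂Pr) atTop (𝓝 0) := by
      have h4 : Tendsto (fun k => ∫ η, g b k η ^ 2 ∂Pr - 2 * c * ∫ η, g b k η ∂Pr + c ^ 2) atTop
          (𝓝 (c ^ 2 - 2 * c * c + c ^ 2)) := (h1.sub (h2.const_mul _)).add_const _
      rw [show c ^ 2 - 2 * c * c + c ^ 2 = 0 by ring] at h4
      refine h4.congr fun k => ?_
      have e : ∀ η, (g b k η - c) ^ 2 = g b k η ^ 2 - 2 * c * g b k η + c ^ 2 := fun η => by ring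
      simp only [e]
      have k1 := integral_add ((hg2 b k).integrable_sq.sub ((hgi b k).const_mul (2 * c)))
        (integrable_const (c ^ 2)) (μ := Pr)
      simp only [Pi.sub_apply] at k1
      rw [k1, integral_sub (hg2 b k).integrable_sq ((hgi b k).const_mul (2 * c)),
        integral_const_mul]
      simp
    have h5 := (Real.continuous_sqrt.tendsto 0).comp h3
    rw [Real.sqrt_zero] at h5
    refine squeeze_zero (fun k => integral_nonneg fun _ => abs_nonneg _) (fun k => ?_) h5
    exact Real.le_sqrt_of_sq_le (sq_integral_abs_le ((hg2 b k).sub (memLp_const c)))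
  -- the conditional distribution of the bootstrap estimator
  let T : ℕ → Ω → ℝ := fun k η => √((L * k : ℕ) : ℝ) * (θStar k η - θHat k η)
  have hTm : ∀ k, Measurable (T k) := fun k => ((hm' k).sub (hm k)).const_mul _
  let X : (k : ℕ) → Ω → Fin (L * k) → A := fun k η i => S i η
  have hXm : ∀ k, Measurable (X k) := fun k => measurable_pi_iff.2 fun i => hSm i
  let κ : (k : ℕ) → Ω → Measure ℝ := fun k η => condDistrib (T k) (X k) Pr (X k η)
  have hκ : ∀ a, SmallProb Pr fun k η => ‖(κ k η).real (Set.Iic a) - γ.real (Set.Iic a)‖ₑ := by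
    intro a
    have hκi : ∀ k, Integrable (fun η => (κ k η).real (Set.Iic a)) Pr := fun k =>
      integrable_toReal_condDistrib (hXm k).aemeasurable measurableSet_Iic
    -- Continuity of the limit gives `d` for which replacing `a` by `a ± d / 2` costs less than `ρ /
    -- 2` in total. The other error terms together are eventually below `ρ / 4`.
    have hL1 : Tendsto (fun k => ∫ η, |(κ k η).real (Set.Iic a) - γ.real (Set.Iic a)| ∂Pr) atTop
        (𝓝 0) := by
      rw [Metric.tendsto_atTop']
      intro ρ hρ
      obtain ⟨d, hd, hd'⟩ := Metric.continuousAt_iff.1 (hγc.continuousAt (x := a)) (ρ / 4)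
        (by positivity)
      have hd2 : 0 < d / 2 := by positivity
      have hp := hd' (x := a + d / 2) (by rw [Real.dist_eq]; rw [abs_lt]; constructor <;> linarith)
      have hq := hd' (x := a - d / 2) (by rw [Real.dist_eq]; rw [abs_lt]; constructor <;> linarith)
      rw [Real.dist_eq, abs_lt] at hp hq
      have hrem : Tendsto (fun k => Pr.real {η | d / 2 < |T k η - Z k η|}) atTop (𝓝 0) := by
        have h1 := h' (ENNReal.ofReal (d / 2)) (by simpa using hd)
        have h2 := (ENNReal.tendsto_toReal ENNReal.zero_ne_top).comp h1
        rw [ENNReal.toReal_zero] at h2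
        refine h2.congr fun k => ?_
        simp only [Function.comp_apply, Measure.real]
        congr 2
        ext η
        simp only [Set.mem_ofPred_eq, Real.enorm_eq_ofReal_abs]
        rw [ENNReal.ofReal_lt_ofReal_iff_of_nonneg hd2.le]
        rfl
      have hsum := ((hgL (a + d / 2)).add (hgL (a - d / 2))).add (hrem.const_mul 2)
      simp only [add_zero, mul_zero] at hsum
      obtain ⟨N, hN⟩ := Metric.tendsto_atTop'.1 hsum (ρ / 4) (by positivity)
      refine ⟨N, fun k hk => ?_⟩
      have h1 := hN k hk
      rw [Real.dist_eq, sub_zero] at h1 ⊢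
      rw [abs_of_nonneg (integral_nonneg fun _ => abs_nonneg _)]
      have h2 := lt_of_abs_lt h1
      have hmono : ∀ x y : ℝ, x ≤ y → γ.real (Set.Iic x) ≤ γ.real (Set.Iic y) := fun x y hxy =>
        measureReal_mono (Set.Iic_subset_Iic.2 hxy)
      have h3 := integral_abs_condDistrib_sub_le (Pr := Pr) (hXm k) (hTm k) (hZm k)
        (hgi (a - d / 2) k) (hgi (a + d / 2) k) (hgZ (a - d / 2) k) (hgZ (a + d / 2) k)
        (hmono (a - d / 2) a (by linarith)) (hmono a (a + d / 2) (by linarith))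
      simp only [κ]
      linarith
    refine SmallProb.of_lintegral (fun k =>
      ((hκi k).sub (integrable_const _)).aestronglyMeasurable.enorm) ?_
    have h1 := ENNReal.tendsto_ofReal hL1
    rw [ENNReal.ofReal_zero] at h1
    refine h1.congr fun k => ?_
    exact ofReal_integral_norm_eq_lintegral_enorm ((hκi k).sub (integrable_const _))
  -- uniformity
  refine smallProb_enorm_iff_tendstoInMeasure.1 fun ε hε => ?_
  obtain ⟨r, hr0, hr⟩ := ENNReal.lt_iff_exists_real_btwn.1 (pos_iff_ne_zero.2 hε)
  have hrpos : 0 < r := by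
    by_contra hcon
    simp [ENNReal.ofReal_of_nonpos (not_lt.1 hcon)] at hr
  -- The tolerance `r` is spent in four equal parts: the Pólya error and the deviations on the
  -- finite set, once for the conditional law of the bootstrap estimator and once for the law of the
  -- original one.
  obtain ⟨F, hF⟩ := exists_finset_forall_abs_measureReal_Iic_sub_le γ hγc (ε := r / 4)
    (by positivity)
  have hPF : Tendsto (fun k => ∑ b ∈ F,
      |Pr.real {η | √((L * k : ℕ) : ℝ) * (θHat k η - θ) ≤ b} - γ.real (Set.Iic b)|) atTop (𝓝 0) := by
    have h1 := tendsto_finsetSum F fun b _ => ((hP b).sub_const (γ.real (Set.Iic b))).abs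
    simpa using h1
  have hκF := SmallProb.sum F fun b _ => hκ b
  refine tendsto_measure_of_subset (hκF (ENNReal.ofReal (r / 4)) (by simpa using hrpos)) ?_
  filter_upwards [hPF.eventually (gt_mem_nhds (show (0 : ℝ) < r / 4 by positivity))] with k hk η hη
  simp only [Set.mem_ofPred_eq] at hη ⊢
  by_contra hcon
  rw [not_lt] at hcon
  have hsum : ∑ b ∈ F, |(κ k η).real (Set.Iic b) - γ.real (Set.Iic b)| ≤ r / 4 := by
    simp only [Real.enorm_eq_ofReal_abs] at hcon
    rw [← ENNReal.ofReal_sum_of_nonneg fun _ _ => abs_nonneg _] at hcon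
    exact (ENNReal.ofReal_le_ofReal_iff (by positivity)).1 hcon
  have hQ : Measurable fun η => √((L * k : ℕ) : ℝ) * (θHat k η - θ) :=
    ((hm k).sub_const θ).const_mul _
  have hsup : (⨆ a : ℝ, |(κ k η).real (Set.Iic a)
      - Pr.real {η' | √((L * k : ℕ) : ℝ) * (θHat k η' - θ) ≤ a}|) ≤ r := by
    refine ciSup_le fun a => ?_
    have h1 := hF (κ k η) inferInstance a
    have h2 := hF (Pr.map fun η => √((L * k : ℕ) : ℝ) * (θHat k η - θ))
      (Measure.isProbabilityMeasure_map hQ.aemeasurable) a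
    have h3 : ∀ b, (Pr.map fun η => √((L * k : ℕ) : ℝ) * (θHat k η - θ)).real (Set.Iic b)
        = Pr.real {η' | √((L * k : ℕ) : ℝ) * (θHat k η' - θ) ≤ b} := fun b => by
      rw [Measure.real, Measure.map_apply hQ measurableSet_Iic]; rfl
    simp only [h3] at h2
    have h4 := abs_sub_le ((κ k η).real (Set.Iic a)) (γ.real (Set.Iic a))
      (Pr.real {η' | √((L * k : ℕ) : ℝ) * (θHat k η' - θ) ≤ a})
    rw [abs_sub_comm (γ.real (Set.Iic a))] at h4
    linarith
  refine absurd hη (not_lt.2 ?_)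
  rw [Real.enorm_eq_ofReal_abs, abs_of_nonneg (Real.iSup_nonneg fun _ => abs_nonneg _)]
  exact (ENNReal.ofReal_le_ofReal hsup).trans hr.2.le

end Bootstrap

end PanelATT

/-! ### Cross-fitting: sums over a fold of functions estimated on the other folds -/

namespace PanelATT

section CrossFit

variable {Ω B : Type*} [MeasurableSpace Ω] [MeasurableSpace B] {Pr : Measure Ω}

variable {L : ℕ} {fold : FoldMap L}

/-- The data of the units outside fold `ℓ`. -/
def trainData (fold : FoldMap L) (D : ℕ → Ω → B) (k : ℕ) (ℓ : Fin L) (η : Ω) :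
    Train fold k ℓ → B := fun i => D i.1 η

lemma measurable_trainData {D : ℕ → Ω → B} (hDm : ∀ i, Measurable (D i)) (k : ℕ) (ℓ : Fin L) :
    Measurable (trainData fold D k ℓ) := measurable_pi_iff.2 fun i => hDm i.1

/-- The data of the units in fold `ℓ`. -/
def testData (fold : FoldMap L) (D : ℕ → Ω → B) (k : ℕ) (ℓ : Fin L) (η : Ω) :
    {i : Fin (L * k) // fold k i = ℓ} → B := fun i => D i.1 η

lemma indepFun_trainData_testData {D : ℕ → Ω → B} (hDm : ∀ i, Measurable (D i))
    (hDi : iIndepFun D Pr) (k : ℕ) (ℓ : Fin L) :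
    IndepFun (trainData fold D k ℓ) (testData fold D k ℓ) Pr := by
  have h1 : iIndepFun (fun i : Fin (L * k) => D i) Pr :=
    hDi.precomp Fin.val_injective
  let s : Finset (Fin (L * k)) := Finset.univ.filter fun i => fold k i ≠ ℓ
  let t : Finset (Fin (L * k)) := Finset.univ.filter fun i => fold k i = ℓ
  have hst : Disjoint s t := by
    rw [Finset.disjoint_left]
    intro i hi hj
    exact (Finset.mem_filter.1 hi).2 (Finset.mem_filter.1 hj).2
  have h2 := h1.indepFun_finset s t hst fun i => hDm i
  refine h2.comp (φ := fun (a : s → B) (i : Train fold k ℓ) => a ⟨i.1, by simp [s, i.2]⟩)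
    (ψ := fun (a : t → B) (i : {i : Fin (L * k) // fold k i = ℓ}) => a ⟨i.1, by simp [t, i.2]⟩)
    ?_ ?_
  · exact measurable_pi_iff.2 fun i => measurable_pi_apply _
  · exact measurable_pi_iff.2 fun i => measurable_pi_apply _

variable [IsProbabilityMeasure Pr]

/-- Conditional Markov inequality: if the conditional mean of `H k` given the first of two
independent variables is `o_p(1)`, then so is `H k`. -/
lemma SmallProb.of_conditional {X' Y' : ℕ → Type*} [∀ k, MeasurableSpace (X' k)]
    [∀ k, MeasurableSpace (Y' k)] {X : ∀ k, Ω → X' k} {Y : ∀ k, Ω → Y' k}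
    (hX : ∀ k, Measurable (X k)) (hY : ∀ k, Measurable (Y k))
    (hXY : ∀ k, IndepFun (X k) (Y k) Pr) {H : ∀ k, X' k × Y' k → ℝ≥0∞}
    (hH : ∀ k, Measurable (H k))
    (h : SmallProb Pr fun k η => ∫⁻ η', H k (X k η, Y k η') ∂Pr) :
    SmallProb Pr fun k η => H k (X k η, Y k η) := by
  intro ε hε
  rcases eq_or_ne ε ∞ with rfl | hε'
  · simp
  rw [ENNReal.tendsto_nhds_zero]
  intro ρ hρ
  rcases eq_or_ne ρ ∞ with rfl | hρ'
  · simp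
  have hδ : ε * (ρ / 2) ≠ 0 := mul_ne_zero hε (ENNReal.half_pos hρ.ne').ne'
  have hδ' : ε * (ρ / 2) ≠ ∞ := ENNReal.mul_ne_top hε' (ENNReal.div_ne_top hρ' two_ne_zero)
  filter_upwards [(ENNReal.tendsto_nhds_zero.1 (h _ hδ)) (ρ / 2) (ENNReal.half_pos hρ.ne')]
    with k hk
  set δ := ε * (ρ / 2) with hδdef
  let v : X' k → ℝ≥0∞ := fun d => ∫⁻ η', H k (d, Y k η') ∂Pr
  have hv : Measurable v :=
    Measurable.lintegral_prod_right' (f := fun x : X' k × Ω => H k (x.1, Y k x.2))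
      ((hH k).comp (measurable_fst.prodMk ((hY k).comp measurable_snd)))
  -- Restricting to data with conditional mean at most `δ` makes the expectation at most `δ`,
  -- although `H k` itself may have infinite expectation. Since `δ = ε * (ρ / 2)`, Markov's
  -- inequality then costs `ρ / 2`.
  let G : X' k × Y' k → ℝ≥0∞ := {x | v x.1 ≤ δ}.indicator (H k)
  have hG : Measurable G := (hH k).indicator (measurableSet_le (hv.comp measurable_fst)
    measurable_const)
  have hGle : ∫⁻ η, G (X k η, Y k η) ∂Pr ≤ δ := by
    rw [lintegral_indepFun (hX k) (hY k) (hXY k) hG]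
    calc _ ≤ ∫⁻ _, δ ∂Pr := lintegral_mono fun η => ?_
      _ = δ := by simp
    by_cases hη : v (X k η) ≤ δ
    · have e : ∀ η', G (X k η, Y k η') = H k (X k η, Y k η') := fun η' =>
        Set.indicator_of_mem (s := {x : X' k × Y' k | v x.1 ≤ δ}) hη _
      simp only [e]
      exact hη
    · have e : ∀ η', G (X k η, Y k η') = 0 := fun η' =>
        Set.indicator_of_notMem (s := {x : X' k × Y' k | v x.1 ≤ δ}) hη _
      simp [e]
  have hsub : {η | ε < H k (X k η, Y k η)} ⊆
      {η | δ < v (X k η)} ∪ {η | ε ≤ G (X k η, Y k η)} := by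
    intro η hη
    by_cases h1 : v (X k η) ≤ δ
    · right
      simp only [Set.mem_ofPred_eq] at hη ⊢
      simpa [G, h1] using hη.le
    · exact Or.inl (not_le.1 h1)
  refine (measure_mono hsub).trans ((measure_union_le _ _).trans ?_)
  have h2 : Pr {η | ε ≤ G (X k η, Y k η)} ≤ ρ / 2 := by
    refine (meas_ge_le_lintegral_div (hG.comp ((hX k).prodMk (hY k))).aemeasurable hε hε').trans ?_
    refine (ENNReal.div_le_div_right hGle ε).trans ?_
    rw [hδdef, mul_comm, ENNReal.mul_div_cancel_right hε hε']
  exact (add_le_add hk h2).trans (ENNReal.add_halves ρ).le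

/-- Second moment of a centred iid sum. -/
lemma lintegral_sq_sum_sub_le {ι : Type*} {D : ι → Ω → B} {μ : Measure B}
    (hDm : ∀ i, Measurable (D i)) (hDi : iIndepFun D Pr) (hDd : ∀ i, Pr.map (D i) = μ)
    (s : Finset ι) {f : B → ℝ} (hf : Measurable f) :
    ∫⁻ η, ‖∑ i ∈ s, (f (D i η) - ∫ y, f y ∂μ)‖ₑ ^ 2 ∂Pr
      ≤ s.card * ∫⁻ y, ‖f y‖ₑ ^ 2 ∂μ := by
  rcases s.eq_empty_or_nonempty with rfl | ⟨i₀, hi₀⟩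
  · simp
  have hμ : IsProbabilityMeasure μ := by
    rw [← hDd i₀]; exact Measure.isProbabilityMeasure_map (hDm i₀).aemeasurable
  -- An infinite second moment makes the bound trivial, since the sum has at least one term.
  by_cases hfin : ∫⁻ y, ‖f y‖ₑ ^ 2 ∂μ = ∞
  · rw [hfin, ENNReal.mul_top (by exact_mod_cast (Finset.card_pos.2 ⟨i₀, hi₀⟩).ne')]
    exact le_top
  have hint : Integrable (fun y => f y ^ 2) μ := by
    refine ⟨(hf.pow_const 2).aestronglyMeasurable, ?_⟩
    rw [HasFiniteIntegral]
    simp only [enorm_pow]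
    exact lt_top_iff_ne_top.2 hfin
  have hf2 : MemLp f 2 μ := (memLp_two_iff_integrable_sq hf.aestronglyMeasurable).2 hint
  have hmp : ∀ i, MeasurePreserving (D i) Pr μ := fun i => ⟨hDm i, hDd i⟩
  have hf2' : ∀ i, MemLp (fun η => f (D i η)) 2 Pr := fun i => hf2.comp_measurePreserving (hmp i)
  have hmean : ∀ i, ∫ η, f (D i η) ∂Pr = ∫ y, f y ∂μ := fun i => by
    rw [← hDd i, integral_map (hDm i).aemeasurable hf.aestronglyMeasurable]
  have hsq : ∀ i, ∫ η, f (D i η) ^ 2 ∂Pr = ∫ y, f y ^ 2 ∂μ := fun i => by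
    rw [← hDd i, integral_map (hDm i).aemeasurable (hf.pow_const 2).aestronglyMeasurable]
  have hvar : Var[∑ i ∈ s, fun η => f (D i η); Pr] ≤ s.card * ∫ y, f y ^ 2 ∂μ := by
    rw [IndepFun.variance_sum (fun i _ => hf2' i) fun i _ j _ hij =>
      (hDi.indepFun hij).comp hf hf]
    refine (Finset.sum_le_sum (g := fun _ => ∫ y, f y ^ 2 ∂μ) fun i _ => ?_).trans (by simp)
    rw [← hsq i]
    exact variance_le_expectation_sq (hf2' i).aestronglyMeasurable
  have hsum2 : MemLp (fun η => ∑ i ∈ s, (f (D i η) - ∫ y, f y ∂μ)) 2 Pr :=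
    memLp_finsetSum s fun i _ => (hf2' i).sub (memLp_const _)
  have e1 : ∫⁻ η, ‖∑ i ∈ s, (f (D i η) - ∫ y, f y ∂μ)‖ₑ ^ 2 ∂Pr
      = ENNReal.ofReal (Var[∑ i ∈ s, fun η => f (D i η); Pr]) := by
    have hsm : AEMeasurable (∑ i ∈ s, fun η => f (D i η)) Pr :=
      Finset.aemeasurable_sum s fun i _ => (hf.comp (hDm i)).aemeasurable
    rw [variance_eq_integral hsm]
    have e2 : ∫ η, (∑ i ∈ s, fun η => f (D i η)) η ∂Pr = ∑ i ∈ s, ∫ y, f y ∂μ := by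
      simp only [Finset.sum_apply]
      rw [integral_finsetSum s fun i _ => (hf2' i).integrable one_le_two]
      exact Finset.sum_congr rfl fun i _ => hmean i
    rw [e2]
    simp only [Finset.sum_apply, ← Finset.sum_sub_distrib]
    rw [ofReal_integral_eq_lintegral_ofReal hsum2.integrable_sq
      (Eventually.of_forall fun _ => sq_nonneg _)]
    refine lintegral_congr fun η => ?_
    rw [← enorm_pow, Real.enorm_eq_ofReal (sq_nonneg _)]
  have e3 : ∫⁻ y, ‖f y‖ₑ ^ 2 ∂μ = ENNReal.ofReal (∫ y, f y ^ 2 ∂μ) := by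
    rw [ofReal_integral_eq_lintegral_ofReal hint (Eventually.of_forall fun _ => sq_nonneg _)]
    refine lintegral_congr fun η => ?_
    rw [← enorm_pow, Real.enorm_eq_ofReal (sq_nonneg _)]
  rw [e1, e3, ← ENNReal.ofReal_natCast, ← ENNReal.ofReal_mul (by positivity)]
  exact ENNReal.ofReal_le_ofReal hvar

lemma sum_fold_eq_sum_subtype {M : Type*} [AddCommMonoid M] (k : ℕ) (ℓ : Fin L)
    (g : Fin (L * k) → M) :
    ∑ i with fold k i = ℓ, g i = ∑ i : {i : Fin (L * k) // fold k i = ℓ}, g i.1 :=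
  Finset.sum_subtype _ (by simp) g

variable {D : ℕ → Ω → B} {μ : Measure B}

/-- Sums over a fold of a nonnegative function estimated on the other folds. -/
lemma smallProb_fold_sum (hDm : ∀ i, Measurable (D i)) (hDi : iIndepFun D Pr)
    (hDd : ∀ i, Pr.map (D i) = μ) (hfold : fold.Balanced) (ℓ : Fin L)
    {G : ∀ k, (Train fold k ℓ → B) → B → ℝ≥0∞} (hG : ∀ k, Measurable (Function.uncurry (G k)))
    (h : SmallProb Pr fun k η => k * ∫⁻ y, G k (trainData fold D k ℓ η) y ∂μ) :
    SmallProb Pr fun k η =>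
      ∑ i : Fin (L * k) with fold k i = ℓ, G k (trainData fold D k ℓ η) (D i η) := by
  have hYm : ∀ k, Measurable (testData fold D k ℓ) := fun k => measurable_pi_iff.2 fun i => hDm i.1
  have h1 := SmallProb.of_conditional (Pr := Pr) (fun k => measurable_trainData hDm k ℓ) hYm
    (fun k => indepFun_trainData_testData (fold := fold) hDm hDi k ℓ)
    (H := fun k x => ∑ i : {i : Fin (L * k) // fold k i = ℓ}, G k x.1 (x.2 i))
    (fun k => Finset.measurable_fun_sum _ fun i _ => (hG k).comp
      (measurable_fst.prodMk ((measurable_pi_apply i).comp measurable_snd)))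
  refine (h1 (h.mono fun k η => ?_)).mono fun k η => ?_
  · have hGd : Measurable (G k (trainData fold D k ℓ η)) := (hG k).comp measurable_prodMk_left
    simp only [testData]
    have hGi : ∀ i : {i : Fin (L * k) // fold k i = ℓ},
        Measurable fun η' => G k (trainData fold D k ℓ η) (D i.1 η') := fun i => hGd.comp (hDm i.1)
    rw [lintegral_finsetSum _ fun i _ => hGi i]
    have e : ∀ i : {i : Fin (L * k) // fold k i = ℓ},
        ∫⁻ η', G k (trainData fold D k ℓ η) (D i.1 η') ∂Pr
          = ∫⁻ y, G k (trainData fold D k ℓ η) y ∂μ := fun i => by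
      rw [← hDd i.1, lintegral_map hGd (hDm i.1)]
    simp only [e, Finset.sum_const, nsmul_eq_mul, Finset.card_univ]
    rw [Fintype.card_subtype, hfold k ℓ]
  · rw [sum_fold_eq_sum_subtype k ℓ fun i => G k (trainData fold D k ℓ η) (D i η)]
    rfl

/-- Centred sums over a fold of a function estimated on the other folds. -/
lemma smallProb_fold_sum_sub (hDm : ∀ i, Measurable (D i)) (hDi : iIndepFun D Pr)
    (hDd : ∀ i, Pr.map (D i) = μ) (hfold : fold.Balanced) (ℓ : Fin L)
    {F : ∀ k, (Train fold k ℓ → B) → B → ℝ} (hF : ∀ k, Measurable (Function.uncurry (F k)))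
    (h : SmallProb Pr fun k η => k * ∫⁻ y, ‖F k (trainData fold D k ℓ η) y‖ₑ ^ 2 ∂μ) :
    SmallProb Pr fun k η =>
      ‖∑ i : Fin (L * k) with fold k i = ℓ, (F k (trainData fold D k ℓ η) (D i η) -
        ∫ y, F k (trainData fold D k ℓ η) y ∂μ)‖ₑ := by
  have hμ : IsProbabilityMeasure μ := by
    rw [← hDd 0]; exact Measure.isProbabilityMeasure_map (hDm 0).aemeasurable
  have hYm : ∀ k, Measurable (testData fold D k ℓ) := fun k => measurable_pi_iff.2 fun i => hDm i.1
  have h1 := SmallProb.of_conditional (Pr := Pr) (fun k => measurable_trainData hDm k ℓ) hYm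
    (fun k => indepFun_trainData_testData (fold := fold) hDm hDi k ℓ)
    (H := fun k x => ‖∑ i : {i : Fin (L * k) // fold k i = ℓ},
      (F k x.1 (x.2 i) - ∫ y, F k x.1 y ∂μ)‖ₑ ^ 2)
    (fun k => by
      refine Measurable.pow_const (Measurable.enorm (Finset.measurable_fun_sum _ fun i _ => ?_)) 2
      refine Measurable.sub ((hF k).comp
        (measurable_fst.prodMk ((measurable_pi_apply i).comp measurable_snd))) ?_
      have h2 : StronglyMeasurable fun d => ∫ y, Function.uncurry (F k) (d, y) ∂μ :=
        (hF k).stronglyMeasurable.integral_prod_right'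
      exact h2.measurable.comp measurable_fst)
  -- Given the training data the summands are iid and centred, so the conditional second moment of
  -- the sum is at most `k` times that of one summand.
  refine SmallProb.sqrt ((h1 (h.mono fun k η => ?_)).mono fun k η => ?_)
  · have hFd : Measurable (F k (trainData fold D k ℓ η)) := (hF k).comp measurable_prodMk_left
    have h3 := lintegral_sq_sum_sub_le (Pr := Pr)
      (D := fun i : {i : Fin (L * k) // fold k i = ℓ} => D i.1) (fun i => hDm i.1)
      (hDi.precomp (Fin.val_injective.comp Subtype.val_injective)) (fun i => hDd i.1)
      Finset.univ hFd
    rw [Finset.card_univ, Fintype.card_subtype, hfold k ℓ] at h3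
    exact h3
  · rw [sum_fold_eq_sum_subtype k ℓ fun i => F k (trainData fold D k ℓ η) (D i η) -
        ∫ y, F k (trainData fold D k ℓ η) y ∂μ]
    rfl

end CrossFit

end PanelATT

/-! ### Conditional means within a group -/

namespace PanelATT

section CondMean

variable {Ω E : Type*} [MeasurableSpace Ω] [mE : MeasurableSpace E] {P : Measure Ω}
  {X : Ω → E} {A : Set Ω}

lemma IsCondMean.ae_eq {Z Z' : Ω → ℝ} {f f' : E → ℝ} (h : IsCondMean P X A Z f)
    (h' : IsCondMean P X A Z' f') (hZ : Z =ᵐ[cond P A] Z') :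
    f ∘ X =ᵐ[cond P A] f' ∘ X :=
  h.2.2.symm.trans ((condExp_congr_ae hZ).trans h'.2.2)

lemma IsCondMean.sub {Z Z' : Ω → ℝ} {f f' : E → ℝ} (h : IsCondMean P X A Z f)
    (h' : IsCondMean P X A Z' f') :
    IsCondMean P X A (fun a => Z a - Z' a) (fun x => f x - f' x) := by
  refine ⟨h.1.sub h'.1, h.2.1.sub h'.2.1, ?_⟩
  filter_upwards [condExp_sub h.2.1 h'.2.1 (MeasurableSpace.comap X mE), h.2.2, h'.2.2]
    with a h1 h2 h3
  have h4 : (fun a => Z a - Z' a) = Z - Z' := rfl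
  rw [h4, h1, Pi.sub_apply, h2, h3]
  rfl

lemma IsCondMean.congr {Z Z' : Ω → ℝ} {f f' : E → ℝ} (h : IsCondMean P X A Z f)
    (hZ : Z =ᵐ[cond P A] Z') (hf' : Measurable f') (hf : f ∘ X =ᵐ[cond P A] f' ∘ X) :
    IsCondMean P X A Z' f' :=
  ⟨hf', h.2.1.congr hZ, (condExp_congr_ae hZ).symm.trans (h.2.2.trans hf)⟩

lemma integral_cond_eq (f : Ω → ℝ) :
    ∫ a, f a ∂(cond P A) = (P.real A)⁻¹ * ∫ a in A, f a ∂P := by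
  rw [ProbabilityTheory.cond, integral_smul_measure, ENNReal.toReal_inv, smul_eq_mul]
  rfl

lemma isCondMean_comp (hX : Measurable X) {f : E → ℝ} (hf : Measurable f)
    (hi : Integrable (fun a => f (X a)) (cond P A)) :
    IsCondMean P X A (fun a => f (X a)) f :=
  ⟨hf, hi, by
    have : IsFiniteMeasure (cond P A) := inferInstance
    have h1 : StronglyMeasurable[MeasurableSpace.comap X mE] (fun a => f (X a)) :=
      (hf.comp (comap_measurable X)).stronglyMeasurable
    rw [condExp_of_stronglyMeasurable hX.comap_le h1 hi]
    rfl⟩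

variable [IsProbabilityMeasure P]

lemma ae_cond_iff {q : Ω → Prop} :
    (∀ᵐ a ∂(cond P A), q a) ↔ ∀ᵐ a ∂(P.restrict A), q a := by
  rw [ProbabilityTheory.cond]
  exact Measure.ae_ennreal_smul_measure_iff (ENNReal.inv_ne_zero.2 (measure_ne_top _ _))

lemma integrable_cond_iff (hA : P A ≠ 0) {f : Ω → ℝ} :
    Integrable f (cond P A) ↔ Integrable f (P.restrict A) :=
  integrable_smul_measure (ENNReal.inv_ne_zero.2 (measure_ne_top _ _)) (ENNReal.inv_ne_top.2 hA)

/-- The defining property of the conditional mean, with a multiplier depending on `X`. -/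
lemma IsCondMean.setIntegral_mul {Z : Ω → ℝ} {f : E → ℝ} (h : IsCondMean P X A Z f)
    (hX : Measurable X) (hA : P A ≠ 0) {u : E → ℝ} (hu : Measurable u)
    (hi : Integrable (fun a => u (X a) * Z a) (P.restrict A)) :
    Integrable (fun a => u (X a) * f (X a)) (P.restrict A) ∧
      ∫ a in A, u (X a) * Z a ∂P = ∫ a in A, u (X a) * f (X a) ∂P := by
  obtain ⟨hf, hZ, hcond⟩ := h
  have := cond_isProbabilityMeasure (μ := P) hA
  have hm : MeasurableSpace.comap X mE ≤ _ := hX.comap_le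
  have huX : StronglyMeasurable[MeasurableSpace.comap X mE] (fun a => u (X a)) :=
    (hu.comp (comap_measurable X)).stronglyMeasurable
  have hi' : Integrable ((fun a => u (X a)) * Z) (cond P A) := (integrable_cond_iff hA).2 hi
  have h1 := condExp_mul_of_stronglyMeasurable_left huX hi' hZ
  have h2 : condExp (MeasurableSpace.comap X mE) (cond P A) ((fun a => u (X a)) * Z)
      =ᵐ[cond P A] fun a => u (X a) * f (X a) := by
    filter_upwards [h1, hcond] with a ha hb
    rw [ha, Pi.mul_apply, hb]
    rfl
  refine ⟨(integrable_cond_iff hA).1 (integrable_condExp.congr h2), ?_⟩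
  have h3 := integral_condExp (μ := cond P A) hm (f := (fun a => u (X a)) * Z)
  rw [integral_congr_ae h2, integral_cond_eq, integral_cond_eq] at h3
  have h4 : (P.real A)⁻¹ ≠ 0 := inv_ne_zero ((measureReal_ne_zero_iff (measure_ne_top _ _)).2 hA)
  exact (mul_left_cancel₀ h4 h3).symm

/-- A bounded conditional second moment, with a multiplier depending on `X`. -/
lemma lintegral_mul_sq_le_of_condExp_le (hX : Measurable X) (hA : P A ≠ 0) {e : Ω → ℝ}
    (he : MemLp e 2 (cond P A)) {C : ℝ}
    (hC : ∀ᵐ a ∂(cond P A), condExp (MeasurableSpace.comap X mE) (cond P A)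
      (fun b => e b ^ 2) a ≤ C) {u : E → ℝ≥0∞} (hu : Measurable u) (hem : Measurable e) :
    ∫⁻ a in A, u (X a) * ‖e a‖ₑ ^ 2 ∂P ≤ ENNReal.ofReal C * ∫⁻ a in A, u (X a) ∂P := by
  have := cond_isProbabilityMeasure (μ := P) hA
  have hm : MeasurableSpace.comap X mE ≤ _ := hX.comap_le
  -- The bound is a comparison of measures on the covariate space: the image of `e² dP(· | A)` under
  -- `X` is at most `C` times the law of `X` given `A`. Testing on preimages `X ⁻¹' B` suffices, and
  -- there `e²` may be replaced by its conditional expectation.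
  have hle : ((cond P A).withDensity fun a => ‖e a‖ₑ ^ 2).map X ≤
      ENNReal.ofReal C • (cond P A).map X := by
    refine Measure.le_iff.2 fun B hB => ?_
    rw [Measure.map_apply hX hB, withDensity_apply _ (hX hB), Measure.smul_apply,
      Measure.map_apply hX hB, smul_eq_mul]
    have h1 : ∫⁻ a in X ⁻¹' B, ‖e a‖ₑ ^ 2 ∂(cond P A)
        = ENNReal.ofReal (∫ a in X ⁻¹' B, e a ^ 2 ∂(cond P A)) := by
      rw [ofReal_integral_eq_lintegral_ofReal he.integrable_sq.integrableOn
        (Eventually.of_forall fun _ => sq_nonneg _)]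
      refine lintegral_congr fun η => ?_
      rw [← enorm_pow, Real.enorm_eq_ofReal (sq_nonneg _)]
    rw [h1, ← setIntegral_condExp hm he.integrable_sq ⟨B, hB, rfl⟩]
    have h2 : ∫ a in X ⁻¹' B, (condExp (MeasurableSpace.comap X mE) (cond P A)
        (fun b => e b ^ 2)) a ∂(cond P A) ≤ ∫ _ in X ⁻¹' B, C ∂(cond P A) :=
      setIntegral_mono_ae integrable_condExp.integrableOn (integrable_const C).integrableOn hC
    refine (ENNReal.ofReal_le_ofReal h2).trans ?_
    rw [setIntegral_const, smul_eq_mul, mul_comm, ENNReal.ofReal_mul' measureReal_nonneg,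
      ofReal_measureReal]
  have h3 := lintegral_mono' hle (le_refl u)
  have huX : Measurable fun a => u (X a) := hu.comp hX
  rw [lintegral_map hu hX, lintegral_smul_measure, lintegral_map hu hX,
    lintegral_withDensity_eq_lintegral_mul _ (hem.enorm.pow_const 2) huX,
    ProbabilityTheory.cond,
    lintegral_smul_measure, lintegral_smul_measure] at h3
  simp only [smul_eq_mul, Pi.mul_apply] at h3
  rw [mul_left_comm, ENNReal.mul_le_mul_iff_right (ENNReal.inv_ne_zero.2 (measure_ne_top _ _))
    (ENNReal.inv_ne_top.2 hA)] at h3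
  simpa only [mul_comm] using h3

/-- A bounded conditional second moment bounds the conditional mean. -/
lemma IsCondMean.ae_abs_le (hA : P A ≠ 0) {e : Ω → ℝ} {d : E → ℝ}
    (hd : IsCondMean P X A e d) (he : MemLp e 2 (cond P A)) {C : ℝ}
    (hX : Measurable X)
    (hC : ∀ᵐ a ∂(cond P A), condExp (MeasurableSpace.comap X mE) (cond P A)
      (fun b => e b ^ 2) a ≤ C) : ∀ᵐ a ∂(cond P A), |d (X a)| ≤ 1 + C := by
  have := cond_isProbabilityMeasure (μ := P) hA
  have hsq := he.integrable_sq
  have hadd := condExp_add (m := MeasurableSpace.comap X mE) (integrable_const (1 : ℝ)) hsq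
  -- From `|e| ≤ 1 + e²` by taking conditional expectations, separately for `e` and `-e`.
  have h1 := condExp_mono (m := MeasurableSpace.comap X mE) hd.2.1
    ((integrable_const (1 : ℝ)).add hsq)
    (Eventually.of_forall fun a => by
      simp only [Pi.add_apply]; nlinarith [sq_nonneg (e a - 1), sq_nonneg (e a + 1)])
  have h2 := condExp_mono (m := MeasurableSpace.comap X mE) hd.2.1.neg
    ((integrable_const (1 : ℝ)).add hsq)
    (Eventually.of_forall fun a => by
      simp only [Pi.add_apply, Pi.neg_apply]
      nlinarith [sq_nonneg (e a - 1), sq_nonneg (e a + 1)])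
  have h3 := condExp_neg e (MeasurableSpace.comap X mE) (μ := cond P A)
  rw [condExp_const hX.comap_le] at hadd
  filter_upwards [h1, h2, h3, hadd, hC, hd.2.2] with a k1 k2 k3 k4 k5 k6
  rw [k4, Pi.add_apply] at k1 k2
  rw [k3, Pi.neg_apply] at k2
  rw [k6] at k1 k2
  simp only [Function.comp_apply] at k1 k2
  rw [abs_le]
  constructor <;> linarith

end CondMean

end PanelATT

/-! ### Observations, propensity scores and changes of measure -/

namespace PanelATT

section Obs

variable {E : Type*} [MeasurableSpace E] {J R : ℕ}

lemma measurable_ind (g : Fin (J + 2)) : Measurable (ind g : Obs J R E → ℝ) := by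
  unfold ind
  exact Measurable.ite ((measurable_fst.comp measurable_snd) (measurableSet_singleton g))
    measurable_const measurable_const

lemma measurable_cov : Measurable (cov : Obs J R E → E) := measurable_snd.comp measurable_snd

lemma measurable_dY : Measurable (dY : Obs J R E → ℝ) :=
  ((measurable_pi_apply _).comp measurable_fst).sub ((measurable_pi_apply _).comp measurable_fst)

lemma measurable_ratio {p : Fin (J + 2) → E → ℝ} (hp : ∀ g, Measurable (p g)) (g : Fin (J + 1)) :
    Measurable (ratio p g) := (hp 0).div (hp g.succ)

lemma measurable_phi {m : E → ℝ} {r w : Fin (J + 1) → E → ℝ} (hm : Measurable m)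
    (hr : ∀ g, Measurable (r g)) (hw : ∀ g, Measurable (w g)) (π : ℝ) :
    Measurable fun s : Obs J R E => phi s m r w π := by
  unfold phi
  refine ((measurable_const).mul ((measurable_ind 0).sub ?_)).mul
    (measurable_dY.sub (hm.comp measurable_cov))
  exact Finset.measurable_fun_sum _ fun g _ =>
    (((hw g).comp measurable_cov).mul ((hr g).comp measurable_cov)).mul (measurable_ind _)

end Obs

namespace Population

variable {Ω E : Type*} [MeasurableSpace Ω] [mE : MeasurableSpace E] {J R : ℕ}
  (pop : Population Ω E J R)

attribute [instance] Population.isProb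

lemma measurable_Y (t : Fin (R + 2)) : Measurable (pop.Y t) :=
  Measurable.ite (pop.measurable_G (measurableSet_singleton 0)) (pop.measurable_Y1 t)
    (pop.measurable_Y0 t)

lemma measurable_obs : Measurable pop.obs :=
  (measurable_pi_iff.2 pop.measurable_Y).prodMk (pop.measurable_G.prodMk pop.measurable_X)

lemma measurableSet_grp (g : Fin (J + 2)) : MeasurableSet (pop.grp g) :=
  pop.measurable_G (measurableSet_singleton g)

instance : IsProbabilityMeasure pop.FX :=
  Measure.isProbabilityMeasure_map pop.measurable_X.aemeasurable

lemma ind_obs (g : Fin (J + 2)) (a : Ω) :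
    ind g (pop.obs a) = (pop.grp g).indicator (fun _ => (1 : ℝ)) a := by
  by_cases h : pop.G a = g <;> simp [ind, obs, grp, h]

lemma cov_obs (a : Ω) : cov (pop.obs a) = pop.X a := rfl

variable {pop} {p : Fin (J + 2) → E → ℝ}

/-- Over `X ∈ B`, integrating the indicator of the group and integrating its conditional expectation
`p_g(X)` give the same value. Integrals over a group thereby become integrals against `F_X` with the
factor `p_g`. -/
lemma IsPropensity.map_restrict (hp : pop.IsPropensity p) (ho : pop.Overlap p) (g : Fin (J + 2)) :
    (pop.P.restrict (pop.grp g)).map pop.X = pop.FX.withDensity fun x => ENNReal.ofReal (p g x) := by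
  obtain ⟨hpm, hpe⟩ := hp g
  have hX := pop.measurable_X
  have hi1 : Integrable ((pop.grp g).indicator fun _ => (1 : ℝ)) pop.P :=
    (integrable_const 1).indicator (pop.measurableSet_grp g)
  have hpi : Integrable (p g ∘ pop.X) pop.P := integrable_condExp.congr hpe
  refine Measure.ext fun B hB => ?_
  rw [Measure.map_apply hX hB, withDensity_apply _ hB, Measure.restrict_apply (hX hB)]
  have h1 := setIntegral_condExp hX.comap_le hi1 (s := pop.X ⁻¹' B) ⟨B, hB, rfl⟩
  have h2 : ∫ a in pop.X ⁻¹' B, (p g ∘ pop.X) a ∂pop.P = pop.P.real (pop.X ⁻¹' B ∩ pop.grp g) := by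
    rw [← integral_congr_ae (ae_restrict_of_ae hpe), h1,
      integral_indicator (pop.measurableSet_grp g)]
    simp [Measure.restrict_restrict (pop.measurableSet_grp g), Set.inter_comm]
  have h3 : ∫⁻ x in B, ENNReal.ofReal (p g x) ∂pop.FX
      = ∫⁻ a in pop.X ⁻¹' B, ENNReal.ofReal ((p g ∘ pop.X) a) ∂pop.P := by
    rw [FX, setLIntegral_map hB hpm.ennreal_ofReal hX]
    rfl
  rw [h3, ← ofReal_integral_eq_lintegral_ofReal hpi.integrableOn, h2, ofReal_measureReal]
  exact ae_restrict_of_ae ((ae_of_ae_map hX.aemeasurable (ho g)).mono fun a ha => ha.le)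

lemma IsPropensity.lintegral_grp (hp : pop.IsPropensity p) (ho : pop.Overlap p) (g : Fin (J + 2))
    {u : E → ℝ≥0∞} (hu : Measurable u) :
    ∫⁻ a in pop.grp g, u (pop.X a) ∂pop.P = ∫⁻ x, ENNReal.ofReal (p g x) * u x ∂pop.FX := by
  rw [← lintegral_map hu pop.measurable_X, hp.map_restrict ho g,
    lintegral_withDensity_eq_lintegral_mul _ (hp g).1.ennreal_ofReal hu]
  rfl

lemma IsPropensity.ae_le_one (hp : pop.IsPropensity p) (g : Fin (J + 2)) :
    ∀ᵐ x ∂pop.FX, p g x ≤ 1 := by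
  obtain ⟨hpm, hpe⟩ := hp g
  refine (ae_map_iff pop.measurable_X.aemeasurable (measurableSet_le hpm measurable_const)).2 ?_
  have hi1 : Integrable ((pop.grp g).indicator fun _ => (1 : ℝ)) pop.P :=
    (integrable_const 1).indicator (pop.measurableSet_grp g)
  have h1 := condExp_mono (m := MeasurableSpace.comap pop.X mE) hi1 (integrable_const (1 : ℝ))
    (Eventually.of_forall fun a => Set.indicator_le_self' (fun _ _ => zero_le_one) a)
  rw [condExp_const pop.measurable_X.comap_le] at h1
  filter_upwards [h1, hpe] with a ha hb
  rw [hb] at ha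
  exact ha

lemma IsPropensity.integral_grp (hp : pop.IsPropensity p) (ho : pop.Overlap p) (g : Fin (J + 2))
    {u : E → ℝ} (hu : Measurable u) :
    ∫ a in pop.grp g, u (pop.X a) ∂pop.P = ∫ x, p g x * u x ∂pop.FX := by
  rw [← integral_map pop.measurable_X.aemeasurable hu.aestronglyMeasurable, hp.map_restrict ho g,
    integral_withDensity_eq_integral_toReal_smul (hp g).1.ennreal_ofReal
      (Eventually.of_forall fun _ => ENNReal.ofReal_lt_top)]
  refine integral_congr_ae ((ho g).mono fun x hx => ?_)
  simp [ENNReal.toReal_ofReal hx.le]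

lemma IsPropensity.integrable_grp_iff (hp : pop.IsPropensity p) (ho : pop.Overlap p)
    (g : Fin (J + 2)) {u : E → ℝ} (hu : Measurable u) :
    Integrable (fun a => u (pop.X a)) (pop.P.restrict (pop.grp g)) ↔
      Integrable (fun x => p g x * u x) pop.FX := by
  have h1 := integrable_map_measure (μ := pop.P.restrict (pop.grp g)) (f := pop.X)
    hu.aestronglyMeasurable pop.measurable_X.aemeasurable
  rw [hp.map_restrict ho g] at h1
  refine h1.symm.trans ((integrable_withDensity_iff_integrable_smul' (hp g).1.ennreal_ofReal
      (Eventually.of_forall fun _ => ENNReal.ofReal_lt_top)).trans (integrable_congr ?_))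
  refine (ho g).mono fun x hx => ?_
  simp [ENNReal.toReal_ofReal hx.le]

/-- The probability of the group is the `F_X`-integral of a function that is positive almost
everywhere. -/
lemma IsPropensity.measure_grp_ne_zero (hp : pop.IsPropensity p) (ho : pop.Overlap p)
    (g : Fin (J + 2)) : pop.P (pop.grp g) ≠ 0 := by
  have h := hp.lintegral_grp ho g (u := fun _ => 1) measurable_const
  simp only [lintegral_const, mul_one, one_mul, Measure.restrict_apply_univ] at h
  rw [h]
  intro h0
  rw [lintegral_eq_zero_iff (hp g).1.ennreal_ofReal] at h0
  have h2 : ∀ᵐ _ ∂pop.FX, False := by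
    filter_upwards [h0, ho g] with x hx hx'
    simp only [Pi.zero_apply, ENNReal.ofReal_eq_zero] at hx
    linarith
  simp only [eventually_const] at h2

/-- Since `p_g > 0` almost everywhere, `F_X` and the law of `X` in group `g` have the same null
sets. This transfers almost sure statements from one group to all covariates, and hence to every
other group. -/
lemma IsPropensity.ae_cond_grp_iff (hp : pop.IsPropensity p) (ho : pop.Overlap p)
    (g : Fin (J + 2)) {q : E → Prop} (hq : MeasurableSet {x | q x}) :
    (∀ᵐ a ∂(cond pop.P (pop.grp g)), q (pop.X a)) ↔ ∀ᵐ x ∂pop.FX, q x := by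
  rw [ae_cond_iff, ← ae_map_iff pop.measurable_X.aemeasurable hq, hp.map_restrict ho g,
    ae_withDensity_iff (hp g).1.ennreal_ofReal]
  constructor
  · intro h
    filter_upwards [h, ho g] with x h1 h2
    exact h1 (by simpa using h2)
  · intro h
    filter_upwards [h] with x h1 _ using h1

lemma ae_cond_grp_of_ae {q : E → Prop} (g : Fin (J + 2)) (h : ∀ᵐ x ∂pop.FX, q x) :
    ∀ᵐ a ∂(cond pop.P (pop.grp g)), q (pop.X a) :=
  ae_cond_iff.2 (ae_restrict_of_ae (ae_of_ae_map pop.measurable_X.aemeasurable h))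

lemma pi1_pos (hp : pop.IsPropensity p) (ho : pop.Overlap p) : 0 < pop.pi1 :=
  ENNReal.toReal_pos (hp.measure_grp_ne_zero ho 0) (measure_ne_top _ _)

end Population

end PanelATT

/-! ### Conditional moments of indicators and residuals -/

namespace PanelATT

/-- `E[z(S) | X] = ζ(X)` is bounded, and so is `E[z(S)² | X]`, when `S` has distribution `μ`. -/
structure HasCondMoment {E : Type*} [MeasurableSpace E] {J R : ℕ} (μ : Measure (Obs J R E))
    (FX : Measure E) (z : Obs J R E → ℝ) (ζ : E → ℝ) : Prop where
  measurable : Measurable z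
  measurable_mean : Measurable ζ
  bounded : ∃ C : ℝ, ∀ᵐ x ∂FX, |ζ x| ≤ C
  sq : ∃ C : ℝ≥0∞, C ≠ ∞ ∧ ∀ u : E → ℝ≥0∞, Measurable u →
    ∫⁻ s, u (cov s) * ‖z s‖ₑ ^ 2 ∂μ ≤ C * ∫⁻ x, u x ∂FX
  mean : ∀ u : E → ℝ, Measurable u → MemLp u 2 FX → ∫ s, u (cov s) * z s ∂μ = ∫ x, u x * ζ x ∂FX

lemma eLpNorm_two_sq {A : Type*} [MeasurableSpace A] (μ : Measure A) (f : A → ℝ) :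
    eLpNorm f 2 μ ^ 2 = ∫⁻ x, ‖f x‖ₑ ^ 2 ∂μ := by
  rw [eLpNorm_eq_lintegral_rpow_enorm_toReal two_ne_zero ENNReal.ofNat_ne_top]
  simp only [ENNReal.toReal_ofNat, one_div]
  rw [← ENNReal.rpow_natCast, ← ENNReal.rpow_mul]
  norm_num

lemma memLp_two_of_lintegral {A : Type*} [MeasurableSpace A] {μ : Measure A} {f : A → ℝ}
    (hf : Measurable f) (h : ∫⁻ x, ‖f x‖ₑ ^ 2 ∂μ ≠ ∞) : MemLp f 2 μ := by
  refine ⟨hf.aestronglyMeasurable, lt_top_iff_ne_top.2 fun h' => h ?_⟩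
  rw [← eLpNorm_two_sq, h']
  simp

lemma HasCondMoment.memLp {E : Type*} [MeasurableSpace E] {J R : ℕ} {μ : Measure (Obs J R E)}
    {FX : Measure E} {z : Obs J R E → ℝ} {ζ : E → ℝ} (h : HasCondMoment μ FX z ζ)
    {u : E → ℝ} (hu : Measurable u) (hu2 : MemLp u 2 FX) :
    MemLp (fun s => u (cov s) * z s) 2 μ := by
  obtain ⟨C, hC, hz⟩ := h.sq
  refine memLp_two_of_lintegral ((hu.comp measurable_cov).mul h.measurable) ?_
  have h1 := hz (fun x => ‖u x‖ₑ ^ 2) (hu.enorm.pow_const 2)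
  simp only [enorm_mul, mul_pow]
  refine ne_top_of_le_ne_top (ENNReal.mul_ne_top hC ?_) h1
  rw [← eLpNorm_two_sq]
  exact ENNReal.pow_ne_top hu2.2.ne

section Indicators

variable {E : Type*} {J R : ℕ}

lemma enorm_ind_sq (g : Fin (J + 2)) (s : Obs J R E) : ‖ind g s‖ₑ ^ 2 = ‖ind g s‖ₑ := by
  by_cases h : s.2.1 = g <;> simp [ind, h]

end Indicators

namespace Population

variable {Ω E : Type*} [MeasurableSpace Ω] [mE : MeasurableSpace E] {J R : ℕ}
  (pop : Population Ω E J R)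

/-- The distribution of the observed variable. -/
noncomputable def law : Measure (Obs J R E) := pop.P.map pop.obs

instance : IsProbabilityMeasure pop.law :=
  Measure.isProbabilityMeasure_map pop.measurable_obs.aemeasurable

variable {pop} {p : Fin (J + 2) → E → ℝ}

lemma lintegral_law {F : Obs J R E → ℝ≥0∞} (hF : Measurable F) :
    ∫⁻ s, F s ∂pop.law = ∫⁻ a, F (pop.obs a) ∂pop.P := lintegral_map hF pop.measurable_obs

lemma integral_law {F : Obs J R E → ℝ} (hF : Measurable F) :
    ∫ s, F s ∂pop.law = ∫ a, F (pop.obs a) ∂pop.P :=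
  integral_map pop.measurable_obs.aemeasurable hF.aestronglyMeasurable

lemma ae_law_of_ae {q : E → Prop} (h : ∀ᵐ x ∂pop.FX, q x) : ∀ᵐ s ∂pop.law, q (cov s) := by
  have h1 : pop.FX = pop.law.map cov := by
    rw [law, Measure.map_map measurable_cov pop.measurable_obs]; rfl
  rw [h1] at h
  exact ae_of_ae_map measurable_cov.aemeasurable h

lemma integral_ind_mul (g : Fin (J + 2)) (F : Ω → ℝ) :
    ∫ a, ind g (pop.obs a) * F a ∂pop.P = ∫ a in pop.grp g, F a ∂pop.P := by
  rw [← integral_indicator (pop.measurableSet_grp g)]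
  refine integral_congr_ae (Eventually.of_forall fun a => ?_)
  simp only [ind_obs]
  by_cases h : a ∈ pop.grp g <;> simp [h]

lemma lintegral_ind_mul (g : Fin (J + 2)) (F : Ω → ℝ≥0∞) :
    ∫⁻ a, ‖ind g (pop.obs a)‖ₑ * F a ∂pop.P = ∫⁻ a in pop.grp g, F a ∂pop.P := by
  rw [← lintegral_indicator (pop.measurableSet_grp g)]
  refine lintegral_congr fun a => ?_
  simp only [ind_obs]
  by_cases h : a ∈ pop.grp g <;> simp [h]

lemma integrable_ind_mul (g : Fin (J + 2)) {F : Ω → ℝ} :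
    Integrable (fun a => ind g (pop.obs a) * F a) pop.P ↔
      Integrable F (pop.P.restrict (pop.grp g)) := by
  rw [← IntegrableOn, ← integrable_indicator_iff (pop.measurableSet_grp g)]
  refine integrable_congr (Eventually.of_forall fun a => ?_)
  simp only [ind_obs]
  by_cases h : a ∈ pop.grp g <;> simp [h]

lemma lintegral_grp_le (hp : pop.IsPropensity p) (ho : pop.Overlap p) (g : Fin (J + 2))
    {u : E → ℝ≥0∞} (hu : Measurable u) :
    ∫⁻ a in pop.grp g, u (pop.X a) ∂pop.P ≤ ∫⁻ x, u x ∂pop.FX := by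
  rw [hp.lintegral_grp ho g hu]
  refine lintegral_mono_ae ?_
  filter_upwards [hp.ae_le_one g] with x hx
  calc ENNReal.ofReal (p g x) * u x ≤ 1 * u x := by
        gcongr
        exact ENNReal.ofReal_le_one.2 hx
    _ = u x := one_mul _

/-- An indicator equals its square, and its conditional mean `p_g` is at most one. -/
lemma hasCondMoment_ind (hp : pop.IsPropensity p) (ho : pop.Overlap p) (g : Fin (J + 2)) :
    HasCondMoment pop.law pop.FX (ind g) (p g) where
  measurable := measurable_ind g
  measurable_mean := (hp g).1
  bounded := ⟨1, by
    filter_upwards [hp.ae_le_one g, ho g] with x h1 h2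
    rw [abs_of_pos h2]; exact h1⟩
  sq := ⟨1, ENNReal.one_ne_top, fun u hu => by
    have hF : Measurable fun s : Obs J R E => u (cov s) * ‖ind g s‖ₑ ^ 2 :=
      (hu.comp measurable_cov).mul ((measurable_ind g).enorm.pow_const 2)
    rw [one_mul, lintegral_law hF]
    simp only [enorm_ind_sq, mul_comm (u _)]
    rw [lintegral_ind_mul]
    exact lintegral_grp_le hp ho g hu⟩
  mean u hu _ := by
    have hF : Measurable fun s : Obs J R E => u (cov s) * ind g s :=
      (hu.comp measurable_cov).mul (measurable_ind g)
    rw [integral_law hF]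
    simp only [mul_comm (u _)]
    rw [integral_ind_mul]
    exact hp.integral_grp ho g hu

/-- Second moments of the residual in a group, given the covariate. -/
lemma BoundedMoments.sq_resid {m : E → ℝ} {ω : Fin (J + 1) → E → ℝ}
    (hB : pop.BoundedMoments m p ω) (hp : pop.IsPropensity p) (ho : pop.Overlap p)
    (hm : Measurable m) (g : Fin (J + 2)) :
    ∃ C : ℝ≥0∞, C ≠ ∞ ∧ ∀ u : E → ℝ≥0∞, Measurable u →
      ∫⁻ s, u (cov s) * ‖ind g s * (dY s - m (cov s))‖ₑ ^ 2 ∂pop.law ≤ C * ∫⁻ x, u x ∂pop.FX := by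
  obtain ⟨he, C, hC⟩ := hB.1 g
  have hem : Measurable fun s : Obs J R E => dY s - m (cov s) :=
    measurable_dY.sub (hm.comp measurable_cov)
  refine ⟨ENNReal.ofReal C, ENNReal.ofReal_ne_top, fun u hu => ?_⟩
  have hF : Measurable fun s : Obs J R E => u (cov s) * ‖ind g s * (dY s - m (cov s))‖ₑ ^ 2 :=
    (hu.comp measurable_cov).mul (((measurable_ind g).mul hem).enorm.pow_const 2)
  rw [lintegral_law hF]
  simp only [enorm_mul, mul_pow, enorm_ind_sq, mul_left_comm (u _)]
  rw [lintegral_ind_mul]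
  refine (lintegral_mul_sq_le_of_condExp_le pop.measurable_X (hp.measure_grp_ne_zero ho g) he hC hu
    (hem.comp pop.measurable_obs)).trans ?_
  gcongr
  exact lintegral_grp_le hp ho g hu

/-- The conditional mean over the whole population is the within-group mean `d` times the
probability `p_g` of the group. It is bounded because the conditional second moment within the group
is. -/
lemma hasCondMoment_resid {m : E → ℝ} {ω : Fin (J + 1) → E → ℝ}
    (hB : pop.BoundedMoments m p ω) (hp : pop.IsPropensity p) (ho : pop.Overlap p)
    (hm : Measurable m) (g : Fin (J + 2)) {d : E → ℝ}
    (hd : IsCondMean pop.P pop.X (pop.grp g) (fun a => dY (pop.obs a) - m (pop.X a)) d) :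
    HasCondMoment pop.law pop.FX (fun s => ind g s * (dY s - m (cov s))) (fun x => p g x * d x) where
  measurable := (measurable_ind g).mul (measurable_dY.sub (hm.comp measurable_cov))
  measurable_mean := (hp g).1.mul hd.1
  bounded := by
    obtain ⟨he, C, hC⟩ := hB.1 g
    have h1 := hd.ae_abs_le (hp.measure_grp_ne_zero ho g) he pop.measurable_X hC
    have h2 := (hp.ae_cond_grp_iff ho g (q := fun x => |d x| ≤ 1 + C)
      (measurableSet_le hd.1.abs measurable_const)).1 h1
    refine ⟨1 + C, ?_⟩
    filter_upwards [h2, hp.ae_le_one g, ho g] with x k1 k2 k3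
    rw [abs_mul, abs_of_pos k3]
    nlinarith [abs_nonneg (d x)]
  sq := hB.sq_resid hp ho hm g
  mean u hu hu2 := by
    have hem : Measurable fun s : Obs J R E => dY s - m (cov s) :=
      measurable_dY.sub (hm.comp measurable_cov)
    obtain ⟨C, hC, hz⟩ := hB.sq_resid hp ho hm g
    have hL2 : MemLp (fun s : Obs J R E => u (cov s) * (ind g s * (dY s - m (cov s)))) 2 pop.law := by
      refine memLp_two_of_lintegral ((hu.comp measurable_cov).mul ((measurable_ind g).mul hem)) ?_
      have h1 := hz (fun x => ‖u x‖ₑ ^ 2) (hu.enorm.pow_const 2)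
      simp only [enorm_mul, mul_pow] at h1 ⊢
      refine ne_top_of_le_ne_top (ENNReal.mul_ne_top hC ?_) h1
      rw [← eLpNorm_two_sq]
      exact ENNReal.pow_ne_top hu2.2.ne
    have hint : Integrable (fun a => ind g (pop.obs a) * (u (pop.X a) *
        (dY (pop.obs a) - m (pop.X a)))) pop.P := by
      have h2 := (integrable_map_measure hL2.aestronglyMeasurable
        pop.measurable_obs.aemeasurable).1 (hL2.integrable one_le_two)
      refine h2.congr (Eventually.of_forall fun a => ?_)
      simp only [Function.comp_apply, cov_obs]
      ring
    have hF : Measurable fun s : Obs J R E => u (cov s) * (ind g s * (dY s - m (cov s))) :=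
      (hu.comp measurable_cov).mul ((measurable_ind g).mul hem)
    rw [integral_law hF]
    simp only [mul_left_comm (u _)]
    rw [integral_ind_mul]
    simp only [cov_obs]
    rw [(hd.setIntegral_mul pop.measurable_X (hp.measure_grp_ne_zero ho g) hu
      (integrable_ind_mul g |>.1 hint)).2]
    rw [hp.integral_grp ho g (u := fun x => u x * d x) (hu.mul hd.1)]

end Population

end PanelATT

/-! ### Fold sums with multipliers -/

namespace PanelATT

/-- An iid sample with distribution `μ` together with iid multipliers with distribution `ν`. -/
structure IsWeightedSample {Ω A : Type*} [MeasurableSpace Ω] [MeasurableSpace A] (Pr : Measure Ω)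
    (μ : Measure A) (ν : Measure ℝ) (S : ℕ → Ω → A) (V : ℕ → Ω → ℝ) : Prop where
  measurable_fst : ∀ i, Measurable (S i)
  measurable_snd : ∀ i, Measurable (V i)
  indep : iIndepFun (withWeights S V) Pr
  map_eq : ∀ i, Pr.map (withWeights S V i) = μ.prod ν
  memLp : MemLp (fun v => v) 2 ν
  mean : ∫ v, v ∂ν = 1

lemma IsWeightedSample.measurable {Ω A : Type*} [MeasurableSpace Ω] [MeasurableSpace A]
    {Pr : Measure Ω} {μ : Measure A} {ν : Measure ℝ} {S : ℕ → Ω → A} {V : ℕ → Ω → ℝ}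
    (hD : IsWeightedSample Pr μ ν S V) (i : ℕ) : Measurable (withWeights S V i) :=
  (hD.measurable_fst i).prodMk (hD.measurable_snd i)

section FoldSums

variable {Ω E : Type*} [MeasurableSpace Ω] [MeasurableSpace E] {J R L : ℕ} {Pr : Measure Ω}
  [IsProbabilityMeasure Pr] {fold : FoldMap L} {μ : Measure (Obs J R E)} [IsProbabilityMeasure μ]
  {ν : Measure ℝ} [IsProbabilityMeasure ν] {FX : Measure E}
  {S : ℕ → Ω → Obs J R E} {V : ℕ → Ω → ℝ}

lemma natCast_mul_enorm_inv_sqrt_sq_le (hL : 0 < L) (k : ℕ) :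
    (k : ℝ≥0∞) * ‖(√((L * k : ℕ) : ℝ))⁻¹‖ₑ ^ 2 ≤ 1 := by
  rw [← enorm_pow, inv_pow, Real.sq_sqrt (Nat.cast_nonneg _),
    Real.enorm_eq_ofReal (by positivity), ← ENNReal.ofReal_natCast,
    ← ENNReal.ofReal_mul (by positivity)]
  refine ENNReal.ofReal_le_one.2 ?_
  rw [← div_eq_mul_inv]
  refine div_le_one_of_le₀ ?_ (by positivity)
  push_cast
  have : (1 : ℝ) ≤ L := by exact_mod_cast hL
  nlinarith [(Nat.cast_nonneg k : (0 : ℝ) ≤ k)]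

lemma natCast_mul_enorm_inv_sqrt_le (hL : 0 < L) (k : ℕ) :
    (k : ℝ≥0∞) * ‖(√((L * k : ℕ) : ℝ))⁻¹‖ₑ ≤ ENNReal.ofReal (√((L * k : ℕ) : ℝ)) := by
  rw [Real.enorm_eq_ofReal (by positivity), ← ENNReal.ofReal_natCast,
    ← ENNReal.ofReal_mul (by positivity)]
  refine ENNReal.ofReal_le_ofReal ?_
  have h1 : (k : ℝ) ≤ ((L * k : ℕ) : ℝ) := by
    push_cast
    have : (1 : ℝ) ≤ L := by exact_mod_cast hL
    nlinarith [(Nat.cast_nonneg k : (0 : ℝ) ≤ k)]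
  rw [← div_eq_mul_inv]
  refine (div_le_div_of_nonneg_right h1 (Real.sqrt_nonneg _)).trans ?_
  rw [Real.div_sqrt]

/-- Given the training data, the variance of the normalized fold sum is at most a constant times `(k
/ n) ‖b̂‖²`, which is `o_p(1)`. The conditional mean is subtracted explicitly because it need not be
small: it is what later cancels between terms or forms the bias. -/
lemma smallProb_fold_sum_moment (hL : 0 < L) (hD : IsWeightedSample Pr μ ν S V)
    (hfold : fold.Balanced) (ℓ : Fin L) {b : Estimator fold (Obs J R E × ℝ) E} (hb : b.IsMeas)
    {z : Obs J R E → ℝ} {ζ : E → ℝ} (hz : HasCondMoment μ FX z ζ)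
    (h : SmallProb Pr fun k η => eLpNorm (b.eval (withWeights S V) k ℓ η) 2 FX) :
    SmallProb Pr fun k η => ‖(√((L * k : ℕ) : ℝ))⁻¹ * ∑ i : Fin (L * k) with fold k i = ℓ,
        V i η * (b.eval (withWeights S V) k ℓ η (cov (S i η)) * z (S i η)) -
      (√((L * k : ℕ) : ℝ))⁻¹ * (k * ∫ x, b.eval (withWeights S V) k ℓ η x * ζ x ∂FX)‖ₑ := by
  obtain ⟨C, hC, hzC⟩ := hz.sq
  let F : ∀ k, (Train fold k ℓ → Obs J R E × ℝ) → Obs J R E × ℝ → ℝ := fun k d y =>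
    (√((L * k : ℕ) : ℝ))⁻¹ * (b k ℓ d (cov y.1) * z y.1 * y.2)
  have hF : ∀ k, Measurable (Function.uncurry (F k)) := fun k => by
    refine measurable_const.mul (Measurable.mul (Measurable.mul ?_ ?_) ?_)
    · exact (hb k ℓ).comp (measurable_fst.prodMk
        (measurable_cov.comp (measurable_fst.comp measurable_snd)))
    · exact hz.measurable.comp (measurable_fst.comp measurable_snd)
    · exact measurable_snd.comp measurable_snd
  have hbm : ∀ k η, Measurable (b.eval (withWeights S V) k ℓ η) := fun k η =>
    (hb k ℓ).comp measurable_prodMk_left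
  have hmain := smallProb_fold_sum_sub hD.measurable hD.indep hD.map_eq hfold ℓ hF (by
    have hc : C * ∫⁻ v, ‖v‖ₑ ^ 2 ∂ν ≠ ∞ := by
      refine ENNReal.mul_ne_top hC ?_
      rw [← eLpNorm_two_sq ν (fun v => v)]
      exact ENNReal.pow_ne_top hD.memLp.2.ne
    refine (h.sq.const_mul hc).mono fun k η => ?_
    have e : ∀ y : Obs J R E × ℝ, ‖F k (trainData fold (withWeights S V) k ℓ η) y‖ₑ ^ 2 =
        ‖(√((L * k : ℕ) : ℝ))⁻¹‖ₑ ^ 2 * ((‖b.eval (withWeights S V) k ℓ η (cov y.1)‖ₑ ^ 2 *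
          ‖z y.1‖ₑ ^ 2) * ‖y.2‖ₑ ^ 2) := by
      intro y
      simp only [F, enorm_mul, mul_pow]
      rfl
    have hm1 : Measurable fun s : Obs J R E =>
        ‖b.eval (withWeights S V) k ℓ η (cov s)‖ₑ ^ 2 * ‖z s‖ₑ ^ 2 :=
      (((hbm k η).comp measurable_cov).enorm.pow_const 2).mul (hz.measurable.enorm.pow_const 2)
    have hm2 : Measurable fun v : ℝ => ‖v‖ₑ ^ 2 := measurable_enorm.pow_const 2
    have hm3 : Measurable fun y : Obs J R E × ℝ =>
        (‖b.eval (withWeights S V) k ℓ η (cov y.1)‖ₑ ^ 2 * ‖z y.1‖ₑ ^ 2) * ‖y.2‖ₑ ^ 2 :=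
      (hm1.comp measurable_fst).mul (hm2.comp measurable_snd)
    simp only [e]
    rw [lintegral_const_mul _ hm3,
      lintegral_prod_mul hm1.aemeasurable hm2.aemeasurable, ← mul_assoc, eLpNorm_two_sq]
    refine (mul_le_mul' (natCast_mul_enorm_inv_sqrt_sq_le hL k) (mul_le_mul_left
      (hzC _ ((hbm k η).enorm.pow_const 2)) _)).trans (le_of_eq ?_)
    ring)
  -- The conditional mean is identified only where `b̂` has finite `L²` norm; elsewhere the moment
  -- property gives no information.
  refine hmain.mono_event h.ne_top (Eventually.of_forall fun k η hη => le_of_eq ?_)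
  have hη2 : MemLp (b.eval (withWeights S V) k ℓ η) 2 FX :=
    ⟨(hbm k η).aestronglyMeasurable, lt_top_iff_ne_top.2 hη⟩
  have hmean : ∫ y, F k (trainData fold (withWeights S V) k ℓ η) y ∂(μ.prod ν)
      = (√((L * k : ℕ) : ℝ))⁻¹ * ∫ x, b.eval (withWeights S V) k ℓ η x * ζ x ∂FX := by
    rw [← hz.mean _ (hbm k η) hη2]
    have e : ∀ y : Obs J R E × ℝ, F k (trainData fold (withWeights S V) k ℓ η) y =
        (√((L * k : ℕ) : ℝ))⁻¹ * ((b.eval (withWeights S V) k ℓ η (cov y.1) * z y.1) * y.2) :=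
      fun y => rfl
    simp only [e]
    rw [integral_const_mul, integral_prod_mul
      (fun s => b.eval (withWeights S V) k ℓ η (cov s) * z s) (fun v => v), hD.mean, mul_one]
  rw [Finset.sum_sub_distrib, hmean, Finset.sum_const, hfold k ℓ, nsmul_eq_mul, Finset.mul_sum]
  congr 1
  have e2 : ∀ i : Fin (L * k), F k (trainData fold (withWeights S V) k ℓ η) (withWeights S V i η) =
      (√((L * k : ℕ) : ℝ))⁻¹ *
        (V i η * (b.eval (withWeights S V) k ℓ η (cov (S i η)) * z (S i η))) := by
    intro i
    simp only [F, withWeights]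
    rw [mul_comm (V i η)]
    rfl
  simp only [e2]
  ring

/-- For second-order terms no centring is needed: the sum of absolute values has conditional mean at
most a constant times `√n ‖b̂‖_1`. -/
lemma smallProb_fold_sum_abs (hL : 0 < L) (hD : IsWeightedSample Pr μ ν S V)
    (hfold : fold.Balanced) (ℓ : Fin L) {b : Estimator fold (Obs J R E × ℝ) E} (hb : b.IsMeas)
    {z : Obs J R E → ℝ} (hz : Measurable z) {C : ℝ≥0∞} (hC : C ≠ ∞)
    (hzC : ∀ u : E → ℝ≥0∞, Measurable u → ∫⁻ s, u (cov s) * ‖z s‖ₑ ∂μ ≤ C * ∫⁻ x, u x ∂FX)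
    (h : SmallProb Pr fun k η => ENNReal.ofReal (√((L * k : ℕ) : ℝ)) *
      ∫⁻ x, ‖b.eval (withWeights S V) k ℓ η x‖ₑ ∂FX) :
    SmallProb Pr fun k η => ‖(√((L * k : ℕ) : ℝ))⁻¹ * ∑ i : Fin (L * k) with fold k i = ℓ,
        V i η * (b.eval (withWeights S V) k ℓ η (cov (S i η)) * z (S i η))‖ₑ := by
  let G : ∀ k, (Train fold k ℓ → Obs J R E × ℝ) → Obs J R E × ℝ → ℝ≥0∞ := fun k d y =>
    ‖(√((L * k : ℕ) : ℝ))⁻¹‖ₑ * ((‖b k ℓ d (cov y.1)‖ₑ * ‖z y.1‖ₑ) * ‖y.2‖ₑ)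
  have hG : ∀ k, Measurable (Function.uncurry (G k)) := fun k => by
    have h1 : Measurable fun q : (Train fold k ℓ → Obs J R E × ℝ) × Obs J R E × ℝ =>
        ‖b k ℓ q.1 (cov q.2.1)‖ₑ := ((hb k ℓ).comp (measurable_fst.prodMk
          (measurable_cov.comp (measurable_fst.comp measurable_snd)))).enorm
    have h2 : Measurable fun q : (Train fold k ℓ → Obs J R E × ℝ) × Obs J R E × ℝ => ‖z q.2.1‖ₑ :=
      (hz.comp (measurable_fst.comp measurable_snd)).enorm
    have h3 : Measurable fun q : (Train fold k ℓ → Obs J R E × ℝ) × Obs J R E × ℝ => ‖q.2.2‖ₑ :=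
      (measurable_snd.comp measurable_snd).enorm
    exact ((h1.mul h2).mul h3).const_mul _
  have hbm : ∀ k η, Measurable (b.eval (withWeights S V) k ℓ η) := fun k η =>
    (hb k ℓ).comp measurable_prodMk_left
  refine (smallProb_fold_sum hD.measurable hD.indep hD.map_eq hfold ℓ hG ?_).mono fun k η => ?_
  · have hc : C * ∫⁻ v, ‖v‖ₑ ∂ν ≠ ∞ := by
      refine ENNReal.mul_ne_top hC ?_
      exact (hD.memLp.integrable one_le_two).2.ne
    refine (h.const_mul hc).mono fun k η => ?_
    have hm1 : Measurable fun s : Obs J R E =>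
        ‖b.eval (withWeights S V) k ℓ η (cov s)‖ₑ * ‖z s‖ₑ :=
      ((hbm k η).comp measurable_cov).enorm.mul hz.enorm
    have e : ∀ y : Obs J R E × ℝ, G k (trainData fold (withWeights S V) k ℓ η) y =
        ‖(√((L * k : ℕ) : ℝ))⁻¹‖ₑ * ((‖b.eval (withWeights S V) k ℓ η (cov y.1)‖ₑ *
          ‖z y.1‖ₑ) * ‖y.2‖ₑ) := fun y => rfl
    have hm3 : Measurable fun y : Obs J R E × ℝ =>
        (‖b.eval (withWeights S V) k ℓ η (cov y.1)‖ₑ * ‖z y.1‖ₑ) * ‖y.2‖ₑ :=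
      (hm1.comp measurable_fst).mul measurable_snd.enorm
    simp only [e]
    rw [lintegral_const_mul _ hm3,
      lintegral_prod_mul hm1.aemeasurable measurable_enorm.aemeasurable, ← mul_assoc]
    refine (mul_le_mul' (natCast_mul_enorm_inv_sqrt_le hL k) (mul_le_mul_left
      (hzC _ (hbm k η).enorm) _)).trans (le_of_eq ?_)
    ring
  · rw [Finset.mul_sum]
    refine (enorm_sum_le _ _).trans (Finset.sum_le_sum fun i _ => le_of_eq ?_)
    simp only [G, enorm_mul, withWeights]
    rw [mul_comm (‖V i η‖ₑ)]
    rfl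

end FoldSums

end PanelATT

/-! ### Expansion of the moment function in its nuisance functions -/

namespace PanelATT

lemma eLpNorm_mul_le_top_mul_two {A : Type*} [MeasurableSpace A] {μ : Measure A} {u v : A → ℝ}
    (hv : Measurable v) :
    eLpNorm (fun x => u x * v x) 2 μ ≤ eLpNorm u ∞ μ * eLpNorm v 2 μ := by
  simpa using eLpNorm_le_eLpNorm_top_mul_eLpNorm 2 u hv.aestronglyMeasurable (· * ·) 1
    (Eventually.of_forall fun x => by simp)

lemma eLpNorm_top_le_of_abs_le {A : Type*} [MeasurableSpace A] {μ : Measure A} {u : A → ℝ} {C : ℝ}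
    (h : ∀ᵐ x ∂μ, |u x| ≤ C) : eLpNorm u ∞ μ ≤ ENNReal.ofReal C := by
  rw [eLpNorm_exponent_top]
  exact eLpNormEssSup_le_of_ae_bound h

lemma lintegral_mul_le_two_mul_two {A : Type*} [MeasurableSpace A] {μ : Measure A} {u v : A → ℝ}
    (hu : Measurable u) (hv : Measurable v) :
    ∫⁻ x, ‖u x * v x‖ₑ ∂μ ≤ eLpNorm u 2 μ * eLpNorm v 2 μ := by
  rw [← eLpNorm_one_eq_lintegral_enorm]
  have h : eLpNorm (u • v) 1 μ ≤ eLpNorm u 2 μ * eLpNorm v 2 μ :=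
    eLpNorm_smul_le_mul_eLpNorm hv.aestronglyMeasurable hu.aestronglyMeasurable
  exact h

lemma lintegral_mul_le_top_mul {A : Type*} [MeasurableSpace A] {μ : Measure A} {u v : A → ℝ}
    (hv : Measurable v) :
    ∫⁻ x, ‖u x * v x‖ₑ ∂μ ≤ eLpNorm u ∞ μ * ∫⁻ x, ‖v x‖ₑ ∂μ := by
  rw [← eLpNorm_one_eq_lintegral_enorm, ← eLpNorm_one_eq_lintegral_enorm]
  simpa using eLpNorm_le_eLpNorm_top_mul_eLpNorm 1 u hv.aestronglyMeasurable (· * ·) 1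
    (Eventually.of_forall fun x => by simp)

lemma tendsto_measure_iUnion {Ω ι : Type*} [MeasurableSpace Ω] [Fintype ι] {Pr : Measure Ω}
    {B : ι → ℕ → Set Ω} (h : ∀ i, Tendsto (fun k => Pr (B i k)) atTop (𝓝 0)) :
    Tendsto (fun k => Pr (⋃ i, B i k)) atTop (𝓝 0) := by
  refine tendsto_of_tendsto_of_tendsto_of_le_of_le tendsto_const_nhds
    (h := fun k => ∑ i, Pr (B i k)) ?_ (fun _ => zero_le) fun k => measure_iUnion_fintype_le _ _
  simpa using tendsto_finsetSum Finset.univ fun i _ => h i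

section Expansion

variable {Ω E : Type*} [MeasurableSpace Ω] [MeasurableSpace E] {J R L : ℕ} {Pr : Measure Ω}
  [IsProbabilityMeasure Pr] {fold : FoldMap L} {μ : Measure (Obs J R E)} [IsProbabilityMeasure μ]
  {ν : Measure ℝ} [IsProbabilityMeasure ν] {FX : Measure E} [IsProbabilityMeasure FX]
  {S : ℕ → Ω → Obs J R E} {V : ℕ → Ω → ℝ}

/-- An exact identity, arranged by what happens given the training data: the first sum carries the
bias, the next two terms have conditional means that cancel when the new weights sum to one, and the
last sum is a product of two errors. -/
lemma phi_sub_phi (s : Obs J R E) (m m' : E → ℝ) (r r' w w' : Fin (J + 1) → E → ℝ) :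
    phi s m' r' w' 1 - phi s m r w 1 =
      -(∑ g : Fin (J + 1), (w' g (cov s) * r' g (cov s) - w g (cov s) * r g (cov s)) *
          (ind g.succ s * (dY s - m (cov s))))
        - (m' (cov s) - m (cov s)) * ind 0 s
        + ∑ g : Fin (J + 1), w' g (cov s) * (r g (cov s) * (m' (cov s) - m (cov s))) * ind g.succ s
        + ∑ g : Fin (J + 1), w' g (cov s) * ((r' g (cov s) - r g (cov s)) *
          (m' (cov s) - m (cov s))) * ind g.succ s := by
  have h1 : ∀ (c : Fin (J + 1) → ℝ), ∑ g : Fin (J + 1), c g * (ind g.succ s * (dY s - m (cov s))) =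
      (∑ g : Fin (J + 1), c g * ind g.succ s) * (dY s - m (cov s)) := by
    intro c
    rw [Finset.sum_mul]
    exact Finset.sum_congr rfl fun g _ => by ring
  have h2 : ∀ (c : Fin (J + 1) → ℝ), ∑ g : Fin (J + 1),
      w' g (cov s) * (c g * (m' (cov s) - m (cov s))) * ind g.succ s =
      (∑ g : Fin (J + 1), w' g (cov s) * c g * ind g.succ s) * (m' (cov s) - m (cov s)) := by
    intro c
    rw [Finset.sum_mul]
    exact Finset.sum_congr rfl fun g _ => by ring
  rw [h1, h2 (fun g => r g (cov s)), h2 (fun g => r' g (cov s) - r g (cov s))]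
  simp only [phi, sub_mul, mul_sub, Finset.sum_sub_distrib]
  ring

/-- The effect of estimating the nuisance functions on the sum of the moment functions over a
fold. -/
lemma smallProb_fold_sum_phi (hL : 0 < L) (hD : IsWeightedSample Pr μ ν S V)
    (hfold : fold.Balanced) {p : Fin (J + 2) → E → ℝ} {m : E → ℝ} {ω d : Fin (J + 1) → E → ℝ}
    (hind : ∀ g, HasCondMoment μ FX (ind g) (p g)) (hp : ∀ g, ∀ᵐ x ∂FX, 0 < p g x)
    (hres : ∀ g : Fin (J + 1), HasCondMoment μ FX (fun s => ind g.succ s * (dY s - m (cov s)))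
      fun x => p g.succ x * d g x)
    (hm : Measurable m) (hω : ∀ g, Measurable (ω g))
    (hr : ∀ g, ∃ C : ℝ, ∀ᵐ x ∂FX, |ratio p g x| ≤ C)
    {mE : Estimator fold (Obs J R E × ℝ) E} {rE wE : Fin (J + 1) → Estimator fold (Obs J R E × ℝ) E}
    (hmE : mE.IsMeas) (hrE : ∀ g, (rE g).IsMeas) (hwE : ∀ g, (wE g).IsMeas)
    (hF : FirstStage Pr FX m (ratio p) ω (mE.eval (withWeights S V))
      (fun g => (rE g).eval (withWeights S V)) (fun g => (wE g).eval (withWeights S V)))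
    (ℓ : Fin L) :
    SmallProb Pr fun k η => ‖(√((L * k : ℕ) : ℝ))⁻¹ * ∑ i : Fin (L * k) with fold k i = ℓ,
        V i η * (phi (S i η) (mE.eval (withWeights S V) k ℓ η)
            (fun g => (rE g).eval (withWeights S V) k ℓ η)
            (fun g => (wE g).eval (withWeights S V) k ℓ η) 1 - phi (S i η) m (ratio p) ω 1) +
      (√((L * k : ℕ) : ℝ))⁻¹ * (k * ∑ g, ∫ x, ((wE g).eval (withWeights S V) k ℓ η x *
          (rE g).eval (withWeights S V) k ℓ η x - ω g x * ratio p g x) *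
            (p g.succ x * d g x) ∂FX)‖ₑ := by
  have hpm : ∀ g, Measurable (p g) := fun g => (hind g).measurable_mean
  have hrm : ∀ g, Measurable (ratio p g) := fun g => measurable_ratio hpm g
  choose Cr hCr using hr
  let D := withWeights S V
  let aE : Estimator fold (Obs J R E × ℝ) E := fun k ℓ y x => mE k ℓ y x - m x
  let cE : Fin (J + 1) → Estimator fold (Obs J R E × ℝ) E := fun g k ℓ y x =>
    wE g k ℓ y x * rE g k ℓ y x - ω g x * ratio p g x
  let uE : Fin (J + 1) → Estimator fold (Obs J R E × ℝ) E := fun g k ℓ y x =>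
    wE g k ℓ y x * (ratio p g x * (mE k ℓ y x - m x))
  let vE : Fin (J + 1) → Estimator fold (Obs J R E × ℝ) E := fun g k ℓ y x =>
    wE g k ℓ y x * ((rE g k ℓ y x - ratio p g x) * (mE k ℓ y x - m x))
  have haE : aE.IsMeas := fun k ℓ => (hmE k ℓ).sub (hm.comp measurable_snd)
  have hcE : ∀ g, (cE g).IsMeas := fun g k ℓ => ((hwE g k ℓ).mul (hrE g k ℓ)).sub
    (((hω g).comp measurable_snd).mul ((hrm g).comp measurable_snd))
  have huE : ∀ g, (uE g).IsMeas := fun g k ℓ =>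
    (hwE g k ℓ).mul (((hrm g).comp measurable_snd).mul (haE k ℓ))
  have hvE : ∀ g, (vE g).IsMeas := fun g k ℓ =>
    (hwE g k ℓ).mul (((hrE g k ℓ).sub ((hrm g).comp measurable_snd)).mul (haE k ℓ))
  have hev : ∀ {b : Estimator fold (Obs J R E × ℝ) E}, b.IsMeas → ∀ k η,
      Measurable (b.eval D k ℓ η) := fun hb k η => (hb k ℓ).comp measurable_prodMk_left
  have ha2 : SmallProb Pr fun k η => eLpNorm (aE.eval D k ℓ η) 2 FX := (hF.trend ℓ).smallProb
  have hu2 : ∀ g, SmallProb Pr fun k η => eLpNorm ((uE g).eval D k ℓ η) 2 FX := by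
    intro g
    refine ((ha2.const_mul (ENNReal.ofReal_ne_top (r := Cr g))).mul_bounded
      (hF.bounded ℓ g)).mono fun k η => ?_
    refine (eLpNorm_mul_le_top_mul_two ((hrm g).mul (hev haE k η))).trans (mul_le_mul_right ?_ _)
    exact (eLpNorm_mul_le_top_mul_two (hev haE k η)).trans
      (mul_le_mul_left (eLpNorm_top_le_of_abs_le (hCr g)) _)
  -- Here `ŵ r̂ - ω r = ŵ (r̂ - r) + r (ŵ - ω)`, with `ŵ` bounded in probability and `r` bounded.
  have hc2 : ∀ g, SmallProb Pr fun k η => eLpNorm ((cE g).eval D k ℓ η) 2 FX := by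
    intro g
    refine (((hF.ratios ℓ g).smallProb.mul_bounded (hF.bounded ℓ g)).add
      ((hF.weights ℓ g).smallProb.const_mul (ENNReal.ofReal_ne_top (r := Cr g)))).mono
      fun k η => ?_
    have e : (cE g).eval D k ℓ η = (fun x => (wE g).eval D k ℓ η x *
        ((rE g).eval D k ℓ η x - ratio p g x)) +
        fun x => ratio p g x * ((wE g).eval D k ℓ η x - ω g x) := by
      funext x
      simp only [cE, Estimator.eval, Pi.add_apply]
      ring
    rw [e]
    have k1 : Measurable fun x => (rE g).eval D k ℓ η x - ratio p g x := (hev (hrE g) k η).sub (hrm g)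
    have k2 : Measurable fun x => (wE g).eval D k ℓ η x - ω g x := (hev (hwE g) k η).sub (hω g)
    refine (eLpNorm_add_le ((hev (hwE g) k η).mul k1).aestronglyMeasurable
      ((hrm g).mul k2).aestronglyMeasurable one_le_two).trans (add_le_add ?_ ?_)
    · exact eLpNorm_mul_le_top_mul_two k1
    · exact (eLpNorm_mul_le_top_mul_two k2).trans
        (mul_le_mul_left (eLpNorm_top_le_of_abs_le (hCr g)) _)
  -- Cauchy-Schwarz puts the product rate condition to use; the weight is taken out in the supremum
  -- norm.
  have hv1 : ∀ g, SmallProb Pr fun k η => ENNReal.ofReal (√((L * k : ℕ) : ℝ)) *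
      ∫⁻ x, ‖(vE g).eval D k ℓ η x‖ₑ ∂FX := by
    intro g
    refine (((hF.product ℓ g).smallProb_rate hL).mul_bounded (hF.bounded ℓ g)).mono fun k η => ?_
    have k1 : Measurable fun x => (rE g).eval D k ℓ η x - ratio p g x := (hev (hrE g) k η).sub (hrm g)
    have k2 : Measurable fun x => mE.eval D k ℓ η x - m x := hev haE k η
    rw [Real.sqrt_eq_rpow, mul_left_comm]
    refine mul_le_mul_right ?_ _
    exact (lintegral_mul_le_top_mul (k1.mul k2)).trans
      (mul_le_mul_right (lintegral_mul_le_two_mul_two k1 k2) _)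
  have hA := fun g => smallProb_fold_sum_moment hL hD hfold ℓ (hcE g) (hres g) (hc2 g)
  have hB := smallProb_fold_sum_moment hL hD hfold ℓ haE (hind 0) ha2
  have hC := fun g : Fin (J + 1) =>
    smallProb_fold_sum_moment hL hD hfold ℓ (huE g) (hind g.succ) (hu2 g)
  have hE : ∀ g : Fin (J + 1), SmallProb Pr fun k η => ‖(√((L * k : ℕ) : ℝ))⁻¹ *
      ∑ i : Fin (L * k) with fold k i = ℓ,
        V i η * ((vE g).eval D k ℓ η (cov (S i η)) * ind g.succ (S i η))‖ₑ := by
    intro g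
    obtain ⟨C, hC, hzC⟩ := (hind g.succ).sq
    simp only [enorm_ind_sq] at hzC
    exact smallProb_fold_sum_abs hL hD hfold ℓ (hvE g) (hind g.succ).measurable hC hzC (hv1 g)
  have hall := (((SmallProb.enorm_sum Finset.univ fun g _ => hA g).enorm_const_mul (-1)).enorm_sub
    hB).enorm_add (SmallProb.enorm_sum Finset.univ fun g _ => hC g) |>.enorm_add
      (SmallProb.enorm_sum Finset.univ fun g _ => hE g)
  -- Events discarded so that the integrals below exist and the cancellation is valid: an infinite
  -- norm of `m̂ - m`, an infinite supremum of a weight, or weights not summing to one.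
  have hbad := tendsto_measure_union (tendsto_measure_union ha2.ne_top
    (tendsto_measure_iUnion fun g => (hF.bounded ℓ g).ne_top))
    (B := fun k => {η | ¬ ∀ᵐ x ∂FX, ∑ g, (wE g).eval D k ℓ η x = 1})
    (tendsto_const_nhds.congr fun k => (ae_iff.1 (hF.sum_one k ℓ)).symm)
  refine hall.mono_event hbad (Eventually.of_forall fun k η hη => le_of_eq ?_)
  simp only [Set.mem_union, Set.mem_iUnion, Set.mem_ofPred_eq, not_or, not_exists, not_not] at hη
  obtain ⟨⟨hη1, hη2⟩, hη3⟩ := hη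
  have haL : MemLp (aE.eval D k ℓ η) 2 FX :=
    ⟨(hev haE k η).aestronglyMeasurable, lt_top_iff_ne_top.2 hη1⟩
  -- The cancellation of the first-order effect of `m̂ - m`: since `r_{1,g} p_g = p_1`, the controls
  -- contribute `p_1 ∑ ŵ_g = p_1`, the same as the treated group.
  have hzero : ∑ g : Fin (J + 1), ∫ x, (uE g).eval D k ℓ η x * p g.succ x ∂FX
      = ∫ x, aE.eval D k ℓ η x * p 0 x ∂FX := by
    obtain ⟨C0, hC0⟩ := (hind 0).bounded
    have hap : Integrable (fun x => aE.eval D k ℓ η x * p 0 x) FX :=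
      (haL.integrable one_le_two).mul_bdd (c := C0) (hpm 0).aestronglyMeasurable hC0
    have hui : ∀ g, (fun x => (uE g).eval D k ℓ η x * p g.succ x) =ᵐ[FX]
        fun x => (wE g).eval D k ℓ η x * (aE.eval D k ℓ η x * p 0 x) := by
      intro g
      filter_upwards [hp g.succ] with x hx
      simp only [uE, aE, Estimator.eval, ratio]
      field_simp
    have hwi : ∀ g, Integrable (fun x => (wE g).eval D k ℓ η x * (aE.eval D k ℓ η x * p 0 x)) FX := by
      intro g
      refine ⟨((hev (hwE g) k η).mul ((hev haE k η).mul (hpm 0))).aestronglyMeasurable, ?_⟩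
      refine lt_of_le_of_lt (lintegral_mul_le_top_mul ((hev haE k η).mul (hpm 0))) ?_
      exact ENNReal.mul_lt_top (lt_top_iff_ne_top.2 (hη2 g)) hap.2
    rw [Finset.sum_congr rfl fun g _ => integral_congr_ae (hui g),
      ← integral_finsetSum _ fun g _ => hwi g]
    refine integral_congr_ae ?_
    filter_upwards [hη3] with x hx
    rw [← Finset.sum_mul, hx, one_mul]
  congr 1
  have e1 : ∀ i : Fin (L * k), V i η * (phi (S i η) (mE.eval D k ℓ η) (fun g => (rE g).eval D k ℓ η)
      (fun g => (wE g).eval D k ℓ η) 1 - phi (S i η) m (ratio p) ω 1) =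
      -(∑ g, V i η * ((cE g).eval D k ℓ η (cov (S i η)) *
          (ind g.succ (S i η) * (dY (S i η) - m (cov (S i η))))))
        - V i η * (aE.eval D k ℓ η (cov (S i η)) * ind 0 (S i η))
        + ∑ g : Fin (J + 1), V i η * ((uE g).eval D k ℓ η (cov (S i η)) * ind g.succ (S i η))
        + ∑ g : Fin (J + 1), V i η * ((vE g).eval D k ℓ η (cov (S i η)) * ind g.succ (S i η)) := by
    intro i
    rw [phi_sub_phi, mul_add, mul_add, mul_sub, mul_neg, Finset.mul_sum, Finset.mul_sum,
      Finset.mul_sum]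
    rfl
  rw [Finset.sum_congr rfl fun i _ => e1 i]
  simp only [Finset.sum_add_distrib, Finset.sum_sub_distrib, Finset.sum_neg_distrib]
  rw [Finset.sum_comm, Finset.sum_comm (t := Finset.univ) (f := fun (i : Fin (L * k))
    (g : Fin (J + 1)) => V i η * ((uE g).eval D k ℓ η (cov (S i η)) * ind g.succ (S i η))),
    Finset.sum_comm (t := Finset.univ) (f := fun (i : Fin (L * k))
    (g : Fin (J + 1)) => V i η * ((vE g).eval D k ℓ η (cov (S i η)) * ind g.succ (S i η)))]
  simp only [← Finset.mul_sum]
  have hzero' : ∑ g : Fin (J + 1), ∫ x, (uE g).eval (withWeights S V) k ℓ η x * p g.succ x ∂FX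
      = ∫ x, aE.eval (withWeights S V) k ℓ η x * p 0 x ∂FX := hzero
  rw [hzero']
  have hcI : ∑ g, ∫ x, ((wE g).eval (withWeights S V) k ℓ η x *
      (rE g).eval (withWeights S V) k ℓ η x - ω g x * ratio p g x) * (p g.succ x * d g x) ∂FX =
      ∑ g, ∫ x, (cE g).eval (withWeights S V) k ℓ η x * (p g.succ x * d g x) ∂FX := rfl
  rw [hcI]
  ring

end Expansion

end PanelATT

/-! ### The estimated probability of treatment in the denominator -/

namespace PanelATT

section Studentize

variable {Ω : Type*} [MeasurableSpace Ω] {Pr : Measure Ω} [IsProbabilityMeasure Pr]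

lemma IsBoundedInProb.of_lintegral_sq {Z : ℕ → Ω → ℝ≥0∞} (hm : ∀ k, AEMeasurable (Z k) Pr)
    {C : ℝ≥0∞} (hC : C ≠ ∞) (h : ∀ k, ∫⁻ η, Z k η ^ 2 ∂Pr ≤ C) : IsBoundedInProb Pr Z := by
  intro ε hε
  rcases eq_or_ne ε ∞ with rfl | hε'
  · exact ⟨0, Eventually.of_forall fun _ => le_top⟩
  -- The added one makes `c ≥ 1`, so that `Z > c` implies `Z² ≥ c`, and also excludes `c = 0`.
  -- Markov's inequality for `Z²` then gives `C / c ≤ ε`.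
  obtain ⟨c, hc⟩ : ∃ c : ℝ≥0∞, c = C / ε + 1 := ⟨_, rfl⟩
  have hc1 : 1 ≤ c := by rw [hc]; exact le_add_self
  have hctop : c ≠ ∞ := by
    rw [hc]; exact ENNReal.add_ne_top.2 ⟨ENNReal.div_ne_top hC hε.ne', ENNReal.one_ne_top⟩
  refine ⟨c.toReal, Eventually.of_forall fun k => ?_⟩
  rw [ENNReal.ofReal_toReal hctop]
  have h1 : {η | c < Z k η} ⊆ {η | c ≤ Z k η ^ 2} := fun η hη => by
    have h2 : c ≤ Z k η := (show c < Z k η from hη).le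
    calc c ≤ c * c := le_mul_of_one_le_left' hc1
      _ ≤ Z k η * Z k η := mul_le_mul' h2 h2
      _ = Z k η ^ 2 := (sq _).symm
  refine (measure_mono h1).trans ((meas_ge_le_lintegral_div ((hm k).pow_const 2)
    (zero_lt_one.trans_le hc1).ne' hctop).trans ?_)
  refine (ENNReal.div_le_div_right (h k) c).trans (ENNReal.div_le_of_le_mul ?_)
  rw [hc, mul_add, ENNReal.mul_div_cancel hε.ne' hε']
  exact le_self_add

/-- The normalized centred sum has second moment at most that of one summand. -/
lemma isBoundedInProb_sum {A : Type*} [MeasurableSpace A] {D : ℕ → Ω → A} {μ : Measure A}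
    (hDm : ∀ i, Measurable (D i)) (hDi : iIndepFun D Pr) (hDd : ∀ i, Pr.map (D i) = μ) (L : ℕ)
    {f : A → ℝ} (hf : Measurable f) (hf2 : MemLp f 2 μ) :
    IsBoundedInProb Pr fun k η => ‖(√((L * k : ℕ) : ℝ))⁻¹ *
      ∑ i ∈ Finset.range (L * k), (f (D i η) - ∫ y, f y ∂μ)‖ₑ := by
  have hC : eLpNorm f 2 μ ^ 2 ≠ ∞ := ENNReal.pow_ne_top hf2.2.ne
  refine IsBoundedInProb.of_lintegral_sq (fun k => ?_) hC fun k => ?_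
  · refine Measurable.aemeasurable (Measurable.enorm (Measurable.const_mul ?_ _))
    exact Finset.measurable_fun_sum _ fun i _ => (hf.comp (hDm i)).sub_const _
  · have h1 := lintegral_sq_sum_sub_le hDm hDi hDd (Finset.range (L * k)) hf
    simp only [enorm_mul, mul_pow]
    have hm : Measurable fun η => ‖∑ i ∈ Finset.range (L * k), (f (D i η) - ∫ y, f y ∂μ)‖ₑ ^ 2 :=
      (Finset.measurable_fun_sum _ fun i _ => (hf.comp (hDm i)).sub_const _).enorm.pow_const 2
    rw [lintegral_const_mul _ hm]
    refine (mul_le_mul_right h1 _).trans ?_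
    rw [Finset.card_range, ← mul_assoc, eLpNorm_two_sq, mul_comm (‖_‖ₑ ^ 2)]
    have h2 := natCast_mul_enorm_inv_sqrt_sq_le (L := 1) one_pos (L * k)
    rw [one_mul] at h2
    exact (mul_le_mul_left h2 _).trans (one_mul _).le

lemma smallProb_inv_sqrt {L : ℕ} (hL : 0 < L) :
    SmallProb Pr fun k _ => ‖(√((L * k : ℕ) : ℝ))⁻¹‖ₑ := by
  have h1 : Tendsto (fun k : ℕ => ‖(√((L * k : ℕ) : ℝ))⁻¹‖ₑ) atTop (𝓝 0) := by
    have h2 : Tendsto (fun k : ℕ => (√((L * k : ℕ) : ℝ))⁻¹) atTop (𝓝 0) :=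
      tendsto_inv_atTop_zero.comp (Real.tendsto_sqrt_atTop.comp
        (tendsto_natCast_atTop_atTop.comp (tendsto_id.const_mul_atTop' hL)))
    simpa using h2.enorm
  intro ε hε
  refine tendsto_const_nhds.congr' ?_
  filter_upwards [h1.eventually (gt_mem_nhds (pos_iff_ne_zero.2 hε))] with k hk
  have h3 : {η : Ω | ε < ‖(√((L * k : ℕ) : ℝ))⁻¹‖ₑ} = ∅ :=
    Set.eq_empty_of_forall_notMem fun _ h => absurd hk (not_lt.2 (le_of_lt h))
  rw [h3, measure_empty]

/-- Ratio of an asymptotically linear numerator and a consistent denominator. -/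
lemma smallProb_inv_mul_sub {U U0 ρ : ℕ → Ω → ℝ} {π : ℝ} (hπ : 0 < π)
    (hU : SmallProb Pr fun k η => ‖U k η - U0 k η‖ₑ)
    (hU0 : IsBoundedInProb Pr fun k η => ‖U0 k η‖ₑ)
    (hρ : SmallProb Pr fun k η => ‖ρ k η - π‖ₑ) :
    SmallProb Pr fun k η => ‖(ρ k η)⁻¹ * U k η - π⁻¹ * U0 k η‖ₑ := by
  have hbad := hρ (ENNReal.ofReal (π / 2)) (by simpa using hπ)
  refine ((hU.const_mul (ENNReal.ofReal_ne_top (r := 2 / π))).add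
    ((hρ.mul_bounded hU0).const_mul (ENNReal.ofReal_ne_top (r := 2 / π ^ 2)))).mono_event hbad
    (Eventually.of_forall fun k η hη => ?_)
  simp only [Set.mem_ofPred_eq, not_lt, Real.enorm_eq_ofReal_abs] at hη
  have hη' : |ρ k η - π| ≤ π / 2 := (ENNReal.ofReal_le_ofReal_iff (by positivity)).1 hη
  have hρ2 : π / 2 ≤ ρ k η := by linarith [(abs_le.1 hη').1]
  have hρ0 : 0 < ρ k η := by linarith
  have h1 : (ρ k η)⁻¹ ≤ 2 / π := by
    rw [inv_le_comm₀ hρ0 (by positivity), inv_div]; exact hρ2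
  -- The two sources of error are separated: that of the numerator, and that of the denominator
  -- times the bounded leading term. On the event considered, `ρ ≥ π / 2` bounds both reciprocals.
  have e : (ρ k η)⁻¹ * U k η - π⁻¹ * U0 k η = (ρ k η)⁻¹ * (U k η - U0 k η)
      - (ρ k η)⁻¹ * π⁻¹ * ((ρ k η - π) * U0 k η) := by
    field_simp
    ring
  simp only [Real.enorm_eq_ofReal_abs]
  rw [← ENNReal.ofReal_mul (by positivity), ← ENNReal.ofReal_mul (by positivity),
    ← ENNReal.ofReal_mul (by positivity), ← ENNReal.ofReal_add (by positivity) (by positivity)]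
  refine ENNReal.ofReal_le_ofReal ?_
  rw [e]
  refine (abs_sub _ _).trans ?_
  rw [abs_mul, abs_mul, abs_mul (ρ k η - π), abs_mul (ρ k η)⁻¹, abs_of_pos (inv_pos.2 hρ0),
    abs_of_pos (inv_pos.2 hπ)]
  have h2 : (ρ k η)⁻¹ * π⁻¹ ≤ 2 / π ^ 2 := by
    calc (ρ k η)⁻¹ * π⁻¹ ≤ 2 / π * π⁻¹ := by gcongr
      _ = 2 / π ^ 2 := by field_simp
  rw [mul_comm |U0 k η|]
  gcongr

variable {E : Type*} [MeasurableSpace E] {J R L : ℕ} {fold : FoldMap L}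
  {μ : Measure (Obs J R E)} [IsProbabilityMeasure μ]
  {ν : Measure ℝ} [IsProbabilityMeasure ν] {S : ℕ → Ω → Obs J R E} {V : ℕ → Ω → ℝ}

lemma IsWeightedSample.memLp_mul {A : Type*} [MeasurableSpace A] {μ : Measure A}
    [IsProbabilityMeasure μ] {S : ℕ → Ω → A} (hD : IsWeightedSample Pr μ ν S V)
    {f : A → ℝ} (hf : Measurable f) (hf2 : MemLp f 2 μ) :
    MemLp (fun y : A × ℝ => y.2 * f y.1) 2 (μ.prod ν) := by
  refine memLp_two_of_lintegral (Measurable.mul _root_.measurable_snd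
    (hf.comp _root_.measurable_fst)) ?_
  have e : ∀ y : A × ℝ, ‖y.2 * f y.1‖ₑ ^ 2 = ‖f y.1‖ₑ ^ 2 * ‖y.2‖ₑ ^ 2 := fun y => by
    rw [enorm_mul, mul_pow, mul_comm]
  simp only [e]
  rw [lintegral_prod_mul (f := fun s => ‖f s‖ₑ ^ 2) (g := fun v => ‖v‖ₑ ^ 2)
    (hf.enorm.pow_const 2).aemeasurable (measurable_enorm.pow_const 2).aemeasurable,
    ← eLpNorm_two_sq, ← eLpNorm_two_sq ν (fun v => v)]
  exact ENNReal.mul_ne_top (ENNReal.pow_ne_top hf2.2.ne) (ENNReal.pow_ne_top hD.memLp.2.ne)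

lemma IsWeightedSample.integral_mul {A : Type*} [MeasurableSpace A] {μ : Measure A}
    [IsProbabilityMeasure μ] {S : ℕ → Ω → A} (hD : IsWeightedSample Pr μ ν S V) (f : A → ℝ) :
    ∫ y : A × ℝ, y.2 * f y.1 ∂(μ.prod ν) = ∫ s, f s ∂μ := by
  have h := integral_prod_mul (μ := μ) (ν := ν) f (fun v => v)
  rw [hD.mean, mul_one] at h
  rw [← h]
  simp only [mul_comm]

lemma sum_folds_eq_sum_range {M : Type*} [AddCommMonoid M] (k : ℕ) (g : ℕ → M) :
    ∑ ℓ : Fin L, ∑ i : Fin (L * k) with fold k i = ℓ, g i = ∑ i ∈ Finset.range (L * k), g i := by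
  rw [Finset.sum_fiberwise, Finset.sum_range]

/-- From the moment functions with estimated nuisance functions to the estimator. -/
lemma smallProb_thetaEst (hL : 0 < L) (hD : IsWeightedSample Pr μ ν S V)
    {mHat : ℕ → Fin L → Ω → E → ℝ} {rHat wHat : Fin (J + 1) → ℕ → Fin L → Ω → E → ℝ} {θ π : ℝ}
    (hπ : 0 < π) (hπ0 : ∫ s, ind 0 s ∂μ = π) {ψ : Obs J R E → ℝ} (hψ : Measurable ψ)
    (hψ2 : MemLp ψ 2 μ) (hψ0 : ∫ s, ψ s ∂μ = 0)
    (h : SmallProb Pr fun k η => ‖(√((L * k : ℕ) : ℝ))⁻¹ * (∑ ℓ : Fin L,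
        ∑ i : Fin (L * k) with fold k i = ℓ, V i η * (phi (S i η) (mHat k ℓ η)
          (fun g => rHat g k ℓ η) (fun g => wHat g k ℓ η) 1 - θ * ind 0 (S i η))) -
      (√((L * k : ℕ) : ℝ))⁻¹ * ∑ i ∈ Finset.range (L * k), V i η * (π * ψ (S i η))‖ₑ) :
    SmallProb Pr fun k η => ‖√((L * k : ℕ) : ℝ) * (thetaEst fold S V mHat rHat wHat k η - θ) -
      (√((L * k : ℕ) : ℝ))⁻¹ * ∑ i ∈ Finset.range (L * k), V i η * ψ (S i η)‖ₑ := by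
  have hi2 : MemLp (ind 0 : Obs J R E → ℝ) 2 μ :=
    MemLp.of_bound (measurable_ind 0).aestronglyMeasurable 1 (Eventually.of_forall fun s => by
      unfold ind; split_ifs <;> simp)
  have hρ0 := isBoundedInProb_sum hD.measurable hD.indep hD.map_eq L
    (f := fun y => y.2 * ind 0 y.1) (measurable_snd.mul ((measurable_ind 0).comp measurable_fst))
    (hD.memLp_mul (measurable_ind 0) hi2)
  have hU0 := isBoundedInProb_sum hD.measurable hD.indep hD.map_eq L
    (f := fun y => y.2 * (π * ψ y.1))
    (measurable_snd.mul ((hψ.const_mul π).comp measurable_fst))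
    (hD.memLp_mul (hψ.const_mul π) (hψ2.const_mul π))
  rw [hD.integral_mul (ind 0), hπ0] at hρ0
  rw [hD.integral_mul (fun s => π * ψ s), integral_const_mul, hψ0, mul_zero] at hU0
  simp only [withWeights, sub_zero] at hρ0 hU0
  -- The estimated probability minus `π` is `n^{-1/2}` times a centred normalized sum, which is
  -- bounded in probability.
  have hρ : SmallProb Pr fun k η => ‖((1 / ((L * k : ℕ) : ℝ)) *
      ∑ j : Fin (L * k), V j η * ind 0 (S j η)) - π‖ₑ := by
    refine ((smallProb_inv_sqrt hL).mul_bounded hρ0).mono_ae ?_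
    filter_upwards [eventually_gt_atTop 0] with k hk
    refine Eventually.of_forall fun η => le_of_eq ?_
    rw [← enorm_mul]
    congr 1
    have hn : (0 : ℝ) < ((L * k : ℕ) : ℝ) := by exact_mod_cast Nat.mul_pos hL hk
    rw [Finset.sum_sub_distrib, Finset.sum_const, Finset.card_range, nsmul_eq_mul,
      Finset.sum_range]
    obtain ⟨T, hT⟩ : ∃ T, T = √((L * k : ℕ) : ℝ) := ⟨_, rfl⟩
    have hT0 : 0 < T := by rw [hT]; exact Real.sqrt_pos.2 hn
    have hTT : ((L * k : ℕ) : ℝ) = T * T := by rw [hT, Real.mul_self_sqrt hn.le]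
    rw [← hT, hTT]
    field_simp
  refine (smallProb_inv_mul_sub hπ h hU0 hρ).mono_event (hρ (ENNReal.ofReal (π / 2))
    (by simpa using hπ)) ?_
  filter_upwards [eventually_gt_atTop 0] with k hk η hη
  simp only [not_lt, Real.enorm_eq_ofReal_abs] at hη
  have hη' := (ENNReal.ofReal_le_ofReal_iff (by positivity)).1 hη
  obtain ⟨ρ, hρdef⟩ : ∃ ρ, ρ = (1 / ((L * k : ℕ) : ℝ)) *
      ∑ j : Fin (L * k), V j η * ind 0 (S j η) := ⟨_, rfl⟩
  rw [← hρdef] at hη' ⊢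
  have hρpos : 0 < ρ := by linarith [(abs_le.1 hη').1]
  refine le_of_eq ?_
  congr 1
  have hn : (0 : ℝ) < ((L * k : ℕ) : ℝ) := by exact_mod_cast Nat.mul_pos hL hk
  have e1 : thetaEst fold S V mHat rHat wHat k η = (1 / ((L * k : ℕ) : ℝ)) * (ρ⁻¹ * ∑ ℓ : Fin L,
      ∑ i : Fin (L * k) with fold k i = ℓ, V i η * phi (S i η) (mHat k ℓ η)
        (fun g => rHat g k ℓ η) (fun g => wHat g k ℓ η) 1) := by
    simp only [thetaEst, ← hρdef, Finset.mul_sum]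
    refine Finset.sum_congr rfl fun ℓ _ => Finset.sum_congr rfl fun i _ => ?_
    simp only [phi]
    ring
  -- Since `n ρ = ∑ V_i 𝒢_{1i}`, the target `θ` is `ρ⁻¹` times the average of `V_i θ 𝒢_{1i}`. So `θ̂
  -- - θ` is a ratio whose numerator is already centred, and replacing `ρ` by `π` adds no
  -- first-order term.
  have e2 : ∑ ℓ : Fin L, ∑ i : Fin (L * k) with fold k i = ℓ, V i η * (phi (S i η) (mHat k ℓ η)
        (fun g => rHat g k ℓ η) (fun g => wHat g k ℓ η) 1 - θ * ind 0 (S i η)) =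
      ∑ ℓ : Fin L, ∑ i : Fin (L * k) with fold k i = ℓ, V i η * phi (S i η) (mHat k ℓ η)
        (fun g => rHat g k ℓ η) (fun g => wHat g k ℓ η) 1 - θ * (((L * k : ℕ) : ℝ) * ρ) := by
    have e3 : ((L * k : ℕ) : ℝ) * ρ = ∑ ℓ : Fin L, ∑ i : Fin (L * k) with fold k i = ℓ,
        V i η * ind 0 (S i η) := by
      rw [sum_folds_eq_sum_range k fun i => V i η * ind 0 (S i η), Finset.sum_range, hρdef]
      field_simp
    rw [e3, Finset.mul_sum, ← Finset.sum_sub_distrib]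
    refine Finset.sum_congr rfl fun ℓ _ => ?_
    rw [Finset.mul_sum, ← Finset.sum_sub_distrib]
    exact Finset.sum_congr rfl fun i _ => by ring
  have e4 : ∑ i ∈ Finset.range (L * k), V i η * (π * ψ (S i η)) =
      π * ∑ i ∈ Finset.range (L * k), V i η * ψ (S i η) := by
    rw [Finset.mul_sum]
    exact Finset.sum_congr rfl fun i _ => by ring
  rw [e1, e2, e4]
  obtain ⟨T, hT⟩ : ∃ T, T = √((L * k : ℕ) : ℝ) := ⟨_, rfl⟩
  have hT0 : 0 < T := by rw [hT]; exact Real.sqrt_pos.2 hn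
  have hTT : ((L * k : ℕ) : ℝ) = T * T := by rw [hT, Real.mul_self_sqrt hn.le]
  rw [← hT, hTT]
  field_simp

end Studentize

end PanelATT

/-! ### Original and bootstrap samples as weighted samples -/

namespace PanelATT

section Weighted

variable {Ω₀ Ω E : Type*} [MeasurableSpace Ω₀] [MeasurableSpace Ω] [MeasurableSpace E]
  {Pr : Measure Ω} [IsProbabilityMeasure Pr] {J R L : ℕ} {fold : FoldMap L}
  {pop : Population Ω₀ E J R} {S : ℕ → Ω → Obs J R E} {W : ℕ → Ω → ℝ}

/-- Constant multipliers are iid with law `δ_1`. This is what lets one expansion serve both the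
original and the bootstrap estimator. -/
lemma IsSample.isWeightedSample_unit (hS : IsSample pop Pr S) :
    IsWeightedSample Pr pop.law (Measure.dirac 1) S unitWeights where
  measurable_fst := hS.1
  measurable_snd _ := measurable_const
  indep := hS.2.1.comp (fun _ s => (s, (1 : ℝ))) fun _ => measurable_prodMk_right
  map_eq i := by
    have h1 : withWeights S unitWeights i = (fun s => (s, (1 : ℝ))) ∘ S i := rfl
    rw [h1, ← Measure.map_map measurable_prodMk_right (hS.1 i), hS.2.2 i, ← Population.law,
      Measure.prod_dirac]
  memLp := memLp_two_of_lintegral measurable_id (by simp)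
  mean := by simp

/-- The variance of a variable outside `L²` takes the default value zero, which contradicts variance
one. -/
lemma IsBootstrapWeights.memLp {A : Type*} [MeasurableSpace A] {S : ℕ → Ω → A}
    (hW : IsBootstrapWeights Pr S W) : MemLp (W 0) 2 Pr := by
  by_contra h
  have h1 := hW.2.2.2.2.2.1
  rw [variance_of_not_memLp (hW.1 0).aestronglyMeasurable h] at h1
  exact zero_ne_one h1

lemma IsSample.isWeightedSample (hS : IsSample pop Pr S) (hW : IsBootstrapWeights Pr S W) :
    IsWeightedSample Pr pop.law (Pr.map (W 0)) S W where
  measurable_fst := hS.1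
  measurable_snd := hW.1
  indep := iIndepFun_prodMk_of_indepFun hS.1 hW.1 hS.2.1 hW.2.1 hW.2.2.2.1
  map_eq i := by
    have h1 : IndepFun (S i) (W i) Pr :=
      hW.2.2.2.1.comp (measurable_pi_apply i) (measurable_pi_apply i)
    have h2 := (indepFun_iff_map_prod_eq_prod_map_map (hS.1 i).aemeasurable
      (hW.1 i).aemeasurable).1 h1
    rw [hS.2.2 i, (hW.2.2.1 i).map_eq] at h2
    exact h2
  memLp := (memLp_map_measure_iff measurable_id.aestronglyMeasurable (hW.1 0).aemeasurable).2
    hW.memLp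
  mean := by
    have h1 := integral_map (μ := Pr) (f := fun v : ℝ => v) (hW.1 0).aemeasurable
      measurable_id.aestronglyMeasurable
    exact h1.trans hW.2.2.2.2.1

lemma Estimator.IsMeas.eval {A : Type*} [MeasurableSpace A] {est : Estimator fold A E}
    (h : est.IsMeas) {D : ℕ → Ω → A} (hD : ∀ i, Measurable (D i)) (k : ℕ) (ℓ : Fin L) :
    Measurable fun q : Ω × E => est.eval D k ℓ q.1 q.2 := by
  have h1 : Measurable fun (q : Ω × E) (i : Train fold k ℓ) => D i.1 q.1 :=
    measurable_pi_iff.2 fun i => (hD i.1).comp measurable_fst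
  exact (h k ℓ).comp (h1.prodMk measurable_snd)

lemma measurable_thetaEst {V : ℕ → Ω → ℝ} (hS : ∀ i, Measurable (S i)) (hV : ∀ i, Measurable (V i))
    {mHat : ℕ → Fin L → Ω → E → ℝ} {rHat wHat : Fin (J + 1) → ℕ → Fin L → Ω → E → ℝ}
    (hm : ∀ k ℓ, Measurable fun q : Ω × E => mHat k ℓ q.1 q.2)
    (hr : ∀ g k ℓ, Measurable fun q : Ω × E => rHat g k ℓ q.1 q.2)
    (hw : ∀ g k ℓ, Measurable fun q : Ω × E => wHat g k ℓ q.1 q.2) (k : ℕ) :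
    Measurable (thetaEst fold S V mHat rHat wHat k) := by
  have hX : ∀ i : ℕ, Measurable fun η => (η, cov (S i η)) := fun i =>
    measurable_id.prodMk (measurable_cov.comp (hS i))
  have hind : ∀ g (i : ℕ), Measurable fun η => ind g (S i η) := fun g i =>
    (measurable_ind g).comp (hS i)
  have hρ : Measurable fun η => (1 / ((L * k : ℕ) : ℝ)) * ∑ j : Fin (L * k), V j η * ind 0 (S j η) := by
    have h1 : ∀ j : Fin (L * k), Measurable fun η => V j η * ind 0 (S j η) := fun j =>
      (hV j).mul (hind 0 j)
    exact (Finset.measurable_fun_sum _ fun j _ => h1 j).const_mul _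
  have hφ : ∀ (ℓ : Fin L) (i : Fin (L * k)), Measurable fun η =>
      V i η * phi (S i η) (mHat k ℓ η) (fun g => rHat g k ℓ η) (fun g => wHat g k ℓ η)
        ((1 / ((L * k : ℕ) : ℝ)) * ∑ j : Fin (L * k), V j η * ind 0 (S j η)) := by
    intro ℓ i
    refine (hV i).mul ?_
    unfold phi
    refine ((measurable_const.div hρ).mul ((hind 0 i).sub (Finset.measurable_fun_sum _
      fun g _ => ?_))).mul ((measurable_dY.comp (hS i)).sub ((hm k ℓ).comp (hX i)))
    exact (((hw g k ℓ).comp (hX i)).mul ((hr g k ℓ).comp (hX i))).mul (hind _ i)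
  exact (Finset.measurable_fun_sum _ fun ℓ _ =>
    Finset.measurable_fun_sum _ fun i _ => hφ ℓ i).const_mul _

lemma integral_ind_zero : ∫ s, ind 0 s ∂pop.law = pop.pi1 := by
  rw [Population.integral_law (measurable_ind 0)]
  have h1 := pop.integral_ind_mul 0 fun _ => (1 : ℝ)
  simp only [mul_one] at h1
  rw [h1, Population.pi1]
  simp

/-- Bootstrap consistency, given asymptotically linear representations of the sums of the moment
functions of both the original and the bootstrap sample. -/
theorem bootstrapConsistent_of_scores (hL : 0 < L) {p : Fin (J + 2) → E → ℝ}
    (hS : IsSample pop Pr S) (hW : IsBootstrapWeights Pr S W) (hp : pop.IsPropensity p)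
    (ho : pop.Overlap p)
    {mHat mStar : ℕ → Fin L → Ω → E → ℝ} {rHat wHat rStar wStar : Fin (J + 1) → ℕ → Fin L → Ω → E → ℝ}
    (hm : ∀ k ℓ, Measurable fun q : Ω × E => mHat k ℓ q.1 q.2)
    (hr : ∀ g k ℓ, Measurable fun q : Ω × E => rHat g k ℓ q.1 q.2)
    (hw : ∀ g k ℓ, Measurable fun q : Ω × E => wHat g k ℓ q.1 q.2)
    (hm' : ∀ k ℓ, Measurable fun q : Ω × E => mStar k ℓ q.1 q.2)
    (hr' : ∀ g k ℓ, Measurable fun q : Ω × E => rStar g k ℓ q.1 q.2)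
    (hw' : ∀ g k ℓ, Measurable fun q : Ω × E => wStar g k ℓ q.1 q.2)
    {ψ : Obs J R E → ℝ} (hψ : Measurable ψ) (hψ2 : MemLp ψ 2 pop.law) (hψ0 : ∫ s, ψ s ∂pop.law = 0)
    (hpos : 0 < ∫ s, ψ s ^ 2 ∂pop.law) {θ : ℝ}
    (h : SmallProb Pr fun k η => ‖(√((L * k : ℕ) : ℝ))⁻¹ * (∑ ℓ : Fin L,
        ∑ i : Fin (L * k) with fold k i = ℓ, unitWeights i η * (phi (S i η) (mHat k ℓ η)
          (fun g => rHat g k ℓ η) (fun g => wHat g k ℓ η) 1 - θ * ind 0 (S i η))) -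
      (√((L * k : ℕ) : ℝ))⁻¹ * ∑ i ∈ Finset.range (L * k), unitWeights i η *
        (pop.pi1 * ψ (S i η))‖ₑ)
    (h' : SmallProb Pr fun k η => ‖(√((L * k : ℕ) : ℝ))⁻¹ * (∑ ℓ : Fin L,
        ∑ i : Fin (L * k) with fold k i = ℓ, W i η * (phi (S i η) (mStar k ℓ η)
          (fun g => rStar g k ℓ η) (fun g => wStar g k ℓ η) 1 - θ * ind 0 (S i η))) -
      (√((L * k : ℕ) : ℝ))⁻¹ * ∑ i ∈ Finset.range (L * k), W i η * (pop.pi1 * ψ (S i η))‖ₑ) :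
    BootstrapConsistent L Pr S θ (thetaEst fold S unitWeights mHat rHat wHat)
      (thetaEst fold S W mStar rStar wStar) := by
  have hD := hS.isWeightedSample_unit
  have hD' := hS.isWeightedSample hW
  have : IsProbabilityMeasure (Pr.map (W 0)) :=
    Measure.isProbabilityMeasure_map (hW.1 0).aemeasurable
  have hπ := Population.pi1_pos hp ho
  have h1 := smallProb_thetaEst hL hD hπ integral_ind_zero hψ hψ2 hψ0 h
  have h2 := smallProb_thetaEst hL hD' hπ integral_ind_zero hψ hψ2 hψ0 h'
  have hmap : ∀ i, Pr.map (S i) = pop.law := hS.2.2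
  have hint : ∀ {f : Obs J R E → ℝ}, Measurable f → ∫ η, f (S 0 η) ∂Pr = ∫ s, f s ∂pop.law :=
    fun hf => by
      rw [← hmap 0, integral_map (hS.1 0).aemeasurable hf.aestronglyMeasurable]
  refine bootstrapConsistent_of_linear hL hS.1 hS.2.1
    (fun i => ⟨(hS.1 i).aemeasurable, (hS.1 0).aemeasurable, (hmap i).trans (hmap 0).symm⟩) hW hψ
    (hψ2.comp_measurePreserving ⟨hS.1 0, hmap 0⟩) ((hint hψ).trans hψ0)
    (by rw [hint (f := fun s => ψ s ^ 2) (hψ.pow_const 2)]; exact hpos)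
    (measurable_thetaEst hS.1 (fun _ => measurable_const) hm hr hw)
    (measurable_thetaEst hS.1 hW.1 hm' hr' hw') ?_ ?_
  · simpa only [unitWeights, one_mul] using h1
  -- Both expansions are centred at `θ`, so subtracting them leaves `θ* - θ̂` on the left and the
  -- multipliers `W_i - 1` on the right.
  · refine (h2.enorm_sub h1).mono fun k η => le_of_eq ?_
    congr 1
    simp only [unitWeights, one_mul, sub_mul, Finset.sum_sub_distrib]
    ring

/-- Pointwise `f² ≤ 1 + |f|^{2+δ}`. -/
lemma memLp_two_of_integrable_rpow {A : Type*} [MeasurableSpace A] {μ : Measure A}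
    [IsFiniteMeasure μ] {f : A → ℝ} (hf : Measurable f)
    (h : ∃ δ : ℝ, 0 < δ ∧ Integrable (fun a => |f a| ^ (2 + δ)) μ) : MemLp f 2 μ := by
  obtain ⟨δ, hδ, hi⟩ := h
  refine (memLp_two_iff_integrable_sq hf.aestronglyMeasurable).2
    (((integrable_const (1 : ℝ)).add hi).mono' (hf.pow_const 2).aestronglyMeasurable
      (Eventually.of_forall fun a => ?_))
  rw [Real.norm_of_nonneg (sq_nonneg _), Pi.add_apply, ← sq_abs]
  rcases le_total |f a| 1 with h1 | h1
  · have h2 : (0 : ℝ) ≤ |f a| ^ (2 + δ) := by positivity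
    nlinarith [abs_nonneg (f a)]
  · have h2 : |f a| ^ (2 : ℝ) ≤ |f a| ^ (2 + δ) :=
      Real.rpow_le_rpow_of_exponent_le h1 (by linarith)
    rw [Real.rpow_two] at h2
    linarith

end Weighted

end PanelATT

/-! ### Identification of the treatment effect -/

namespace PanelATT

namespace Population

variable {Ω E : Type*} [MeasurableSpace Ω] [mE : MeasurableSpace E] {J R : ℕ}
  {pop : Population Ω E J R} {p : Fin (J + 2) → E → ℝ} {m : E → ℝ} {ω : Fin (J + 1) → E → ℝ}

lemma grp_succ_subset (g : Fin (J + 1)) : pop.grp g.succ ⊆ (pop.grp 0)ᶜ := by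
  intro a ha h0
  exact Fin.succ_ne_zero g ((show pop.G a = g.succ from ha).symm.trans h0)

lemma measure_compl_grp_ne_zero (hp : pop.IsPropensity p) (ho : pop.Overlap p) :
    pop.P (pop.grp 0)ᶜ ≠ 0 := fun h =>
  hp.measure_grp_ne_zero ho (Fin.succ 0) (measure_mono_null (grp_succ_subset 0) h)

lemma ae_abs_ratio_le (hB : pop.BoundedMoments m p ω) (hp : pop.IsPropensity p)
    (ho : pop.Overlap p) (g : Fin (J + 1)) : ∃ C : ℝ, ∀ᵐ x ∂pop.FX, |ratio p g x| ≤ C := by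
  obtain ⟨C, hC⟩ := hB.2.1 g.succ
  refine ⟨C, ?_⟩
  filter_upwards [hC, hp.ae_le_one 0, ho 0, ho g.succ] with x h1 h2 h3 h4
  rw [ratio, abs_of_pos (div_pos h3 h4)]
  exact (div_le_div_of_nonneg_right h2 h4.le).trans h1

/-- A conditional mean is integrable over the controls only, and so over one control group, which
makes `p_g m` integrable. The boundedness of `1 / p_g` then removes the factor. -/
lemma integrable_trend (hB : pop.BoundedMoments m p ω) (hp : pop.IsPropensity p)
    (ho : pop.Overlap p) (hm : pop.IsControlTrend m) : Integrable m pop.FX := by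
  have h1 : Integrable (fun a => m (pop.X a)) (cond pop.P (pop.grp 0)ᶜ) :=
    integrable_condExp.congr hm.2.2
  have h2 := (integrable_cond_iff (measure_compl_grp_ne_zero hp ho)).1 h1
  have h3 : Integrable (fun a => m (pop.X a)) (pop.P.restrict (pop.grp (Fin.succ 0))) :=
    h2.mono_measure (Measure.restrict_mono (grp_succ_subset 0) le_rfl)
  have h4 := (hp.integrable_grp_iff ho (Fin.succ 0) hm.1).1 h3
  obtain ⟨C, hC⟩ := hB.2.1 (Fin.succ 0)
  have h5 := h4.bdd_mul (f := fun x => 1 / p (Fin.succ 0) x) (c := C)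
    (measurable_const.div (hp _).1).aestronglyMeasurable (by
      filter_upwards [hC, ho (Fin.succ 0)] with x k1 k2
      rw [Real.norm_of_nonneg (by positivity)]; exact k1)
  refine h5.congr ?_
  filter_upwards [ho (Fin.succ 0)] with x hx
  field_simp

lemma integrable_comp_X {u : E → ℝ} (hu : Integrable u pop.FX) :
    Integrable (fun a => u (pop.X a)) pop.P := hu.comp_measurable pop.measurable_X

lemma integrable_comp_X_cond (hp : pop.IsPropensity p) (ho : pop.Overlap p) {u : E → ℝ}
    (hu : Integrable u pop.FX) (g : Fin (J + 2)) :
    Integrable (fun a => u (pop.X a)) (cond pop.P (pop.grp g)) :=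
  (integrable_cond_iff (hp.measure_grp_ne_zero ho g)).2 (integrable_comp_X hu).restrict

lemma obs_dY_of_ne {a : Ω} (h : pop.G a ≠ 0) : dY (pop.obs a) =
    pop.Y0 (Fin.last (R + 1)) a - pop.Y0 (Fin.last R).castSucc a := by
  simp [dY, obs, Y, h]

lemma ae_cond_grp_mem (g : Fin (J + 2)) : ∀ᵐ a ∂(cond pop.P (pop.grp g)), pop.G a = g :=
  ae_cond_iff.2 (ae_restrict_mem (pop.measurableSet_grp g))

lemma ae_bounded_of_isCondMean_resid (hB : pop.BoundedMoments m p ω) (hp : pop.IsPropensity p)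
    (ho : pop.Overlap p) {d : E → ℝ} {g : Fin (J + 2)}
    (hd : IsCondMean pop.P pop.X (pop.grp g) (fun a => dY (pop.obs a) - m (pop.X a)) d) :
    ∃ C : ℝ, ∀ᵐ x ∂pop.FX, |d x| ≤ C := by
  obtain ⟨he, C, hC⟩ := hB.1 g
  have h1 := hd.ae_abs_le (hp.measure_grp_ne_zero ho g) he pop.measurable_X hC
  exact ⟨1 + C, (hp.ae_cond_grp_iff ho g (q := fun x => |d x| ≤ 1 + C)
    (measurableSet_le hd.1.abs measurable_const)).1 h1⟩

lemma memLp_of_ae_bounded {u : E → ℝ} (hu : Measurable u) {C : ℝ}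
    (h : ∀ᵐ x ∂pop.FX, |u x| ≤ C) : MemLp u 2 pop.FX :=
  MemLp.of_bound hu.aestronglyMeasurable C h

lemma memLp_ind_mul_resid (hB : pop.BoundedMoments m p ω) (hp : pop.IsPropensity p)
    (ho : pop.Overlap p) (hm : Measurable m) {u : E → ℝ} (hu : Measurable u) {C : ℝ}
    (hC : ∀ᵐ x ∂pop.FX, |u x| ≤ C) (g : Fin (J + 2)) :
    MemLp (fun s : Obs J R E => u (cov s) * (ind g s * (dY s - m (cov s)))) 2 pop.law := by
  obtain ⟨c, hc, hz⟩ := hB.sq_resid hp ho hm g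
  refine memLp_two_of_lintegral ((hu.comp measurable_cov).mul ((measurable_ind g).mul
    (measurable_dY.sub (hm.comp measurable_cov)))) ?_
  have h1 := hz (fun x => ‖u x‖ₑ ^ 2) (hu.enorm.pow_const 2)
  simp only [enorm_mul, mul_pow] at h1 ⊢
  refine ne_top_of_le_ne_top (ENNReal.mul_ne_top hc ?_) h1
  rw [← eLpNorm_two_sq]
  exact ENNReal.pow_ne_top (memLp_of_ae_bounded hu hC).2.ne

lemma phi_one_eq (s : Obs J R E) (m : E → ℝ) (r w : Fin (J + 1) → E → ℝ) :
    phi s m r w 1 = 1 * (ind 0 s * (dY s - m (cov s))) -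
      ∑ g : Fin (J + 1), (w g (cov s) * r g (cov s)) * (ind g.succ s * (dY s - m (cov s))) := by
  have h : ∑ g : Fin (J + 1), (w g (cov s) * r g (cov s)) * (ind g.succ s * (dY s - m (cov s))) =
      (∑ g : Fin (J + 1), w g (cov s) * r g (cov s) * ind g.succ s) * (dY s - m (cov s)) := by
    rw [Finset.sum_mul]
    exact Finset.sum_congr rfl fun g _ => by ring
  rw [h, phi]
  ring

/-- The moment condition identifying the average treatment effect on the treated. -/
lemma integral_phi (hB : pop.BoundedMoments m p ω) (hp : pop.IsPropensity p) (ho : pop.Overlap p)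
    (hna : pop.NoAnticipation) (hm : pop.IsControlTrend m) (hω : ∀ g, Measurable (ω g))
    {d : Fin (J + 1) → E → ℝ} {d0 : E → ℝ}
    (hd : ∀ g : Fin (J + 1), IsCondMean pop.P pop.X (pop.grp g.succ)
      (fun a => dY (pop.obs a) - m (pop.X a)) (d g))
    (hd0 : IsCondMean pop.P pop.X (pop.grp 0) (fun a => pop.Y0 (Fin.last (R + 1)) a -
      pop.Y0 (Fin.last R).castSucc a - m (pop.X a)) d0)
    (h0 : ∀ᵐ x ∂pop.FX, d0 x = ∑ g, ω g x * d g x) :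
    MemLp (fun s => phi s m (ratio p) ω 1) 2 pop.law ∧
      ∫ s, phi s m (ratio p) ω 1 ∂pop.law = pop.pi1 * pop.att := by
  have hrm := fun g => measurable_ratio (fun g => (hp g).1) g
  have hA0 := hp.measure_grp_ne_zero ho 0
  choose Cr hCr using fun g => ae_abs_ratio_le hB hp ho g
  choose Cω hCω using hB.2.2
  have hbd : ∀ g, ∀ᵐ x ∂pop.FX, |ω g x * ratio p g x| ≤ Cω g * Cr g := by
    intro g
    filter_upwards [hCr g, hCω g] with x h1 h2
    rw [abs_mul]
    exact mul_le_mul h2 h1 (abs_nonneg _) ((abs_nonneg _).trans h2)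
  have hL0 := memLp_ind_mul_resid hB hp ho hm.1 (u := fun _ => 1) measurable_const (C := 1)
    (by simp) 0
  have hLg : ∀ g : Fin (J + 1), MemLp (fun s : Obs J R E => (ω g (cov s) * ratio p g (cov s)) *
      (ind g.succ s * (dY s - m (cov s)))) 2 pop.law := fun g => memLp_ind_mul_resid hB hp ho hm.1
    ((hω g).mul (hrm g)) (hbd g) g.succ
  simp only [phi_one_eq]
  refine ⟨hL0.sub (memLp_finsetSum _ fun g _ => hLg g), ?_⟩
  rw [integral_sub (hL0.integrable one_le_two)
    (integrable_finsetSum _ fun g _ => (hLg g).integrable one_le_two),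
    integral_finsetSum _ fun g _ => (hLg g).integrable one_le_two]
  -- The ratio converts the law of `X` in group `g` into that of the treated, because `r_{1,g} p_g =
  -- p_1`.
  have hg : ∀ g : Fin (J + 1), ∫ s : Obs J R E, (ω g (cov s) * ratio p g (cov s)) *
      (ind g.succ s * (dY s - m (cov s))) ∂pop.law = ∫ x, p 0 x * (ω g x * d g x) ∂pop.FX := by
    intro g
    rw [(hasCondMoment_resid hB hp ho hm.1 g.succ (hd g)).mean (fun x => ω g x * ratio p g x)
      ((hω g).mul (hrm g)) (memLp_of_ae_bounded ((hω g).mul (hrm g)) (hbd g))]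
    refine integral_congr_ae ?_
    filter_upwards [ho g.succ] with x hx
    simp only [ratio]
    field_simp
  have hig : ∀ g, Integrable (fun x => p 0 x * (ω g x * d g x)) pop.FX := by
    intro g
    obtain ⟨Cd, hCd⟩ := ae_bounded_of_isCondMean_resid hB hp ho (hd g)
    refine Integrable.of_bound ((hp 0).1.mul ((hω g).mul (hd g).1)).aestronglyMeasurable
      (1 * (Cω g * Cd)) ?_
    filter_upwards [hCω g, hCd, hp.ae_le_one 0, ho 0] with x h1 h2 h3 h4
    rw [norm_mul, norm_mul, Real.norm_of_nonneg h4.le]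
    refine mul_le_mul h3 (mul_le_mul h1 h2 (norm_nonneg _) ((abs_nonneg _).trans h1))
      (by positivity) zero_le_one
  rw [Finset.sum_congr rfl fun g _ => hg g, ← integral_finsetSum _ fun g _ => hig g]
  -- The weighted control trends reproduce the untreated trend of the treated group; this is the
  -- only place where the identifying assumption enters.
  have hs : ∫ x, ∑ g, p 0 x * (ω g x * d g x) ∂pop.FX = ∫ x, p 0 x * d0 x ∂pop.FX := by
    refine integral_congr_ae (h0.mono fun x hx => ?_)
    simp only
    rw [hx, Finset.mul_sum]
  rw [hs, ← hp.integral_grp ho 0 hd0.1]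
  have hem : Measurable fun s : Obs J R E => 1 * (ind 0 s * (dY s - m (cov s))) :=
    ((measurable_ind 0).mul (measurable_dY.sub (hm.1.comp measurable_cov))).const_mul 1
  rw [integral_law hem]
  simp only [one_mul]
  rw [integral_ind_mul, att, integral_cond_eq, pi1]
  have hπ : pop.P.real (pop.grp 0) ≠ 0 := (measureReal_ne_zero_iff (measure_ne_top _ _)).2 hA0
  rw [mul_inv_cancel_left₀ hπ]
  have he0 : Integrable (fun a => dY (pop.obs a) - m (pop.X a)) (pop.P.restrict (pop.grp 0)) :=
    (integrable_cond_iff hA0).1 ((hB.1 0).1.integrable one_le_two)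
  have hd0i : Integrable (fun a => pop.Y0 (Fin.last (R + 1)) a -
      pop.Y0 (Fin.last R).castSucc a - m (pop.X a)) (pop.P.restrict (pop.grp 0)) :=
    (integrable_cond_iff hA0).1 hd0.2.1
  -- By no anticipation the period before treatment cancels for treated units, and the effect in the
  -- last period remains.
  have hE : (fun a => dY (pop.obs a) - m (pop.X a) - (pop.Y0 (Fin.last (R + 1)) a -
      pop.Y0 (Fin.last R).castSucc a - m (pop.X a))) =ᵐ[pop.P.restrict (pop.grp 0)]
      fun a => pop.Y1 (Fin.last (R + 1)) a - pop.Y0 (Fin.last (R + 1)) a := by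
    filter_upwards [ae_restrict_mem (pop.measurableSet_grp 0), ae_restrict_of_ae (hna (Fin.last R))]
      with a ha hb
    have ha' : pop.G a = 0 := ha
    simp only [dY, obs, Y, ha', if_true, hb]
    ring
  have h1 := (hd0.setIntegral_mul pop.measurable_X hA0 (u := fun _ => 1) measurable_const
    (by simpa using hd0i)).2
  simp only [one_mul] at h1
  rw [← h1, ← integral_congr_ae hE, integral_sub he0 hd0i]
  rfl

/-- Under parallel trends the trend of the control groups is that of each group. -/
lemma ParallelTrends.trend_eq (hPT : pop.ParallelTrends) (hB : pop.BoundedMoments m p ω)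
    (hp : pop.IsPropensity p) (ho : pop.Overlap p) (hm : pop.IsControlTrend m) :
    (∀ g : Fin (J + 1), IsCondMean pop.P pop.X (pop.grp g.succ)
      (fun a => dY (pop.obs a) - m (pop.X a)) fun _ => 0) ∧
    IsCondMean pop.P pop.X (pop.grp 0) (fun a => pop.Y0 (Fin.last (R + 1)) a -
      pop.Y0 (Fin.last R).castSucc a - m (pop.X a)) fun _ => 0 := by
  obtain ⟨τ, hτ, hτe⟩ := hPT
  have hmi := integrable_trend hB hp ho hm
  have hsub := fun g => (hτ g).sub
    (isCondMean_comp pop.measurable_X hm.1 (integrable_comp_X_cond hp ho hmi g))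
  have hd : ∀ g : Fin (J + 1), IsCondMean pop.P pop.X (pop.grp g.succ)
      (fun a => dY (pop.obs a) - m (pop.X a)) (fun x => τ 0 x - m x) := by
    intro g
    refine (hsub g.succ).congr ?_ ((hτ 0).1.sub hm.1) ?_
    · filter_upwards [ae_cond_grp_mem g.succ] with a ha
      rw [obs_dY_of_ne (by rw [ha]; exact Fin.succ_ne_zero g)]
    · filter_upwards [ae_cond_grp_of_ae g.succ (hτe g)] with a ha
      simp only [Function.comp_apply, ha]
  obtain ⟨C, hC⟩ := ae_bounded_of_isCondMean_resid hB hp ho (hd 0)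
  have hdm : Measurable fun x => τ 0 x - m x := (hτ 0).1.sub hm.1
  have hAc := measure_compl_grp_ne_zero hp ho
  have hCX : ∀ᵐ a ∂pop.P, ‖τ 0 (pop.X a) - m (pop.X a)‖ ≤ C :=
    ae_of_ae_map pop.measurable_X.aemeasurable hC
  have hcm : IsCondMean pop.P pop.X (pop.grp 0)ᶜ (fun a => dY (pop.obs a) - m (pop.X a))
      (fun x => m x - m x) :=
    IsCondMean.sub hm (isCondMean_comp pop.measurable_X hm.1
      ((integrable_cond_iff hAc).2 (integrable_comp_X hmi).restrict))
  have hei := (integrable_cond_iff hAc).1 hcm.2.1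
  have hdei : Integrable (fun a => (τ 0 (pop.X a) - m (pop.X a)) *
      (dY (pop.obs a) - m (pop.X a))) (pop.P.restrict (pop.grp 0)ᶜ) :=
    hei.bdd_mul (hdm.comp pop.measurable_X).aestronglyMeasurable (ae_restrict_of_ae hCX)
  -- With `δ = τ_1 - m_Δ`, where `τ_1` is the trend of the treated group: `ΔY - m_Δ(X)` has
  -- conditional mean zero over the pooled controls, and in each control group it has mean `δ(X)`.
  -- Testing with `δ` itself gives `∑_g ∫ p_g δ² = 0`, and positivity of `p_g` forces `δ = 0`.
  have h1 := (hcm.setIntegral_mul pop.measurable_X hAc hdm hdei).2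
  simp only [sub_self, mul_zero, integral_zero] at h1
  have hU : (pop.grp 0)ᶜ = ⋃ g : Fin (J + 1), pop.grp g.succ := by
    ext a
    simp only [Set.mem_compl_iff, Set.mem_iUnion, grp, Set.mem_ofPred_eq]
    exact ⟨fun h => (Fin.exists_succ_eq.2 h).imp fun g hg => hg.symm,
      fun ⟨g, hg⟩ h0 => Fin.succ_ne_zero g (hg.symm.trans h0)⟩
  have hdj : Pairwise (Function.onFun Disjoint fun g : Fin (J + 1) => pop.grp g.succ) := by
    intro g g' hgg
    refine Set.disjoint_left.2 fun a ha hb => hgg ?_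
    exact Fin.succ_injective _ ((show pop.G a = g.succ from ha).symm.trans hb)
  have hsg : ∀ g : Fin (J + 1), ∫ a in pop.grp g.succ, (τ 0 (pop.X a) - m (pop.X a)) *
      (dY (pop.obs a) - m (pop.X a)) ∂pop.P = ∫ x, p g.succ x * (τ 0 x - m x) ^ 2 ∂pop.FX := by
    intro g
    rw [((hd g).setIntegral_mul pop.measurable_X (hp.measure_grp_ne_zero ho g.succ) hdm
      (hdei.mono_measure (Measure.restrict_mono (grp_succ_subset g) le_rfl))).2,
      hp.integral_grp ho g.succ (u := fun x => (τ 0 x - m x) * (τ 0 x - m x)) (hdm.mul hdm)]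
    simp only [sq]
  rw [hU, integral_iUnion_fintype (fun g => pop.measurableSet_grp g.succ) hdj
    (fun g => (hdei.mono_measure (Measure.restrict_mono (grp_succ_subset g) le_rfl))),
    Finset.sum_congr rfl fun g _ => hsg g] at h1
  have hnn : ∀ g : Fin (J + 1), 0 ≤ᵐ[pop.FX] fun x => p g.succ x * (τ 0 x - m x) ^ 2 := fun g => by
    filter_upwards [ho g.succ] with x hx
    simp only [Pi.zero_apply]
    positivity
  have h2 := (Finset.sum_eq_zero_iff_of_nonneg fun g _ => integral_nonneg_of_ae (hnn g)).1 h1 0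
    (Finset.mem_univ _)
  have hi : Integrable (fun x => p (Fin.succ 0) x * (τ 0 x - m x) ^ 2) pop.FX := by
    refine Integrable.of_bound ((hp _).1.mul (hdm.pow_const 2)).aestronglyMeasurable
      (1 * C ^ 2) ?_
    filter_upwards [hC, hp.ae_le_one (Fin.succ 0), ho (Fin.succ 0)] with x k1 k2 k3
    rw [norm_mul, norm_pow, Real.norm_of_nonneg k3.le]
    exact mul_le_mul k2 (pow_le_pow_left₀ (norm_nonneg _) k1 2) (by positivity) zero_le_one
  have h3 : ∀ᵐ x ∂pop.FX, τ 0 x - m x = 0 := by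
    filter_upwards [(integral_eq_zero_iff_of_nonneg_ae (hnn 0) hi).1 h2, ho (Fin.succ 0)]
      with x k1 k2
    simp only [Pi.zero_apply, mul_eq_zero, k2.ne', false_or] at k1
    exact pow_eq_zero_iff two_ne_zero |>.1 k1
  refine ⟨fun g => (hd g).congr (EventuallyEq.refl _ _) measurable_const ?_,
    (hsub 0).congr (EventuallyEq.refl _ _) measurable_const ?_⟩
  · filter_upwards [ae_cond_grp_of_ae g.succ h3] with a ha using ha
  · filter_upwards [ae_cond_grp_of_ae 0 h3] with a ha using ha

end Population

end PanelATT

/-! ### Expansion over all folds and the parallel trends case -/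

namespace PanelATT

section Scores

variable {Ω₀ Ω E : Type*} [MeasurableSpace Ω₀] [MeasurableSpace Ω] [mE : MeasurableSpace E]
  {Pr : Measure Ω} [IsProbabilityMeasure Pr] {J R L : ℕ} {fold : FoldMap L}
  {pop : Population Ω₀ E J R} {S : ℕ → Ω → Obs J R E} {V W : ℕ → Ω → ℝ}
  {ν : Measure ℝ} [IsProbabilityMeasure ν]
  {p : Fin (J + 2) → E → ℝ} {m : E → ℝ} {ω : Fin (J + 1) → E → ℝ}

/-- The effect of the first stage on the sum of the moment functions over all folds. -/
lemma smallProb_sum_phi (hL : 0 < L) (hD : IsWeightedSample Pr pop.law ν S V)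
    (hfold : fold.Balanced) (hB : pop.BoundedMoments m p ω) (hp : pop.IsPropensity p)
    (ho : pop.Overlap p) (hm : Measurable m) (hω : ∀ g, Measurable (ω g))
    {d : Fin (J + 1) → E → ℝ}
    (hd : ∀ g : Fin (J + 1), IsCondMean pop.P pop.X (pop.grp g.succ)
      (fun a => dY (pop.obs a) - m (pop.X a)) (d g))
    {mE : Estimator fold (Obs J R E × ℝ) E} {rE wE : Fin (J + 1) → Estimator fold (Obs J R E × ℝ) E}
    (hmE : mE.IsMeas) (hrE : ∀ g, (rE g).IsMeas) (hwE : ∀ g, (wE g).IsMeas)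
    (hF : FirstStage Pr pop.FX m (ratio p) ω (mE.eval (withWeights S V))
      (fun g => (rE g).eval (withWeights S V)) (fun g => (wE g).eval (withWeights S V))) (θ : ℝ) :
    SmallProb Pr fun k η => ‖(√((L * k : ℕ) : ℝ))⁻¹ * (∑ ℓ : Fin L,
        ∑ i : Fin (L * k) with fold k i = ℓ, V i η * (phi (S i η) (mE.eval (withWeights S V) k ℓ η)
          (fun g => (rE g).eval (withWeights S V) k ℓ η)
          (fun g => (wE g).eval (withWeights S V) k ℓ η) 1 - θ * ind 0 (S i η))) -
      (√((L * k : ℕ) : ℝ))⁻¹ * ∑ i ∈ Finset.range (L * k), V i η *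
        (phi (S i η) m (ratio p) ω 1 - θ * ind 0 (S i η)) +
      ∑ ℓ : Fin L, (√((L * k : ℕ) : ℝ))⁻¹ * (k * ∑ g, ∫ x, ((wE g).eval (withWeights S V) k ℓ η x *
          (rE g).eval (withWeights S V) k ℓ η x - ω g x * ratio p g x) *
            (p g.succ x * d g x) ∂pop.FX)‖ₑ := by
  have h := SmallProb.enorm_sum (Finset.univ : Finset (Fin L)) fun ℓ _ =>
    smallProb_fold_sum_phi hL hD hfold (fun g => Population.hasCondMoment_ind hp ho g)
    ho (fun g => Population.hasCondMoment_resid hB hp ho hm g.succ (hd g)) hm hω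
    (fun g => Population.ae_abs_ratio_le hB hp ho g) hmE hrE hwE hF ℓ
  refine h.mono fun k η => le_of_eq ?_
  congr 1
  rw [Finset.sum_add_distrib, ← sum_folds_eq_sum_range (fold := fold) k fun i => V i η *
    (phi (S i η) m (ratio p) ω 1 - θ * ind 0 (S i η))]
  congr 1
  rw [← mul_sub, ← Finset.sum_sub_distrib, Finset.mul_sum]
  refine Finset.sum_congr rfl fun ℓ _ => ?_
  rw [← Finset.sum_sub_distrib]
  congr 1
  exact Finset.sum_congr rfl fun i _ => by ring

/-- An estimator that ignores the weights. -/
def Estimator.ignoreWeights {A : Type*} (est : Estimator fold A E) : Estimator fold (A × ℝ) E :=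
  fun k ℓ d x => est k ℓ (fun i => (d i).1) x

lemma Estimator.IsMeas.ignoreWeights {A : Type*} [MeasurableSpace A] {est : Estimator fold A E}
    (h : est.IsMeas) : est.ignoreWeights.IsMeas := fun k ℓ => by
  have h1 : Measurable fun (q : (Train fold k ℓ → A × ℝ) × E) (i : Train fold k ℓ) => (q.1 i).1 :=
    measurable_pi_iff.2 fun i => measurable_fst.comp ((measurable_pi_apply i).comp measurable_fst)
  exact (h k ℓ).comp (h1.prodMk measurable_snd)

lemma psiPT_eq {π : ℝ} (θ : ℝ) (hπ : π ≠ 0) (s : Obs J R E) :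
    π * psiPT m p ω π θ s = phi s m (ratio p) ω 1 - θ * ind 0 s := by
  simp only [psiPT, phi]
  field_simp

lemma measurable_psiPT (hm : Measurable m) (hp : ∀ g, Measurable (p g))
    (hω : ∀ g, Measurable (ω g)) (π θ : ℝ) : Measurable (psiPT (J := J) (R := R) m p ω π θ) :=
  (measurable_phi hm (measurable_ratio hp) hω π).sub
    (((measurable_ind 0).const_mul θ).div_const π)

lemma memLp_ind (g : Fin (J + 2)) : MemLp (ind g : Obs J R E → ℝ) 2 pop.law :=
  MemLp.of_bound (measurable_ind g).aestronglyMeasurable 1 (Eventually.of_forall fun s => by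
    unfold ind; split_ifs <;> simp)

lemma integral_score_eq_zero
    (h : MemLp (fun s => phi s m (ratio p) ω 1) 2 pop.law ∧
      ∫ s, phi s m (ratio p) ω 1 ∂pop.law = pop.pi1 * pop.att) :
    ∫ s, (phi s m (ratio p) ω 1 - pop.att * ind 0 s) ∂pop.law = 0 := by
  rw [integral_sub (h.1.integrable one_le_two)
    (((memLp_ind 0).const_mul _).integrable one_le_two), h.2, integral_const_mul,
    integral_ind_zero]
  ring

/-- Bootstrap consistency under parallel trends. -/
theorem bootstrapConsistent_parallelTrends (hL : 0 < L) (hfold : fold.Balanced)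
    {mHat : Estimator fold (Obs J R E) E} {rHat wHat : Fin (J + 1) → Estimator fold (Obs J R E) E}
    {mStar : Estimator fold (Obs J R E × ℝ) E}
    {rStar wStar : Fin (J + 1) → Estimator fold (Obs J R E × ℝ) E}
    (hS : IsSample pop Pr S) (hW : IsBootstrapWeights Pr S W)
    (hna : pop.NoAnticipation) (hp : pop.IsPropensity p) (ho : pop.Overlap p)
    (hPT : pop.ParallelTrends) (hm : pop.IsControlTrend m) (hω : ∀ g, Measurable (ω g))
    (hB : pop.BoundedMoments m p ω) (hmH : mHat.IsMeas) (hrH : ∀ g, (rHat g).IsMeas)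
    (hwH : ∀ g, (wHat g).IsMeas) (hmS : mStar.IsMeas) (hrS : ∀ g, (rStar g).IsMeas)
    (hwS : ∀ g, (wStar g).IsMeas)
    (hF : FirstStage Pr pop.FX m (ratio p) ω
      (mHat.eval S) (fun g => (rHat g).eval S) (fun g => (wHat g).eval S))
    (hF' : FirstStage Pr pop.FX m (ratio p) ω (mStar.eval (withWeights S W))
      (fun g => (rStar g).eval (withWeights S W)) (fun g => (wStar g).eval (withWeights S W)))
    (hmom : ∃ δ : ℝ, 0 < δ ∧
      Integrable (fun a => |psiPT m p ω pop.pi1 pop.att (pop.obs a)| ^ (2 + δ)) pop.P)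
    (hpos : 0 < ∫ a, psiPT m p ω pop.pi1 pop.att (pop.obs a) ^ 2 ∂pop.P) :
    BootstrapConsistent L Pr S pop.att
      (thetaEst fold S unitWeights
        (mHat.eval S) (fun g => (rHat g).eval S) (fun g => (wHat g).eval S))
      (thetaEst fold S W (mStar.eval (withWeights S W))
        (fun g => (rStar g).eval (withWeights S W))
        (fun g => (wStar g).eval (withWeights S W))) := by
  have hD := hS.isWeightedSample_unit
  have hD' := hS.isWeightedSample hW
  have : IsProbabilityMeasure (Pr.map (W 0)) :=
    Measure.isProbabilityMeasure_map (hW.1 0).aemeasurable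
  have hπ := (Population.pi1_pos hp ho).ne'
  obtain ⟨hd, hd0⟩ := hPT.trend_eq hB hp ho hm
  have hmo := Population.integral_phi hB hp ho hna hm hω hd hd0
    (Eventually.of_forall fun x => by simp)
  have hψ : Measurable (psiPT (J := J) (R := R) m p ω pop.pi1 pop.att) :=
    measurable_psiPT hm.1 (fun g => (hp g).1) hω _ _
  -- An estimator that discards the weights, evaluated on data with unit weights, is definitionally
  -- the original estimator; hence `hF` fits as it stands.
  have h1 := smallProb_sum_phi hL hD hfold hB hp ho hm.1 hω hd hmH.ignoreWeights
    (fun g => (hrH g).ignoreWeights) (fun g => (hwH g).ignoreWeights) hF pop.att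
  have h2 := smallProb_sum_phi hL hD' hfold hB hp ho hm.1 hω hd hmS hrS hwS hF' pop.att
  -- Here every `d_g` is zero, so the whole bias term disappears.
  simp only [mul_zero, integral_zero, Finset.sum_const_zero, add_zero] at h1 h2
  refine bootstrapConsistent_of_scores hL hS hW hp ho
    (fun k ℓ => hmH.eval hS.1 k ℓ) (fun g k ℓ => (hrH g).eval hS.1 k ℓ)
    (fun g k ℓ => (hwH g).eval hS.1 k ℓ) (fun k ℓ => hmS.eval hD'.measurable k ℓ)
    (fun g k ℓ => (hrS g).eval hD'.measurable k ℓ) (fun g k ℓ => (hwS g).eval hD'.measurable k ℓ)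
    hψ ((memLp_map_measure_iff hψ.aestronglyMeasurable pop.measurable_obs.aemeasurable).2
      (memLp_two_of_integrable_rpow (hψ.comp pop.measurable_obs) hmom)) ?_
    (by rw [Population.integral_law (hψ.pow_const 2)]; exact hpos) ?_ ?_
  · have h3 := integral_score_eq_zero hmo
    simp only [← psiPT_eq _ hπ] at h3
    rw [integral_const_mul] at h3
    exact (mul_eq_zero.1 h3).resolve_left hπ
  · simp only [psiPT_eq _ hπ]
    exact h1
  · simp only [psiPT_eq _ hπ]
    exact h2

end Scores

end PanelATT

/-! ### Kernel smoothing -/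

namespace PanelATT

section Smoothing

/-- Translations are measure preserving and depend continuously on the shift, so they act
continuously on `L¹`. -/
lemma tendsto_eLpNorm_translate {g : ℝ → ℝ} (hg : MemLp g 1 volume) :
    Tendsto (fun t => eLpNorm (fun y => g (y - t) - g y) 1 volume) (𝓝 (0 : ℝ)) (𝓝 0) := by
  let T : C(ℝ, C(ℝ, ℝ)) :=
    (⟨fun a : ℝ × ℝ => a.2 - a.1, by fun_prop⟩ : C(ℝ × ℝ, ℝ)).curry
  have hmp : ∀ t, MeasurePreserving (T t) volume volume := fun t =>
    measurePreserving_sub_right volume t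
  have : Fact ((1 : ℝ≥0∞) ≤ 1) := ⟨le_rfl⟩
  have hc := (continuous_const (y := hg.toLp g)).compMeasurePreservingLp T.continuous hmp
    ENNReal.one_ne_top
  simp only [Lp.toLp_compMeasurePreserving] at hc
  have h1 := (Lp.tendsto_Lp_iff_tendsto_eLpNorm'' _ (fun t => hg.comp_measurePreserving (hmp t)) _
    (hg.comp_measurePreserving (hmp 0))).1 (hc.tendsto 0)
  refine h1.congr fun t => ?_
  congr 1
  funext y
  simp [T]

/-- The integral of a non-integrable function is zero by default, whereas the kernel has integral
one. -/
lemma IsKernel.integrable {K : ℝ → ℝ} (hK : IsKernel K) : Integrable K := by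
  by_contra h
  have h1 := hK.2.2.2.1
  rw [integral_undef h] at h1
  exact zero_ne_one h1

/-- The convolution of `g` with the kernel `K(· / h) / h`. -/
noncomputable def smoothing (K : ℝ → ℝ) (h : ℝ) (g : ℝ → ℝ) (y : ℝ) : ℝ :=
  ∫ x, g x * (K ((y - x) / h) / h)

lemma smoothing_eq (K : ℝ → ℝ) {h : ℝ} (hh : 0 < h) (g : ℝ → ℝ) (y : ℝ) :
    smoothing K h g y = ∫ u, g (y - h * u) * K u := by
  have h1 : smoothing K h g y = ∫ x, (fun z => g (y - z) * (K (z / h) / h)) (y - x) := by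
    simp only [smoothing, sub_sub_cancel]
  rw [h1, integral_sub_left_eq_self (fun z => g (y - z) * (K (z / h) / h)) volume y]
  have h2 : ∀ z, g (y - z) * (K (z / h) / h) = (fun u => g (y - h * u) * K u / h) (z / h) := by
    intro z
    simp only [mul_div_cancel₀ z hh.ne', mul_div_assoc]
  simp only [h2]
  rw [Measure.integral_comp_div (fun u => g (y - h * u) * K u / h) h, abs_of_pos hh,
    integral_div, smul_eq_mul, mul_div_cancel₀ _ hh.ne']

variable {K : ℝ → ℝ} {g : ℝ → ℝ} {C : ℝ}

lemma integrable_translate_mul_kernel (hK : IsKernel K) (hg : Measurable g) (hC : ∀ x, |g x| ≤ C)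
    (h y : ℝ) : Integrable fun u => g (y - h * u) * K u :=
  hK.integrable.bdd_mul (c := C) (hg.comp (by fun_prop)).aestronglyMeasurable
    (Eventually.of_forall fun u => hC _)

lemma abs_smoothing_le (hK : IsKernel K) (hC : ∀ x, |g x| ≤ C) {h : ℝ}
    (hh : 0 < h) (y : ℝ) : |smoothing K h g y| ≤ C := by
  rw [smoothing_eq K hh]
  refine (norm_integral_le_of_norm_le (f := fun u => g (y - h * u) * K u) (hK.integrable.const_mul C)
    (Eventually.of_forall fun u => ?_)).trans ?_
  · rw [norm_mul, Real.norm_of_nonneg (hK.2.1 u)]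
    exact mul_le_mul_of_nonneg_right (hC _) (hK.2.1 u)
  · rw [integral_const_mul, hK.2.2.2.1, mul_one]

lemma measurable_smoothing (hK : IsKernel K) (hg : Measurable g) (h : ℝ) :
    Measurable (smoothing K h g) := by
  have h1 : Measurable fun q : ℝ × ℝ => g q.2 * (K ((q.1 - q.2) / h) / h) :=
    (hg.comp measurable_snd).mul ((hK.1.comp (by fun_prop)).div_const h)
  exact (h1.stronglyMeasurable.integral_prod_right' (ν := volume)).measurable

/-- As the kernel has mass one, the smoothing error at `y` is an average of the translation errors
`g (y - h u) - g y`. Exchanging the integrals gives the bound. -/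
lemma lintegral_smoothing_sub_le (hK : IsKernel K) (hg : Measurable g) (hC : ∀ x, |g x| ≤ C)
    {h : ℝ} (hh : 0 < h) : ∫⁻ y, ‖smoothing K h g y - g y‖ₑ ≤
      ∫⁻ u, ‖K u‖ₑ * eLpNorm (fun y => g (y - h * u) - g y) 1 volume := by
  have h1 : ∀ y, ‖smoothing K h g y - g y‖ₑ ≤ ∫⁻ u, ‖K u‖ₑ * ‖g (y - h * u) - g y‖ₑ := by
    intro y
    have e : smoothing K h g y - g y = ∫ u, K u * (g (y - h * u) - g y) := by
      have e1 : ∀ u, K u * (g (y - h * u) - g y) = g (y - h * u) * K u - g y * K u := fun u => by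
        ring
      simp only [e1]
      rw [integral_sub (integrable_translate_mul_kernel hK hg hC h y) (hK.integrable.const_mul _),
        integral_const_mul, hK.2.2.2.1, mul_one, smoothing_eq K hh]
    rw [e]
    refine (enorm_integral_le_lintegral_enorm _).trans (le_of_eq ?_)
    simp only [enorm_mul]
  refine (lintegral_mono h1).trans (le_of_eq ?_)
  have hm : Measurable fun q : ℝ × ℝ => ‖K q.2‖ₑ * ‖g (q.1 - h * q.2) - g q.1‖ₑ :=
    (hK.1.comp measurable_snd).enorm.mul
      ((hg.comp (by fun_prop)).sub (hg.comp measurable_fst)).enorm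
  rw [lintegral_lintegral_swap hm.aemeasurable]
  refine lintegral_congr fun u => ?_
  have hm2 : Measurable fun y => ‖g (y - h * u) - g y‖ₑ := ((hg.comp (by fun_prop)).sub hg).enorm
  rw [lintegral_const_mul _ hm2, eLpNorm_one_eq_lintegral_enorm]

/-- Dominated convergence in the kernel variable: each translation error tends to zero in `L¹` and
is at most twice the norm of `g`. No smoothness of `g` is needed, since no rate is claimed. -/
lemma tendsto_lintegral_smoothing_sub (hK : IsKernel K) (hg : Measurable g) (hC : ∀ x, |g x| ≤ C)
    (hgi : Integrable g) {h : ℕ → ℝ} (hh : ∀ k, 0 < h k) (hh0 : Tendsto h atTop (𝓝 0)) :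
    Tendsto (fun k => ∫⁻ y, ‖smoothing K (h k) g y - g y‖ₑ) atTop (𝓝 0) := by
  have hg1 : MemLp g 1 volume := memLp_one_iff_integrable.2 hgi
  refine tendsto_of_tendsto_of_tendsto_of_le_of_le tendsto_const_nhds (h := fun k =>
    ∫⁻ u, ‖K u‖ₑ * eLpNorm (fun y => g (y - h k * u) - g y) 1 volume) ?_ (fun _ => zero_le)
    fun k => lintegral_smoothing_sub_le hK hg hC (hh k)
  have hlim := tendsto_lintegral_of_dominated_convergence (μ := (volume : Measure ℝ))
    (F := fun k u => ‖K u‖ₑ * eLpNorm (fun y => g (y - h k * u) - g y) 1 volume)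
    (f := fun _ => 0) (fun u => ‖K u‖ₑ * (eLpNorm g 1 volume + eLpNorm g 1 volume)) ?_ ?_ ?_ ?_
  · simpa using hlim
  · intro k
    simp only [eLpNorm_one_eq_lintegral_enorm]
    have hm : Measurable fun q : ℝ × ℝ => ‖g (q.2 - h k * q.1) - g q.2‖ₑ :=
      ((hg.comp (by fun_prop)).sub (hg.comp measurable_snd)).enorm
    exact hK.1.enorm.mul hm.lintegral_prod_right'
  · intro k
    refine Eventually.of_forall fun u => mul_le_mul_right ?_ _
    have h2 := eLpNorm_comp_measurePreserving (p := 1) (g := g) hg.aestronglyMeasurable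
      (measurePreserving_sub_right volume (h k * u))
    refine (eLpNorm_sub_le (f := fun y => g (y - h k * u)) (g := g)
      (hg.comp (by fun_prop)).aestronglyMeasurable hg.aestronglyMeasurable le_rfl).trans ?_
    rw [← h2]
    rfl
  · have hm : ∫⁻ u, ‖K u‖ₑ * (eLpNorm g 1 volume + eLpNorm g 1 volume) =
        (∫⁻ u, ‖K u‖ₑ) * (eLpNorm g 1 volume + eLpNorm g 1 volume) :=
      lintegral_mul_const _ hK.1.enorm
    rw [hm]
    exact ENNReal.mul_ne_top hK.integrable.2.ne (ENNReal.add_ne_top.2 ⟨hg1.2.ne, hg1.2.ne⟩)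
  · refine Eventually.of_forall fun u => ?_
    have h3 : Tendsto (fun k => h k * u) atTop (𝓝 0) := by simpa using hh0.mul_const u
    have h4 := (tendsto_eLpNorm_translate hg1).comp h3
    simpa using ENNReal.Tendsto.const_mul h4 (Or.inr (enorm_ne_top (x := K u)))

/-- Convergence in `L²` of the smoothed function, with respect to any finite measure that is
absolutely continuous. -/
lemma tendsto_lintegral_sq_smoothing_sub (hK : IsKernel K) (hg : Measurable g)
    (hC : ∀ x, |g x| ≤ C) (hgi : Integrable g) {h : ℕ → ℝ} (hh : ∀ k, 0 < h k)
    (hh0 : Tendsto h atTop (𝓝 0)) {ρ : Measure ℝ} [IsFiniteMeasure ρ] (hρ : ρ ≪ volume) :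
    Tendsto (fun k => ∫⁻ y, ‖smoothing K (h k) g y - g y‖ₑ ^ 2 ∂ρ) atTop (𝓝 0) := by
  have hL1 := tendsto_lintegral_smoothing_sub hK hg hC hgi hh hh0
  have hms := fun k => measurable_smoothing hK hg (h k)
  -- Convergence in `L¹` gives almost everywhere convergence along a subsequence of any given
  -- subsequence. It passes to `ρ` by absolute continuity, and bounded convergence gives the `L²`
  -- limit.
  refine tendsto_of_subseq_tendsto fun ns hns => ?_
  have hin : TendstoInMeasure volume (fun j => smoothing K (h (ns j)) g) atTop g := by
    refine tendstoInMeasure_of_tendsto_eLpNorm (p := 1) one_ne_zero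
      (fun j => (hms _).aestronglyMeasurable) hg.aestronglyMeasurable ?_
    simp only [eLpNorm_one_eq_lintegral_enorm]
    exact hL1.comp hns
  obtain ⟨ms, -, hms'⟩ := hin.exists_seq_tendsto_ae
  refine ⟨ms, ?_⟩
  have hlim := tendsto_lintegral_of_dominated_convergence (μ := ρ)
    (F := fun j y => ‖smoothing K (h (ns (ms j))) g y - g y‖ₑ ^ 2) (f := fun _ => 0)
    (fun _ => ENNReal.ofReal (C + C) ^ 2)
    (fun j => ((hms _).sub hg).enorm.pow_const 2) ?_ ?_ ?_
  · simpa using hlim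
  · intro j
    refine Eventually.of_forall fun y => ?_
    simp only
    gcongr
    rw [Real.enorm_eq_ofReal_abs]
    refine ENNReal.ofReal_le_ofReal ((abs_sub _ _).trans (add_le_add ?_ (hC y)))
    exact abs_smoothing_le hK hC (hh _) y
  · rw [lintegral_const]
    exact ENNReal.mul_ne_top (ENNReal.pow_ne_top ENNReal.ofReal_ne_top) (measure_ne_top _ _)
  · filter_upwards [hρ.ae_le hms'] with y hy
    have h1 : Tendsto (fun j => smoothing K (h (ns (ms j))) g y - g y) atTop (𝓝 0) := by
      simpa using hy.sub_const (g y)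
    have h2 := ENNReal.Tendsto.pow (n := 2) h1.enorm
    simpa using h2

end Smoothing

end PanelATT

/-! ### Integrals of estimators with a Bahadur representation -/

namespace PanelATT

section Bahadur

variable {Ω : Type*} [MeasurableSpace Ω] {Pr : Measure Ω} [IsProbabilityMeasure Pr] {J R L : ℕ}
  {fold : FoldMap L} {μ : Measure (Obs J R ℝ)} [IsProbabilityMeasure μ]
  {ν : Measure ℝ} [IsProbabilityMeasure ν] {FX : Measure ℝ} [IsProbabilityMeasure FX]
  {S : ℕ → Ω → Obs J R ℝ} {V : ℕ → Ω → ℝ}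
  {K f : ℝ → ℝ} {h : ℕ → ℝ} {ξ : Obs J R ℝ → ℝ}

lemma card_train_add (hfold : fold.Balanced) (k : ℕ) (ℓ : Fin L) :
    Fintype.card (Train fold k ℓ) + k = L * k := by
  have h1 := hfold k ℓ
  have h2 := Finset.card_filter_add_card_filter_not (s := (Finset.univ : Finset (Fin (L * k))))
    (fun i => fold k i = ℓ)
  rw [Finset.card_univ, Fintype.card_fin, h1] at h2
  rw [Fintype.card_subtype]
  simp only [ne_eq]
  omega

lemma IsWeightedSample.map_fst (hD : IsWeightedSample Pr μ ν S V) (i : ℕ) : Pr.map (S i) = μ := by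
  have h1 : Pr.map (S i) = (Pr.map (withWeights S V i)).map Prod.fst := by
    rw [Measure.map_map _root_.measurable_fst (hD.measurable i)]
    rfl
  rw [h1, hD.map_eq, Measure.map_fst_prod, measure_univ, one_smul]

/-- Averages over the training sample of a mean zero function whose second moment vanishes. -/
lemma smallProb_train_average (hL : 2 ≤ L) (hD : IsWeightedSample Pr μ ν S V)
    (hfold : fold.Balanced) (ℓ : Fin L) {F : ℕ → Obs J R ℝ → ℝ} (hF : ∀ k, Measurable (F k))
    (hF0 : ∀ k, ∫ s, F k s ∂μ = 0)
    (hF2 : Tendsto (fun k => ∫⁻ s, ‖F k s‖ₑ ^ 2 ∂μ) atTop (𝓝 0)) :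
    SmallProb Pr fun k η => ‖√((L * k : ℕ) : ℝ) * ((1 / (Fintype.card (Train fold k ℓ) : ℝ)) *
      ∑ i : Train fold k ℓ, V i.1 η * F k (S i.1 η))‖ₑ := by
  have hFm : ∀ k, Measurable fun y : Obs J R ℝ × ℝ => y.2 * F k y.1 := fun k =>
    measurable_snd.mul ((hF k).comp measurable_fst)
  have hm : ∀ k, Measurable fun η => ∑ i : Train fold k ℓ, V i.1 η * F k (S i.1 η) := fun k =>
    Finset.measurable_fun_sum _ fun i _ => (hFm k).comp (hD.measurable i.1)
  refine SmallProb.sqrt (SmallProb.of_lintegral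
    (fun k => (((hm k).const_mul _).const_mul _).enorm.pow_const 2 |>.aemeasurable) ?_)
  have hc : (2 : ℝ≥0∞) * ∫⁻ v, ‖v‖ₑ ^ 2 ∂ν ≠ ∞ := by
    refine ENNReal.mul_ne_top ENNReal.ofNat_ne_top ?_
    rw [← eLpNorm_two_sq ν (fun v => v)]
    exact ENNReal.pow_ne_top hD.memLp.2.ne
  have hlim := ENNReal.Tendsto.const_mul hF2 (Or.inr hc)
  rw [mul_zero] at hlim
  refine tendsto_of_tendsto_of_tendsto_of_le_of_le tendsto_const_nhds hlim (fun _ => zero_le)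
    fun k => ?_
  have h1 := lintegral_sq_sum_sub_le (Pr := Pr)
    (D := fun i : Train fold k ℓ => withWeights S V i.1) (fun i => hD.measurable i.1)
    (hD.indep.precomp (Fin.val_injective.comp Subtype.val_injective)) (fun i => hD.map_eq i.1)
    Finset.univ (hFm k)
  rw [hD.integral_mul, hF0] at h1
  simp only [sub_zero, withWeights] at h1
  have e : ∀ y : Obs J R ℝ × ℝ, ‖y.2 * F k y.1‖ₑ ^ 2 = ‖F k y.1‖ₑ ^ 2 * ‖y.2‖ₑ ^ 2 := fun y => by
    rw [enorm_mul, mul_pow, mul_comm]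
  simp only [e] at h1
  rw [lintegral_prod_mul (f := fun s => ‖F k s‖ₑ ^ 2) (g := fun v => ‖v‖ₑ ^ 2)
    ((hF k).enorm.pow_const 2).aemeasurable (measurable_enorm.pow_const 2).aemeasurable] at h1
  have e2 : ∀ η, ‖√((L * k : ℕ) : ℝ) * ((1 / (Fintype.card (Train fold k ℓ) : ℝ)) *
      ∑ i : Train fold k ℓ, V i.1 η * F k (S i.1 η))‖ₑ ^ 2 =
      ‖√((L * k : ℕ) : ℝ) * (1 / (Fintype.card (Train fold k ℓ) : ℝ))‖ₑ ^ 2 *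
      ‖∑ i : Train fold k ℓ, V i.1 η * F k (S i.1 η)‖ₑ ^ 2 := fun η => by
    rw [← mul_assoc, enorm_mul, mul_pow]
  simp only [e2]
  rw [lintegral_const_mul _ ((hm k).enorm.pow_const 2)]
  refine (mul_le_mul_right h1 _).trans ?_
  rw [Finset.card_univ, ← mul_assoc]
  -- A training sample contains at least half of the units because `L ≥ 2`, hence the constant `2`.
  have h3 : ‖√((L * k : ℕ) : ℝ) * (1 / (Fintype.card (Train fold k ℓ) : ℝ))‖ₑ ^ 2 *
      (Fintype.card (Train fold k ℓ) : ℝ≥0∞) ≤ 2 := by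
    have hcard := card_train_add hfold k ℓ
    have hle : ((L * k : ℕ) : ℝ) ≤ 2 * (Fintype.card (Train fold k ℓ) : ℝ) := by
      have : L * k ≤ 2 * Fintype.card (Train fold k ℓ) := by nlinarith
      exact_mod_cast this
    set N : ℝ := (Fintype.card (Train fold k ℓ) : ℝ) with hN
    have hN0 : 0 ≤ N := Nat.cast_nonneg _
    rw [← enorm_pow, Real.enorm_eq_ofReal (by positivity), mul_pow, Real.sq_sqrt (Nat.cast_nonneg _),
      ← ENNReal.ofReal_natCast, ← ENNReal.ofReal_mul (by positivity), ← hN]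
    rw [show (2 : ℝ≥0∞) = ENNReal.ofReal 2 by simp]
    refine ENNReal.ofReal_le_ofReal ?_
    rcases hN0.eq_or_lt with h0 | h0
    · rw [← h0]; simp
    · have e3 : ((L * k : ℕ) : ℝ) * (1 / N) ^ 2 * N = ((L * k : ℕ) : ℝ) / N := by
        field_simp
      rw [e3, div_le_iff₀ h0]
      exact hle
  refine (mul_le_mul_left h3 _).trans (le_of_eq ?_)
  ring

lemma IsDensity.absolutelyContinuous (hf : IsDensity FX f) : FX ≪ volume := by
  rw [hf.2.2]; exact withDensity_absolutelyContinuous _ _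

lemma IsDensity.integral_eq (hf : IsDensity FX f) (g : ℝ → ℝ) :
    ∫ x, g x ∂FX = ∫ x, f x * g x := by
  rw [hf.2.2, integral_withDensity_eq_integral_toReal_smul hf.1.ennreal_ofReal
    (Eventually.of_forall fun _ => ENNReal.ofReal_lt_top)]
  simp only [ENNReal.toReal_ofReal (hf.2.1 _), smul_eq_mul]

lemma IsDensity.integrable_iff (hf : IsDensity FX f) {g : ℝ → ℝ} :
    Integrable g FX ↔ Integrable fun x => f x * g x := by
  rw [hf.2.2, integrable_withDensity_iff_integrable_smul' hf.1.ennreal_ofReal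
    (Eventually.of_forall fun _ => ENNReal.ofReal_lt_top)]
  simp only [ENNReal.toReal_ofReal (hf.2.1 _), smul_eq_mul]

lemma IsDensity.ae_pos (hf : IsDensity FX f) : ∀ᵐ x ∂FX, 0 < f x := by
  rw [hf.2.2, ae_withDensity_iff hf.1.ennreal_ofReal]
  exact Eventually.of_forall fun x hx => by simpa using hx

lemma ae_mem_support (FX : Measure ℝ) : ∀ᵐ x ∂FX, x ∈ FX.support := Measure.support_mem_ae

/-- Integrals of estimators with a Bahadur representation with a kernel. -/
lemma smallProb_bahadur (hL : 2 ≤ L) (hD : IsWeightedSample Pr μ ν S V)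
    (hfold : fold.Balanced) (ℓ : Fin L) (hμ : μ.map cov = FX) (hf : IsDensity FX f)
    (hcomp : IsCompact FX.support) (hK : IsKernel K) (hh : ∀ k, 0 < h k)
    (hh0 : Tendsto h atTop (𝓝 0)) {G : ℕ → Ω → ℝ → ℝ} {g : ℝ → ℝ}
    (hG : ∀ k η, Measurable (G k η)) (hg : Measurable g) (hξ : Measurable ξ) (hξ2 : MemLp ξ 2 μ)
    (hξ0 : ∀ u : ℝ → ℝ, Measurable u → (∃ C, ∀ x, |u x| ≤ C) → ∫ s, u (cov s) * ξ s ∂μ = 0)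
    {b : ℝ → ℝ} (hb : Measurable b) (hbC : ∃ C : ℝ, ∀ᵐ x ∂FX, |b x| ≤ C)
    (hB : IsLittleOp Pr (fun k η => eLpNorm (fun x => G k η x - g x -
      leadingTerm fold S V K h f ξ k ℓ η x) ∞ FX) (rate L (1 / 2))) :
    SmallProb Pr fun k η => ‖√((L * k : ℕ) : ℝ) * ∫ x, b x * (G k η x - g x) ∂FX -
      √((L * k : ℕ) : ℝ) * ((1 / (Fintype.card (Train fold k ℓ) : ℝ)) *
        ∑ i : Train fold k ℓ, V i.1 η * (b (cov (S i.1 η)) * ξ (S i.1 η)))‖ₑ := by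
  obtain ⟨C', hC'⟩ := hbC
  obtain ⟨C, hC⟩ : ∃ C : ℝ, C = max C' 0 := ⟨_, rfl⟩
  have hC0 : 0 ≤ C := by rw [hC]; exact le_max_right _ _
  let A : Set ℝ := {x | 0 < f x} ∩ FX.support ∩ {x | |b x| ≤ C}
  have hA : MeasurableSet A := ((measurableSet_lt measurable_const hf.1).inter
    hcomp.measurableSet).inter (measurableSet_le hb.abs measurable_const)
  -- A version of `b` that is bounded everywhere, Lebesgue integrable because it vanishes off the
  -- compact support, and zero where `f` is not positive, so that dividing by `f` is harmless.
  let bt : ℝ → ℝ := A.indicator b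
  have hbt : Measurable bt := hb.indicator hA
  have hAae : ∀ᵐ x ∂FX, x ∈ A := by
    filter_upwards [hf.ae_pos, ae_mem_support FX, hC'] with x h1 h2 h3
    exact ⟨⟨h1, h2⟩, h3.trans (by rw [hC]; exact le_max_left _ _)⟩
  have hbtae : ∀ᵐ x ∂FX, b x = bt x := hAae.mono fun x hx => (Set.indicator_of_mem hx b).symm
  have hbtC : ∀ x, |bt x| ≤ C := by
    intro x
    by_cases hx : x ∈ A
    · rw [show bt x = b x from Set.indicator_of_mem hx b]; exact hx.2
    · rw [show bt x = 0 from Set.indicator_of_notMem hx b, abs_zero]; exact hC0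
  have hbti : Integrable bt := by
    have h1 : IntegrableOn (fun _ : ℝ => C) FX.support :=
      integrableOn_const hcomp.measure_lt_top.ne
    refine (integrable_indicator_iff hcomp.measurableSet |>.2 h1).mono' hbt.aestronglyMeasurable
      (Eventually.of_forall fun x => ?_)
    by_cases hx : x ∈ FX.support
    · rw [Set.indicator_of_mem hx]; exact hbtC x
    · have : x ∉ A := fun h => hx h.1.2
      rw [Set.indicator_of_notMem hx, show bt x = 0 from Set.indicator_of_notMem this b]; simp
  have hsm := fun k => measurable_smoothing hK hbt (h k)
  -- the averages
  let F : ℕ → Obs J R ℝ → ℝ := fun k s => (smoothing K (h k) bt (cov s) - bt (cov s)) * ξ s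
  have hF : ∀ k, Measurable (F k) := fun k =>
    (((hsm k).sub hbt).comp measurable_cov).mul hξ
  have hF0 : ∀ k, ∫ s, F k s ∂μ = 0 := fun k =>
    hξ0 (fun x => smoothing K (h k) bt x - bt x) ((hsm k).sub hbt) ⟨C + C, fun x =>
      (abs_sub _ _).trans (add_le_add (abs_smoothing_le hK hbtC (hh k) x) (hbtC x))⟩
  have hF2 : Tendsto (fun k => ∫⁻ s, ‖F k s‖ₑ ^ 2 ∂μ) atTop (𝓝 0) := by
    -- The variance is the squared smoothing error integrated against the law of `X` weighted by
    -- `ξ²`. This measure is finite, and absolutely continuous because `F_X` has a density.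
    let ρ : Measure ℝ := (μ.withDensity fun s => ‖ξ s‖ₑ ^ 2).map cov
    have hfin : IsFiniteMeasure (μ.withDensity fun s => ‖ξ s‖ₑ ^ 2) :=
      isFiniteMeasure_withDensity (by
        rw [← eLpNorm_two_sq]; exact ENNReal.pow_ne_top hξ2.2.ne)
    have hρfin : IsFiniteMeasure ρ := Measure.isFiniteMeasure_map _ _
    have hρ : ρ ≪ volume := by
      refine (((withDensity_absolutelyContinuous μ _).map measurable_cov).trans ?_)
      rw [hμ]
      exact hf.absolutelyContinuous
    refine (tendsto_lintegral_sq_smoothing_sub hK hbt hbtC hbti hh hh0 hρ).congr fun k => ?_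
    have hm : Measurable fun y => ‖smoothing K (h k) bt y - bt y‖ₑ ^ 2 :=
      ((hsm k).sub hbt).enorm.pow_const 2
    have hm' : Measurable fun s : Obs J R ℝ => ‖smoothing K (h k) bt (cov s) - bt (cov s)‖ₑ ^ 2 :=
      hm.comp measurable_cov
    rw [lintegral_map hm measurable_cov, lintegral_withDensity_eq_lintegral_mul _
      (hξ.enorm.pow_const 2) hm']
    refine lintegral_congr fun s => ?_
    simp only [F, Pi.mul_apply, enorm_mul, mul_pow]
    rw [mul_comm]
  have hT := smallProb_train_average hL hD hfold ℓ hF hF0 hF2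
  -- the remainder
  have hrem := ((hB.smallProb_rate (by omega)).const_mul (ENNReal.ofReal_ne_top (r := C)))
  have hbX : ∀ k, ∀ᵐ η ∂Pr, ∀ i : Train fold k ℓ, b (cov (S i.1 η)) = bt (cov (S i.1 η)) := by
    intro k
    rw [ae_all_iff]
    intro i
    have h1 : Pr.map (fun η => cov (S i.1 η)) = FX := by
      rw [← hμ, ← hD.map_fst i.1, Measure.map_map measurable_cov (hD.measurable_fst i.1)]
      rfl
    rw [← h1] at hbtae
    exact ae_of_ae_map (measurable_cov.comp (hD.measurable_fst i.1)).aemeasurable hbtae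
  have hlm : ∀ k η, Measurable (leadingTerm fold S V K h f ξ k ℓ η) := by
    intro k η
    have h1 : ∀ i : Train fold k ℓ, Measurable fun x => V i.1 η * (K ((cov (S i.1 η) - x) / h k) /
        h k / f x * ξ (S i.1 η)) := fun i =>
      ((((hK.1.comp (by fun_prop)).div_const (h k)).div hf.1).mul_const _).const_mul _
    exact (Finset.measurable_fun_sum _ fun i _ => h1 i).const_mul _
  -- The factor `1 / f` in the leading term cancels the density of `F_X` and leaves a convolution.
  have hterm : ∀ k (y : ℝ), Integrable (fun x => bt x * (K ((y - x) / h k) / h k / f x)) FX ∧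
      ∫ x, bt x * (K ((y - x) / h k) / h k / f x) ∂FX = smoothing K (h k) bt y := by
    intro k y
    have e : ∀ x, f x * (bt x * (K ((y - x) / h k) / h k / f x)) =
        bt x * (K ((y - x) / h k) / h k) := by
      intro x
      by_cases hx : x ∈ A
      · have : 0 < f x := hx.1.1
        field_simp
      · rw [show bt x = 0 from Set.indicator_of_notMem hx b]; simp
    rw [hf.integrable_iff, hf.integral_eq]
    simp only [e]
    refine ⟨?_, rfl⟩
    have hKi : Integrable fun x => K ((y - x) / h k) / h k :=
      (((integrable_comp_sub_left (fun z => K (z / h k)) y).2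
        (hK.integrable.comp_div (hh k).ne'))).div_const _
    exact hKi.bdd_mul hbt.aestronglyMeasurable (Eventually.of_forall hbtC)
  refine (hrem.add hT).mono_event (B := fun k =>
    {η | eLpNorm (fun x => G k η x - g x - leadingTerm fold S V K h f ξ k ℓ η x) ∞ FX = ∞} ∪
    {η | ¬ ∀ i : Train fold k ℓ, b (cov (S i.1 η)) = bt (cov (S i.1 η))}) ?_ ?_
  · refine tendsto_measure_union ?_
      (tendsto_const_nhds.congr fun k => (ae_iff.1 (hbX k)).symm)
    refine tendsto_measure_of_subset (hB.smallProb_rate (by omega : 0 < L)).ne_top ?_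
    filter_upwards [eventually_gt_atTop 0] with k hk η hη
    simp only [Set.mem_ofPred_eq] at hη ⊢
    rw [hη, ENNReal.mul_top]
    have : (0 : ℝ) < ((L * k : ℕ) : ℝ) := by exact_mod_cast Nat.mul_pos (by omega) hk
    simpa using Real.rpow_pos_of_pos this _
  refine Eventually.of_forall fun k η hη => ?_
  simp only [Set.mem_union, Set.mem_ofPred_eq, not_or, not_not] at hη
  obtain ⟨hη1, hη2⟩ := hη
  let Q : ℝ → ℝ := fun x => G k η x - g x - leadingTerm fold S V K h f ξ k ℓ η x
  have hQ : Measurable Q := ((hG k η).sub hg).sub (hlm k η)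
  have hQL : MemLp Q ∞ FX := ⟨hQ.aestronglyMeasurable, lt_top_iff_ne_top.2 hη1⟩
  have hQi : Integrable (fun x => bt x * Q x) FX :=
    (hQL.integrable le_top).bdd_mul hbt.aestronglyMeasurable (Eventually.of_forall hbtC)
  have hbl : ∀ x, bt x * leadingTerm fold S V K h f ξ k ℓ η x =
      (1 / (Fintype.card (Train fold k ℓ) : ℝ)) * ∑ i : Train fold k ℓ, (V i.1 η * ξ (S i.1 η)) *
        (bt x * (K ((cov (S i.1 η) - x) / h k) / h k / f x)) := by
    intro x
    simp only [leadingTerm]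
    rw [mul_left_comm, Finset.mul_sum]
    congr 1
    exact Finset.sum_congr rfl fun i _ => by ring
  have hli : Integrable (fun x => bt x * leadingTerm fold S V K h f ξ k ℓ η x) FX := by
    simp only [hbl]
    exact (integrable_finsetSum _ fun i _ => (hterm k _).1.const_mul _).const_mul _
  have hlI : ∫ x, bt x * leadingTerm fold S V K h f ξ k ℓ η x ∂FX =
      (1 / (Fintype.card (Train fold k ℓ) : ℝ)) * ∑ i : Train fold k ℓ, (V i.1 η * ξ (S i.1 η)) *
        smoothing K (h k) bt (cov (S i.1 η)) := by
    simp only [hbl]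
    rw [integral_const_mul, integral_finsetSum _ fun i _ => (hterm k _).1.const_mul _]
    congr 1
    refine Finset.sum_congr rfl fun i _ => ?_
    rw [integral_const_mul, (hterm k _).2]
  have hsplit : ∫ x, b x * (G k η x - g x) ∂FX = ∫ x, bt x * Q x ∂FX +
      ∫ x, bt x * leadingTerm fold S V K h f ξ k ℓ η x ∂FX := by
    rw [← integral_add hQi hli]
    refine integral_congr_ae (hbtae.mono fun x hx => ?_)
    simp only [hx, Q]
    ring
  have hQb : ‖∫ x, bt x * Q x ∂FX‖ₑ ≤ ENNReal.ofReal C * eLpNorm Q ∞ FX := by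
    refine (enorm_integral_le_lintegral_enorm _).trans ?_
    simp only [mul_comm (bt _)]
    refine (lintegral_mul_le_top_mul hbt).trans ?_
    rw [mul_comm (ENNReal.ofReal C)]
    refine mul_le_mul_right ?_ _
    calc ∫⁻ x, ‖bt x‖ₑ ∂FX ≤ ∫⁻ _, ENNReal.ofReal C ∂FX := lintegral_mono fun x => by
          rw [Real.enorm_eq_ofReal_abs]; exact ENNReal.ofReal_le_ofReal (hbtC x)
      _ = ENNReal.ofReal C := by simp
  have hfin : √((L * k : ℕ) : ℝ) * ∫ x, b x * (G k η x - g x) ∂FX -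
      √((L * k : ℕ) : ℝ) * ((1 / (Fintype.card (Train fold k ℓ) : ℝ)) *
        ∑ i : Train fold k ℓ, V i.1 η * (b (cov (S i.1 η)) * ξ (S i.1 η))) =
      √((L * k : ℕ) : ℝ) * ∫ x, bt x * Q x ∂FX + √((L * k : ℕ) : ℝ) *
        ((1 / (Fintype.card (Train fold k ℓ) : ℝ)) *
          ∑ i : Train fold k ℓ, V i.1 η * F k (S i.1 η)) := by
    rw [hsplit, hlI, mul_add, add_sub_assoc, ← mul_sub, ← mul_sub, ← Finset.sum_sub_distrib]
    congr 3
    refine Finset.sum_congr rfl fun i _ => ?_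
    rw [hη2 i]
    simp only [F]
    ring
  rw [hfin]
  refine (enorm_add_le _ _).trans (add_le_add ?_ le_rfl)
  rw [enorm_mul, Real.enorm_eq_ofReal (Real.sqrt_nonneg _), Real.sqrt_eq_rpow, mul_left_comm]
  exact mul_le_mul_right hQb _

end Bahadur

end PanelATT

/-! ### Perturbation of the least squares weights -/

namespace PanelATT

section Algebra

attribute [local instance] Matrix.linftyOpNormedAddCommGroup

variable {J R : ℕ}

lemma linftyOpNorm_le_sum {a b : Type*} [Fintype a] [Fintype b] (A : Matrix a b ℝ) :
    ‖A‖ ≤ ∑ i, ∑ j, |A i j| := by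
  rw [Matrix.linfty_opNorm_def]
  have h : (Finset.univ.sup fun i => ∑ j, ‖A i j‖₊) ≤ ∑ i, ∑ j, ‖A i j‖₊ :=
    Finset.sup_le fun i _ => Finset.single_le_sum (f := fun i => ∑ j, ‖A i j‖₊)
      (fun _ _ => zero_le) (Finset.mem_univ i)
  have h' := NNReal.coe_le_coe.2 h
  simpa using h'

lemma linftyOpNorm_le_of_entries {a b : Type*} [Fintype a] [Fintype b] (A : Matrix a b ℝ) {B : ℝ}
    (h : ∀ i j, |A i j| ≤ B) : ‖A‖ ≤ Fintype.card a * (Fintype.card b * B) := by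
  refine (linftyOpNorm_le_sum A).trans ?_
  refine (Finset.sum_le_sum fun i _ => Finset.sum_le_sum fun j _ => h i j).trans (le_of_eq ?_)
  simp

/-- The error of the linear approximation of the least squares weights. -/
lemma norm_ls_remainder_le {a b : Type*} [Fintype a] [Fintype b] [DecidableEq b]
    {M A : Matrix a b ℝ} {m1 a1 : a → ℝ} {β : b → ℝ} (hβ : m1 = M *ᵥ β)
    (hdet : (Mᵀ * M).det ≠ 0) {B s : ℝ} (hB : 1 ≤ B) (hN : ‖(Mᵀ * M)⁻¹‖ ≤ B) (hM : ‖M‖ ≤ B)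
    (hMt : ‖Mᵀ‖ ≤ B) (hb : ‖β‖ ≤ B) (hA : ‖A‖ ≤ s) (hAt : ‖Aᵀ‖ ≤ s) (ha : ‖a1‖ ≤ s) :
    ‖((M + A)ᵀ * (M + A))⁻¹ *ᵥ ((M + A)ᵀ *ᵥ (m1 + a1)) - β -
        (Mᵀ * M)⁻¹ *ᵥ (Mᵀ *ᵥ (a1 - A *ᵥ β))‖ ≤
      (B ^ 2 + B ^ 4 * (1 + B) + B * (1 + B) + B * (2 * B + 1)) * (s * (s +
        ‖((M + A)ᵀ * (M + A))⁻¹ *ᵥ ((M + A)ᵀ *ᵥ (m1 + a1)) - β‖)) := by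
  set βh := ((M + A)ᵀ * (M + A))⁻¹ *ᵥ ((M + A)ᵀ *ᵥ (m1 + a1)) with hβh
  set c := a1 - A *ᵥ β with hc
  have hs : 0 ≤ s := (norm_nonneg _).trans hA
  have hB0 : 0 ≤ B := zero_le_one.trans hB
  have hcn : ‖c‖ ≤ s * (1 + B) := by
    have h1 : ‖A *ᵥ β‖ ≤ s * B := (Matrix.linfty_opNorm_mulVec A β).trans
      (mul_le_mul hA hb (norm_nonneg _) hs)
    calc ‖c‖ ≤ ‖a1‖ + ‖A *ᵥ β‖ := norm_sub_le _ _
      _ ≤ s + s * B := add_le_add ha h1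
      _ = s * (1 + B) := by ring
  have hNM : ∀ v : a → ℝ, ‖(Mᵀ * M)⁻¹ *ᵥ (Mᵀ *ᵥ v)‖ ≤ B ^ 2 * ‖v‖ := by
    intro v
    refine (Matrix.linfty_opNorm_mulVec _ _).trans ?_
    calc ‖(Mᵀ * M)⁻¹‖ * ‖Mᵀ *ᵥ v‖ ≤ B * (B * ‖v‖) := by
          refine mul_le_mul hN ((Matrix.linfty_opNorm_mulVec _ _).trans ?_) (norm_nonneg _) hB0
          exact mul_le_mul_of_nonneg_right hMt (norm_nonneg _)
      _ = B ^ 2 * ‖v‖ := by ring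
  have hinv : ∀ v : b → ℝ, (Mᵀ * M)⁻¹ *ᵥ ((Mᵀ * M) *ᵥ v) = v := by
    intro v
    rw [Matrix.mulVec_mulVec, Matrix.nonsing_inv_mul _ (isUnit_iff_ne_zero.2 hdet),
      Matrix.one_mulVec]
  have hD0 := norm_nonneg (βh - β)
  -- A small perturbation keeps the Gram matrix invertible. For a large one the inverse may be the
  -- default zero, but then `1 ≤ B² s` and a crude bound is already of the required form. The
  -- constant adds the coefficients from both cases.
  by_cases hsmall : B ^ 2 * s < 1
  · have hdet' : ((M + A)ᵀ * (M + A)).det ≠ 0 := by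
      intro h0
      obtain ⟨v, hv0, hv⟩ := Matrix.exists_mulVec_eq_zero_iff.2 h0
      have h1 : (M + A) *ᵥ v = 0 := by
        rw [← Matrix.conjTranspose_eq_transpose_of_trivial] at hv
        exact (Matrix.conjTranspose_mul_self_mulVec_eq_zero _ _).1 hv
      have h2 : M *ᵥ v = -(A *ᵥ v) := by
        rw [Matrix.add_mulVec] at h1
        exact eq_neg_of_add_eq_zero_left h1
      have h3 : v = (Mᵀ * M)⁻¹ *ᵥ (Mᵀ *ᵥ (-(A *ᵥ v))) := by
        rw [← h2, Matrix.mulVec_mulVec v Mᵀ, hinv]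
      have h4 : ‖v‖ ≤ B ^ 2 * (s * ‖v‖) := by
        calc ‖v‖ = ‖(Mᵀ * M)⁻¹ *ᵥ (Mᵀ *ᵥ (-(A *ᵥ v)))‖ := by rw [← h3]
          _ ≤ B ^ 2 * ‖-(A *ᵥ v)‖ := hNM _
          _ ≤ B ^ 2 * (s * ‖v‖) := by
            rw [norm_neg]
            refine mul_le_mul_of_nonneg_left ((Matrix.linfty_opNorm_mulVec _ _).trans ?_)
              (by positivity)
            exact mul_le_mul_of_nonneg_right hA (norm_nonneg _)
      have h5 : 0 < ‖v‖ := norm_pos_iff.2 hv0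
      nlinarith
    have hs1 : s ≤ 1 := by nlinarith
    -- The perturbed normal equations, with `M β` subtracted by means of `m1 = M *ᵥ β`; the
    -- remaining right-hand side is `c = a1 - A *ᵥ β`.
    have hne : ((M + A)ᵀ * (M + A)) *ᵥ (βh - β) = (M + A)ᵀ *ᵥ c := by
      have h1 : ((M + A)ᵀ * (M + A)) *ᵥ βh = (M + A)ᵀ *ᵥ (m1 + a1) := by
        rw [hβh, Matrix.mulVec_mulVec, Matrix.mul_nonsing_inv _ (isUnit_iff_ne_zero.2 hdet'),
          Matrix.one_mulVec]
      rw [Matrix.mulVec_sub, h1, ← Matrix.mulVec_mulVec, ← Matrix.mulVec_sub, hβ,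
        Matrix.add_mulVec, hc]
      congr 1
      abel
    -- Only `Mᵀ * M` is kept on the left. Everything moved to the right contains `A` together with
    -- `c` or `βh - β`, so it is of order `s (s + ‖βh - β‖)`; the unknown `βh - β` may stay in the
    -- bound because the weights come with their own rate.
    have hkey : βh - β - (Mᵀ * M)⁻¹ *ᵥ (Mᵀ *ᵥ c) = (Mᵀ * M)⁻¹ *ᵥ (Aᵀ *ᵥ c -
        (Mᵀ *ᵥ (A *ᵥ (βh - β)) + Aᵀ *ᵥ (M *ᵥ (βh - β)) + Aᵀ *ᵥ (A *ᵥ (βh - β)))) := by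
      have h2 : (Mᵀ * M) *ᵥ (βh - β) = Mᵀ *ᵥ c + (Aᵀ *ᵥ c -
          (Mᵀ *ᵥ (A *ᵥ (βh - β)) + Aᵀ *ᵥ (M *ᵥ (βh - β)) + Aᵀ *ᵥ (A *ᵥ (βh - β)))) := by
        rw [← Matrix.mulVec_mulVec, Matrix.transpose_add, Matrix.add_mulVec, Matrix.add_mulVec,
          Matrix.add_mulVec, Matrix.mulVec_add, Matrix.mulVec_add] at hne
        rw [← Matrix.mulVec_mulVec, ← add_sub_assoc, ← hne]
        abel
      have h3 := hinv (βh - β)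
      rw [h2, Matrix.mulVec_add] at h3
      exact sub_eq_iff_eq_add'.2 h3.symm
    have hAD : ‖A *ᵥ (βh - β)‖ ≤ s * ‖βh - β‖ := (Matrix.linfty_opNorm_mulVec _ _).trans
      (mul_le_mul_of_nonneg_right hA (norm_nonneg _))
    have hMD : ‖M *ᵥ (βh - β)‖ ≤ B * ‖βh - β‖ := (Matrix.linfty_opNorm_mulVec _ _).trans
      (mul_le_mul_of_nonneg_right hM (norm_nonneg _))
    have e1 : ‖Aᵀ *ᵥ c‖ ≤ s * (s * (1 + B)) := (Matrix.linfty_opNorm_mulVec _ _).trans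
      (mul_le_mul hAt hcn (norm_nonneg _) hs)
    have e2 : ‖Mᵀ *ᵥ (A *ᵥ (βh - β))‖ ≤ B * (s * ‖βh - β‖) :=
      (Matrix.linfty_opNorm_mulVec _ _).trans (mul_le_mul hMt hAD (norm_nonneg _) hB0)
    have e3 : ‖Aᵀ *ᵥ (M *ᵥ (βh - β))‖ ≤ s * (B * ‖βh - β‖) :=
      (Matrix.linfty_opNorm_mulVec _ _).trans (mul_le_mul hAt hMD (norm_nonneg _) hs)
    have e4 : ‖Aᵀ *ᵥ (A *ᵥ (βh - β))‖ ≤ s * (s * ‖βh - β‖) :=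
      (Matrix.linfty_opNorm_mulVec _ _).trans (mul_le_mul hAt hAD (norm_nonneg _) hs)
    have e5 : s * (s * ‖βh - β‖) ≤ s * ‖βh - β‖ := by
      refine mul_le_mul_of_nonneg_left ?_ hs
      exact mul_le_of_le_one_left hD0 hs1
    rw [hkey]
    refine (Matrix.linfty_opNorm_mulVec _ _).trans ?_
    refine (mul_le_mul hN ((norm_sub_le _ _).trans (add_le_add e1 ((norm_add_le _ _).trans
      (add_le_add ((norm_add_le _ _).trans (add_le_add e2 e3)) (e4.trans e5))))) (norm_nonneg _)
      hB0).trans ?_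
    have f1 : 0 ≤ s * s := mul_nonneg hs hs
    have f2 : 0 ≤ s * ‖βh - β‖ := mul_nonneg hs hD0
    have f3 : B * (s * (s * (1 + B)) + (B * (s * ‖βh - β‖) + s * (B * ‖βh - β‖) + s * ‖βh - β‖)) =
      B * (1 + B) * (s * s) + B * (2 * B + 1) * (s * ‖βh - β‖) := by ring
    have f4 : (B ^ 2 + B ^ 4 * (1 + B) + B * (1 + B) + B * (2 * B + 1)) * (s * (s + ‖βh - β‖)) =
      (B ^ 2 + B ^ 4 * (1 + B) + B * (1 + B) + B * (2 * B + 1)) * (s * s) +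
      (B ^ 2 + B ^ 4 * (1 + B) + B * (1 + B) + B * (2 * B + 1)) * (s * ‖βh - β‖) := by ring
    rw [f3, f4]
    refine add_le_add (mul_le_mul_of_nonneg_right ?_ f1) (mul_le_mul_of_nonneg_right ?_ f2)
    · have : 0 ≤ B ^ 2 + B ^ 4 * (1 + B) + B * (2 * B + 1) := by positivity
      linarith
    · have : 0 ≤ B ^ 2 + B ^ 4 * (1 + B) + B * (1 + B) := by positivity
      linarith
  · rw [not_lt] at hsmall
    refine (norm_sub_le _ _).trans ?_
    have g1 : ‖βh - β‖ ≤ B ^ 2 * (s * ‖βh - β‖) := by nlinarith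
    -- One factor of `s` is free, and the second is inserted through `1 ≤ B² s`.
    have g2 : ‖(Mᵀ * M)⁻¹ *ᵥ (Mᵀ *ᵥ c)‖ ≤ B ^ 4 * (1 + B) * (s * s) := by
      calc _ ≤ B ^ 2 * ‖c‖ := hNM c
        _ ≤ B ^ 2 * (s * (1 + B)) := mul_le_mul_of_nonneg_left hcn (by positivity)
        _ ≤ B ^ 2 * (s * (1 + B)) * (B ^ 2 * s) := le_mul_of_one_le_right (by positivity) hsmall
        _ = B ^ 4 * (1 + B) * (s * s) := by ring
    have f1 : 0 ≤ s * s := mul_nonneg hs hs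
    have f2 : 0 ≤ s * ‖βh - β‖ := mul_nonneg hs hD0
    have f4 : (B ^ 2 + B ^ 4 * (1 + B) + B * (1 + B) + B * (2 * B + 1)) * (s * (s + ‖βh - β‖)) =
      (B ^ 2 + B ^ 4 * (1 + B) + B * (1 + B) + B * (2 * B + 1)) * (s * s) +
      (B ^ 2 + B ^ 4 * (1 + B) + B * (1 + B) + B * (2 * B + 1)) * (s * ‖βh - β‖) := by ring
    rw [f4, add_comm]
    refine add_le_add (g2.trans (mul_le_mul_of_nonneg_right ?_ f1))
      (g1.trans ((mul_le_mul_of_nonneg_right ?_ f2)))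
    · have : 0 ≤ B ^ 2 + B * (1 + B) + B * (2 * B + 1) := by positivity
      linarith
    · have : 0 ≤ B ^ 4 * (1 + B) + B * (1 + B) + B * (2 * B + 1) := by positivity
      linarith

/-- The derivative of the least squares weights with respect to the left hand side. -/
noncomputable def scGradient (q : Fin (J + 2) → Fin (R + 1) → ℝ) (j : Fin J) (t : Fin (R + 1)) : ℝ :=
  (((diffMatrix q)ᵀ * diffMatrix q)⁻¹ * (diffMatrix q)ᵀ) j t

lemma diffMatrix_add (q q' : Fin (J + 2) → Fin (R + 1) → ℝ) :
    diffMatrix (fun g t => q g t + q' g t) = diffMatrix q + diffMatrix q' := by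
  ext t j
  simp only [diffMatrix, Matrix.of_apply, Matrix.add_apply]
  ring

lemma diffVec_add (q q' : Fin (J + 2) → Fin (R + 1) → ℝ) :
    diffVec (fun g t => q g t + q' g t) = diffVec q + diffVec q' := by
  ext t
  simp only [diffVec, Pi.add_apply]
  ring

/-- The residual of the synthetic control equation, with `w` summing to one. -/
lemma diffVec_sub_diffMatrix_mulVec (q : Fin (J + 2) → Fin (R + 1) → ℝ) {w : Fin (J + 1) → ℝ}
    (hw : ∑ g, w g = 1) (t : Fin (R + 1)) :
    (diffVec q - diffMatrix q *ᵥ fun j => w j.castSucc) t =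
      q 0 t - ∑ g : Fin (J + 1), w g * q g.succ t := by
  rw [Fin.sum_univ_castSucc] at hw
  have hl : w (Fin.last J) = 1 - ∑ j : Fin J, w j.castSucc := by linarith
  rw [Fin.sum_univ_castSucc, hl]
  simp only [Pi.sub_apply, diffVec, Matrix.mulVec, dotProduct, diffMatrix, Matrix.of_apply,
    Fin.succ_last]
  simp only [sub_mul, Finset.sum_sub_distrib, mul_comm (q _ t)]
  rw [← Finset.sum_mul]
  ring

lemma diffVec_eq_of_sum {q : Fin (J + 2) → Fin (R + 1) → ℝ} {w : Fin (J + 1) → ℝ}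
    (hw : ∑ g, w g = 1) (hq : ∀ t, q 0 t = ∑ g : Fin (J + 1), w g * q g.succ t) :
    diffVec q = diffMatrix q *ᵥ fun j => w j.castSucc := by
  ext t
  have h := diffVec_sub_diffMatrix_mulVec q hw t
  rw [← hq t, sub_self, Pi.sub_apply] at h
  exact sub_eq_zero.1 h

lemma mulVec_eq_sum_scGradient (q : Fin (J + 2) → Fin (R + 1) → ℝ) (v : Fin (R + 1) → ℝ)
    (j : Fin J) : (((diffMatrix q)ᵀ * diffMatrix q)⁻¹ *ᵥ ((diffMatrix q)ᵀ *ᵥ v)) j =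
      ∑ t, scGradient q j t * v t := by
  rw [Matrix.mulVec_mulVec]
  rfl

/-- With `m_1 = M β` the vector `(M'M)⁻¹ M' m_1` is `β`, and the two terms containing `A' M β`
cancel. What is left is the linear term `(M'M)⁻¹ M' (a_1 - A β)` of the perturbation bound. -/
lemma weightInfluence_eq {E : Type*} {q : Fin (J + 2) → Fin (R + 2) → E → ℝ}
    {p : Fin (J + 2) → E → ℝ} {s : Obs J R E} {w : Fin (J + 1) → ℝ} (hw : ∑ g, w g = 1)
    (hq : ∀ t : Fin (R + 1), q 0 t.castSucc (cov s) =
      ∑ g : Fin (J + 1), w g * q g.succ t.castSucc (cov s))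
    (hdet : ((diffMatrix fun g (t : Fin (R + 1)) => q g t.castSucc (cov s))ᵀ *
      diffMatrix fun g (t : Fin (R + 1)) => q g t.castSucc (cov s)).det ≠ 0) (j : Fin J) :
    weightInfluence q p s j = ∑ t, scGradient (fun g (t : Fin (R + 1)) => q g t.castSucc (cov s)) j t *
      (ipwResid q p s 0 t - ∑ g : Fin (J + 1), w g * ipwResid q p s g.succ t) := by
  have h1 := diffVec_eq_of_sum (q := fun g (t : Fin (R + 1)) => q g t.castSucc (cov s)) hw hq
  simp only [← diffVec_sub_diffMatrix_mulVec (ipwResid q p s) hw]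
  rw [← mulVec_eq_sum_scGradient]
  simp only [weightInfluence]
  rw [h1]
  set M := diffMatrix fun g (t : Fin (R + 1)) => q g t.castSucc (cov s)
  set A := diffMatrix (ipwResid q p s)
  set β : Fin J → ℝ := fun j => w j.castSucc
  have h2 : (Mᵀ * M)⁻¹ *ᵥ (Mᵀ *ᵥ (M *ᵥ β)) = β := by
    rw [Matrix.mulVec_mulVec β Mᵀ M, Matrix.mulVec_mulVec,
      Matrix.nonsing_inv_mul _ (isUnit_iff_ne_zero.2 hdet), Matrix.one_mulVec]
  rw [h2, Matrix.add_mulVec, ← Matrix.mulVec_mulVec, ← Matrix.mulVec_mulVec, Matrix.mulVec_sub,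
    Matrix.mulVec_sub, Matrix.mulVec_add]
  simp only [Pi.sub_apply, Pi.add_apply]
  ring

lemma scWeights_castSucc (q : Fin (J + 2) → Fin (R + 1) → ℝ) (j : Fin J) :
    scWeights q j.castSucc = lsWeights q j := by simp [scWeights]

lemma scWeights_last (q : Fin (J + 2) → Fin (R + 1) → ℝ) :
    scWeights q (Fin.last J) = 1 - ∑ j, lsWeights q j := by simp [scWeights]

/-- Quadratic bound for the error of the linear approximation of the synthetic control weights. -/
lemma exists_abs_scWeights_remainder_le (J R : ℕ) (B : ℝ) : ∃ C : ℝ, 0 ≤ C ∧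
    ∀ (q q' : Fin (J + 2) → Fin (R + 1) → ℝ) (w : Fin (J + 1) → ℝ), ∑ g, w g = 1 →
      (∀ t, q 0 t = ∑ g : Fin (J + 1), w g * q g.succ t) →
      ((diffMatrix q)ᵀ * diffMatrix q).det ≠ 0 →
      (∀ i j, |((diffMatrix q)ᵀ * diffMatrix q)⁻¹ i j| ≤ B) → (∀ t j, |diffMatrix q t j| ≤ B) →
      (∀ g, |w g| ≤ B) → ∀ j : Fin J,
      |scWeights q' j.castSucc - w j.castSucc - ∑ t, scGradient q j t * ((q' 0 t - q 0 t) -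
        ∑ g : Fin (J + 1), w g * (q' g.succ t - q g.succ t))| ≤
      C * ((∑ g, ∑ t, |q' g t - q g t|) * ((∑ g, ∑ t, |q' g t - q g t|) +
        ∑ g, |scWeights q' g - w g|)) := by
  -- One number that dominates all operator norms in question, obtained from the entrywise bound and
  -- the dimensions, and is at least one.
  obtain ⟨D, hD⟩ : ∃ D : ℝ, D = 1 + (J * (J * |B|) + (R + 1) * (J * |B|) + J * ((R + 1) * |B|) + |B|) :=
    ⟨_, rfl⟩
  have hD1 : 1 ≤ D := by rw [hD]; exact le_add_of_nonneg_right (by positivity)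
  -- The analogous factor for the perturbations, whose entries are differences of two errors and so
  -- at most `2 * σ`.
  obtain ⟨c, hc⟩ : ∃ c : ℝ, c = (R + 1) * (J * 2) + J * ((R + 1) * 2) + 2 := ⟨_, rfl⟩
  have hc0 : 1 ≤ c := by rw [hc]; exact le_add_of_nonneg_of_le (by positivity) (by norm_num)
  refine ⟨(D ^ 2 + D ^ 4 * (1 + D) + D * (1 + D) + D * (2 * D + 1)) * (c * c), by positivity, ?_⟩
  intro q q' w hw hq hdet hN hM hwB j
  obtain ⟨σ, hσ⟩ : ∃ σ, σ = ∑ g, ∑ t, |q' g t - q g t| := ⟨_, rfl⟩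
  have hσg : ∀ g t, |q' g t - q g t| ≤ σ := fun g t => by
    rw [hσ]
    exact (Finset.single_le_sum (f := fun t => |q' g t - q g t|) (fun _ _ => abs_nonneg _)
      (Finset.mem_univ t)).trans (Finset.single_le_sum (f := fun g => ∑ t, |q' g t - q g t|)
      (fun _ _ => Finset.sum_nonneg fun _ _ => abs_nonneg _) (Finset.mem_univ g))
  have hσ0 : 0 ≤ σ := (abs_nonneg _).trans (hσg 0 0)
  let δ : Fin (J + 2) → Fin (R + 1) → ℝ := fun g t => q' g t - q g t
  have hq' : q' = fun g t => q g t + δ g t := by funext g t; simp [δ]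
  have hδ : ∀ g g' t, |δ g t - δ g' t| ≤ 2 * σ := fun g g' t =>
    (abs_sub _ _).trans ((add_le_add (hσg g t) (hσg g' t)).trans (by linarith))
  have hBB : ∀ {x : ℝ}, |x| ≤ B → |x| ≤ |B| := fun h => h.trans (le_abs_self B)
  have hβn : ‖fun j : Fin J => w j.castSucc‖ ≤ D := by
    refine (pi_norm_le_iff_of_nonneg (by positivity)).2 fun j => (hBB (hwB _)).trans ?_
    rw [hD]
    have : (0 : ℝ) ≤ J * (J * |B|) + (R + 1) * (J * |B|) + J * ((R + 1) * |B|) := by positivity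
    linarith
  have k1 : (0 : ℝ) ≤ J * (J * |B|) := by positivity
  have k2 : (0 : ℝ) ≤ (R + 1) * (J * |B|) := by positivity
  have k3 : (0 : ℝ) ≤ J * ((R + 1) * |B|) := by positivity
  have hNn : ‖((diffMatrix q)ᵀ * diffMatrix q)⁻¹‖ ≤ D := by
    refine (linftyOpNorm_le_of_entries _ fun i j => hBB (hN i j)).trans ?_
    simp only [Fintype.card_fin]
    rw [hD]
    linarith [abs_nonneg B]
  have hMn : ‖diffMatrix q‖ ≤ D := by
    refine (linftyOpNorm_le_of_entries _ fun i j => hBB (hM i j)).trans ?_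
    simp only [Fintype.card_fin, Nat.cast_add, Nat.cast_one]
    rw [hD]
    linarith [abs_nonneg B]
  have hMtn : ‖(diffMatrix q)ᵀ‖ ≤ D := by
    refine (linftyOpNorm_le_of_entries _ fun i j => hBB (hM j i)).trans ?_
    simp only [Fintype.card_fin, Nat.cast_add, Nat.cast_one]
    rw [hD]
    linarith [abs_nonneg B]
  have l1 : (0 : ℝ) ≤ (R + 1) * (J * (2 * σ)) := by positivity
  have l2 : (0 : ℝ) ≤ J * ((R + 1) * (2 * σ)) := by positivity
  have hcσ : c * σ = (R + 1) * (J * (2 * σ)) + J * ((R + 1) * (2 * σ)) + 2 * σ := by rw [hc]; ring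
  have hAn : ‖diffMatrix δ‖ ≤ c * σ := by
    refine (linftyOpNorm_le_of_entries (B := 2 * σ) _ fun i j => hδ _ _ _).trans ?_
    simp only [Fintype.card_fin, Nat.cast_add, Nat.cast_one]
    rw [hcσ]; linarith
  have hAtn : ‖(diffMatrix δ)ᵀ‖ ≤ c * σ := by
    refine (linftyOpNorm_le_of_entries (B := 2 * σ) _ fun i j => hδ _ _ _).trans ?_
    simp only [Fintype.card_fin, Nat.cast_add, Nat.cast_one]
    rw [hcσ]; linarith
  have han : ‖diffVec δ‖ ≤ c * σ := by
    refine (pi_norm_le_iff_of_nonneg (by positivity)).2 fun t => (hδ _ _ _).trans ?_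
    rw [hcσ]; linarith
  have hmain := norm_ls_remainder_le (diffVec_eq_of_sum hw hq) hdet hD1 hNn hMn hMtn hβn hAn hAtn han
  rw [← diffMatrix_add, ← diffVec_add, ← hq'] at hmain
  have hls : ((diffMatrix q')ᵀ * diffMatrix q')⁻¹ *ᵥ ((diffMatrix q')ᵀ *ᵥ diffVec q') = lsWeights q' :=
    rfl
  rw [hls] at hmain
  have hτ : ‖lsWeights q' - fun j => w j.castSucc‖ ≤ ∑ g, |scWeights q' g - w g| := by
    refine (pi_norm_le_iff_of_nonneg (Finset.sum_nonneg fun _ _ => abs_nonneg _)).2 fun j => ?_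
    rw [Pi.sub_apply, ← scWeights_castSucc, Real.norm_eq_abs]
    exact Finset.single_le_sum (f := fun g => |scWeights q' g - w g|) (fun _ _ => abs_nonneg _)
      (Finset.mem_univ j.castSucc)
  have hj := (norm_le_pi_norm _ j).trans hmain
  rw [Pi.sub_apply, Pi.sub_apply, mulVec_eq_sum_scGradient, ← scWeights_castSucc] at hj
  simp only [diffVec_sub_diffMatrix_mulVec δ hw] at hj
  rw [Real.norm_eq_abs] at hj
  rw [← hσ]
  refine hj.trans (le_trans ?_ (mul_assoc _ _ _).symm.le)
  refine mul_le_mul_of_nonneg_left ?_ (by positivity)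
  have hτ0 := (norm_nonneg (lsWeights q' - fun j => w j.castSucc))
  calc c * σ * (c * σ + ‖lsWeights q' - fun j => w j.castSucc‖)
      ≤ c * σ * (c * σ + c * ∑ g, |scWeights q' g - w g|) := by
        refine mul_le_mul_of_nonneg_left (add_le_add le_rfl ?_) (by positivity)
        exact hτ.trans (le_mul_of_one_le_left (hτ0.trans hτ) hc0)
    _ = c * c * (σ * (σ + ∑ g, |scWeights q' g - w g|)) := by ring

end Algebra

end PanelATT

/-! ### Regularity of the design and the synthetic control condition for observed outcomes -/

namespace PanelATT

section Design

variable {J R : ℕ}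

lemma continuous_diffMatrix :
    Continuous (diffMatrix : (Fin (J + 2) → Fin (R + 1) → ℝ) → Matrix (Fin (R + 1)) (Fin J) ℝ) := by
  refine continuous_matrix fun t j => ?_
  simp only [diffMatrix, Matrix.of_apply]
  fun_prop

lemma continuous_gram : Continuous fun q : Fin (J + 2) → Fin (R + 1) → ℝ =>
    (diffMatrix q)ᵀ * diffMatrix q :=
  continuous_diffMatrix.matrix_transpose.matrix_mul continuous_diffMatrix

/-- Cramer's formula, valid also for singular matrices, where both sides are zero. It makes the
estimated weights measurable everywhere and the inverse continuous where the determinant does not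
vanish. -/
lemma inv_gram_apply (q : Fin (J + 2) → Fin (R + 1) → ℝ) (i j : Fin J) :
    ((diffMatrix q)ᵀ * diffMatrix q)⁻¹ i j = ((diffMatrix q)ᵀ * diffMatrix q).det⁻¹ *
      ((diffMatrix q)ᵀ * diffMatrix q).adjugate i j := by
  rw [Matrix.inv_def, Ring.inverse_eq_inv', Matrix.smul_apply, smul_eq_mul]

lemma measurable_inv_gram (i j : Fin J) : Measurable fun q : Fin (J + 2) → Fin (R + 1) → ℝ =>
    ((diffMatrix q)ᵀ * diffMatrix q)⁻¹ i j := by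
  simp only [inv_gram_apply]
  exact (continuous_gram.matrix_det.measurable.inv).mul
    (continuous_gram.matrix_adjugate.matrix_elem i j).measurable

lemma continuousOn_inv_gram (i j : Fin J) : ContinuousOn
    (fun q : Fin (J + 2) → Fin (R + 1) → ℝ => ((diffMatrix q)ᵀ * diffMatrix q)⁻¹ i j)
    {q | ((diffMatrix q)ᵀ * diffMatrix q).det ≠ 0} := by
  simp only [inv_gram_apply]
  exact (continuous_gram.matrix_det.continuousOn.inv₀ fun q hq => hq).mul
    (continuous_gram.matrix_adjugate.matrix_elem i j).continuousOn

lemma scGradient_eq_sum (q : Fin (J + 2) → Fin (R + 1) → ℝ) (j : Fin J) (t : Fin (R + 1)) :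
    scGradient q j t = ∑ i, ((diffMatrix q)ᵀ * diffMatrix q)⁻¹ j i * diffMatrix q t i := by
  simp only [scGradient, Matrix.mul_apply, Matrix.transpose_apply]

lemma measurable_scGradient (j : Fin J) (t : Fin (R + 1)) :
    Measurable fun q : Fin (J + 2) → Fin (R + 1) → ℝ => scGradient q j t := by
  simp only [scGradient_eq_sum]
  exact Finset.measurable_fun_sum _ fun i _ => (measurable_inv_gram j i).mul
    (continuous_diffMatrix.matrix_elem t i).measurable

lemma measurable_scWeights (g : Fin (J + 1)) :
    Measurable fun q : Fin (J + 2) → Fin (R + 1) → ℝ => scWeights q g := by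
  have h1 : ∀ j : Fin J, Measurable fun q : Fin (J + 2) → Fin (R + 1) → ℝ => lsWeights q j := by
    intro j
    simp only [lsWeights, mulVec_eq_sum_scGradient]
    refine Finset.measurable_fun_sum _ fun t _ => (measurable_scGradient j t).mul ?_
    simp only [diffVec]
    fun_prop
  refine Fin.lastCases ?_ (fun j => ?_) g
  · simp only [scWeights_last]
    exact measurable_const.sub (Finset.measurable_fun_sum _ fun j _ => h1 j)
  · simp only [scWeights_castSucc]
    exact h1 j

/-- A singular matrix has the eigenvalue zero. -/
lemma det_gram_ne_zero {q : Fin (J + 2) → Fin (R + 1) → ℝ} {c : ℝ} (hc : 0 < c)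
    (h : ∀ lam : ℝ, Module.End.HasEigenvalue (Matrix.toLin' ((diffMatrix q)ᵀ * diffMatrix q)) lam →
      c < lam) : ((diffMatrix q)ᵀ * diffMatrix q).det ≠ 0 := by
  intro h0
  obtain ⟨v, hv0, hv⟩ := Matrix.exists_mulVec_eq_zero_iff.2 h0
  have h1 : Module.End.HasEigenvalue (Matrix.toLin' ((diffMatrix q)ᵀ * diffMatrix q)) 0 :=
    Module.End.hasEigenvalue_of_hasEigenvector (x := v)
      (Module.End.hasEigenvector_iff.2 ⟨Module.End.mem_eigenspace_iff.2 (by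
        rw [Matrix.toLin'_apply, hv, zero_smul]), hv0⟩)
  exact absurd (h 0 h1) (not_lt.2 hc.le)

/-- The properties of the synthetic control weights and of the regression functions that the linear
approximation of the estimated weights is based on, at one point. -/
def GoodDesign (B : ℝ) (q : Fin (J + 2) → Fin (R + 2) → ℝ → ℝ) (w : Fin (J + 1) → ℝ → ℝ) (x : ℝ) :
    Prop :=
  ∑ g, w g x = 1 ∧
  (∀ t : Fin (R + 1), q 0 t.castSucc x = ∑ g : Fin (J + 1), w g x * q g.succ t.castSucc x) ∧
  ((diffMatrix fun g (t : Fin (R + 1)) => q g t.castSucc x)ᵀ *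
    diffMatrix fun g (t : Fin (R + 1)) => q g t.castSucc x).det ≠ 0 ∧
  (∀ i j, |((diffMatrix fun g (t : Fin (R + 1)) => q g t.castSucc x)ᵀ *
    diffMatrix fun g (t : Fin (R + 1)) => q g t.castSucc x)⁻¹ i j| ≤ B) ∧
  (∀ t j, |diffMatrix (fun g (t : Fin (R + 1)) => q g t.castSucc x) t j| ≤ B) ∧
  (∀ g, |w g x| ≤ B) ∧
  (∀ j t, |scGradient (fun g (t : Fin (R + 1)) => q g t.castSucc x) j t| ≤ B) ∧
  ∀ g t, |q g t x| ≤ B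

lemma exists_bound_of_finite {ι : Type*} [Finite ι] {s : Set ℝ} (hs : IsCompact s)
    {F : ι → ℝ → ℝ} (hF : ∀ i, ContinuousOn (F i) s) : ∃ B : ℝ, ∀ i, ∀ x ∈ s, |F i x| ≤ B := by
  choose B hB using fun i => hs.exists_bound_of_continuousOn (hF i)
  obtain ⟨b, hb⟩ := Set.Finite.bddAbove (Set.finite_range B)
  exact ⟨b, fun i x hx => (hB i x hx).trans (hb ⟨i, rfl⟩)⟩

/-- All quantities are continuous on the compact support, including the inverse Gram matrix, so
finitely many maxima provide a common bound. -/
lemma exists_goodDesign {FX : Measure ℝ} {q : Fin (J + 2) → Fin (R + 2) → ℝ → ℝ}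
    {w : Fin (J + 1) → ℝ → ℝ} (hcomp : IsCompact FX.support)
    (hwc : ∀ g, ContinuousOn (w g) FX.support) (hqc : ∀ g t, ContinuousOn (q g t) FX.support)
    (hw : ∀ᵐ x ∂FX, ∑ g, w g x = 1)
    (hq : ∀ t : Fin (R + 1), ∀ᵐ x ∂FX,
      q 0 t.castSucc x = ∑ g : Fin (J + 1), w g x * q g.succ t.castSucc x)
    (hdet : ∀ x ∈ FX.support, ((diffMatrix fun g (t : Fin (R + 1)) => q g t.castSucc x)ᵀ *
      diffMatrix fun g (t : Fin (R + 1)) => q g t.castSucc x).det ≠ 0) :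
    ∃ B : ℝ, ∀ᵐ x ∂FX, GoodDesign B q w x := by
  let Q : ℝ → Fin (J + 2) → Fin (R + 1) → ℝ := fun x g t => q g t.castSucc x
  have hQ : ContinuousOn Q FX.support :=
    continuousOn_pi.2 fun g => continuousOn_pi.2 fun t => hqc g t.castSucc
  have hN : ∀ i j, ContinuousOn (fun x => ((diffMatrix (Q x))ᵀ * diffMatrix (Q x))⁻¹ i j)
      FX.support := fun i j => (continuousOn_inv_gram i j).comp hQ hdet
  have hM : ∀ t j, ContinuousOn (fun x => diffMatrix (Q x) t j) FX.support := fun t j =>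
    (continuous_diffMatrix.matrix_elem t j).comp_continuousOn hQ
  have hG : ∀ j t, ContinuousOn (fun x => scGradient (Q x) j t) FX.support := by
    intro j t
    simp only [scGradient_eq_sum]
    exact continuousOn_finsetSum _ fun i _ => (hN j i).mul (hM t i)
  obtain ⟨B1, hB1⟩ := exists_bound_of_finite hcomp fun i : Fin J × Fin J => hN i.1 i.2
  obtain ⟨B2, hB2⟩ := exists_bound_of_finite hcomp fun i : Fin (R + 1) × Fin J => hM i.1 i.2
  obtain ⟨B3, hB3⟩ := exists_bound_of_finite hcomp hwc
  obtain ⟨B4, hB4⟩ := exists_bound_of_finite hcomp fun i : Fin J × Fin (R + 1) => hG i.1 i.2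
  obtain ⟨B5, hB5⟩ := exists_bound_of_finite hcomp fun i : Fin (J + 2) × Fin (R + 2) => hqc i.1 i.2
  refine ⟨max B1 (max B2 (max B3 (max B4 B5))), ?_⟩
  filter_upwards [ae_mem_support FX, hw, ae_all_iff.2 hq] with x hx h1 h2
  exact ⟨h1, h2, hdet x hx, fun i j => (hB1 (i, j) x hx).trans (by simp),
    fun t j => (hB2 (t, j) x hx).trans (by simp), fun g => (hB3 g x hx).trans (by simp),
    fun j t => (hB4 (j, t) x hx).trans (by simp), fun g t => (hB5 (g, t) x hx).trans (by simp)⟩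

end Design

namespace Population

variable {Ω : Type*} [MeasurableSpace Ω] {J R : ℕ} {pop : Population Ω ℝ J R}
  {p : Fin (J + 2) → ℝ → ℝ} {m : ℝ → ℝ} {w : Fin (J + 1) → ℝ → ℝ}
  {q : Fin (J + 2) → Fin (R + 2) → ℝ → ℝ}

lemma ae_eq_of_isCondMean (hp : pop.IsPropensity p) (ho : pop.Overlap p) {g : Fin (J + 2)}
    {Z Z' : Ω → ℝ} {f f' : ℝ → ℝ} (h : IsCondMean pop.P pop.X (pop.grp g) Z f)
    (h' : IsCondMean pop.P pop.X (pop.grp g) Z' f') (hZ : Z =ᵐ[cond pop.P (pop.grp g)] Z') :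
    ∀ᵐ x ∂pop.FX, f x = f' x :=
  (hp.ae_cond_grp_iff ho g (q := fun x => f x = f' x) (measurableSet_eq_fun h.1 h'.1)).1
    (h.ae_eq h' hZ)

/-- Consequences of the synthetic control condition for the observed outcomes. -/
lemma SyntheticControl.observed (hSC : pop.SyntheticControl w) (hp : pop.IsPropensity p)
    (ho : pop.Overlap p) (hna : pop.NoAnticipation)
    (hB : pop.BoundedMoments m p w) (hm : pop.IsControlTrend m)
    (hq : ∀ g t, IsCondMean pop.P pop.X (pop.grp g) (pop.Y t) (q g t)) :
    (∀ t : Fin (R + 1), ∀ᵐ x ∂pop.FX,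
      q 0 t.castSucc x = ∑ g : Fin (J + 1), w g x * q g.succ t.castSucc x) ∧
    (∀ g : Fin (J + 1), IsCondMean pop.P pop.X (pop.grp g.succ)
      (fun a => dY (pop.obs a) - m (pop.X a)) (fun x => groupTrend q g.succ x - m x)) ∧
    ∃ d0 : ℝ → ℝ, IsCondMean pop.P pop.X (pop.grp 0) (fun a => pop.Y0 (Fin.last (R + 1)) a -
      pop.Y0 (Fin.last R).castSucc a - m (pop.X a)) d0 ∧
      ∀ᵐ x ∂pop.FX, d0 x = ∑ g, w g x * (groupTrend q g.succ x - m x) := by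
  obtain ⟨hwm, hw1, ⟨q0, hq0, hq0e⟩, -⟩ := hSC
  have hmi := integrable_trend hB hp ho hm
  have hmX := fun g => isCondMean_comp pop.measurable_X hm.1 (integrable_comp_X_cond hp ho hmi g)
  have hctrl : ∀ (g : Fin (J + 1)) t, ∀ᵐ x ∂pop.FX, q g.succ t x = q0 g.succ t x := by
    intro g t
    refine ae_eq_of_isCondMean hp ho (hq g.succ t) (hq0 g.succ t) ?_
    filter_upwards [ae_cond_grp_mem g.succ] with a ha
    simp [Y, ha]
  -- For the treated, observed and untreated outcomes have the same regression only before
  -- treatment, by no anticipation; for the controls this holds in all periods.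
  have htr : ∀ t : Fin (R + 1), ∀ᵐ x ∂pop.FX, q 0 t.castSucc x = q0 0 t.castSucc x := by
    intro t
    refine ae_eq_of_isCondMean hp ho (hq 0 t.castSucc) (hq0 0 t.castSucc) ?_
    filter_upwards [ae_cond_grp_mem 0, ae_cond_iff.2 (ae_restrict_of_ae (hna t))] with a ha hb
    simp [Y, ha, hb]
  refine ⟨fun t => ?_, fun g => ?_, _, ((hq0 0 _).sub (hq0 0 _)).sub (hmX 0), ?_⟩
  · filter_upwards [htr t, hq0e t.castSucc, ae_all_iff.2 fun g => hctrl g t.castSucc]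
      with x h1 h2 h3
    rw [h1, h2]
    exact Finset.sum_congr rfl fun g _ => by rw [h3 g]
  · exact ((hq g.succ (Fin.last (R + 1))).sub (hq g.succ (Fin.last R).castSucc)).sub (hmX g.succ)
  -- The condition in the last two periods is differenced; subtracting `m` group by group uses that
  -- the weights sum to one.
  · filter_upwards [hw1, hq0e (Fin.last (R + 1)), hq0e (Fin.last R).castSucc,
      ae_all_iff.2 fun g => ae_all_iff.2 fun t => hctrl g t] with x h1 h2 h3 h4
    rw [h2, h3]
    simp only [groupTrend, h4, mul_sub, Finset.sum_sub_distrib]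
    rw [← Finset.sum_mul, h1, one_mul]

end Population

end PanelATT

/-! ### Linearization of products of weights and ratios -/

namespace PanelATT

section Linearization

variable {J R : ℕ}

lemma sum_scWeights (q : Fin (J + 2) → Fin (R + 1) → ℝ) : ∑ g, scWeights q g = 1 := by
  rw [Fin.sum_univ_castSucc]
  simp only [scWeights_castSucc, scWeights_last]
  ring

/-- The derivative with respect to `q` of the weighted sum of the synthetic control weights with
coefficients `p * d g`. -/
noncomputable def weightSlope (q : Fin (J + 2) → Fin (R + 1) → ℝ) (p : ℝ) (d : Fin (J + 1) → ℝ)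
    (t : Fin (R + 1)) : ℝ :=
  ∑ j : Fin J, p * (d j.castSucc - d (Fin.last J)) * scGradient q j t

/-- The last error is minus the sum of the others, so it can be eliminated. -/
lemma sum_mul_sub_eq_of_sum_eq (u v v' : Fin (J + 1) → ℝ) (h : ∑ g, v g = ∑ g, v' g) :
    ∑ g, u g * (v g - v' g) =
      ∑ j : Fin J, (u j.castSucc - u (Fin.last J)) * (v j.castSucc - v' j.castSucc) := by
  rw [Fin.sum_univ_castSucc, Fin.sum_univ_castSucc] at h
  rw [Fin.sum_univ_castSucc]
  have h1 : v (Fin.last J) - v' (Fin.last J) = -∑ j : Fin J, (v j.castSucc - v' j.castSucc) := by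
    rw [Finset.sum_sub_distrib]; linarith
  rw [h1, mul_neg, Finset.mul_sum, ← sub_eq_add_neg, ← Finset.sum_sub_distrib]
  exact Finset.sum_congr rfl fun j _ => by ring

lemma sum_weightSlope_mul (q : Fin (J + 2) → Fin (R + 1) → ℝ) (p : ℝ) (w d : Fin (J + 1) → ℝ)
    (z : Fin (J + 2) → Fin (R + 1) → ℝ) :
    ∑ t, (weightSlope q p d t * z 0 t - ∑ g : Fin (J + 1), weightSlope q p d t * w g * z g.succ t) =
      ∑ j : Fin J, p * (d j.castSucc - d (Fin.last J)) *
        ∑ t, scGradient q j t * (z 0 t - ∑ g : Fin (J + 1), w g * z g.succ t) := by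
  simp only [Finset.mul_sum]
  rw [Finset.sum_comm]
  refine Finset.sum_congr rfl fun t _ => ?_
  simp only [mul_assoc (weightSlope q p d t)]
  rw [← Finset.mul_sum, ← mul_sub, weightSlope, Finset.sum_mul]
  simp only [mul_assoc]

/-- The linear approximation of the products of estimated weights and ratios has a quadratic
remainder. -/
lemma exists_abs_weight_ratio_remainder_le (J R : ℕ) (B : ℝ) : ∃ C : ℝ, 0 ≤ C ∧
    ∀ (q q' : Fin (J + 2) → Fin (R + 1) → ℝ) (w d r' : Fin (J + 1) → ℝ) (p : Fin (J + 2) → ℝ),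
    ∑ g, w g = 1 → (∀ t, q 0 t = ∑ g : Fin (J + 1), w g * q g.succ t) →
    ((diffMatrix q)ᵀ * diffMatrix q).det ≠ 0 →
    (∀ i j, |((diffMatrix q)ᵀ * diffMatrix q)⁻¹ i j| ≤ B) → (∀ t j, |diffMatrix q t j| ≤ B) →
    (∀ g, |w g| ≤ B) → (∀ g, |d g| ≤ B) → (∀ g, 0 < p g) → (∀ g, p g ≤ 1) →
    |∑ g, (scWeights q' g * r' g - w g * (p 0 / p g.succ)) * (p g.succ * d g) -
      (∑ g, w g * (p g.succ * d g) * (r' g - p 0 / p g.succ) +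
        ∑ t, (weightSlope q (p 0) d t * (q' 0 t - q 0 t) - ∑ g : Fin (J + 1),
          weightSlope q (p 0) d t * w g * (q' g.succ t - q g.succ t)))| ≤
    C * ((∑ g, |r' g - p 0 / p g.succ|) + (∑ g, |scWeights q' g - w g|) +
      ∑ g, ∑ t, |q' g t - q g t|) ^ 2 := by
  obtain ⟨C, hC0, hC⟩ := exists_abs_scWeights_remainder_le J R B
  refine ⟨(∑ _g : Fin (J + 1), |B|) + ∑ _j : Fin J, 2 * |B| * C, by positivity, ?_⟩
  intro q q' w d r' p hw hq hdet hN hM hwB hd hp hp1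
  obtain ⟨ρ, hρ⟩ : ∃ ρ, ρ = ∑ g, |r' g - p 0 / p g.succ| := ⟨_, rfl⟩
  obtain ⟨τ, hτ⟩ : ∃ τ, τ = ∑ g, |scWeights q' g - w g| := ⟨_, rfl⟩
  obtain ⟨σ, hσ⟩ : ∃ σ, σ = ∑ g, ∑ t, |q' g t - q g t| := ⟨_, rfl⟩
  have hρ0 : 0 ≤ ρ := by rw [hρ]; positivity
  have hτ0 : 0 ≤ τ := by rw [hτ]; positivity
  have hσ0 : 0 ≤ σ := by rw [hσ]; positivity
  have hrem := fun j => hC q q' w hw hq hdet hN hM hwB j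
  rw [← hρ, ← hτ, ← hσ]
  simp only [← hτ, ← hσ] at hrem
  have hlin := sum_weightSlope_mul q (p 0) w d fun g t => q' g t - q g t
  have hsum := sum_mul_sub_eq_of_sum_eq (fun g => p 0 * d g) (scWeights q') w
    ((sum_scWeights q').trans hw.symm)
  -- Since `ŵ r̂ - w r = w (r̂ - r) + (ŵ - w) (r̂ - r) + r (ŵ - w)` and `r_{1,g} p_g = p_1`,
  -- removing the linear part leaves a product of errors and the linearization error of the weights.
  have hdec : ∑ g, (scWeights q' g * r' g - w g * (p 0 / p g.succ)) * (p g.succ * d g) -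
      (∑ g, w g * (p g.succ * d g) * (r' g - p 0 / p g.succ) +
        ∑ t, (weightSlope q (p 0) d t * (q' 0 t - q 0 t) - ∑ g : Fin (J + 1),
          weightSlope q (p 0) d t * w g * (q' g.succ t - q g.succ t))) =
      ∑ g, (scWeights q' g - w g) * (r' g - p 0 / p g.succ) * (p g.succ * d g) +
      ∑ j : Fin J, p 0 * (d j.castSucc - d (Fin.last J)) * (scWeights q' j.castSucc - w j.castSucc -
        ∑ t, scGradient q j t *
          ((q' 0 t - q 0 t) - ∑ g : Fin (J + 1), w g * (q' g.succ t - q g.succ t))) := by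
    have h1 : ∑ g, (scWeights q' g * r' g - w g * (p 0 / p g.succ)) * (p g.succ * d g) =
        ∑ g, w g * (p g.succ * d g) * (r' g - p 0 / p g.succ) +
        ∑ g, (scWeights q' g - w g) * (r' g - p 0 / p g.succ) * (p g.succ * d g) +
        ∑ g, p 0 * d g * (scWeights q' g - w g) := by
      rw [← Finset.sum_add_distrib, ← Finset.sum_add_distrib]
      refine Finset.sum_congr rfl fun g _ => ?_
      have := (hp g.succ).ne'
      field_simp
      ring
    rw [h1, hsum, hlin]
    simp only [mul_sub, Finset.sum_sub_distrib]
    ring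
  rw [hdec, add_mul, Finset.sum_mul, Finset.sum_mul]
  refine (abs_add_le _ _).trans (add_le_add ?_ ?_)
  · refine (Finset.abs_sum_le_sum_abs _ _).trans (Finset.sum_le_sum fun g _ => ?_)
    have h1 : |scWeights q' g - w g| ≤ τ := by
      rw [hτ]; exact Finset.single_le_sum (f := fun g => |scWeights q' g - w g|)
        (fun _ _ => abs_nonneg _) (Finset.mem_univ g)
    have h2 : |r' g - p 0 / p g.succ| ≤ ρ := by
      rw [hρ]; exact Finset.single_le_sum (f := fun g : Fin (J + 1) => |r' g - p 0 / p g.succ|)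
        (fun _ _ => abs_nonneg _) (Finset.mem_univ g)
    have h3 : |p g.succ * d g| ≤ |B| := by
      rw [abs_mul, abs_of_pos (hp _)]
      exact (mul_le_of_le_one_left (abs_nonneg _) (hp1 _)).trans ((hd g).trans (le_abs_self B))
    rw [abs_mul, abs_mul, mul_comm]
    refine mul_le_mul h3 ?_ (by positivity) (abs_nonneg _)
    exact (mul_le_mul h1 h2 (abs_nonneg _) hτ0).trans (by nlinarith)
  · refine (Finset.abs_sum_le_sum_abs _ _).trans (Finset.sum_le_sum fun j _ => ?_)
    have h3 : |p 0 * (d j.castSucc - d (Fin.last J))| ≤ 2 * |B| := by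
      rw [abs_mul, abs_of_pos (hp _)]
      refine (mul_le_of_le_one_left (abs_nonneg _) (hp1 _)).trans ((abs_sub _ _).trans ?_)
      linarith [hd j.castSucc, hd (Fin.last J), le_abs_self B]
    rw [abs_mul, mul_assoc (2 * |B|)]
    refine mul_le_mul h3 ((hrem j).trans (mul_le_mul_of_nonneg_left ?_ hC0)) (abs_nonneg _)
      (by positivity)
    nlinarith

end Linearization

end PanelATT

/-! ### Integrated linearization -/

namespace PanelATT

section IntegratedLinearization

variable {J R : ℕ} {FX : Measure ℝ} [IsProbabilityMeasure FX] {q : Fin (J + 2) → Fin (R + 2) → ℝ → ℝ}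
  {w d : Fin (J + 1) → ℝ → ℝ} {p : Fin (J + 2) → ℝ → ℝ}

/-- `weightSlope` as a function of the covariate. -/
noncomputable def slopeFun (q : Fin (J + 2) → Fin (R + 2) → ℝ → ℝ) (p : Fin (J + 2) → ℝ → ℝ)
    (d : Fin (J + 1) → ℝ → ℝ) (t : Fin (R + 1)) (x : ℝ) : ℝ :=
  weightSlope (fun g t => q g t.castSucc x) (p 0 x) (fun g => d g x) t

/-- The total pointwise error of estimators of ratios, weights and outcome regressions. -/
noncomputable def nuisanceError (q : Fin (J + 2) → Fin (R + 2) → ℝ → ℝ) (p : Fin (J + 2) → ℝ → ℝ)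
    (w : Fin (J + 1) → ℝ → ℝ) (r' : Fin (J + 1) → ℝ → ℝ) (q' : Fin (J + 2) → Fin (R + 1) → ℝ → ℝ)
    (x : ℝ) : ℝ :=
  (∑ g, |r' g x - ratio p g x|) + (∑ g, |scWeights (fun g t => q' g t x) g - w g x|) +
    ∑ g, ∑ t : Fin (R + 1), |q' g t x - q g t.castSucc x|

lemma measurable_comp_scWeights {q' : Fin (J + 2) → Fin (R + 1) → ℝ → ℝ}
    (hq' : ∀ g t, Measurable (q' g t)) (g : Fin (J + 1)) :
    Measurable fun x => scWeights (fun g t => q' g t x) g :=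
  (measurable_scWeights g).comp (measurable_pi_iff.2 fun g => measurable_pi_iff.2 fun t => hq' g t)

lemma measurable_slopeFun (hq : ∀ g t, Measurable (q g t)) (hp : ∀ g, Measurable (p g))
    (hd : ∀ g, Measurable (d g)) (t : Fin (R + 1)) : Measurable (slopeFun q p d t) := by
  have h1 : Measurable fun x g (t : Fin (R + 1)) => q g t.castSucc x :=
    measurable_pi_iff.2 fun g => measurable_pi_iff.2 fun t => hq g _
  have h2 : ∀ j : Fin J, Measurable fun x => p 0 x * (d j.castSucc x - d (Fin.last J) x) *
      scGradient (fun g (t : Fin (R + 1)) => q g t.castSucc x) j t := fun j =>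
    ((hp 0).mul ((hd _).sub (hd _))).mul ((measurable_scGradient j t).comp h1)
  unfold slopeFun weightSlope
  exact Finset.measurable_fun_sum _ fun j _ => h2 j

lemma measurable_nuisanceError (hq : ∀ g t, Measurable (q g t)) (hp : ∀ g, Measurable (p g))
    (hw : ∀ g, Measurable (w g)) {r' : Fin (J + 1) → ℝ → ℝ}
    {q' : Fin (J + 2) → Fin (R + 1) → ℝ → ℝ} (hr' : ∀ g, Measurable (r' g))
    (hq' : ∀ g t, Measurable (q' g t)) : Measurable (nuisanceError q p w r' q') := by
  have h1 : Measurable fun x => ∑ g, |r' g x - ratio p g x| :=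
    Finset.measurable_fun_sum _ fun g _ => ((hr' g).sub (measurable_ratio hp g)).abs
  have h2 : Measurable fun x => ∑ g, |scWeights (fun g t => q' g t x) g - w g x| :=
    Finset.measurable_fun_sum _ fun g _ => ((measurable_comp_scWeights hq' g).sub (hw g)).abs
  have h3 : Measurable fun x => ∑ g, ∑ t : Fin (R + 1), |q' g t x - q g t.castSucc x| :=
    Finset.measurable_fun_sum _ fun g _ => Finset.measurable_fun_sum _ fun t _ =>
      ((hq' g t).sub (hq g _)).abs
  exact (h1.add h2).add h3

lemma abs_slopeFun_le {B x : ℝ} (hx : GoodDesign B q w x) (hd : ∀ g, |d g x| ≤ B) (hp : 0 < p 0 x)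
    (hp1 : p 0 x ≤ 1) (t : Fin (R + 1)) : |slopeFun q p d t x| ≤ J * (2 * B * B) := by
  have hB0 : 0 ≤ B := (abs_nonneg _).trans (hd 0)
  have h1 : (J : ℝ) * (2 * B * B) = ∑ _j : Fin J, 2 * B * B := by simp
  rw [h1, slopeFun, weightSlope]
  refine (Finset.abs_sum_le_sum_abs _ _).trans (Finset.sum_le_sum fun j _ => ?_)
  rw [abs_mul]
  refine mul_le_mul ?_ (hx.2.2.2.2.2.2.1 j t) (abs_nonneg _) (by positivity)
  rw [abs_mul, abs_of_pos hp]
  refine (mul_le_of_le_one_left (abs_nonneg _) hp1).trans ((abs_sub _ _).trans ?_)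
  linarith [hd j.castSucc, hd (Fin.last J)]

lemma abs_le_nuisanceError {r' : Fin (J + 1) → ℝ → ℝ} {q' : Fin (J + 2) → Fin (R + 1) → ℝ → ℝ}
    (x : ℝ) : 0 ≤ nuisanceError q p w r' q' x ∧
      (∀ g, |r' g x - ratio p g x| ≤ nuisanceError q p w r' q' x) ∧
      (∀ g, |scWeights (fun g t => q' g t x) g - w g x| ≤ nuisanceError q p w r' q' x) ∧
      ∀ g t, |q' g t x - q g (Fin.castSucc t) x| ≤ nuisanceError q p w r' q' x := by
  have h1 : 0 ≤ ∑ g, |r' g x - ratio p g x| := by positivity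
  have h2 : 0 ≤ ∑ g, |scWeights (fun g t => q' g t x) g - w g x| := by positivity
  have h3 : 0 ≤ ∑ g, ∑ t : Fin (R + 1), |q' g t x - q g t.castSucc x| := by positivity
  refine ⟨by unfold nuisanceError; positivity, fun g => ?_, fun g => ?_, fun g t => ?_⟩
  · have := Finset.single_le_sum (f := fun g => |r' g x - ratio p g x|)
      (fun _ _ => abs_nonneg _) (Finset.mem_univ g)
    unfold nuisanceError; linarith
  · have := Finset.single_le_sum (f := fun g => |scWeights (fun g t => q' g t x) g - w g x|)
      (fun _ _ => abs_nonneg _) (Finset.mem_univ g)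
    unfold nuisanceError; linarith
  · have h4 := Finset.single_le_sum (f := fun t : Fin (R + 1) => |q' g t x - q g t.castSucc x|)
      (fun _ _ => abs_nonneg _) (Finset.mem_univ t)
    have h5 := Finset.single_le_sum
      (f := fun g => ∑ t : Fin (R + 1), |q' g t x - q g t.castSucc x|)
      (fun _ _ => Finset.sum_nonneg fun _ _ => abs_nonneg _) (Finset.mem_univ g)
    unfold nuisanceError; linarith

/-- Linear approximation of the bias term of the moment function in the errors of the estimators
of the ratios and of the outcome regressions. -/
lemma exists_enorm_integral_remainder_le {B : ℝ} (hgd : ∀ᵐ x ∂FX, GoodDesign B q w x)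
    (hdB : ∀ g, ∀ᵐ x ∂FX, |d g x| ≤ B) (hp0 : ∀ g, ∀ᵐ x ∂FX, 0 < p g x)
    (hp1 : ∀ g, ∀ᵐ x ∂FX, p g x ≤ 1) (hq : ∀ g t, Measurable (q g t)) (hp : ∀ g, Measurable (p g))
    (hw : ∀ g, Measurable (w g)) (hd : ∀ g, Measurable (d g)) :
    ∃ C : ℝ, 0 ≤ C ∧ ∀ (r' : Fin (J + 1) → ℝ → ℝ) (q' : Fin (J + 2) → Fin (R + 1) → ℝ → ℝ),
      (∀ g, Measurable (r' g)) → (∀ g t, Measurable (q' g t)) →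
      MemLp (nuisanceError q p w r' q') 2 FX →
      ‖∑ g, ∫ x, (scWeights (fun g t => q' g t x) g * r' g x - w g x * ratio p g x) *
          (p g.succ x * d g x) ∂FX -
        (∑ g, ∫ x, w g x * (p g.succ x * d g x) * (r' g x - ratio p g x) ∂FX +
          ∑ t, (∫ x, slopeFun q p d t x * (q' 0 t x - q 0 t.castSucc x) ∂FX -
            ∑ g : Fin (J + 1), ∫ x, slopeFun q p d t x * w g x *
              (q' g.succ t x - q g.succ t.castSucc x) ∂FX))‖ₑ ≤
      ENNReal.ofReal C * eLpNorm (nuisanceError q p w r' q') 2 FX ^ 2 := by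
  obtain ⟨C, hC0, hC⟩ := exists_abs_weight_ratio_remainder_le J R B
  refine ⟨C, hC0, fun r' q' hr' hq' hT => ?_⟩
  let T := nuisanceError q p w r' q'
  have hr := measurable_ratio hp
  have hsc := measurable_comp_scWeights hq'
  have hb := measurable_slopeFun hq hp hd
  -- Every integrand is dominated by a multiple of `T + T²`, where `T` is the total pointwise error,
  -- so its square integrability settles all integrability questions.
  have hI : ∀ (F : ℝ → ℝ) (c : ℝ), Measurable F → (∀ᵐ x ∂FX, |F x| ≤ c * (T x + T x ^ 2)) →
      Integrable F FX := fun F c hF h =>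
    (((hT.integrable one_le_two).add hT.integrable_sq).const_mul c).mono' hF.aestronglyMeasurable h
  have hall : ∀ᵐ x ∂FX, GoodDesign B q w x ∧ (∀ g, |d g x| ≤ B) ∧ (∀ g, 0 < p g x) ∧
      ∀ g, p g x ≤ 1 := by
    filter_upwards [hgd, ae_all_iff.2 hdB, ae_all_iff.2 hp0, ae_all_iff.2 hp1] with x h1 h2 h3 h4
    exact ⟨h1, h2, h3, h4⟩
  have hi1 : ∀ g, Integrable (fun x => w g x * (p g.succ x * d g x) * (r' g x - ratio p g x)) FX := by
    intro g
    refine hI _ (B * B) (((hw g).mul ((hp _).mul (hd g))).mul ((hr' g).sub (hr g))) ?_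
    filter_upwards [hall] with x ⟨h1, h2, h3, h4⟩
    obtain ⟨k0, k1, -, -⟩ := abs_le_nuisanceError (q := q) (p := p) (w := w) (r' := r') (q' := q') x
    have hB0 : 0 ≤ B := (abs_nonneg _).trans (h2 0)
    rw [abs_mul, abs_mul, abs_mul, abs_of_pos (h3 _)]
    have e1 : p g.succ x * |d g x| ≤ B :=
      (mul_le_of_le_one_left (abs_nonneg _) (h4 _)).trans (h2 g)
    refine mul_le_mul (mul_le_mul (h1.2.2.2.2.2.1 g) e1 (mul_nonneg (h3 _).le (abs_nonneg _)) hB0)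
      ((k1 g).trans ?_) (abs_nonneg _) (by positivity)
    exact le_add_of_nonneg_right (sq_nonneg _)
  have hi2 : ∀ t, Integrable (fun x => slopeFun q p d t x * (q' 0 t x - q 0 t.castSucc x)) FX := by
    intro t
    refine hI _ (J * (2 * B * B)) ((hb t).mul ((hq' 0 t).sub (hq 0 _))) ?_
    filter_upwards [hall] with x ⟨h1, h2, h3, h4⟩
    obtain ⟨k0, -, -, k3⟩ := abs_le_nuisanceError (q := q) (p := p) (w := w) (r' := r') (q' := q') x
    have hs := abs_slopeFun_le h1 h2 (h3 0) (h4 0) t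
    rw [abs_mul]
    exact mul_le_mul hs ((k3 0 t).trans (le_add_of_nonneg_right (sq_nonneg _))) (abs_nonneg _)
      ((abs_nonneg _).trans hs)
  have hi3 : ∀ t (g : Fin (J + 1)), Integrable (fun x => slopeFun q p d t x * w g x *
      (q' g.succ t x - q g.succ t.castSucc x)) FX := by
    intro t g
    refine hI _ (J * (2 * B * B) * B) (((hb t).mul (hw g)).mul ((hq' _ t).sub (hq _ _))) ?_
    filter_upwards [hall] with x ⟨h1, h2, h3, h4⟩
    obtain ⟨k0, -, -, k3⟩ := abs_le_nuisanceError (q := q) (p := p) (w := w) (r' := r') (q' := q') x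
    have hs := abs_slopeFun_le h1 h2 (h3 0) (h4 0) t
    have hs0 := (abs_nonneg _).trans hs
    have hB0 : 0 ≤ B := (abs_nonneg _).trans (h2 0)
    rw [abs_mul, abs_mul]
    exact mul_le_mul (mul_le_mul hs (h1.2.2.2.2.2.1 g) (abs_nonneg _) hs0)
      ((k3 _ t).trans (le_add_of_nonneg_right (sq_nonneg _))) (abs_nonneg _) (mul_nonneg hs0 hB0)
  have hi4 : ∀ g, Integrable (fun x => (scWeights (fun g t => q' g t x) g * r' g x -
      w g x * ratio p g x) * (p g.succ x * d g x)) FX := by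
    intro g
    refine hI _ (B * B + B + B) ((((hsc g).mul (hr' g)).sub ((hw g).mul (hr g))).mul
      ((hp _).mul (hd g))) ?_
    filter_upwards [hall] with x ⟨h1, h2, h3, h4⟩
    obtain ⟨k0, k1, k2, -⟩ := abs_le_nuisanceError (q := q) (p := p) (w := w) (r' := r') (q' := q') x
    have hB0 : 0 ≤ B := (abs_nonneg _).trans (h2 0)
    have e1 : |p g.succ x * d g x| ≤ B := by
      rw [abs_mul, abs_of_pos (h3 _)]
      exact (mul_le_of_le_one_left (abs_nonneg _) (h4 _)).trans (h2 g)
    have e2 : |p 0 x * d g x| ≤ B := by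
      rw [abs_mul, abs_of_pos (h3 _)]
      exact (mul_le_of_le_one_left (abs_nonneg _) (h4 _)).trans (h2 g)
    have e3 : (scWeights (fun g t => q' g t x) g * r' g x - w g x * ratio p g x) *
        (p g.succ x * d g x) = w g x * (r' g x - ratio p g x) * (p g.succ x * d g x) +
        (scWeights (fun g t => q' g t x) g - w g x) * (r' g x - ratio p g x) *
          (p g.succ x * d g x) + (scWeights (fun g t => q' g t x) g - w g x) * (p 0 x * d g x) := by
      have := (h3 g.succ).ne'
      simp only [ratio]
      field_simp
      ring
    rw [e3]
    have f1 : |w g x * (r' g x - ratio p g x) * (p g.succ x * d g x)| ≤ B * T x * B := by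
      rw [abs_mul, abs_mul]
      exact mul_le_mul (mul_le_mul (h1.2.2.2.2.2.1 g) (k1 g) (abs_nonneg _) hB0) e1 (abs_nonneg _)
        (mul_nonneg hB0 k0)
    have f2 : |(scWeights (fun g t => q' g t x) g - w g x) * (r' g x - ratio p g x) *
        (p g.succ x * d g x)| ≤ T x * T x * B := by
      rw [abs_mul, abs_mul]
      exact mul_le_mul (mul_le_mul (k2 g) (k1 g) (abs_nonneg _) k0) e1 (abs_nonneg _)
        (mul_nonneg k0 k0)
    have f3 : |(scWeights (fun g t => q' g t x) g - w g x) * (p 0 x * d g x)| ≤ T x * B := by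
      rw [abs_mul]
      exact mul_le_mul (k2 g) e2 (abs_nonneg _) k0
    refine (abs_add_three _ _ _).trans ?_
    have k0' : 0 ≤ T x := k0
    nlinarith [mul_nonneg (mul_nonneg hB0 hB0) (sq_nonneg (T x)), mul_nonneg hB0 (sq_nonneg (T x)),
      mul_nonneg hB0 k0']
  rw [← integral_finsetSum _ fun g _ => hi4 g, ← integral_finsetSum _ fun g _ => hi1 g]
  have h5 : ∀ t, ∫ x, slopeFun q p d t x * (q' 0 t x - q 0 t.castSucc x) ∂FX -
      ∑ g : Fin (J + 1), ∫ x, slopeFun q p d t x * w g x *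
        (q' g.succ t x - q g.succ t.castSucc x) ∂FX =
      ∫ x, (slopeFun q p d t x * (q' 0 t x - q 0 t.castSucc x) - ∑ g : Fin (J + 1),
        slopeFun q p d t x * w g x * (q' g.succ t x - q g.succ t.castSucc x)) ∂FX := fun t => by
    rw [integral_sub (hi2 t) (integrable_finsetSum _ fun g _ => hi3 t g),
      integral_finsetSum _ fun g _ => hi3 t g]
  have hi5 : ∀ t, Integrable (fun x => slopeFun q p d t x * (q' 0 t x - q 0 t.castSucc x) -
      ∑ g : Fin (J + 1), slopeFun q p d t x * w g x *
        (q' g.succ t x - q g.succ t.castSucc x)) FX := fun t =>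
    (hi2 t).sub (integrable_finsetSum Finset.univ fun g _ => hi3 t g)
  have hi6 := integrable_finsetSum Finset.univ fun g _ => hi1 g
  have hi7 : Integrable (fun x => ∑ g, w g x * (p g.succ x * d g x) * (r' g x - ratio p g x) +
      ∑ t, (slopeFun q p d t x * (q' 0 t x - q 0 t.castSucc x) - ∑ g : Fin (J + 1),
        slopeFun q p d t x * w g x * (q' g.succ t x - q g.succ t.castSucc x))) FX :=
    hi6.add (integrable_finsetSum _ fun t _ => hi5 t)
  rw [Finset.sum_congr rfl fun t _ => h5 t, ← integral_finsetSum _ fun t _ => hi5 t,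
    ← integral_add hi6 (integrable_finsetSum _ fun t _ => hi5 t),
    ← integral_sub (integrable_finsetSum _ fun g _ => hi4 g) hi7]
  refine (enorm_integral_le_lintegral_enorm _).trans ?_
  rw [eLpNorm_two_sq, ← lintegral_const_mul' _ _ ENNReal.ofReal_ne_top]
  refine lintegral_mono_ae ?_
  filter_upwards [hall] with x ⟨h1, h2, h3, h4⟩
  rw [← enorm_pow, Real.enorm_eq_ofReal_abs, Real.enorm_eq_ofReal_abs, 
    abs_of_nonneg (sq_nonneg (nuisanceError q p w r' q' x)),
    ← ENNReal.ofReal_mul hC0]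
  exact ENNReal.ofReal_le_ofReal (hC (fun g t => q g t.castSucc x) (fun g t => q' g t x)
    (fun g => w g x) (fun g => d g x) (fun g => r' g x) (fun g => p g x) h1.1 h1.2.1 h1.2.2.1
    h1.2.2.2.1 h1.2.2.2.2.1 h1.2.2.2.2.2.1 h2 h3 h4)

end IntegratedLinearization

end PanelATT

/-! ### Rates of the nuisance estimators and orthogonality of residuals -/

namespace PanelATT

section NuisanceError

variable {Ω : Type*} [MeasurableSpace Ω] {Pr : Measure Ω} {J R L : ℕ} {FX : Measure ℝ}
  {fold : FoldMap L} {S : ℕ → Ω → Obs J R ℝ} {V : ℕ → Ω → ℝ} {K f : ℝ → ℝ} {h : ℕ → ℝ}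
  {q : Fin (J + 2) → Fin (R + 2) → ℝ → ℝ} {p : Fin (J + 2) → ℝ → ℝ} {w : Fin (J + 1) → ℝ → ℝ}
  {rHat : Fin (J + 1) → ℕ → Fin L → Ω → ℝ → ℝ}
  {qHat : Fin (J + 2) → Fin (R + 1) → ℕ → Fin L → Ω → ℝ → ℝ}

lemma eLpNorm_sum_abs_le {ι : Type*} (s : Finset ι) {F : ι → ℝ → ℝ} (hF : ∀ i, Measurable (F i)) :
    eLpNorm (fun x => ∑ i ∈ s, |F i x|) 2 FX ≤ ∑ i ∈ s, eLpNorm (F i) 2 FX := by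
  have h1 : (fun x => ∑ i ∈ s, |F i x|) = ∑ i ∈ s, fun x => ‖F i x‖ := by
    ext x; simp
  rw [h1]
  refine (eLpNorm_sum_le (fun i _ => (hF i).norm.aestronglyMeasurable) one_le_two).trans
    (Finset.sum_le_sum fun i _ => le_of_eq (eLpNorm_norm _))

lemma KernelConditions.smallProb_nuisanceError (hL : 0 < L)
    (hc : KernelConditions Pr FX fold S V K h f q p w rHat qHat) (ℓ : Fin L)
    (hq : ∀ g t, Measurable (q g t)) (hp : ∀ g, Measurable (p g)) (hw : ∀ g, Measurable (w g))
    (hr' : ∀ g k η, Measurable (rHat g k ℓ η)) (hq' : ∀ g t k η, Measurable (qHat g t k ℓ η)) :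
    SmallProb Pr fun k η => ENNReal.ofReal (((L * k : ℕ) : ℝ) ^ (1 / 4 : ℝ)) *
      eLpNorm (nuisanceError q p w (fun g => rHat g k ℓ η) (fun g t => qHat g t k ℓ η)) 2 FX := by
  have h1 := SmallProb.sum Finset.univ fun g _ => (hc.rate_r ℓ g).smallProb_rate hL
  have h2 := SmallProb.sum Finset.univ fun g _ => (hc.rate_w ℓ g).smallProb_rate hL
  have h3 := SmallProb.sum Finset.univ fun g _ =>
    SmallProb.sum Finset.univ fun t _ => (hc.rate_m ℓ g t).smallProb_rate hL
  refine ((h1.add h2).add h3).mono fun k η => ?_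
  simp only [← Finset.mul_sum, ← mul_add]
  refine mul_le_mul_right ?_ _
  have m1 : ∀ g, Measurable fun x => rHat g k ℓ η x - ratio p g x := fun g =>
    (hr' g k η).sub (measurable_ratio hp g)
  have m2 : ∀ g, Measurable fun x => scWeightsHat qHat g k ℓ η x - w g x := fun g =>
    (measurable_comp_scWeights (fun g t => hq' g t k η) g).sub (hw g)
  have m3 : ∀ g (t : Fin (R + 1)), Measurable fun x => qHat g t k ℓ η x - q g t.castSucc x :=
    fun g t => (hq' g t k η).sub (hq g _)
  have s1 : Measurable fun x => ∑ g, |rHat g k ℓ η x - ratio p g x| :=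
    Finset.measurable_fun_sum _ fun g _ => (m1 g).abs
  have s2 : Measurable fun x => ∑ g, |scWeightsHat qHat g k ℓ η x - w g x| :=
    Finset.measurable_fun_sum _ fun g _ => (m2 g).abs
  have s3' : ∀ g, Measurable fun x => ∑ t : Fin (R + 1), |qHat g t k ℓ η x - q g t.castSucc x| :=
    fun g => Finset.measurable_fun_sum _ fun t _ => (m3 g t).abs
  have s3 : Measurable fun x => ∑ g, ∑ t : Fin (R + 1), |qHat g t k ℓ η x - q g t.castSucc x| :=
    Finset.measurable_fun_sum _ fun g _ => s3' g
  refine (eLpNorm_add_le (s1.add s2).aestronglyMeasurable s3.aestronglyMeasurable one_le_two).trans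
    (add_le_add ((eLpNorm_add_le s1.aestronglyMeasurable s2.aestronglyMeasurable one_le_two).trans
      (add_le_add (eLpNorm_sum_abs_le _ m1) (eLpNorm_sum_abs_le _ m2))) ?_)
  have e : (fun x => ∑ g, ∑ t : Fin (R + 1), |qHat g t k ℓ η x - q g t.castSucc x|) =
      fun x => ∑ g, |(∑ t : Fin (R + 1), |qHat g t k ℓ η x - q g t.castSucc x|)| := by
    ext x
    exact Finset.sum_congr rfl fun g _ => (abs_of_nonneg (by positivity)).symm
  rw [e]
  exact (eLpNorm_sum_abs_le _ s3').trans
    (Finset.sum_le_sum fun g _ => eLpNorm_sum_abs_le _ (m3 g))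

/-- The bias of the moment function is asymptotically linear in the errors of the estimators of
the ratios and of the outcome regressions. -/
lemma KernelConditions.smallProb_linearization [IsProbabilityMeasure FX] (hL : 0 < L)
    (hc : KernelConditions Pr FX fold S V K h f q p w rHat qHat) (ℓ : Fin L)
    {d : Fin (J + 1) → ℝ → ℝ} {B : ℝ} (hgd : ∀ᵐ x ∂FX, GoodDesign B q w x)
    (hdB : ∀ g, ∀ᵐ x ∂FX, |d g x| ≤ B) (hp0 : ∀ g, ∀ᵐ x ∂FX, 0 < p g x)
    (hp1 : ∀ g, ∀ᵐ x ∂FX, p g x ≤ 1) (hq : ∀ g t, Measurable (q g t)) (hp : ∀ g, Measurable (p g))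
    (hw : ∀ g, Measurable (w g)) (hd : ∀ g, Measurable (d g))
    (hr' : ∀ g k η, Measurable (rHat g k ℓ η)) (hq' : ∀ g t k η, Measurable (qHat g t k ℓ η)) :
    SmallProb Pr fun k η => ‖√((L * k : ℕ) : ℝ) * (∑ g,
        ∫ x, (scWeightsHat qHat g k ℓ η x * rHat g k ℓ η x - w g x * ratio p g x) *
          (p g.succ x * d g x) ∂FX -
        (∑ g, ∫ x, w g x * (p g.succ x * d g x) * (rHat g k ℓ η x - ratio p g x) ∂FX +
          ∑ t, (∫ x, slopeFun q p d t x * (qHat 0 t k ℓ η x - q 0 t.castSucc x) ∂FX -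
            ∑ g : Fin (J + 1), ∫ x, slopeFun q p d t x * w g x *
              (qHat g.succ t k ℓ η x - q g.succ t.castSucc x) ∂FX)))‖ₑ := by
  obtain ⟨C, hC0, hC⟩ := exists_enorm_integral_remainder_le hgd hdB hp0 hp1 hq hp hw hd
  have hN := hc.smallProb_nuisanceError hL ℓ hq hp hw hr' hq'
  refine ((hN.sq).const_mul (c := ENNReal.ofReal C) ENNReal.ofReal_ne_top |>.mono_event hN.ne_top) ?_
  filter_upwards [eventually_gt_atTop 0] with k hk η hη
  have hn : (0 : ℝ) < ((L * k : ℕ) : ℝ) := by exact_mod_cast Nat.mul_pos hL hk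
  have hT : MemLp (nuisanceError q p w (fun g => rHat g k ℓ η) (fun g t => qHat g t k ℓ η)) 2 FX := by
    refine ⟨(measurable_nuisanceError hq hp hw (fun g => hr' g k η)
      fun g t => hq' g t k η).aestronglyMeasurable, lt_top_iff_ne_top.2 fun h0 => hη ?_⟩
    rw [h0, ENNReal.mul_top]
    simpa using Real.rpow_pos_of_pos hn _
  have h1 := hC (fun g => rHat g k ℓ η) (fun g t => qHat g t k ℓ η) (fun g => hr' g k η)
    (fun g t => hq' g t k η) hT
  -- `√n` is the square of `n^{1/4}`, so a quadratic remainder in errors of order `o_p(n^{-1/4})` is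
  -- negligible.
  have h2 : ‖√((L * k : ℕ) : ℝ)‖ₑ = ENNReal.ofReal (((L * k : ℕ) : ℝ) ^ (1 / 4 : ℝ)) ^ 2 := by
    rw [Real.enorm_eq_ofReal (by positivity), ← ENNReal.ofReal_pow (by positivity),
      ← Real.rpow_natCast, ← Real.rpow_mul hn.le, Real.sqrt_eq_rpow]
    norm_num
  rw [enorm_mul, h2, mul_pow, mul_left_comm]
  exact mul_le_mul_right h1 _

end NuisanceError

section Residuals

variable {Ω₀ E : Type*} [MeasurableSpace Ω₀] [mE : MeasurableSpace E] {J R : ℕ}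
  {pop : Population Ω₀ E J R} {p : Fin (J + 2) → E → ℝ} {m : E → ℝ} {w : Fin (J + 1) → E → ℝ}
  {q : Fin (J + 2) → Fin (R + 2) → E → ℝ}

lemma measurable_ratioResid (hp : ∀ g, Measurable (p g)) (g : Fin (J + 1)) :
    Measurable fun s : Obs J R E => ratioResid p s g :=
  ((measurable_ind 0).sub (((measurable_ratio hp g).comp measurable_cov).mul
    (measurable_ind g.succ))).div ((hp g.succ).comp measurable_cov)

lemma measurable_ipwResid (hp : ∀ g, Measurable (p g)) (hq : ∀ g t, Measurable (q g t))
    (g : Fin (J + 2)) (t : Fin (R + 1)) : Measurable fun s : Obs J R E => ipwResid q p s g t :=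
  ((measurable_ind g).mul (((measurable_pi_apply _).comp measurable_fst).sub
    ((hq g _).comp measurable_cov))).div ((hp g).comp measurable_cov)

lemma ratioResid_eq (s : Obs J R E) (g : Fin (J + 1)) : ratioResid p s g =
    1 / p g.succ (cov s) * ind 0 s - ratio p g (cov s) / p g.succ (cov s) * ind g.succ s := by
  unfold ratioResid
  ring

/-- Given `X`, the numerator has mean `p_1 - r_{1,g} p_g = 0`. -/
lemma memLp_ratioResid (hB : pop.BoundedMoments m p w) (hp : pop.IsPropensity p)
    (ho : pop.Overlap p) (g : Fin (J + 1)) :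
    MemLp (fun s : Obs J R E => ratioResid p s g) 2 pop.law ∧
    ∀ u : E → ℝ, Measurable u → (∃ C, ∀ x, |u x| ≤ C) →
      ∫ s, u (cov s) * ratioResid p s g ∂pop.law = 0 := by
  obtain ⟨C, hC⟩ := hB.2.1 g.succ
  obtain ⟨Cr, hCr⟩ := Population.ae_abs_ratio_le hB hp ho g
  have hpm := fun g => (hp g).1
  have hrm := measurable_ratio hpm g
  have m1 : ∀ {u : E → ℝ} {c : ℝ}, Measurable u → (∀ x, |u x| ≤ c) →
      MemLp (fun x => u x * (1 / p g.succ x)) 2 pop.FX ∧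
      MemLp (fun x => u x * (ratio p g x / p g.succ x)) 2 pop.FX := by
    intro u c hu hc
    constructor
    · refine Population.memLp_of_ae_bounded (hu.mul (measurable_const.div (hpm _))) (C := c * C) ?_
      filter_upwards [hC, ho g.succ] with x h1 h2
      rw [abs_mul, abs_of_pos (a := 1 / p g.succ x) (by positivity)]
      exact mul_le_mul (hc x) h1 (by positivity) ((abs_nonneg _).trans (hc x))
    · refine Population.memLp_of_ae_bounded (hu.mul (hrm.div (hpm _))) (C := c * (Cr * C)) ?_
      filter_upwards [hC, hCr, ho g.succ] with x h1 h2 h3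
      rw [abs_mul, div_eq_mul_one_div, abs_mul, abs_of_pos (a := 1 / p g.succ x) (by positivity)]
      exact mul_le_mul (hc x) (mul_le_mul h2 h1 (by positivity) ((abs_nonneg _).trans h2))
        (by positivity) ((abs_nonneg _).trans (hc x))
  have hi0 := Population.hasCondMoment_ind hp ho 0
  have hig := Population.hasCondMoment_ind hp ho g.succ
  have key : ∀ {u : E → ℝ} {c : ℝ} (hu : Measurable u) (hc : ∀ x, |u x| ≤ c),
      MemLp (fun s : Obs J R E => u (cov s) * (1 / p g.succ (cov s)) * ind 0 s) 2 pop.law ∧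
      MemLp (fun s : Obs J R E => u (cov s) * (ratio p g (cov s) / p g.succ (cov s)) *
        ind g.succ s) 2 pop.law := fun hu hc =>
    ⟨hi0.memLp (hu.mul (measurable_const.div (hpm _))) (m1 hu hc).1,
      hig.memLp (hu.mul (hrm.div (hpm _))) (m1 hu hc).2⟩
  constructor
  · have h1 := key (u := fun _ => 1) (c := 1) measurable_const (by simp)
    simp only [one_mul] at h1
    simp only [ratioResid_eq]
    exact h1.1.sub h1.2
  · rintro u hu ⟨c, hc⟩
    have h1 := key hu hc
    have h2 : ∀ s : Obs J R E, u (cov s) * ratioResid p s g =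
        u (cov s) * (1 / p g.succ (cov s)) * ind 0 s -
        u (cov s) * (ratio p g (cov s) / p g.succ (cov s)) * ind g.succ s := fun s => by
      rw [ratioResid_eq]; ring
    simp only [h2]
    rw [integral_sub (h1.1.integrable one_le_two) (h1.2.integrable one_le_two),
      hi0.mean (fun x => u x * (1 / p g.succ x)) (hu.mul (measurable_const.div (hpm _))) (m1 hu hc).1,
      hig.mean (fun x => u x * (ratio p g x / p g.succ x)) (hu.mul (hrm.div (hpm _))) (m1 hu hc).2,
      sub_eq_zero]
    refine integral_congr_ae ?_
    filter_upwards [ho g.succ] with x hx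
    simp only [ratio]
    field_simp

/-- Within group `g` the residual `Y_t - m_{g,t}(X)` has conditional mean zero. Square integrability
comes from the domination by `C (|Y_t| + B)`. -/
lemma memLp_ipwResid (hB : pop.BoundedMoments m p w) (hp : pop.IsPropensity p)
    (ho : pop.Overlap p) (hq : ∀ g t, IsCondMean pop.P pop.X (pop.grp g) (pop.Y t) (q g t))
    (hY : ∀ t : Fin (R + 1), MemLp (pop.Y t.castSucc) 2 pop.P) (g : Fin (J + 2)) (t : Fin (R + 1))
    (hqB : ∃ B : ℝ, ∀ᵐ x ∂pop.FX, |q g t.castSucc x| ≤ B) :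
    MemLp (fun s : Obs J R E => ipwResid q p s g t) 2 pop.law ∧
    ∀ u : E → ℝ, Measurable u → (∃ C, ∀ x, |u x| ≤ C) →
      ∫ s, u (cov s) * ipwResid q p s g t ∂pop.law = 0 := by
  obtain ⟨C, hC⟩ := hB.2.1 g
  obtain ⟨B, hB'⟩ := hqB
  have hpm := fun g => (hp g).1
  have hqm := fun g t => (hq g t).1
  have hYm : Measurable fun s : Obs J R E => s.1 t.castSucc :=
    (measurable_pi_apply _).comp measurable_fst
  have hYl : MemLp (fun s : Obs J R E => s.1 t.castSucc) 2 pop.law :=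
    (memLp_map_measure_iff hYm.aestronglyMeasurable pop.measurable_obs.aemeasurable).2 (hY t)
  have hmem : MemLp (fun s : Obs J R E => ipwResid q p s g t) 2 pop.law := by
    refine ((hYl.norm.add (memLp_const B)).const_mul C).mono
      (measurable_ipwResid hpm hqm g t).aestronglyMeasurable ?_
    filter_upwards [Population.ae_law_of_ae hC, Population.ae_law_of_ae hB',
      Population.ae_law_of_ae (ho g)] with s h1 h2 h3
    have h4 : |ind g s| ≤ 1 := by unfold ind; split_ifs <;> simp
    have h5 : 0 ≤ 1 / p g (cov s) := by positivity
    have h6 : |s.1 t.castSucc - q g t.castSucc (cov s)| ≤ |s.1 t.castSucc| + B :=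
      (abs_sub _ _).trans (by linarith)
    refine le_trans ?_ (le_abs_self _)
    rw [ipwResid, div_eq_mul_one_div, norm_mul, norm_mul, Real.norm_of_nonneg h5, mul_comm]
    refine mul_le_mul h1 ?_ (by positivity) (h5.trans h1)
    calc _ ≤ 1 * (|s.1 t.castSucc| + B) := mul_le_mul h4 h6 (abs_nonneg _) zero_le_one
      _ = _ := by simp
  refine ⟨hmem, ?_⟩
  rintro u hu ⟨c, hc⟩
  have hA := hp.measure_grp_ne_zero ho g
  have hu' : Measurable fun x => u x / p g x := hu.div (hpm g)
  have hqi : Integrable (q g t.castSucc) pop.FX := Integrable.of_bound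
    (hqm _ _).aestronglyMeasurable B hB'
  have hcm := (hq g t.castSucc).sub (isCondMean_comp pop.measurable_X (hqm g t.castSucc)
    (Population.integrable_comp_X_cond hp ho hqi g))
  have hFm : Measurable fun s : Obs J R E => u (cov s) * ipwResid q p s g t :=
    (hu.comp measurable_cov).mul (measurable_ipwResid hpm hqm g t)
  have hint : Integrable (fun s : Obs J R E => u (cov s) * ipwResid q p s g t) pop.law :=
    (hmem.integrable one_le_two).bdd_mul (hu.comp measurable_cov).aestronglyMeasurable
      (Eventually.of_forall fun s => hc (cov s))
  have heq : ∀ a, u (cov (pop.obs a)) * ipwResid q p (pop.obs a) g t =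
      ind g (pop.obs a) * (u (pop.X a) / p g (pop.X a) *
        (pop.Y t.castSucc a - q g t.castSucc (pop.X a))) := fun a => by
    simp only [ipwResid, Population.cov_obs]
    simp only [Population.obs]
    ring
  have hint' : Integrable (fun a => u (pop.X a) / p g (pop.X a) *
      (pop.Y t.castSucc a - q g t.castSucc (pop.X a))) (pop.P.restrict (pop.grp g)) := by
    rw [← Population.integrable_ind_mul]
    simp only [← heq]
    exact (integrable_map_measure hFm.aestronglyMeasurable pop.measurable_obs.aemeasurable).1 hint
  rw [Population.integral_law hFm]
  simp only [heq]
  rw [Population.integral_ind_mul, (hcm.setIntegral_mul pop.measurable_X hA hu' hint').2]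
  simp

end Residuals

end PanelATT

/-! ### The adjustment terms of the influence function -/

namespace PanelATT

section Adjustment

variable {J R : ℕ}

/-- The effect of the estimation of the ratios and of the synthetic control weights on the moment
function. -/
noncomputable def scAdjustment (q : Fin (J + 2) → Fin (R + 2) → ℝ → ℝ) (p : Fin (J + 2) → ℝ → ℝ)
    (w d : Fin (J + 1) → ℝ → ℝ) (s : Obs J R ℝ) : ℝ :=
  ∑ g, w g (cov s) * (p g.succ (cov s) * d g (cov s)) * ratioResid p s g +
    ∑ t : Fin (R + 1), (slopeFun q p d t (cov s) * ipwResid q p s 0 t -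
      ∑ g : Fin (J + 1), slopeFun q p d t (cov s) * w g (cov s) * ipwResid q p s g.succ t)

/-- The first-stage bias enters the moment function with a minus sign, which is that of `ψ_1` and
`ψ_2`. The vector of all weight influences sums to zero, so its last entry is eliminated as for the
weights themselves. -/
lemma psiSC_eq {m : ℝ → ℝ} {q : Fin (J + 2) → Fin (R + 2) → ℝ → ℝ} {p : Fin (J + 2) → ℝ → ℝ}
    {w : Fin (J + 1) → ℝ → ℝ} {B π θ : ℝ} {s : Obs J R ℝ} (hπ : π ≠ 0)
    (hx : GoodDesign B q w (cov s)) (hp : ∀ g, p g (cov s) ≠ 0) :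
    π * psiSC m q p w π θ s = phi s m (ratio p) w 1 - θ * ind 0 s -
      scAdjustment q p w (fun g x => groupTrend q g.succ x - m x) s := by
  have h1 : π * psi1 m q p w π s = -∑ g, w g (cov s) * (p g.succ (cov s) *
      (groupTrend q g.succ (cov s) - m (cov s))) * ratioResid p s g := by
    rw [psi1, neg_mul, mul_neg, ← mul_assoc, mul_one_div_cancel hπ, one_mul, neg_inj]
    refine Finset.sum_congr rfl fun g _ => ?_
    have := hp g.succ
    rw [ratioResid]
    field_simp
  have h2 : π * psi2 m q p π s = -∑ t : Fin (R + 1),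
      (slopeFun q p (fun g x => groupTrend q g.succ x - m x) t (cov s) * ipwResid q p s 0 t -
        ∑ g : Fin (J + 1), slopeFun q p (fun g x => groupTrend q g.succ x - m x) t (cov s) *
          w g (cov s) * ipwResid q p s g.succ t) := by
    rw [psi2, neg_mul, mul_neg, ← mul_assoc, mul_one_div_cancel hπ, one_mul, neg_inj]
    refine Eq.trans ?_ (sum_weightSlope_mul (fun g t => q g t.castSucc (cov s)) (p 0 (cov s))
      (fun g => w g (cov s)) (fun g => groupTrend q g.succ (cov s) - m (cov s))
      (ipwResid q p s)).symm
    rw [Fin.sum_univ_castSucc]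
    simp only [Fin.snoc_castSucc, Fin.snoc_last]
    rw [mul_neg, Finset.mul_sum, ← sub_eq_add_neg, ← Finset.sum_sub_distrib]
    refine Finset.sum_congr rfl fun j _ => ?_
    rw [← weightInfluence_eq hx.1 hx.2.1 hx.2.2.1 j]
    ring
  rw [psiSC, mul_add, mul_add, psiPT_eq θ hπ, h1, h2, scAdjustment]
  ring

variable {q : Fin (J + 2) → Fin (R + 2) → ℝ → ℝ} {p : Fin (J + 2) → ℝ → ℝ}
  {w d : Fin (J + 1) → ℝ → ℝ}

lemma sum_mul_scAdjustment {ι : Type*} (s : Finset ι) (c : ℝ) (v : ι → ℝ) (S : ι → Obs J R ℝ) :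
    c * ∑ i ∈ s, v i * scAdjustment q p w d (S i) =
      ∑ g, c * ∑ i ∈ s, v i * (w g (cov (S i)) * (p g.succ (cov (S i)) * d g (cov (S i))) *
        ratioResid p (S i) g) +
      ∑ t : Fin (R + 1), (c * ∑ i ∈ s, v i * (slopeFun q p d t (cov (S i)) * ipwResid q p (S i) 0 t) -
        ∑ g : Fin (J + 1), c * ∑ i ∈ s, v i * (slopeFun q p d t (cov (S i)) * w g (cov (S i)) *
          ipwResid q p (S i) g.succ t)) := by
  simp only [scAdjustment, mul_add, mul_sub, Finset.mul_sum, Finset.sum_add_distrib,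
    Finset.sum_sub_distrib]
  congr 1
  · exact Finset.sum_comm
  congr 1
  · exact Finset.sum_comm
  · rw [Finset.sum_comm]
    exact Finset.sum_congr rfl fun t _ => Finset.sum_comm

/-- Every unit belongs to the training sample of all folds but its own. -/
lemma sum_folds_sum_train {L : ℕ} (fold : FoldMap L) (k : ℕ) (F : ℕ → ℝ) :
    ∑ ℓ : Fin L, ∑ i : Train fold k ℓ, F i.1 = ((L : ℝ) - 1) * ∑ i ∈ Finset.range (L * k), F i := by
  have h1 : ∀ ℓ : Fin L, ∑ i : Train fold k ℓ, F i.1 =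
      ∑ i ∈ Finset.range (L * k), F i - ∑ i : Fin (L * k) with fold k i = ℓ, F i := by
    intro ℓ
    rw [← Finset.sum_subtype (Finset.univ.filter fun i => fold k i ≠ ℓ) (by simp)
      fun i : Fin (L * k) => F i, ← Fin.sum_univ_eq_sum_range F, eq_sub_iff_add_eq, add_comm]
    exact Finset.sum_filter_add_sum_filter_not _ _ _
  simp only [h1]
  rw [Finset.sum_sub_distrib, sum_folds_eq_sum_range (fold := fold) k F]
  simp
  ring

end Adjustment

section SyntheticControl

variable {Ω₀ Ω : Type*} [MeasurableSpace Ω₀] [MeasurableSpace Ω]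
  {Pr : Measure Ω} [IsProbabilityMeasure Pr] {J R L : ℕ} {fold : FoldMap L}
  {pop : Population Ω₀ ℝ J R} {S : ℕ → Ω → Obs J R ℝ} {V W : ℕ → Ω → ℝ}
  {ν : Measure ℝ} [IsProbabilityMeasure ν] {K f : ℝ → ℝ} {h : ℕ → ℝ}
  {p : Fin (J + 2) → ℝ → ℝ} {m : ℝ → ℝ} {w d : Fin (J + 1) → ℝ → ℝ}
  {q : Fin (J + 2) → Fin (R + 2) → ℝ → ℝ}
  {rHat : Fin (J + 1) → ℕ → Fin L → Ω → ℝ → ℝ}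
  {qHat : Fin (J + 2) → Fin (R + 1) → ℕ → Fin L → Ω → ℝ → ℝ}

lemma map_cov_law : pop.law.map cov = pop.FX := by
  rw [Population.law, Measure.map_map measurable_cov pop.measurable_obs]
  rfl

lemma ae_bounded_ratio_coeff (hp : pop.IsPropensity p) (ho : pop.Overlap p) {B : ℝ}
    (hgd : ∀ᵐ x ∂pop.FX, GoodDesign B q w x) (hdB : ∀ g, ∀ᵐ x ∂pop.FX, |d g x| ≤ B)
    (g : Fin (J + 1)) : ∃ C : ℝ, ∀ᵐ x ∂pop.FX, |w g x * (p g.succ x * d g x)| ≤ C := by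
  refine ⟨B * B, ?_⟩
  filter_upwards [hgd, hdB g, ho g.succ, hp.ae_le_one g.succ] with x h1 h2 h3 h4
  rw [abs_mul, abs_mul, abs_of_pos h3]
  exact mul_le_mul (h1.2.2.2.2.2.1 g) ((mul_le_of_le_one_left (abs_nonneg _) h4).trans h2)
    (mul_nonneg h3.le (abs_nonneg _)) ((abs_nonneg _).trans h2)

lemma ae_bounded_slopeFun (hp : pop.IsPropensity p) (ho : pop.Overlap p) {B : ℝ}
    (hgd : ∀ᵐ x ∂pop.FX, GoodDesign B q w x) (hdB : ∀ g, ∀ᵐ x ∂pop.FX, |d g x| ≤ B)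
    (t : Fin (R + 1)) : ∃ C : ℝ, ∀ᵐ x ∂pop.FX, |slopeFun q p d t x| ≤ C := by
  refine ⟨J * (2 * B * B), ?_⟩
  filter_upwards [hgd, ae_all_iff.2 hdB, ho 0, hp.ae_le_one 0] with x h1 h2 h3 h4
  exact abs_slopeFun_le h1 h2 h3 h4 t

lemma ae_bounded_slopeFun_mul (hp : pop.IsPropensity p) (ho : pop.Overlap p) {B : ℝ}
    (hgd : ∀ᵐ x ∂pop.FX, GoodDesign B q w x) (hdB : ∀ g, ∀ᵐ x ∂pop.FX, |d g x| ≤ B)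
    (t : Fin (R + 1)) (g : Fin (J + 1)) :
    ∃ C : ℝ, ∀ᵐ x ∂pop.FX, |slopeFun q p d t x * w g x| ≤ C := by
  obtain ⟨C, hC⟩ := ae_bounded_slopeFun hp ho hgd hdB t
  refine ⟨C * B, ?_⟩
  filter_upwards [hgd, hC] with x h1 h2
  rw [abs_mul]
  exact mul_le_mul h2 (h1.2.2.2.2.2.1 g) (abs_nonneg _) ((abs_nonneg _).trans h2)

/-- Linearization reduces the bias to integrals of estimation errors against fixed bounded
coefficients, and the Bahadur representations turn each of these into an average of residuals over
the training sample. -/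
lemma smallProb_fold_adjustment (hL : 2 ≤ L) (hD : IsWeightedSample Pr pop.law ν S V)
    (hfold : fold.Balanced) (hf : IsDensity pop.FX f) (hcomp : IsCompact pop.FX.support)
    (hK : IsKernel K) (hh : ∀ k, 0 < h k) (hh0 : Tendsto h atTop (𝓝 0))
    (hB : pop.BoundedMoments m p w) (hp : pop.IsPropensity p) (ho : pop.Overlap p)
    (hq : ∀ g t, IsCondMean pop.P pop.X (pop.grp g) (pop.Y t) (q g t))
    (hY : ∀ t : Fin (R + 1), MemLp (pop.Y t.castSucc) 2 pop.P) (hw : ∀ g, Measurable (w g))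
    (hd : ∀ g, Measurable (d g)) {B : ℝ} (hgd : ∀ᵐ x ∂pop.FX, GoodDesign B q w x)
    (hdB : ∀ g, ∀ᵐ x ∂pop.FX, |d g x| ≤ B) (ℓ : Fin L)
    (hc : KernelConditions Pr pop.FX fold S V K h f q p w rHat qHat)
    (hr' : ∀ g k η, Measurable (rHat g k ℓ η)) (hq' : ∀ g t k η, Measurable (qHat g t k ℓ η)) :
    SmallProb Pr fun k η => ‖√((L * k : ℕ) : ℝ) * ∑ g,
        ∫ x, (scWeightsHat qHat g k ℓ η x * rHat g k ℓ η x - w g x * ratio p g x) *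
          (p g.succ x * d g x) ∂pop.FX -
      √((L * k : ℕ) : ℝ) * ((1 / (Fintype.card (Train fold k ℓ) : ℝ)) *
        ∑ i : Train fold k ℓ, V i.1 η * scAdjustment q p w d (S i.1 η))‖ₑ := by
  have hpm := fun g => (hp g).1
  have hqm := fun g t => (hq g t).1
  have hsm := measurable_slopeFun hqm hpm hd
  have hqB : ∀ g (t : Fin (R + 1)), ∃ B : ℝ, ∀ᵐ x ∂pop.FX, |q g t.castSucc x| ≤ B := fun g t =>
    ⟨B, hgd.mono fun x hx => hx.2.2.2.2.2.2.2 g _⟩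
  have hR := fun g => memLp_ratioResid (R := R) hB hp ho g
  have hI := fun g t => memLp_ipwResid hB hp ho hq hY g t (hqB g t)
  have hlin := hc.smallProb_linearization (by omega) ℓ hgd hdB ho hp.ae_le_one hqm hpm hw hd hr' hq'
  have k1 := SmallProb.enorm_sum Finset.univ fun g _ => smallProb_bahadur hL hD hfold ℓ map_cov_law
    hf hcomp hK hh hh0 (hr' g) (measurable_ratio hpm g) (measurable_ratioResid hpm g) (hR g).1
    (hR g).2 ((hw g).mul ((hpm g.succ).mul (hd g))) (ae_bounded_ratio_coeff hp ho hgd hdB g)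
    (hc.bahadur_r ℓ g)
  have k2 := fun t => smallProb_bahadur hL hD hfold ℓ map_cov_law hf hcomp hK hh hh0 (hq' 0 t)
    (hqm 0 t.castSucc) (measurable_ipwResid hpm hqm 0 t) (hI 0 t).1 (hI 0 t).2 (hsm t)
    (ae_bounded_slopeFun hp ho hgd hdB t) (hc.bahadur_m ℓ 0 t)
  have k3 := fun t => SmallProb.enorm_sum Finset.univ fun (g : Fin (J + 1)) _ =>
    smallProb_bahadur hL hD hfold ℓ map_cov_law hf hcomp hK hh hh0 (hq' g.succ t)
    (hqm g.succ t.castSucc) (measurable_ipwResid hpm hqm g.succ t) (hI g.succ t).1 (hI g.succ t).2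
    ((hsm t).mul (hw g)) (ae_bounded_slopeFun_mul hp ho hgd hdB t g)
    (hc.bahadur_m ℓ g.succ t)
  have k4 := SmallProb.enorm_sum Finset.univ fun t _ => (k2 t).enorm_sub (k3 t)
  refine (hlin.enorm_add (k1.enorm_add k4)).mono fun k η => le_of_eq ?_
  congr 1
  simp only [← mul_assoc (√((L * k : ℕ) : ℝ)) (1 / (Fintype.card (Train fold k ℓ) : ℝ))]
  rw [sum_mul_scAdjustment]
  simp only [Pi.mul_apply, Finset.sum_sub_distrib, mul_sub, mul_add, Finset.mul_sum]
  ring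

/-- The effect of the first stage on the moment function, summed over the folds. -/
lemma smallProb_sum_adjustment (hL : 2 ≤ L) (hfold : fold.Balanced) {I : Fin L → ℕ → Ω → ℝ}
    {A : Obs J R ℝ → ℝ} (hI : ∀ ℓ, SmallProb Pr fun k η => ‖√((L * k : ℕ) : ℝ) * I ℓ k η -
      √((L * k : ℕ) : ℝ) * ((1 / (Fintype.card (Train fold k ℓ) : ℝ)) *
        ∑ i : Train fold k ℓ, V i.1 η * A (S i.1 η))‖ₑ) :
    SmallProb Pr fun k η => ‖∑ ℓ, (√((L * k : ℕ) : ℝ))⁻¹ * (k * I ℓ k η) -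
      (√((L * k : ℕ) : ℝ))⁻¹ * ∑ i ∈ Finset.range (L * k), V i η * A (S i η)‖ₑ := by
  have h1 := SmallProb.enorm_const_mul (SmallProb.enorm_sum Finset.univ fun ℓ _ => hI ℓ) (1 / L : ℝ)
  refine h1.mono_ae ?_
  filter_upwards [eventually_gt_atTop 0] with k hk
  refine Eventually.of_forall fun η => le_of_eq ?_
  congr 1
  have hL' : (2 : ℝ) ≤ L := by exact_mod_cast hL
  have hk' : (0 : ℝ) < k := by exact_mod_cast hk
  -- With `k / √n = √n / L`, the multiplicity `L - 1` of a unit cancels against the size `(L - 1) k`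
  -- of the training samples, which leaves `√n / (L k) = n^{-1/2}`.
  have hcard : ∀ ℓ, (Fintype.card (Train fold k ℓ) : ℝ) = (L - 1) * k := fun ℓ => by
    have h2 : ((Fintype.card (Train fold k ℓ) + k : ℕ) : ℝ) = ((L * k : ℕ) : ℝ) := by
      rw [card_train_add hfold k ℓ]
    push_cast at h2
    linarith
  have hs : √((L * k : ℕ) : ℝ) * √((L * k : ℕ) : ℝ) = L * k := by
    rw [Real.mul_self_sqrt (by positivity)]; push_cast; ring
  have hs0 : √((L * k : ℕ) : ℝ) ≠ 0 := fun h0 => by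
    rw [h0, mul_zero] at hs
    have : (0 : ℝ) < L * k := by positivity
    linarith
  have hfs := sum_folds_sum_train fold k fun i => V i η * A (S i η)
  simp only [hcard]
  rw [Finset.sum_sub_distrib, ← Finset.mul_sum, ← Finset.mul_sum, ← Finset.mul_sum,
    ← Finset.mul_sum, ← Finset.mul_sum, hfs]
  generalize √((L * k : ℕ) : ℝ) = σ at hs hs0
  have hL1 : (L : ℝ) - 1 ≠ 0 := by linarith
  have hL0 : (L : ℝ) ≠ 0 := by linarith
  have hinv : σ⁻¹ = σ / (L * k) := by rw [← hs]; field_simp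
  rw [hinv]
  field_simp

end SyntheticControl

end PanelATT

/-! ### The synthetic control case -/

namespace PanelATT

lemma GoodDesign.mono {J R : ℕ} {B B' : ℝ} {q : Fin (J + 2) → Fin (R + 2) → ℝ → ℝ}
    {w : Fin (J + 1) → ℝ → ℝ} {x : ℝ} (hx : GoodDesign B q w x) (h : B ≤ B') :
    GoodDesign B' q w x := by
  obtain ⟨h1, h2, h3, h4, h5, h6, h7, h8⟩ := hx
  exact ⟨h1, h2, h3, fun i j => (h4 i j).trans h, fun t j => (h5 t j).trans h,
    fun g => (h6 g).trans h, fun j t => (h7 j t).trans h, fun g t => (h8 g t).trans h⟩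

lemma tendsto_rate {L : ℕ} (hL : 0 < L) {c : ℝ} (hc : 0 < c) :
    Tendsto (rate L c) atTop (𝓝 0) :=
  (tendsto_rpow_neg_atTop hc).comp
    (tendsto_natCast_atTop_atTop.comp (tendsto_id.const_mul_atTop' hL))

/-- The synthetic control weights built from estimators of the outcome regressions. -/
noncomputable def scEstimator {A E : Type*} {J R L : ℕ} {fold : FoldMap L}
    (qE : Fin (J + 2) → Fin (R + 1) → Estimator fold A E) (g : Fin (J + 1)) : Estimator fold A E :=
  fun k ℓ D x => scWeights (fun g' t => qE g' t k ℓ D x) g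

lemma isMeas_scEstimator {A E : Type*} [MeasurableSpace A] [MeasurableSpace E] {J R L : ℕ}
    {fold : FoldMap L} {qE : Fin (J + 2) → Fin (R + 1) → Estimator fold A E}
    (h : ∀ g t, (qE g t).IsMeas) (g : Fin (J + 1)) : (scEstimator qE g).IsMeas := fun k ℓ =>
  (measurable_scWeights g).comp
    (measurable_pi_iff.2 fun g' => measurable_pi_iff.2 fun t => h g' t k ℓ)

lemma Estimator.IsMeas.measurable_eval {Ω A E : Type*} [MeasurableSpace A]
    [MeasurableSpace E] {L : ℕ} {fold : FoldMap L} {est : Estimator fold A E} (h : est.IsMeas)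
    (D : ℕ → Ω → A) (k : ℕ) (ℓ : Fin L) (η : Ω) : Measurable (est.eval D k ℓ η) :=
  (h k ℓ).comp measurable_prodMk_left

section SyntheticControl

variable {Ω₀ Ω : Type*} [MeasurableSpace Ω₀] [MeasurableSpace Ω]
  {Pr : Measure Ω} [IsProbabilityMeasure Pr] {J R L : ℕ} {fold : FoldMap L}
  {pop : Population Ω₀ ℝ J R} {S : ℕ → Ω → Obs J R ℝ} {V W : ℕ → Ω → ℝ}
  {ν : Measure ℝ} [IsProbabilityMeasure ν] {K f : ℝ → ℝ} {h : ℕ → ℝ}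
  {p : Fin (J + 2) → ℝ → ℝ} {m : ℝ → ℝ} {w d : Fin (J + 1) → ℝ → ℝ}
  {q : Fin (J + 2) → Fin (R + 2) → ℝ → ℝ}

lemma measurable_scAdjustment (hq : ∀ g t, Measurable (q g t)) (hp : ∀ g, Measurable (p g))
    (hw : ∀ g, Measurable (w g)) (hd : ∀ g, Measurable (d g)) :
    Measurable (scAdjustment q p w d) := by
  have h1 : ∀ g, Measurable fun s : Obs J R ℝ =>
      w g (cov s) * (p g.succ (cov s) * d g (cov s)) * ratioResid p s g := fun g =>
    (((hw g).mul ((hp _).mul (hd g))).comp measurable_cov).mul (measurable_ratioResid hp g)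
  have h2 : ∀ t, Measurable fun s : Obs J R ℝ =>
      slopeFun q p d t (cov s) * ipwResid q p s 0 t := fun t =>
    ((measurable_slopeFun hq hp hd t).comp measurable_cov).mul (measurable_ipwResid hp hq 0 t)
  have h3 : ∀ t (g : Fin (J + 1)), Measurable fun s : Obs J R ℝ =>
      slopeFun q p d t (cov s) * w g (cov s) * ipwResid q p s g.succ t := fun t g =>
    (((measurable_slopeFun hq hp hd t).mul (hw g)).comp measurable_cov).mul
      (measurable_ipwResid hp hq g.succ t)
  exact (Finset.measurable_fun_sum _ fun g _ => h1 g).add (Finset.measurable_fun_sum _ fun t _ =>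
    (h2 t).sub (Finset.measurable_fun_sum _ fun g _ => h3 t g))

/-- Residuals that are orthogonal to bounded functions of the covariate are orthogonal to
essentially bounded ones. -/
lemma integral_mul_eq_zero_of_ae_bounded {ξ : Obs J R ℝ → ℝ} (hξ2 : MemLp ξ 2 pop.law)
    (hξ0 : ∀ u : ℝ → ℝ, Measurable u → (∃ C, ∀ x, |u x| ≤ C) → ∫ s, u (cov s) * ξ s ∂pop.law = 0)
    {b : ℝ → ℝ} (hb : Measurable b) (hbC : ∃ C : ℝ, ∀ᵐ x ∂pop.FX, |b x| ≤ C) :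
    Integrable (fun s => b (cov s) * ξ s) pop.law ∧ ∫ s, b (cov s) * ξ s ∂pop.law = 0 := by
  obtain ⟨C, hC⟩ := hbC
  have hC' := Population.ae_law_of_ae hC
  refine ⟨(hξ2.integrable one_le_two).bdd_mul (hb.comp measurable_cov).aestronglyMeasurable hC', ?_⟩
  have hA : MeasurableSet {x | |b x| ≤ C} := measurableSet_le hb.abs measurable_const
  rw [← hξ0 ({x | |b x| ≤ C}.indicator b) (hb.indicator hA) ⟨|C|, fun x => ?_⟩]
  · refine integral_congr_ae (hC'.mono fun s hs => ?_)
    simp only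
    rw [Set.indicator_of_mem (show cov s ∈ {x | |b x| ≤ C} from hs)]
  · by_cases hx : |b x| ≤ C
    · rw [Set.indicator_of_mem (show x ∈ {x | |b x| ≤ C} from hx)]
      exact hx.trans (le_abs_self C)
    · rw [Set.indicator_of_notMem (show x ∉ {x | |b x| ≤ C} from hx), abs_zero]
      exact abs_nonneg _

/-- Each summand is a residual times an essentially bounded function of the covariate. -/
lemma integral_scAdjustment (hB : pop.BoundedMoments m p w) (hp : pop.IsPropensity p)
    (ho : pop.Overlap p)
    (hq : ∀ g t, IsCondMean pop.P pop.X (pop.grp g) (pop.Y t) (q g t))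
    (hY : ∀ t : Fin (R + 1), MemLp (pop.Y t.castSucc) 2 pop.P) (hw : ∀ g, Measurable (w g))
    (hd : ∀ g, Measurable (d g)) {B : ℝ} (hgd : ∀ᵐ x ∂pop.FX, GoodDesign B q w x)
    (hdB : ∀ g, ∀ᵐ x ∂pop.FX, |d g x| ≤ B) :
    Integrable (scAdjustment q p w d) pop.law ∧ ∫ s, scAdjustment q p w d s ∂pop.law = 0 := by
  have hpm := fun g => (hp g).1
  have hqm := fun g t => (hq g t).1
  have hsm := measurable_slopeFun hqm hpm hd
  have hR := fun g => memLp_ratioResid (R := R) hB hp ho g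
  have hI := fun g (t : Fin (R + 1)) => memLp_ipwResid hB hp ho hq hY g t
    ⟨B, hgd.mono fun x hx => hx.2.2.2.2.2.2.2 g _⟩
  have h1 := fun g => integral_mul_eq_zero_of_ae_bounded (hR g).1 (hR g).2
    ((hw g).mul ((hpm g.succ).mul (hd g))) (ae_bounded_ratio_coeff hp ho hgd hdB g)
  have h2 := fun t => integral_mul_eq_zero_of_ae_bounded (hI 0 t).1 (hI 0 t).2 (hsm t)
    (ae_bounded_slopeFun hp ho hgd hdB t)
  have h3 := fun t (g : Fin (J + 1)) => integral_mul_eq_zero_of_ae_bounded (hI g.succ t).1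
    (hI g.succ t).2 ((hsm t).mul (hw g)) (ae_bounded_slopeFun_mul hp ho hgd hdB t g)
  simp only [Pi.mul_apply] at h1 h3
  have i1 := integrable_finsetSum Finset.univ fun g _ => (h1 g).1
  have i3 := fun t => integrable_finsetSum Finset.univ fun g _ => (h3 t g).1
  have i2 := integrable_finsetSum Finset.univ fun t _ => (h2 t).1.sub (i3 t)
  refine ⟨i1.add i2, ?_⟩
  refine (integral_add i1 i2).trans ?_
  rw [integral_finsetSum _ fun g _ => (h1 g).1, integral_finsetSum _ fun t _ => (h2 t).1.sub (i3 t)]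
  rw [Finset.sum_eq_zero fun g _ => (h1 g).2, zero_add]
  refine Finset.sum_eq_zero fun t _ => (integral_sub (h2 t).1 (i3 t)).trans ?_
  rw [(h2 t).2, integral_finsetSum _ fun g _ => (h3 t g).1, Finset.sum_eq_zero fun g _ => (h3 t g).2,
    sub_zero]

/-- Asymptotically linear representation of the sum of the estimated moment functions. -/
lemma smallProb_scores (hL : 2 ≤ L) (hD : IsWeightedSample Pr pop.law ν S V)
    (hfold : fold.Balanced) (hf : IsDensity pop.FX f) (hcomp : IsCompact pop.FX.support)
    (hK : IsKernel K) (hh : ∀ k, 0 < h k) (hh0 : Tendsto h atTop (𝓝 0))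
    (hB : pop.BoundedMoments m p w) (hp : pop.IsPropensity p) (ho : pop.Overlap p)
    (hm : Measurable m)
    (hq : ∀ g t, IsCondMean pop.P pop.X (pop.grp g) (pop.Y t) (q g t))
    (hY : ∀ t : Fin (R + 1), MemLp (pop.Y t.castSucc) 2 pop.P) (hw : ∀ g, Measurable (w g))
    (hd : ∀ g : Fin (J + 1), IsCondMean pop.P pop.X (pop.grp g.succ)
      (fun a => dY (pop.obs a) - m (pop.X a)) (d g)) {B : ℝ}
    (hgd : ∀ᵐ x ∂pop.FX, GoodDesign B q w x)
    (hdB : ∀ g, ∀ᵐ x ∂pop.FX, |d g x| ≤ B)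
    {mE : Estimator fold (Obs J R ℝ × ℝ) ℝ} {rE : Fin (J + 1) → Estimator fold (Obs J R ℝ × ℝ) ℝ}
    {qE : Fin (J + 2) → Fin (R + 1) → Estimator fold (Obs J R ℝ × ℝ) ℝ}
    (hmE : mE.IsMeas) (hrE : ∀ g, (rE g).IsMeas) (hqE : ∀ g t, (qE g t).IsMeas)
    (hF : FirstStage Pr pop.FX m (ratio p) w (mE.eval (withWeights S V))
      (fun g => (rE g).eval (withWeights S V))
      (scWeightsHat fun g t => (qE g t).eval (withWeights S V)))
    (hc : KernelConditions Pr pop.FX fold S V K h f q p w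
      (fun g => (rE g).eval (withWeights S V)) (fun g t => (qE g t).eval (withWeights S V)))
    (θ : ℝ) :
    SmallProb Pr fun k η => ‖(√((L * k : ℕ) : ℝ))⁻¹ * (∑ ℓ : Fin L,
        ∑ i : Fin (L * k) with fold k i = ℓ, V i η * (phi (S i η) (mE.eval (withWeights S V) k ℓ η)
          (fun g => (rE g).eval (withWeights S V) k ℓ η)
          (fun g => scWeightsHat (fun g t => (qE g t).eval (withWeights S V)) g k ℓ η) 1 -
            θ * ind 0 (S i η))) -
      (√((L * k : ℕ) : ℝ))⁻¹ * ∑ i ∈ Finset.range (L * k), V i η *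
        (phi (S i η) m (ratio p) w 1 - θ * ind 0 (S i η) - scAdjustment q p w d (S i η))‖ₑ := by
  have h1 := smallProb_sum_phi (by omega) hD hfold hB hp ho hm hw hd hmE hrE
    (isMeas_scEstimator hqE) hF θ
  have h2 := smallProb_sum_adjustment hL hfold fun ℓ => smallProb_fold_adjustment hL hD hfold hf hcomp
    hK hh hh0 hB hp ho hq hY hw (fun g => (hd g).1) hgd hdB ℓ hc
    (fun g k η => (hrE g).measurable_eval _ k ℓ η) (fun g t k η => (hqE g t).measurable_eval _ k ℓ η)
  refine (h1.enorm_sub h2).mono fun k η => le_of_eq ?_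
  congr 1
  simp only [mul_sub (V _ η) (_ - _) (scAdjustment q p w d _), Finset.sum_sub_distrib (f := fun i =>
    V i η * (phi (S i η) m (ratio p) w 1 - θ * ind 0 (S i η)))]
  rw [mul_sub (√((L * k : ℕ) : ℝ))⁻¹ (∑ i ∈ Finset.range (L * k), V i η *
    (phi (S i η) m (ratio p) w 1 - θ * ind 0 (S i η)))]
  have e : ∀ a b c D D' : ℝ, D = D' → a - (b - c) = a - b + D - (D' - c) := fun a b c D D' h => by
    rw [h]; ring
  exact e _ _ _ _ _ rfl

/-- Bootstrap consistency under the synthetic control condition. -/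
theorem bootstrapConsistent_syntheticControl (hL : 2 ≤ L) (hfold : fold.Balanced)
    {mHat : Estimator fold (Obs J R ℝ) ℝ} {rHat : Fin (J + 1) → Estimator fold (Obs J R ℝ) ℝ}
    {qHat : Fin (J + 2) → Fin (R + 1) → Estimator fold (Obs J R ℝ) ℝ}
    {mStar : Estimator fold (Obs J R ℝ × ℝ) ℝ}
    {rStar : Fin (J + 1) → Estimator fold (Obs J R ℝ × ℝ) ℝ}
    {qStar : Fin (J + 2) → Fin (R + 1) → Estimator fold (Obs J R ℝ × ℝ) ℝ}
    (hS : IsSample pop Pr S) (hW : IsBootstrapWeights Pr S W)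
    (hna : pop.NoAnticipation) (hp : pop.IsPropensity p) (ho : pop.Overlap p)
    (hSC : pop.SyntheticControl w) (hm : pop.IsControlTrend m)
    (hq : ∀ g t, IsCondMean pop.P pop.X (pop.grp g) (pop.Y t) (q g t))
    (hY : ∀ t : Fin (R + 1), MemLp (pop.Y t.castSucc) 2 pop.P)
    (hB : pop.BoundedMoments m p w) (hcomp : IsCompact pop.FX.support) (hf : IsDensity pop.FX f)
    (hK : IsKernel K) (hh : ∀ k, 0 < h k) (hh0 : h =o[atTop] rate L (1 / 4))
    (hwc : ∀ g, ContDiffOn ℝ 2 (w g) pop.FX.support)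
    (hqc : ∀ g t, ContDiffOn ℝ 2 (q g t) pop.FX.support)
    (heig : ∃ c : ℝ, 0 < c ∧ ∀ x ∈ pop.FX.support, ∀ lam : ℝ,
        Module.End.HasEigenvalue (Matrix.toLin'
          ((diffMatrix fun g (t : Fin (R + 1)) => q g t.castSucc x)ᵀ *
            diffMatrix fun g (t : Fin (R + 1)) => q g t.castSucc x)) lam → c < lam)
    (hmH : mHat.IsMeas) (hrH : ∀ g, (rHat g).IsMeas) (hqH : ∀ g t, (qHat g t).IsMeas)
    (hmS : mStar.IsMeas) (hrS : ∀ g, (rStar g).IsMeas) (hqS : ∀ g t, (qStar g t).IsMeas)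
    (hF : FirstStage Pr pop.FX m (ratio p) w (mHat.eval S) (fun g => (rHat g).eval S)
      (scWeightsHat fun g t => (qHat g t).eval S))
    (hc : KernelConditions Pr pop.FX fold S unitWeights K h f q p w
      (fun g => (rHat g).eval S) (fun g t => (qHat g t).eval S))
    (hF' : FirstStage Pr pop.FX m (ratio p) w (mStar.eval (withWeights S W))
      (fun g => (rStar g).eval (withWeights S W))
      (scWeightsHat fun g t => (qStar g t).eval (withWeights S W)))
    (hc' : KernelConditions Pr pop.FX fold S W K h f q p w
      (fun g => (rStar g).eval (withWeights S W)) (fun g t => (qStar g t).eval (withWeights S W)))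
    (hmom : ∃ δ : ℝ, 0 < δ ∧
      Integrable (fun a => |psiSC m q p w pop.pi1 pop.att (pop.obs a)| ^ (2 + δ)) pop.P)
    (hpos : 0 < ∫ a, psiSC m q p w pop.pi1 pop.att (pop.obs a) ^ 2 ∂pop.P) :
    BootstrapConsistent L Pr S pop.att
      (thetaEst fold S unitWeights (mHat.eval S) (fun g => (rHat g).eval S)
        (scWeightsHat fun g t => (qHat g t).eval S))
      (thetaEst fold S W (mStar.eval (withWeights S W))
        (fun g => (rStar g).eval (withWeights S W))
        (scWeightsHat fun g t => (qStar g t).eval (withWeights S W))) := by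
  have hD := hS.isWeightedSample_unit
  have hD' := hS.isWeightedSample hW
  have : IsProbabilityMeasure (Pr.map (W 0)) :=
    Measure.isProbabilityMeasure_map (hW.1 0).aemeasurable
  have hπ := (Population.pi1_pos hp ho).ne'
  have hh0' : Tendsto h atTop (𝓝 0) := hh0.trans_tendsto (tendsto_rate (by omega) (by norm_num))
  obtain ⟨c, hc0, hcl⟩ := heig
  obtain ⟨hqe, hd, d0, hd0, hd0e⟩ := hSC.observed hp ho hna hB hm hq
  let d : Fin (J + 1) → ℝ → ℝ := fun g x => groupTrend q g.succ x - m x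
  have hwm := hSC.1
  obtain ⟨B1, hB1⟩ := exists_goodDesign hcomp (fun g => (hwc g).continuousOn)
    (fun g t => (hqc g t).continuousOn) hSC.2.1 hqe fun x hx => det_gram_ne_zero hc0 (hcl x hx)
  choose Cd hCd using fun g => Population.ae_bounded_of_isCondMean_resid hB hp ho (hd g)
  obtain ⟨B2, hB2⟩ := Set.Finite.bddAbove (Set.finite_range Cd)
  let B := max B1 B2
  have hgd : ∀ᵐ x ∂pop.FX, GoodDesign B q w x := hB1.mono fun x hx => hx.mono (le_max_left _ _)
  have hdB : ∀ g, ∀ᵐ x ∂pop.FX, |d g x| ≤ B := fun g => (hCd g).mono fun x hx =>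
    hx.trans ((hB2 ⟨g, rfl⟩).trans (le_max_right _ _))
  have hmo := Population.integral_phi hB hp ho hna hm hwm hd hd0 hd0e
  have hadj := integral_scAdjustment hB hp ho hq hY hwm (fun g => (hd g).1) hgd hdB
  -- This form is measurable and matches the expansion for every observation. It agrees with `psiSC`
  -- only where the design is good and the propensity scores are nonzero, that is almost surely,
  -- which suffices for the moments.
  let ψ : Obs J R ℝ → ℝ := fun s => pop.pi1⁻¹ *
    (phi s m (ratio p) w 1 - pop.att * ind 0 s - scAdjustment q p w d s)
  have hψ : Measurable ψ := (((measurable_phi hm.1 (measurable_ratio fun g => (hp g).1) hwm 1).sub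
    ((measurable_ind 0).const_mul _)).sub (measurable_scAdjustment (fun g t => (hq g t).1)
      (fun g => (hp g).1) hwm fun g => (hd g).1)).const_mul _
  have hψeq : ∀ᵐ a ∂pop.P, psiSC m q p w pop.pi1 pop.att (pop.obs a) = ψ (pop.obs a) := by
    filter_upwards [ae_of_ae_map pop.measurable_X.aemeasurable hgd,
      ae_of_ae_map pop.measurable_X.aemeasurable (ae_all_iff.2 ho)] with a h1 h2
    have h3 := psiSC_eq (m := m) (p := p) (θ := pop.att) (s := pop.obs a) hπ h1
      fun g => (h2 g).ne'
    simp only [ψ, d]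
    rw [← h3, inv_mul_cancel_left₀ hπ]
  have hπψ : ∀ s, pop.pi1 * ψ s =
      phi s m (ratio p) w 1 - pop.att * ind 0 s - scAdjustment q p w d s := fun s =>
    mul_inv_cancel_left₀ hπ _
  have hmom' : ∃ δ : ℝ, 0 < δ ∧ Integrable (fun a => |ψ (pop.obs a)| ^ (2 + δ)) pop.P := by
    obtain ⟨δ, hδ, hi⟩ := hmom
    exact ⟨δ, hδ, hi.congr (hψeq.mono fun a ha => by simp only [ha])⟩
  refine bootstrapConsistent_of_scores (by omega) hS hW hp ho
    (fun k ℓ => hmH.eval hS.1 k ℓ) (fun g k ℓ => (hrH g).eval hS.1 k ℓ)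
    (fun g k ℓ => (isMeas_scEstimator hqH g).eval hS.1 k ℓ)
    (fun k ℓ => hmS.eval hD'.measurable k ℓ)
    (fun g k ℓ => (hrS g).eval hD'.measurable k ℓ)
    (fun g k ℓ => (isMeas_scEstimator hqS g).eval hD'.measurable k ℓ)
    hψ ((memLp_map_measure_iff hψ.aestronglyMeasurable pop.measurable_obs.aemeasurable).2
      (memLp_two_of_integrable_rpow (hψ.comp pop.measurable_obs) hmom')) ?_ ?_ ?_ ?_
  · have h3 := integral_score_eq_zero hmo
    have h4 : Integrable (fun s => phi s m (ratio p) w 1 - pop.att * ind 0 s) pop.law :=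
      (hmo.1.integrable one_le_two).sub (((memLp_ind 0).const_mul _).integrable one_le_two)
    rw [integral_const_mul, integral_sub h4 hadj.1, h3, hadj.2, sub_zero, mul_zero]
  · rw [Population.integral_law (hψ.pow_const 2)]
    refine hpos.trans_eq (integral_congr_ae (hψeq.mono fun a ha => ?_))
    simp only [ha]
  · simp only [hπψ]
    exact smallProb_scores hL hD hfold hf hcomp hK hh hh0' hB hp ho hm.1 hq hY hwm hd hgd hdB
      hmH.ignoreWeights (fun g => (hrH g).ignoreWeights) (fun g t => (hqH g t).ignoreWeights)
      hF hc pop.att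
  · simp only [hπψ]
    exact smallProb_scores hL hD' hfold hf hcomp hK hh hh0' hB hp ho hm.1 hq hY hwm hd hgd hdB
      hmS hrS hqS hF' hc' pop.att

end SyntheticControl

end PanelATT

/-! ### The theorem -/

open PanelATT
theorem mainTheorem4
    {Ω₀ Ω E : Type*} [MeasurableSpace Ω₀] [MeasurableSpace Ω] [MeasurableSpace E]
    (Pr : Measure Ω) [IsProbabilityMeasure Pr] {J R L : ℕ} (hL : 2 ≤ L)
    (fold : FoldMap L) (hfold : fold.Balanced) :
    -- (i) parallel trends
    (∀ (pop : Population Ω₀ E J R) (S : ℕ → Ω → Obs J R E) (W : ℕ → Ω → ℝ)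
      (p : Fin (J + 2) → E → ℝ) (m : E → ℝ) (ω : Fin (J + 1) → E → ℝ)
      (mHat : Estimator fold (Obs J R E) E)
      (rHat wHat : Fin (J + 1) → Estimator fold (Obs J R E) E)
      (mStar : Estimator fold (Obs J R E × ℝ) E)
      (rStar wStar : Fin (J + 1) → Estimator fold (Obs J R E × ℝ) E),
      IsSample pop Pr S → IsBootstrapWeights Pr S W →
      pop.NoAnticipation → pop.IsPropensity p → pop.Overlap p → pop.ParallelTrends →
      pop.IsControlTrend m → (∀ g, Measurable (ω g)) → pop.BoundedMoments m p ω →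
      mHat.IsMeas → (∀ g, (rHat g).IsMeas) → (∀ g, (wHat g).IsMeas) →
      mStar.IsMeas → (∀ g, (rStar g).IsMeas) → (∀ g, (wStar g).IsMeas) →
      FirstStage Pr pop.FX m (ratio p) ω
        (mHat.eval S) (fun g => (rHat g).eval S) (fun g => (wHat g).eval S) →
      FirstStage Pr pop.FX m (ratio p) ω (mStar.eval (withWeights S W))
        (fun g => (rStar g).eval (withWeights S W)) (fun g => (wStar g).eval (withWeights S W)) →
      (∃ δ : ℝ, 0 < δ ∧
        Integrable (fun a => |psiPT m p ω pop.pi1 pop.att (pop.obs a)| ^ (2 + δ)) pop.P) →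
      0 < ∫ a, psiPT m p ω pop.pi1 pop.att (pop.obs a) ^ 2 ∂pop.P →
      BootstrapConsistent L Pr S pop.att
        (thetaEst fold S unitWeights
          (mHat.eval S) (fun g => (rHat g).eval S) (fun g => (wHat g).eval S))
        (thetaEst fold S W (mStar.eval (withWeights S W))
          (fun g => (rStar g).eval (withWeights S W))
          (fun g => (wStar g).eval (withWeights S W)))) ∧
    -- (ii) synthetic control
    (∀ (pop : Population Ω₀ ℝ J R) (S : ℕ → Ω → Obs J R ℝ) (W : ℕ → Ω → ℝ)
      (p : Fin (J + 2) → ℝ → ℝ) (m : ℝ → ℝ) (q : Fin (J + 2) → Fin (R + 2) → ℝ → ℝ)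
      (w : Fin (J + 1) → ℝ → ℝ) (K f : ℝ → ℝ) (h : ℕ → ℝ)
      (mHat : Estimator fold (Obs J R ℝ) ℝ)
      (rHat : Fin (J + 1) → Estimator fold (Obs J R ℝ) ℝ)
      (qHat : Fin (J + 2) → Fin (R + 1) → Estimator fold (Obs J R ℝ) ℝ)
      (mStar : Estimator fold (Obs J R ℝ × ℝ) ℝ)
      (rStar : Fin (J + 1) → Estimator fold (Obs J R ℝ × ℝ) ℝ)
      (qStar : Fin (J + 2) → Fin (R + 1) → Estimator fold (Obs J R ℝ × ℝ) ℝ),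
      IsSample pop Pr S → IsBootstrapWeights Pr S W →
      pop.NoAnticipation → pop.IsPropensity p → pop.Overlap p → pop.SyntheticControl w →
      pop.IsControlTrend m →
      (∀ g t, IsCondMean pop.P pop.X (pop.grp g) (pop.Y t) (q g t)) →
      (∀ t : Fin (R + 1), MemLp (pop.Y t.castSucc) 2 pop.P) →
      pop.BoundedMoments m p w →
      IsCompact pop.FX.support → IsDensity pop.FX f → IsKernel K →
      (∀ k, 0 < h k) → h =o[atTop] rate L (1 / 4) →
      (∀ g, ContDiffOn ℝ 2 (w g) pop.FX.support) →
      (∀ g t, ContDiffOn ℝ 2 (q g t) pop.FX.support) →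
      (∀ g, ContDiffOn ℝ 2 (p g) pop.FX.support) →
      (∃ c : ℝ, 0 < c ∧ ∀ x ∈ pop.FX.support, ∀ lam : ℝ,
        Module.End.HasEigenvalue (Matrix.toLin'
          ((diffMatrix fun g (t : Fin (R + 1)) => q g t.castSucc x)ᵀ *
            diffMatrix fun g (t : Fin (R + 1)) => q g t.castSucc x)) lam → c < lam) →
      mHat.IsMeas → (∀ g, (rHat g).IsMeas) → (∀ g t, (qHat g t).IsMeas) →
      mStar.IsMeas → (∀ g, (rStar g).IsMeas) → (∀ g t, (qStar g t).IsMeas) →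
      FirstStage Pr pop.FX m (ratio p) w (mHat.eval S) (fun g => (rHat g).eval S)
        (scWeightsHat fun g t => (qHat g t).eval S) →
      KernelConditions Pr pop.FX fold S unitWeights K h f q p w
        (fun g => (rHat g).eval S) (fun g t => (qHat g t).eval S) →
      FirstStage Pr pop.FX m (ratio p) w (mStar.eval (withWeights S W))
        (fun g => (rStar g).eval (withWeights S W))
        (scWeightsHat fun g t => (qStar g t).eval (withWeights S W)) →
      KernelConditions Pr pop.FX fold S W K h f q p w
        (fun g => (rStar g).eval (withWeights S W))
        (fun g t => (qStar g t).eval (withWeights S W)) →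
      (∃ δ : ℝ, 0 < δ ∧
        Integrable (fun a => |psiSC m q p w pop.pi1 pop.att (pop.obs a)| ^ (2 + δ)) pop.P) →
      0 < ∫ a, psiSC m q p w pop.pi1 pop.att (pop.obs a) ^ 2 ∂pop.P →
      BootstrapConsistent L Pr S pop.att
        (thetaEst fold S unitWeights (mHat.eval S) (fun g => (rHat g).eval S)
          (scWeightsHat fun g t => (qHat g t).eval S))
        (thetaEst fold S W (mStar.eval (withWeights S W))
          (fun g => (rStar g).eval (withWeights S W))
          (scWeightsHat fun g t => (qStar g t).eval (withWeights S W)))) := by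
  refine ⟨?_, ?_⟩
  · intro pop S W p m ω mHat rHat wHat mStar rStar wStar hS hW hna hp ho hPT hm hω hB h1 h2 h3
      h4 h5 h6 hF hF' hmom hpos
    exact bootstrapConsistent_parallelTrends (by omega) hfold hS hW hna hp ho hPT hm hω hB h1 h2 h3
      h4 h5 h6 hF hF' hmom hpos
  · intro pop S W p m q w K f h mHat rHat qHat mStar rStar qStar hS hW hna hp ho hSC hm hq hY hB
      hcomp hf hK hh hh0 hwc hqc _ heig h1 h2 h3 h4 h5 h6 hF hc hF' hc' hmom hpos
    exact bootstrapConsistent_syntheticControl hL hfold hS hW hna hp ho hSC hm hq hY hB hcomp hf hK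
      hh hh0 hwc hqc heig h1 h2 h3 h4 h5 h6 hF hc hF' hc' hmom hpos
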